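/- **Setting.** Let $M$ be a triangulated closed oriented 4-manifold (more generally, any finite family of oriented 4-simplices, whose edges and 2-faces are determined by their vertices; no condition on how they fit together is needed), with a covering with group $\Gamma$ (e.g. the universal covering, $\Gamma=\pi_1(M)$), and let $f\colon\Gamma\to E_4$ be a representation in the group of motions of $\mathbb R^4$. Let $g=(g_j)$ be finitely many parameters of infinitesimal deformations of $f$ (given by 1-cocycles $\Gamma\to\mathfrak e_4$). The vertices of the covering are mapped $f$-equivariantly to $\mathbb R^4$ so that every 4-simplex is non-degenerate. Denote by $l_a$ and $L_a=l_a^2$ the lengths and squared lengths of the edges $a$, by $S_i$ the areas of the 2-faces $i$, by $V$ the (positive) volumes of the 4-simplices. For squared lengths $L_a$ near the given ones, let $\omega_i=-\sum\pm\varphi_i$ (mod $2\pi$) be the deficit angle at the 2-face $i$: the sum is over the 4-simplices containing $i$, $\varphi_i$ are their dihedral angles at $i$, and the sign is that of the orientation of the image of the 4-simplex in $\mathbb R^4$. Consider the sequence of real vector spaces $$0\to\mathfrak a\xrightarrow{d_0}(dx\text{ and }dg)\xrightarrow{d_1}(dL_a)\xrightarrow{d_2}(d\omega_i)\xrightarrow{d_3}(d\vec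 v_a)^*\xrightarrow{d_4}(d\sigma)^*\xrightarrow{d_5}(d\sigma)_0^*\to0 .$$ * $\mathfrak a$ is the algebra of infinitesimal motions commuting with $f(\Gamma)$, with any basis; it is mapped to the displacements $dx$ of the vertices that it produces (and to $dg=0$). * $(dx\text{ and }dg)$ has as coordinates the four coordinate differentials of every vertex of $M$ and the $dg_j$; $d_1$ is the differential of the squared lengths. * $d_2=(\partial\omega_i/\partial L_a)$. * $d_3$ is the transpose of the map $(d\vec v_a)\to(dS_i)$. Here $d\vec v_a$ is a vector orthogonal to the edge $a$, with components in some orthonormal system of three axes, and $dS_i=\sum_{a\subset i}l_a\,\langle n_{i,a},d\vec v_a\rangle$, where $n_{i,a}$ is the outer unit normal to the edge $a$ in the plane of the triangle $i$. * $d_4$ is the transpose of the map $(d\sigma)\to(d\vec v_a)$. Here $d\sigma$ consists of a bivector $d\sigma_A$ (six components) at every vertex $A$, and $(d\vec v_{AB})_\beta=\frac1{L_{AB}}\sum_\alpha l_\alpha\,(d\sigma_A-d\sigma_B)_{\alpha\beta}$ with $(l_\alpha)=\overrightarrow{AB}$. * $d_5$ is the transpose of the map $(d\sigma)_0\to(d\sigma)$.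 Here $(d\sigma)_0$ (with any basis) consists of the pairs of a bivector $d\tau$ and a vector $ds$ for which the field $r\mapsto d\tau_{\alpha\beta}+\sum_{\gamma,\delta}\epsilon_{\alpha\beta\gamma\delta}\,r_\gamma\,ds_\delta$ is invariant under $f(\Gamma)$, and the map takes the value of this field at the vertices. A *choice of minors* is a choice, for each of the five middle spaces, of a subset of its basis: the chosen elements are rows of the minor of the incoming map, the others are columns of the minor of the outgoing map; all of the basis of $\mathfrak a$ are columns and all of the basis of $(d\sigma)_0^*$ are rows. Minors are taken in absolute value (a non-square one is $0$). If $m_k$ is the minor of $d_k$, and all the minors are nonzero, the torsion is $\tau=\dfrac{m_1m_3m_5}{m_0m_2m_4}$. **Move $1\to5$.** A 4-simplex $ABCDE=\hat F$ is replaced with the five 4-simplices $\hat A=FBCDE$, $\hat B=AFCDE,\dots,\hat E=ABCDF$, where $F$ is a new vertex, with any position such that these are non-degenerate. The representation $f$, its deformations and the bases of $\mathfrak a$ and $(d\sigma)_0$ are the same before and after the move. **Theorem.** 1. Suppose that the axes for the old edges do not change, and that the axes $x,y,z$ for the new edges $AF$, $BF$, $CF$ are such that: the $x$ axes for $AF$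 and $BF$ lie in the plane $ABF$ and their $y$ axes in the hyperplane $ABCF$; the $x$ axis for $CF$ is orthogonal to the plane $BCF$ and the $x,y$ axes for $CF$ lie in $ABCF$. Take any choice of minors before the move and extend it as follows: to the minor of $d_1$ add the rows $dL_{AF},dL_{BF},dL_{CF},dL_{DF}$ and the columns of the four coordinates of $F$; to the minor of $d_2$ add the row $d\omega_{DEF}$ and the column $dL_{EF}$; to the minor of $(d\vec v_a)\to(dS_i)$ add all new faces except $DEF$ and the components $(dv_{DF})_{x,y,z}$, $(dv_{EF})_{x,y,z}$, $(dv_{BF})_x$, $(dv_{CF})_x$, $(dv_{CF})_y$; to the minor of $(d\sigma)\to(d\vec v_a)$ add the six remaining components of $d\vec v$ of the new edges and all six components of $d\sigma_F$. Then $m_0$ and $m_5$ do not change, and $m_1,m_2,m_3,m_4$ are multiplied, respectively, by $$384\,V_{\hat E},\qquad \frac{S_{DEF}}{24}\,\frac{V_{\hat E}V_{\hat F}}{V_{\hat A}V_{\hat B}V_{\hat C}},$$ $$\frac{9\,V_{\hat E}V_{\hat D}\,l_{DF}^5\,l_{EF}^5}{S_{ADF}S_{BDF}S_{CDF}S_{AEF}S_{BEF}S_{CEF}}\;l_{BF}\,l_{CF}^2\sin\alpha,\qquad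 \frac{8\,S_{ACF}S_{BCF}S_{ABF}}{l_{AF}^5\,l_{BF}^4\,l_{CF}^3}\,\sin\alpha,$$ where $\alpha$ is the angle between the planes $ACF$ and $BCF$. 2. For any axes for the edges before and after the move, the sequence before the move is acyclic (exact in all its terms) if and only if the sequence after the move is acyclic. 3. If they are acyclic, then (again for any axes) nonzero minors can be chosen in both sequences, their torsions $\tau,\tau'>0$ do not depend on the choice of nonzero minors, and $$\tau'=\tau\cdot2^7\cdot3^4\cdot\frac{V_{\hat A}V_{\hat B}V_{\hat C}V_{\hat D}V_{\hat E}}{V_{\hat F}}\cdot\frac{\prod_{\text{new edges}}l^5}{\prod_{\text{new 2-faces}}S}.$$ -/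

import Mathlib

open scoped Matrix

noncomputable section

/-- Euclidean four-space. -/
abbrev E4 := EuclideanSpace ℝ (Fin 4)

/-! ## Based sequences of seven spaces, minors, torsion -/

/-- The sequence `0 → ℝ^ι₀ → ℝ^ι₁ → … → ℝ^ι₆ → 0` with matrices `d₀, …, d₅` is exact
in all its terms. -/
def IsAcyclic {ι₀ ι₁ ι₂ ι₃ ι₄ ι₅ ι₆ : Type*} [Fintype ι₀] [Fintype ι₁] [Fintype ι₂]
    [Fintype ι₃] [Fintype ι₄] [Fintype ι₅]
    (d₀ : Matrix ι₁ ι₀ ℝ) (d₁ : Matrix ι₂ ι₁ ℝ) (d₂ : Matrix ι₃ ι₂ ℝ)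
    (d₃ : Matrix ι₄ ι₃ ℝ) (d₄ : Matrix ι₅ ι₄ ℝ) (d₅ : Matrix ι₆ ι₅ ℝ) : Prop :=
  Function.Injective d₀.mulVecLin ∧
  LinearMap.range d₀.mulVecLin = LinearMap.ker d₁.mulVecLin ∧
  LinearMap.range d₁.mulVecLin = LinearMap.ker d₂.mulVecLin ∧
  LinearMap.range d₂.mulVecLin = LinearMap.ker d₃.mulVecLin ∧
  LinearMap.range d₃.mulVecLin = LinearMap.ker d₄.mulVecLin ∧
  LinearMap.range d₄.mulVecLin = LinearMap.ker d₅.mulVecLin ∧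
  Function.Surjective d₅.mulVecLin

/-- The absolute value of the minor of `M` with the given rows and columns. It is `0` if the
numbers of rows and columns differ; the bijection used between rows and columns only affects
the sign of the determinant. -/
def absMinor {m n : Type*} (M : Matrix m n ℝ) (rows : Finset m) (cols : Finset n) : ℝ :=
  open Classical in
  if h : rows.card = cols.card then
    |(Matrix.of fun i j : rows => M i (Fintype.equivOfCardEq (by simpa using h) j : cols)).det|
  else 0

/-- A choice of minors of the six matrices: `Bₖ` is the set of those basis elements of the
`k`-th space that are rows of the minor of the map into this space; the other basis elements
of the `k`-th space are the columns of the minor of the map out of it. All of the `0`-th basis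
are columns, and all of the `6`-th basis are rows. -/
structure MinorChoice (ι₁ ι₂ ι₃ ι₄ ι₅ : Type*) where
  B₁ : Finset ι₁
  B₂ : Finset ι₂
  B₃ : Finset ι₃
  B₄ : Finset ι₄
  B₅ : Finset ι₅

/-- The absolute values of the six minors. -/
def minors {ι₀ ι₁ ι₂ ι₃ ι₄ ι₅ ι₆ : Type*} [Fintype ι₀] [Fintype ι₁] [Fintype ι₂]
    [Fintype ι₃] [Fintype ι₄] [Fintype ι₅] [Fintype ι₆]
    (d₀ : Matrix ι₁ ι₀ ℝ) (d₁ : Matrix ι₂ ι₁ ℝ) (d₂ : Matrix ι₃ ι₂ ℝ)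
    (d₃ : Matrix ι₄ ι₃ ℝ) (d₄ : Matrix ι₅ ι₄ ℝ) (d₅ : Matrix ι₆ ι₅ ℝ)
    (B : MinorChoice ι₁ ι₂ ι₃ ι₄ ι₅) : Fin 6 → ℝ :=
  open Classical in
  ![absMinor d₀ B.B₁ Finset.univ,
    absMinor d₁ B.B₂ B.B₁ᶜ,
    absMinor d₂ B.B₃ B.B₂ᶜ,
    absMinor d₃ B.B₄ B.B₃ᶜ,
    absMinor d₄ B.B₅ B.B₄ᶜ,
    absMinor d₅ Finset.univ B.B₅ᶜ]

/-- The alternating product of minors, the first one entering with exponent `-1`. -/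
def alternatingProduct (m : Fin 6 → ℝ) : ℝ := (m 1 * m 3 * m 5) / (m 0 * m 2 * m 4)

/-! ## Motions, bivectors, representations -/

/-- The affine vector field `p ↦ A p + b` on four-space. -/
def affineField (X : Matrix (Fin 4) (Fin 4) ℝ × E4) (p : E4) : E4 :=
  WithLp.toLp 2 (X.1 *ᵥ p.ofLp) + X.2

/-- The matrix of the linear part of a motion. -/
def rot (g : E4 ≃ᵃⁱ[ℝ] E4) : Matrix (Fin 4) (Fin 4) ℝ :=
  Matrix.of fun α β => g.linearIsometryEquiv (EuclideanSpace.single β 1) α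

/-- The totally antisymmetric tensor with `ε 0 1 2 3 = 1`. -/
def leviCivita (α β γ δ : Fin 4) : ℝ :=
  (Matrix.of fun i j : Fin 4 => if ![α, β, γ, δ] i = j then (1 : ℝ) else 0).det

/-- The bivector `dτ_{αβ} + ∑ ε_{αβγδ} p_γ ds_δ` at the point `p`. -/
def trivialDeviation (X : Matrix (Fin 4) (Fin 4) ℝ × E4) (p : E4) :
    Matrix (Fin 4) (Fin 4) ℝ :=
  Matrix.of fun α β => X.1 α β + ∑ γ, ∑ δ, leviCivita α β γ δ * p γ * X.2 δ

/-- A representation `ρ` of the group `Γ` (the fundamental group, or any group of deck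
transformations) in the group of motions of four-space, together with infinitesimal
deformations of it, indexed by the parameters `j : J`: when the parameters change by `dg`,
the motion `ρ γ` is followed by the infinitesimal motion `∑ j, dg j • dρ j γ`. The identity
`dρ_mul` says that `ρ` remains a representation to first order. -/
structure Representation4 (Γ : Type*) [Group Γ] (J : Type*) where
  ρ : Γ →* (E4 ≃ᵃⁱ[ℝ] E4)
  dρ : J → Γ → Matrix (Fin 4) (Fin 4) ℝ × E4
  dρ_skew : ∀ j γ, (dρ j γ).1ᵀ = -(dρ j γ).1
  dρ_mul : ∀ j γ δ p, affineField (dρ j (γ * δ)) (ρ γ p) =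
    affineField (dρ j γ) (ρ γ p) + (ρ γ).linearIsometryEquiv (affineField (dρ j δ) p)

namespace Representation4

variable {Γ : Type*} [Group Γ] {J : Type*} (R : Representation4 Γ J)

/-- The algebra `𝔞` of infinitesimal motions that commute with the image of `ρ`: an
infinitesimal motion is a vector field `p ↦ A p + b` with `A` antisymmetric, and it commutes
with a motion if it is carried to itself by it. -/
def motions : Submodule ℝ (Matrix (Fin 4) (Fin 4) ℝ × E4) where
  carrier := {X | X.1ᵀ = -X.1 ∧
    ∀ γ p, affineField X (R.ρ γ p) = (R.ρ γ).linearIsometryEquiv (affineField X p)}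
  zero_mem' := by
    refine ⟨by simp, fun γ p => ?_⟩
    simp [affineField]
  add_mem' := by
    rintro X Y ⟨hX, hX'⟩ ⟨hY, hY'⟩
    have key : ∀ p, affineField (X + Y) p = affineField X p + affineField Y p := by
      intro p
      simp only [affineField, Prod.fst_add, Prod.snd_add, Matrix.add_mulVec, WithLp.toLp_add]
      abel
    refine ⟨?_, fun γ p => ?_⟩
    · simp only [Prod.fst_add, Matrix.transpose_add, hX, hY, neg_add]
    · rw [key, key, hX', hY', map_add]
  smul_mem' := by
    rintro c X ⟨hX, hX'⟩
    have key : ∀ p, affineField (c • X) p = c • affineField X p := by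
      intro p
      simp only [affineField, Prod.smul_fst, Prod.smul_snd, Matrix.smul_mulVec,
        WithLp.toLp_smul, smul_add]
    refine ⟨?_, fun γ p => ?_⟩
    · simp only [Prod.smul_fst, Matrix.transpose_smul, hX, smul_neg]
    · rw [key, key, hX', map_smul]

/-- The parameters `(dτ, ds)` of the space `(dσ)₀`: those for which the bivector field
`p ↦ dτ_{αβ} + ∑ ε_{αβγδ} p_γ ds_δ` is carried to itself by the image of `ρ`, that is, gives
the same vertex deviation for all the inverse images of a vertex in the covering. -/
def trivialDeviations : Submodule ℝ (Matrix (Fin 4) (Fin 4) ℝ × E4) where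
  carrier := {X | X.1ᵀ = -X.1 ∧
    ∀ γ p, trivialDeviation X (R.ρ γ p) =
      rot (R.ρ γ) * trivialDeviation X p * (rot (R.ρ γ))ᵀ}
  zero_mem' := by
    have key : ∀ p, trivialDeviation 0 p = 0 := by
      intro p
      ext α β
      simp [trivialDeviation]
    refine ⟨by simp, fun γ p => ?_⟩
    simp [key]
  add_mem' := by
    rintro X Y ⟨hX, hX'⟩ ⟨hY, hY'⟩
    have key : ∀ p, trivialDeviation (X + Y) p =
        trivialDeviation X p + trivialDeviation Y p := by
      intro p
      ext α β
      simp only [trivialDeviation, Matrix.of_apply, Matrix.add_apply, Prod.fst_add,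
        Prod.snd_add, PiLp.add_apply, mul_add, Finset.sum_add_distrib]
      ring
    refine ⟨?_, fun γ p => ?_⟩
    · simp only [Prod.fst_add, Matrix.transpose_add, hX, hY, neg_add]
    · rw [key, key, hX', hY', Matrix.mul_add, Matrix.add_mul]
  smul_mem' := by
    rintro c X ⟨hX, hX'⟩
    have key : ∀ p, trivialDeviation (c • X) p = c • trivialDeviation X p := by
      intro p
      ext α β
      simp only [trivialDeviation, Matrix.of_apply, Matrix.smul_apply, Prod.smul_fst,
        Prod.smul_snd, PiLp.smul_apply, smul_eq_mul, mul_add, Finset.mul_sum]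
      congr 1
      refine Finset.sum_congr rfl fun γ _ => Finset.sum_congr rfl fun δ _ => by ring
    refine ⟨?_, fun γ p => ?_⟩
    · simp only [Prod.smul_fst, Matrix.transpose_smul, hX, smul_neg]
    · rw [key, key, hX', Matrix.mul_smul, Matrix.smul_mul]

end Representation4

/-! ## Elementary Euclidean geometry -/

/-- The component of `x` orthogonal to `y`. -/
def perp (x y : E4) : E4 := x - (inner ℝ x y / inner ℝ y y) • y

/-- The area of the triangle `p q r`. -/
def triangleArea (p q r : E4) : ℝ := ‖q - p‖ * ‖perp (r - p) (q - p)‖ / 2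

/-- The oriented four-volume of the simplex with vertices `p 0, …, p 4`. -/
def signedVolume (p : Fin 5 → E4) : ℝ :=
  (Matrix.of fun i j : Fin 4 => (p i.succ - p 0) j).det / 24

/-- The Gram matrix, based at vertex `0`, of a 4-simplex with squared edge lengths `ℓ`. -/
def gram (ℓ : Fin 5 → Fin 5 → ℝ) : Matrix (Fin 4) (Fin 4) ℝ :=
  Matrix.of fun i j => (ℓ 0 i.succ + ℓ 0 j.succ - ℓ i.succ j.succ) / 2

/-- The inner products of the gradients of the barycentric coordinates `λ_i`, `λ_j` of
a 4-simplex with squared edge lengths `ℓ`. The gradient of `λ_i` is an inner normal to the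
three-dimensional face opposite to the vertex `i`; in the basis dual to the edge vectors
issuing from vertex `0`, it is the `i`-th basis vector for `i ≠ 0`, and minus the sum of all
of them for `i = 0`. -/
def normalInner (ℓ : Fin 5 → Fin 5 → ℝ) (i j : Fin 5) : ℝ :=
  let c : Fin 5 → Fin 4 → ℝ := Fin.cons (fun _ => -1) (fun k => Pi.single k 1)
  c i ⬝ᵥ ((gram ℓ)⁻¹ *ᵥ c j)

/-- The dihedral angle of a 4-simplex with squared edge lengths `ℓ` between its
three-dimensional faces opposite to the vertices `i` and `j`, that is, at the two-dimensional
face containing neither `i` nor `j`. -/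
def dihedralAngle (ℓ : Fin 5 → Fin 5 → ℝ) (i j : Fin 5) : ℝ :=
  Real.arccos (-normalInner ℓ i j / √(normalInner ℓ i i * normalInner ℓ j j))

/-- For an edge `P Q` of a triangle `P Q O`: the vector in the plane of the triangle that is
orthogonal to `P Q`, points away from `O` and has the same length as `P Q`. -/
def outerNormal (P Q O : E4) : E4 :=
  (‖Q - P‖ / ‖perp (P - O) (Q - P)‖) • perp (P - O) (Q - P)

/-! ## Triangulations -/

/-- A triangulation with vertex set `V` and set of 4-simplices `T`, given with a covering
with group `Γ`, and with a Euclidean coordinate vector for every vertex.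
* `vert t` lists the five vertices of `t`, in an order that gives the orientation of `t`.
  Edges and 2-faces are determined by their vertices; different 4-simplices may have the same
  vertices. No condition is imposed on how the 4-simplices fit together, so triangulated closed
  oriented four-manifolds are a special case.
* Over every vertex `v` a point `ṽ` of the covering is chosen, and `hol u v` is such that the
  edge of the covering over `u v` that begins at `ũ` ends at `(hol u v) ṽ`. Only its values on
  edges matter.
* `coord v` is the position of `ṽ`; the position of `γ ṽ` is then its image under `ρ γ`. -/
structure Triangulation4 (Γ : Type*) [Group Γ] (V T : Type*) where
  vert : T → Fin 5 → V
  vert_injective : ∀ t, Function.Injective (vert t)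
  hol : V → V → Γ
  hol_mul : ∀ t i j k,
    hol (vert t i) (vert t j) * hol (vert t j) (vert t k) = hol (vert t i) (vert t k)
  coord : V → E4

namespace Triangulation4

variable {Γ : Type*} [Group Γ] {V T J : Type*} [LinearOrder V]

/-- The edges, as increasing pairs of vertices. -/
def Edge (X : Triangulation4 Γ V T) : Type _ :=
  {e : V × V // e.1 < e.2 ∧ ∃ t, e.1 ∈ Set.range (X.vert t) ∧ e.2 ∈ Set.range (X.vert t)}

/-- The two-dimensional faces, as increasing triples of vertices. -/
def Face (X : Triangulation4 Γ V T) : Type _ :=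
  {f : V × V × V // f.1 < f.2.1 ∧ f.2.1 < f.2.2 ∧ ∃ t, f.1 ∈ Set.range (X.vert t) ∧
    f.2.1 ∈ Set.range (X.vert t) ∧ f.2.2 ∈ Set.range (X.vert t)}

instance (X : Triangulation4 Γ V T) [Fintype V] : Fintype X.Edge :=
  open Classical in
  inferInstanceAs (Fintype {e : V × V // e.1 < e.2 ∧
    ∃ t, e.1 ∈ Set.range (X.vert t) ∧ e.2 ∈ Set.range (X.vert t)})

instance (X : Triangulation4 Γ V T) [Fintype V] : Fintype X.Face :=
  open Classical in
  inferInstanceAs (Fintype {f : V × V × V // f.1 < f.2.1 ∧ f.2.1 < f.2.2 ∧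
    ∃ t, f.1 ∈ Set.range (X.vert t) ∧
      f.2.1 ∈ Set.range (X.vert t) ∧ f.2.2 ∈ Set.range (X.vert t)})

instance (X : Triangulation4 Γ V T) : DecidableEq X.Edge :=
  inferInstanceAs (DecidableEq {_e : V × V // _})

instance (X : Triangulation4 Γ V T) : DecidableEq X.Face :=
  inferInstanceAs (DecidableEq {_f : V × V × V // _})

/-- The edge `01` of a 2-face with vertices `0 < 1 < 2`. -/
def Face.edge₀₁ {X : Triangulation4 Γ V T} (f : X.Face) : X.Edge :=
  ⟨(f.1.1, f.1.2.1), f.2.1, f.2.2.2.imp fun _ h => ⟨h.1, h.2.1⟩⟩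

/-- The edge `02` of a 2-face with vertices `0 < 1 < 2`. -/
def Face.edge₀₂ {X : Triangulation4 Γ V T} (f : X.Face) : X.Edge :=
  ⟨(f.1.1, f.1.2.2), f.2.1.trans f.2.2.1, f.2.2.2.imp fun _ h => ⟨h.1, h.2.2⟩⟩

/-- The edge `12` of a 2-face with vertices `0 < 1 < 2`. -/
def Face.edge₁₂ {X : Triangulation4 Γ V T} (f : X.Face) : X.Edge :=
  ⟨(f.1.2.1, f.1.2.2), f.2.2.1, f.2.2.2.imp fun _ h => ⟨h.2.1, h.2.2⟩⟩

variable (R : Representation4 Γ J) (X : Triangulation4 Γ V T)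

/-- The position of the neighbour `v` of `u` in the coordinate system of `u`. -/
def place (u v : V) : E4 := R.ρ (X.hol u v) (X.coord v)

/-- The vector of the edge `u v` in the coordinate system of `u`. -/
def edgeVec (u v : V) : E4 := X.place R u v - X.coord u

/-- The positions of the vertices of `t` in the coordinate system of its first vertex. -/
def simplexPlace (t : T) (k : Fin 5) : E4 := X.place R (X.vert t 0) (X.vert t k)

/-- The four-volume of `t`. -/
def volume (t : T) : ℝ := |signedVolume (X.simplexPlace R t)|

/-- The area of a 2-face. -/
def area (f : X.Face) : ℝ :=
  triangleArea (X.coord f.1.1) (X.place R f.1.1 f.1.2.1) (X.place R f.1.1 f.1.2.2)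

/-- The length of an edge. -/
def length (e : X.Edge) : ℝ := ‖X.edgeVec R e.1.1 e.1.2‖

/-- The squared lengths of the edges. -/
def sqLength (e : X.Edge) : ℝ := X.length R e ^ 2

/-- All the 4-simplices are non-degenerate. -/
def IsNondegenerate : Prop := ∀ t, X.volume R t ≠ 0

/-- A choice of an orthonormal coordinate system in the three-dimensional space orthogonal to
each edge (in the coordinate system of the first vertex of the edge). -/
def IsFraming (fr : X.Edge → Fin 3 → E4) : Prop :=
  ∀ e, Orthonormal ℝ (fr e) ∧ ∀ k, inner ℝ (fr e k) (X.edgeVec R e.1.1 e.1.2) = 0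

/-! ### The mapping `(dx and dg) → (dL)` -/

/-- The differentials of the squared edge lengths `L` for given differentials `dx` of the
vertex coordinates and `dg` of the parameters of the representation. -/
def dL [Fintype J] (dx : V → E4) (dg : J → ℝ) (e : X.Edge) : ℝ :=
  2 * inner ℝ (X.edgeVec R e.1.1 e.1.2)
    ((R.ρ (X.hol e.1.1 e.1.2)).linearIsometryEquiv (dx e.1.2)
      + ∑ j, dg j • affineField (R.dρ j (X.hol e.1.1 e.1.2)) (X.place R e.1.1 e.1.2)
      - dx e.1.1)

/-! ### The mapping `(dL) → (dω)` -/

/-- The squared distance between the vertices `u` and `v`, for given squared edge lengths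
`L`. -/
def sqDist (L : X.Edge → ℝ) (u v : V) : ℝ :=
  open Classical in
  if h : min u v < max u v ∧ ∃ t, min u v ∈ Set.range (X.vert t) ∧
    max u v ∈ Set.range (X.vert t) then L ⟨(min u v, max u v), h⟩ else 0

/-- The deficit angle at the 2-face `f` (modulo `2π`) as a function of the squared edge
lengths: minus the sum of the dihedral angles at `f` of all the 4-simplices that contain `f`,
each taken with the sign `+` or `-` according to whether the orientation of the 4-simplex
agrees with that of its image in four-space. -/
def deficitAngle [Fintype T] (L : X.Edge → ℝ) (f : X.Face) : ℝ :=
  -∑ t, ∑ i : Fin 5, ∑ j ∈ Finset.Ioi i,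
    if ({i, j}ᶜ : Finset (Fin 5)).image (X.vert t) = {f.1.1, f.1.2.1, f.1.2.2} then
      Real.sign (signedVolume (X.simplexPlace R t)) *
        dihedralAngle (fun a b => X.sqDist L (X.vert t a) (X.vert t b)) i j
    else 0

/-! ### The mapping `(dv) → (dS)` -/

/-- The differential of the area of a 2-face for given deviations `dv` of the edges: every
edge contributes the product of its length and of the component of its deviation along the
outer normal to this edge in the plane of the face. This is the differential of four times the
area of the triangle whose vertices are the midpoints of the edges, when these midpoints are
displaced by `dv`. -/
def dS (dv : X.Edge → E4) (f : X.Face) : ℝ :=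
  let P := X.coord f.1.1
  let Q := X.place R f.1.1 f.1.2.1
  let O := X.place R f.1.1 f.1.2.2
  inner ℝ (outerNormal P Q O) (dv f.edge₀₁) + inner ℝ (outerNormal P O Q) (dv f.edge₀₂)
    + inner ℝ (outerNormal Q O P)
      ((R.ρ (X.hol f.1.1 f.1.2.1)).linearIsometryEquiv (dv f.edge₁₂))

/-! ### The mapping `(dσ) → (dv)` -/

/-- The deviation of an edge for given deviations `dσ` (bivectors) of the vertices:
`(dv_{AB})_β = (1 / L_{AB}) ∑ l_α ((dσ_A)_{αβ} - (dσ_B)_{αβ})`, where `l` is the vector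
`AB`, and `dσ_B` is transformed to the coordinate system of `A`. -/
def dv (dσ : V → Matrix (Fin 4) (Fin 4) ℝ) (e : X.Edge) : E4 :=
  let g := rot (R.ρ (X.hol e.1.1 e.1.2))
  (1 / X.sqLength R e) •
    WithLp.toLp 2 ((X.edgeVec R e.1.1 e.1.2).ofLp ᵥ* (dσ e.1.1 - g * dσ e.1.2 * gᵀ))

/-! ### The matrices -/

/-- The six components of a bivector. -/
abbrev Pair : Type := {c : Fin 4 × Fin 4 // c.1 < c.2}

/-- The bivector with the only nonzero component `αβ`, `α < β`, equal to one. -/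
def basisBivector (c : Pair) : Matrix (Fin 4) (Fin 4) ℝ :=
  Matrix.single c.1.1 c.1.2 1 - Matrix.single c.1.2 c.1.1 1

variable {ι₀ ι₆ : Type*} (a : Module.Basis ι₀ ℝ R.motions)
  (s : Module.Basis ι₆ ℝ R.trivialDeviations) (fr : X.Edge → Fin 3 → E4)

/-- The matrix of `𝔞 → (dx and dg)`. -/
def matrix₀ : Matrix ((V × Fin 4) ⊕ J) ι₀ ℝ :=
  Matrix.of fun r i => Sum.elim
    (fun vα : V × Fin 4 => affineField (a i).1 (X.coord vα.1) vα.2) (fun _ => 0) r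

/-- The matrix of `(dx and dg) → (dL)`. -/
def matrix₁ [Fintype J] : Matrix X.Edge ((V × Fin 4) ⊕ J) ℝ :=
  open Classical in
  Matrix.of fun e c => Sum.elim
    (fun vα : V × Fin 4 => X.dL R (Pi.single vα.1 (EuclideanSpace.single vα.2 1)) 0 e)
    (fun j : J => X.dL R 0 (Pi.single j 1) e) c

/-- The matrix `(∂ω_i / ∂L_a)` of `(dL) → (dω)`. -/
def matrix₂ [Fintype T] : Matrix X.Face X.Edge ℝ :=
  Matrix.of fun f e =>
    deriv (fun ℓ : ℝ => X.deficitAngle R (Function.update (X.sqLength R) e ℓ) f)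
      (X.sqLength R e)

/-- The matrix `(∂S_i / ∂v_a)` of `(dv) → (dS)`. -/
def areaMatrix : Matrix X.Face (X.Edge × Fin 3) ℝ :=
  Matrix.of fun f c => X.dS R (Pi.single c.1 (fr c.1 c.2)) f

/-- The matrix `(∂v_a / ∂σ)` of `(dσ) → (dv)`. -/
def deviationMatrix : Matrix (X.Edge × Fin 3) (V × Pair) ℝ :=
  Matrix.of fun r c => inner ℝ (fr r.1 r.2) (X.dv R (Pi.single c.1 (basisBivector c.2)) r.1)

/-- The matrix of `(dσ)₀ → (dσ)`. -/
def trivialMatrix : Matrix (V × Pair) ι₆ ℝ :=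
  Matrix.of fun r i => trivialDeviation (s i).1 (X.coord r.1) r.2.1.1 r.2.1.2

variable [Fintype V] [Fintype T] [Fintype J] [Fintype ι₀] [Fintype ι₆]

/-- Acyclicity of the sequence
`0 → 𝔞 → (dx and dg) → (dL) → (dω) → (dv)* → (dσ)* → (dσ)₀* → 0`,
where the last three matrices are the transposes of those of the sequence
`(dS) ← (dv) ← (dσ) ← (dσ)₀`. -/
def Acyclic : Prop :=
  IsAcyclic (X.matrix₀ R a) (X.matrix₁ R) (X.matrix₂ R) (X.areaMatrix R fr)ᵀ
    (X.deviationMatrix R fr)ᵀ (X.trivialMatrix R s)ᵀ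

/-- A choice of minors for the matrices of this sequence. -/
abbrev Choice (_ : Representation4 Γ J) (X : Triangulation4 Γ V T) : Type _ :=
  MinorChoice ((V × Fin 4) ⊕ J) X.Edge X.Face (X.Edge × Fin 3) (V × Pair)

/-- The absolute values of the six minors of the sequence for the given choice. -/
def minors (B : X.Choice R) : Fin 6 → ℝ :=
  _root_.minors (X.matrix₀ R a) (X.matrix₁ R) (X.matrix₂ R) (X.areaMatrix R fr)ᵀ
    (X.deviationMatrix R fr)ᵀ (X.trivialMatrix R s)ᵀ B

/-- `τ` is the torsion of the sequence (up to sign): the alternating product of some choice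
of nonzero minors. -/
def IsTorsion (τ : ℝ) : Prop :=
  ∃ B : X.Choice R, (∀ k, X.minors R a s fr B k ≠ 0) ∧
    τ = alternatingProduct (X.minors R a s fr B)

end Triangulation4

/-! ## The 1→5 move -/

namespace Triangulation4

variable {Γ : Type*} [Group Γ] {V T J : Type*} [LinearOrder V]

/-- The 1→5 move: a new vertex `F = ⊤` is added, and the 4-simplex `t₀` is replaced with the
five 4-simplices obtained from it by replacing its vertex number `k` with `F`. The position
of `F` in the coordinate system of the first vertex of `t₀` is `q`, and this coordinate
system is taken also as that of `F`. -/
def move (X : Triangulation4 Γ V T) (t₀ : T) (q : E4) :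
    Triangulation4 Γ (WithTop V) ({t : T // t ≠ t₀} ⊕ Fin 5) where
  vert := Sum.elim (fun t i => (X.vert t.1 i : WithTop V))
    (fun k => Function.update (fun i => (X.vert t₀ i : WithTop V)) k ⊤)
  vert_injective := by
    rintro (t | k) i j hij
    · exact X.vert_injective t.1 (by simpa using hij)
    · simp only [Sum.elim_inr, Function.update_apply] at hij
      split_ifs at hij with h1 h2 h2
      · rw [h1, h2]
      · simp at hij
      · simp at hij
      · exact X.vert_injective t₀ (by simpa using hij)
  hol u v := X.hol (u.untopD (X.vert t₀ 0)) (v.untopD (X.vert t₀ 0))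
  hol_mul := by
    rintro (t | k) i j l
    · simpa using X.hol_mul t.1 i j l
    · have key : ∀ i, ∃ i', (Function.update (fun i => (X.vert t₀ i : WithTop V)) k ⊤ i).untopD
          (X.vert t₀ 0) = X.vert t₀ i' := by
        intro i
        by_cases h : i = k
        · exact ⟨0, by simp [h]⟩
        · exact ⟨i, by simp [h]⟩
      obtain ⟨i', hi⟩ := key i
      obtain ⟨j', hj⟩ := key j
      obtain ⟨l', hl⟩ := key l
      simp only [Sum.elim_inr, hi, hj, hl]
      exact X.hol_mul t₀ i' j' l'
  coord := fun v => WithTop.recTopCoe q X.coord v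

variable (R : Representation4 Γ J) (X : Triangulation4 Γ V T) (t₀ : T) (q : E4)

theorem exists_move_simplex (P : V → Prop) (t : T) (k : Fin 5)
    (hk : ∀ i, P (X.vert t₀ i) → i ≠ k) (hP : ∀ v, P v → v ∈ Set.range (X.vert t)) :
    ∃ t', ∀ v, P v → (v : WithTop V) ∈ Set.range ((X.move t₀ q).vert t') := by
  by_cases h : t = t₀
  · subst h
    refine ⟨Sum.inr k, fun v hv => ?_⟩
    obtain ⟨i, rfl⟩ := hP v hv
    exact ⟨i, by simp [move, hk i hv]⟩
  · refine ⟨Sum.inl ⟨t, h⟩, fun v hv => ?_⟩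
    obtain ⟨i, rfl⟩ := hP v hv
    exact ⟨i, by simp [move]⟩

theorem exists_index_avoiding (u v w : V) :
    ∃ k : Fin 5, ∀ i, (X.vert t₀ i = u ∨ X.vert t₀ i = v ∨ X.vert t₀ i = w) → i ≠ k := by
  classical
  have hcard : ((({u, v, w} : Finset V).preimage (X.vert t₀)
      (X.vert_injective t₀).injOn)).card < (Finset.univ : Finset (Fin 5)).card := by
    have h1 := Finset.card_le_card_of_injOn (X.vert t₀)
      (s := (({u, v, w} : Finset V).preimage (X.vert t₀) (X.vert_injective t₀).injOn))
      (t := ({u, v, w} : Finset V)) (fun i hi => by simpa using hi)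
      (X.vert_injective t₀).injOn
    have h2 : ({u, v, w} : Finset V).card ≤ 3 := Finset.card_le_three
    simp only [Finset.card_univ, Fintype.card_fin]
    omega
  obtain ⟨k, -, hk⟩ := Finset.exists_mem_notMem_of_card_lt_card hcard
  refine ⟨k, fun i hi hik => hk ?_⟩
  subst hik
  simpa using hi

/-- An edge of the old triangulation as an edge of the new one. -/
def oldEdge (e : X.Edge) : (X.move t₀ q).Edge :=
  ⟨((e.1.1 : WithTop V), (e.1.2 : WithTop V)), WithTop.coe_lt_coe.2 e.2.1, by
    obtain ⟨t, h1, h2⟩ := e.2.2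
    obtain ⟨k, hk⟩ := X.exists_index_avoiding t₀ e.1.1 e.1.2 e.1.2
    obtain ⟨t', h'⟩ := X.exists_move_simplex t₀ q (fun v => v = e.1.1 ∨ v = e.1.2 ∨ v = e.1.2)
      t k hk (by rintro v (rfl | rfl | rfl) <;> assumption)
    exact ⟨t', h' _ (by simp), h' _ (by simp)⟩⟩

/-- A 2-face of the old triangulation as a 2-face of the new one. -/
def oldFace (f : X.Face) : (X.move t₀ q).Face :=
  ⟨((f.1.1 : WithTop V), (f.1.2.1 : WithTop V), (f.1.2.2 : WithTop V)),
    WithTop.coe_lt_coe.2 f.2.1, WithTop.coe_lt_coe.2 f.2.2.1, by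
    obtain ⟨t, h1, h2, h3⟩ := f.2.2.2
    obtain ⟨k, hk⟩ := X.exists_index_avoiding t₀ f.1.1 f.1.2.1 f.1.2.2
    obtain ⟨t', h'⟩ := X.exists_move_simplex t₀ q
      (fun v => v = f.1.1 ∨ v = f.1.2.1 ∨ v = f.1.2.2)
      t k hk (by rintro v (rfl | rfl | rfl) <;> assumption)
    exact ⟨t', h' _ (by simp), h' _ (by simp), h' _ (by simp)⟩⟩

theorem mem_range_move {i k : Fin 5} (h : i ≠ k) :
    (X.vert t₀ i : WithTop V) ∈ Set.range ((X.move t₀ q).vert (Sum.inr k)) :=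
  ⟨i, by simp [move, h]⟩

theorem top_mem_range_move (k : Fin 5) :
    (⊤ : WithTop V) ∈ Set.range ((X.move t₀ q).vert (Sum.inr k)) :=
  ⟨k, by simp [move]⟩

/-- The new edge joining the vertex number `i` of `t₀` and the new vertex `F`. -/
def newEdge (i : Fin 5) : (X.move t₀ q).Edge :=
  ⟨((X.vert t₀ i : WithTop V), ⊤), WithTop.coe_lt_top _, Sum.inr (i + 1),
    X.mem_range_move t₀ q (by fin_cases i <;> decide), X.top_mem_range_move t₀ q _⟩

/-- The new 2-face spanned by the vertices number `i` and `j` of `t₀` and by the new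
vertex `F`. -/
def newFace (i j : Fin 5) (h : i ≠ j) : (X.move t₀ q).Face :=
  ⟨((min (X.vert t₀ i) (X.vert t₀ j) : V), (max (X.vert t₀ i) (X.vert t₀ j) : V), ⊤), by
    refine ⟨WithTop.coe_lt_coe.2 (min_lt_max.2 ((X.vert_injective t₀).ne h)),
      WithTop.coe_lt_top _, ?_⟩
    obtain ⟨k, hi, hj⟩ : ∃ k, i ≠ k ∧ j ≠ k := by revert i j; decide
    refine ⟨Sum.inr k, ?_, ?_, X.top_mem_range_move t₀ q k⟩
    · rcases min_choice (X.vert t₀ i) (X.vert t₀ j) with h' | h' <;> rw [h']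
      exacts [X.mem_range_move t₀ q hi, X.mem_range_move t₀ q hj]
    · rcases max_choice (X.vert t₀ i) (X.vert t₀ j) with h' | h' <;> rw [h']
      exacts [X.mem_range_move t₀ q hi, X.mem_range_move t₀ q hj]⟩

/-- Denote by `A, B, C, D, E` the vertices number `0, 1, 2, 3, 4` of `t₀`. The extension of
a choice of minors under the move.
* The columns `dx_F, dy_F, dz_F, dt_F` and the rows `dL_{AF}, dL_{BF}, dL_{CF}, dL_{DF}` are
  added to the minor of `(dx and dg) → (dL)`.
* The column `dL_{EF}` and the row `dω_{DEF}` are added to the minor of `(dL) → (dω)`.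
* All the new faces except `DEF`, all the components of `dv_{DF}` and `dv_{EF}`, and the
  components `(dv_{BF})_x`, `(dv_{CF})_x`, `(dv_{CF})_y` are added to the minor of
  `(∂S_i / ∂v_a)`.
* The remaining six components of `dv` for the new edges and all the six components of
  `dσ_F` are added to the minor of `(∂v_a / ∂σ)`. -/
def extendChoice (B : X.Choice R) : (X.move t₀ q).Choice R where
  B₁ := open Classical in
    B.B₁.image (Sum.map (Prod.map (fun v : V => (v : WithTop V)) id) id)
  B₂ := B.B₂.image (X.oldEdge t₀ q) ∪ ({0, 1, 2, 3} : Finset (Fin 5)).image (X.newEdge t₀ q)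
  B₃ := B.B₃.image (X.oldFace t₀ q) ∪ {X.newFace t₀ q 3 4 (by decide)}
  B₄ := B.B₄.image (Prod.map (X.oldEdge t₀ q) id) ∪
    ({(3, 0), (3, 1), (3, 2), (4, 0), (4, 1), (4, 2), (1, 0), (2, 0), (2, 1)} :
      Finset (Fin 5 × Fin 3)).image (Prod.map (X.newEdge t₀ q) id)
  B₅ := B.B₅.image (Prod.map (fun v : V => (v : WithTop V)) id) ∪
    Finset.univ.image (fun c : Pair => ((⊤ : WithTop V), c))

/-- The vector from the new vertex `F` to the vertex number `i` of `t₀`, in the coordinate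
system of the first vertex of `t₀`. -/
def spoke (i : Fin 5) : E4 := X.simplexPlace R t₀ i - q

/-- The `k`-th axis for the deviation of the new edge from the vertex number `i` of `t₀` to
`F`, in the coordinate system of the first vertex of `t₀`. -/
def newAxis (fr' : (X.move t₀ q).Edge → Fin 3 → E4) (i : Fin 5) (k : Fin 3) : E4 :=
  (R.ρ (X.hol (X.vert t₀ 0) (X.vert t₀ i))).linearIsometryEquiv (fr' (X.newEdge t₀ q i) k)

/-- The axes for the deviations of the old edges do not change under the move, and the axes
`x, y, z = 0, 1, 2` for the deviations of the new edges `AF`, `BF` and `CF` are as follows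
(each of them being orthogonal to its edge and to the other axes for this edge): the `x` axes
for `AF` and `BF` lie in the plane `ABF`, and their `y` axes lie in the hyperplane `ABCF`;
the `x` axis for `CF` is orthogonal to the plane `BCF`, and both the `x` and `y` axes
for `CF` lie in the hyperplane `ABCF`. Consequently, the `y` axes for `AF` and `BF` are
orthogonal to `ABF`, and the `z` axes for all these edges are orthogonal to `ABCF`. -/
structure IsAdaptedFraming (fr : X.Edge → Fin 3 → E4)
    (fr' : (X.move t₀ q).Edge → Fin 3 → E4) : Prop where
  isFraming : (X.move t₀ q).IsFraming R fr'
  old : ∀ e, fr' (X.oldEdge t₀ q e) = fr e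
  x_AF : X.newAxis R t₀ q fr' 0 0 ∈ Submodule.span ℝ {X.spoke R t₀ q 0, X.spoke R t₀ q 1}
  x_BF : X.newAxis R t₀ q fr' 1 0 ∈ Submodule.span ℝ {X.spoke R t₀ q 0, X.spoke R t₀ q 1}
  y_AF : X.newAxis R t₀ q fr' 0 1 ∈
    Submodule.span ℝ {X.spoke R t₀ q 0, X.spoke R t₀ q 1, X.spoke R t₀ q 2}
  y_BF : X.newAxis R t₀ q fr' 1 1 ∈
    Submodule.span ℝ {X.spoke R t₀ q 0, X.spoke R t₀ q 1, X.spoke R t₀ q 2}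
  x_CF : X.newAxis R t₀ q fr' 2 0 ∈
    Submodule.span ℝ {X.spoke R t₀ q 0, X.spoke R t₀ q 1, X.spoke R t₀ q 2}
  x_CF_perp : inner ℝ (X.newAxis R t₀ q fr' 2 0) (X.spoke R t₀ q 1) = 0
  y_CF : X.newAxis R t₀ q fr' 2 1 ∈
    Submodule.span ℝ {X.spoke R t₀ q 0, X.spoke R t₀ q 1, X.spoke R t₀ q 2}

/-- The volume of the new 4-simplex in which `F` replaces the vertex number `k` of `t₀`. -/
def newVolume (k : Fin 5) : ℝ := (X.move t₀ q).volume R (Sum.inr k)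

/-- The length of the new edge from the vertex number `i` of `t₀` to `F`. -/
def newLength (i : Fin 5) : ℝ := (X.move t₀ q).length R (X.newEdge t₀ q i)

/-- The area of the new 2-face spanned by `F` and the vertices number `i ≠ j` of `t₀`. -/
def newArea (i j : Fin 5) (h : i ≠ j := by decide) : ℝ :=
  (X.move t₀ q).area R (X.newFace t₀ q i j h)

/-- The angle between the planes `ACF` and `BCF`. -/
def planeAngle : ℝ :=
  InnerProductGeometry.angle (perp (X.spoke R t₀ q 0) (X.spoke R t₀ q 2))
    (perp (X.spoke R t₀ q 1) (X.spoke R t₀ q 2))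

/-- The factors by which the six minors are multiplied under the move. -/
def moveFactors : Fin 6 → ℝ :=
  let v := X.newVolume R t₀ q
  let S (i j : Fin 5) (h : i ≠ j := by decide) := X.newArea R t₀ q i j h
  let l := X.newLength R t₀ q
  let α := X.planeAngle R t₀ q
  ![1,
    384 * v 4,
    S 3 4 / 24 * (v 4 * X.volume R t₀ / (v 0 * v 1 * v 2)),
    9 * v 4 * v 3 * l 3 ^ 5 * l 4 ^ 5 / (S 0 3 * S 1 3 * S 2 3 * S 0 4 * S 1 4 * S 2 4) *
      (l 1 * l 2 ^ 2 * Real.sin α),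
    8 * S 0 2 * S 1 2 * S 0 1 / (l 0 ^ 5 * l 1 ^ 4 * l 2 ^ 3) * Real.sin α,
    1]

/-- The product of the areas of all the new 2-faces. -/
def newAreaProduct : ℝ :=
  ∏ i : Fin 5, ∏ j : Fin 5, if h : i < j then X.newArea R t₀ q i j h.ne else 1

end Triangulation4

end

/-!
The vertices `A, B, C, D, E` of the replaced 4-simplex and the new vertex `F` are six points of
four-space. Up to a factor they have a single affine dependence; normalized so that `λ_F = -1`,
its other coefficients are the barycentric coordinates of `F`, and they do not vanish, because
`V_k̂ = |λ_k| V_F̂` (`signedVolume_update`). Everything that the move changes is expressed by `λ`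
and by the spokes, the vectors from `F` to the five old vertices.

*The matrices.* With the old basis elements first (`edgeEquiv`, `faceEquiv` and their analogues),
five of the six matrices after the move are block triangular: the old matrix, a block that depends
on the spokes only, and a zero block (`matrix₀_move`, `matrix₁_move`, `areaMatrix_move`,
`deviationMatrix_move`, `trivialMatrix_move`). The remaining matrix `(∂ω_i / ∂L_a)` is extended by
zeros and changed by a matrix of rank one (`matrix₂_move`). Indeed, its change is a sum over the six
4-simplices on the six points, taken with the signs of the `λ_k`. The dihedral angles are angles
between the gradients of the barycentric coordinates, so that their derivatives are explicit
(`IsGradient.hasDerivAt_dihedralAngle`). The gradients in different simplices are related through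
`λ` (`IsGradient.sixGradient`), and the three angles at a triangle `x y z` then contribute a
constant times `S_{xyz} λ_x λ_y λ_z λ_u λ_v` to the derivative with respect to `L_{uv}`
(`IsGradient.sum_three_rates`, `sum_sign_mul_angleSum`).

*The minors.* By the triangular shape each extended minor is the old one times the determinant of a
block; for the perturbation of rank one, the block is the entry `∂ω_{DEF} / ∂L_{EF}`, and the
perturbation of the old block is eliminated by means of it (`absMinor_fromBlocks_zero₁₂`,
`absMinor_fromBlocks_zero₂₁`, `absMinor_fromBlocks_add_rank_one`). The blocks are evaluated in
orthogonal frames that begin with a spoke. For the areas, the components along the axes at `DF` and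
at `EF` give volumes, and for the bivectors the frame at `AF` makes the matrix triangular, by the
choice of the axes (`abs_det_spokeLengthMatrix`, `abs_mul_newFace_newEdge`,
`abs_det_spokeAreaMatrix`, `abs_det_spokeDeviationMatrix`). The result is `minors_extendChoice`.

*Acyclicity.* The two factors of the matrix of rank one are annihilated by the neighbouring maps:
`λ_u λ_v` is a linear relation between the `dL_{uv}` (`sum_moveCoeff_mul_dL`), and
`S_{xyz} λ_x λ_y λ_z` is one between the differentials of the areas
(`sum_areaMatrix_mul_faceCoeff`). The sequence of the added blocks is exact, the factors of the
matrix of rank one spanning the missing cokernel and kernel, by linear algebra of five vectors that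
span four-space (`IsSpokeSystem`). Therefore the extended sequence is acyclic exactly when the old
one is (`isAcyclic_extension_iff`, `acyclic_move_iff_of_old`). Another system of axes amounts to an
orthogonal change of basis in one term (`exists_reframing`).

*Torsion.* In an exact sequence, complementary maximal minors of the incoming and of the outgoing
map are proportional (`exists_duality_constant`). So the alternating product of nonzero minors does
not depend on their choice, nor on an orthogonal change of basis (`IsAcyclic.exists_torsion`).
Adapted axes exist by the Gram–Schmidt process (`exists_isAdaptedFraming`); the extension of nonzero
minors consists of nonzero minors, and the torsion is multiplied by the alternating product of the
six factors (`alternatingProduct_moveFactors`).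
-/

set_option linter.unusedSectionVars false

/-! ### Minors -/

/-- The rows and columns of a minor may be listed by any injective enumerations. -/
theorem absMinor_eq_abs_det {m n κ : Type*} [Fintype κ] [DecidableEq κ] (M : Matrix m n ℝ)
    {R : Finset m} {C : Finset n} {r : κ → m} {c : κ → n} (hr : Function.Injective r)
    (hc : Function.Injective c) (hR : ∀ x, x ∈ R ↔ ∃ k, r k = x)
    (hC : ∀ x, x ∈ C ↔ ∃ k, c k = x) : absMinor M R C = |(M.submatrix r c).det| := by
  classical
  let er : κ ≃ R := Equiv.ofBijective (fun k => ⟨r k, (hR _).2 ⟨k, rfl⟩⟩)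
    ⟨fun a b h => hr (congrArg Subtype.val h), fun x => by
      obtain ⟨k, hk⟩ := (hR _).1 x.2
      exact ⟨k, Subtype.ext hk⟩⟩
  let ec : κ ≃ C := Equiv.ofBijective (fun k => ⟨c k, (hC _).2 ⟨k, rfl⟩⟩)
    ⟨fun a b h => hc (congrArg Subtype.val h), fun x => by
      obtain ⟨k, hk⟩ := (hC _).1 x.2
      exact ⟨k, Subtype.ext hk⟩⟩
  have hcard : R.card = C.card := by
    rw [← Fintype.card_coe R, ← Fintype.card_coe C, ← Fintype.card_congr er,
      ← Fintype.card_congr ec]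
  rw [absMinor, dif_pos hcard]
  generalize_proofs h
  set σ := Fintype.equivOfCardEq h
  have h1 : (Matrix.of fun i j : R => M i (σ j : C)).submatrix er er =
      (M.submatrix r c).submatrix id ((er.trans σ).trans ec.symm) := by
    ext i j
    have : c (ec.symm (σ (er j))) = (σ (er j) : C) :=
      congrArg Subtype.val (ec.apply_symm_apply (σ (er j)))
    simp only [Matrix.submatrix_apply, Matrix.of_apply, id, Equiv.trans_apply, this]
    rfl
  have h2 := Matrix.det_submatrix_equiv_self er (Matrix.of fun i j : R => M i (σ j : C))
  rw [h1, Matrix.det_permute'] at h2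
  have h3 := congrArg abs h2
  rw [abs_mul] at h3
  convert h3.symm using 1
  rcases Int.units_eq_one_or (Equiv.Perm.sign ((er.trans σ).trans ec.symm)) with h | h <;>
    rw [h] <;> simp

theorem absMinor_eq_zero_of_card_ne {m n : Type*} (M : Matrix m n ℝ) {R : Finset m}
    {C : Finset n} (h : R.card ≠ C.card) : absMinor M R C = 0 := by
  rw [absMinor, dif_neg h]

theorem Finset.exists_injective_range_eq {α : Type*} (S : Finset α) {k : ℕ} (hk : S.card = k) :
    ∃ r : Fin k → α, Function.Injective r ∧ ∀ x, x ∈ S ↔ ∃ k, r k = x := by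
  refine ⟨fun i => ((S.equivFinOfCardEq hk).symm i : α), fun a b hab => ?_, fun x => ?_⟩
  · simpa using Subtype.ext hab
  · exact ⟨fun hx => ⟨S.equivFinOfCardEq hk ⟨x, hx⟩, by simp⟩, by rintro ⟨k, rfl⟩; simp⟩

theorem card_eq_of_absMinor_ne_zero {m n : Type*} {M : Matrix m n ℝ} {R : Finset m}
    {C : Finset n} (h : absMinor M R C ≠ 0) : R.card = C.card := by
  by_contra hcard
  exact h (absMinor_eq_zero_of_card_ne M hcard)

theorem absMinor_nonneg {m n : Type*} (M : Matrix m n ℝ) (R : Finset m) (C : Finset n) :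
    0 ≤ absMinor M R C := by
  unfold absMinor
  split_ifs
  exacts [abs_nonneg _, le_rfl]

theorem absMinor_submatrix {m n m' n' : Type*} [DecidableEq m] [DecidableEq n]
    (M : Matrix m n ℝ) {f : m' → m} {g : n' → n}
    (hf : Function.Injective f) (hg : Function.Injective g) (R : Finset m') (C : Finset n') :
    absMinor (M.submatrix f g) R C = absMinor M (R.image f) (C.image g) := by
  by_cases h : R.card = C.card
  · obtain ⟨r, hr, hR⟩ := R.exists_injective_range_eq h
    obtain ⟨c, hc, hC⟩ := C.exists_injective_range_eq rfl
    rw [absMinor_eq_abs_det _ hr hc hR hC,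
      absMinor_eq_abs_det M (hf.comp hr) (hg.comp hc) (fun x => ?_) (fun x => ?_)]
    · rfl
    · simp only [Finset.mem_image, hR]
      exact ⟨by rintro ⟨_, ⟨k, rfl⟩, rfl⟩; exact ⟨k, rfl⟩, by rintro ⟨k, rfl⟩; exact ⟨_, ⟨k, rfl⟩, rfl⟩⟩
    · simp only [Finset.mem_image, hC]
      exact ⟨by rintro ⟨_, ⟨k, rfl⟩, rfl⟩; exact ⟨k, rfl⟩, by rintro ⟨k, rfl⟩; exact ⟨_, ⟨k, rfl⟩, rfl⟩⟩
  · rw [absMinor_eq_zero_of_card_ne _ h, absMinor_eq_zero_of_card_ne]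
    rwa [Finset.card_image_of_injective _ hf, Finset.card_image_of_injective _ hg]

/-- If, for every selection of rows and columns of `A`, the determinant of the bordered submatrix of
`M` is up to sign the product of those of the submatrix of `A` and of the border block of `N`, then
the minors multiply as well. -/
theorem absMinor_disjSum {m n p q κ : Type*} [Fintype κ] [DecidableEq κ]
    (A : Matrix m n ℝ) (M : Matrix (m ⊕ p) (n ⊕ q) ℝ) (N : Matrix p q ℝ)
    {S : Finset p} {D : Finset q} {s : κ → p} {d : κ → q}
    (hs : Function.Injective s) (hd : Function.Injective d)
    (hS : ∀ x, x ∈ S ↔ ∃ k, s k = x) (hD : ∀ x, x ∈ D ↔ ∃ k, d k = x)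
    (hdet : ∀ {k : ℕ} (r : Fin k → m) (c : Fin k → n),
      |(M.submatrix (Sum.map r s) (Sum.map c d)).det| =
        |(A.submatrix r c).det| * |(N.submatrix s d).det|)
    (R : Finset m) (C : Finset n) :
    absMinor M (R.disjSum S) (C.disjSum D) = absMinor A R C * absMinor N S D := by
  have hSD : S.card = D.card := by
    let es : κ ≃ S := Equiv.ofBijective (fun k => ⟨s k, (hS _).2 ⟨k, rfl⟩⟩)
      ⟨fun a b h => hs (congrArg Subtype.val h), fun x => by
        obtain ⟨k, hk⟩ := (hS _).1 x.2
        exact ⟨k, Subtype.ext hk⟩⟩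
    let ed : κ ≃ D := Equiv.ofBijective (fun k => ⟨d k, (hD _).2 ⟨k, rfl⟩⟩)
      ⟨fun a b h => hd (congrArg Subtype.val h), fun x => by
        obtain ⟨k, hk⟩ := (hD _).1 x.2
        exact ⟨k, Subtype.ext hk⟩⟩
    rw [← Fintype.card_coe S, ← Fintype.card_coe D, ← Fintype.card_congr es,
      ← Fintype.card_congr ed]
  by_cases h : R.card = C.card
  · obtain ⟨r, hr, hR⟩ := R.exists_injective_range_eq h
    obtain ⟨c, hc, hC⟩ := C.exists_injective_range_eq rfl
    rw [absMinor_eq_abs_det A hr hc hR hC, absMinor_eq_abs_det N hs hd hS hD, ← hdet,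
      absMinor_eq_abs_det M (hr.sumMap hs) (hc.sumMap hd)]
    · rintro (x | x) <;> simp [hR, hS]
    · rintro (x | x) <;> simp [hC, hD]
  · rw [absMinor_eq_zero_of_card_ne _ h, absMinor_eq_zero_of_card_ne, zero_mul]
    simpa [hSD] using h

section
variable {m n p q κ : Type*} {S : Finset p} {D : Finset q} {s : κ → p} {d : κ → q}

theorem submatrix_sumMap (A : Matrix m n ℝ) (B : Matrix m q ℝ) (C : Matrix p n ℝ)
    (N : Matrix p q ℝ) {k : ℕ} (r : Fin k → m) (c : Fin k → n) :
    (Matrix.fromBlocks A B C N).submatrix (Sum.map r s) (Sum.map c d) =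
      Matrix.fromBlocks (A.submatrix r c) (B.submatrix r d) (C.submatrix s c)
        (N.submatrix s d) := by
  ext (i | i) (j | j) <;> rfl

variable [Fintype κ] [DecidableEq κ]

theorem absMinor_fromBlocks_zero₁₂ (A : Matrix m n ℝ) (C : Matrix p n ℝ) (N : Matrix p q ℝ)
    (hs : Function.Injective s) (hd : Function.Injective d)
    (hS : ∀ x, x ∈ S ↔ ∃ k, s k = x) (hD : ∀ x, x ∈ D ↔ ∃ k, d k = x)
    (R : Finset m) (T : Finset n) :
    absMinor (Matrix.fromBlocks A 0 C N) (R.disjSum S) (T.disjSum D) =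
      absMinor A R T * |(N.submatrix s d).det| := by
  rw [← absMinor_eq_abs_det N hs hd hS hD]
  refine absMinor_disjSum A _ N hs hd hS hD (fun r c => ?_) R T
  rw [submatrix_sumMap, Matrix.submatrix_zero, Pi.zero_apply, Pi.zero_apply,
    Matrix.det_fromBlocks_zero₁₂, abs_mul]

theorem absMinor_fromBlocks_zero₂₁ (A : Matrix m n ℝ) (B : Matrix m q ℝ) (N : Matrix p q ℝ)
    (hs : Function.Injective s) (hd : Function.Injective d)
    (hS : ∀ x, x ∈ S ↔ ∃ k, s k = x) (hD : ∀ x, x ∈ D ↔ ∃ k, d k = x)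
    (R : Finset m) (T : Finset n) :
    absMinor (Matrix.fromBlocks A B 0 N) (R.disjSum S) (T.disjSum D) =
      absMinor A R T * |(N.submatrix s d).det| := by
  rw [← absMinor_eq_abs_det N hs hd hS hD]
  refine absMinor_disjSum A _ N hs hd hS hD (fun r c => ?_) R T
  rw [submatrix_sumMap, Matrix.submatrix_zero, Pi.zero_apply, Pi.zero_apply,
    Matrix.det_fromBlocks_zero₂₁, abs_mul]

/-- A perturbation of rank one, eliminated by means of its lower right entry. -/
theorem absMinor_fromBlocks_add_rank_one [DecidableEq p] [DecidableEq q] (A : Matrix m n ℝ)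
    (c : m → ℝ) (c' : p → ℝ) (v : n → ℝ) (v' : q → ℝ) (i : p) (j : q) (hi : c' i ≠ 0)
    (hj : v' j ≠ 0) (R : Finset m) (T : Finset n) :
    absMinor (Matrix.fromBlocks (A + Matrix.vecMulVec c v) (Matrix.vecMulVec c v')
      (Matrix.vecMulVec c' v) (Matrix.vecMulVec c' v')) (R.disjSum {i}) (T.disjSum {j}) =
      absMinor A R T * |c' i * v' j| := by
  have h1 : absMinor (Matrix.vecMulVec c' v') {i} {j} = |c' i * v' j| := by
    rw [absMinor_eq_abs_det _ (κ := Unit) (r := fun _ => i) (c := fun _ => j)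
      (fun _ _ _ => rfl) (fun _ _ _ => rfl) (by simp [eq_comm]) (by simp [eq_comm]),
      Matrix.det_unique]
    rfl
  rw [← h1]
  refine absMinor_disjSum A _ _ (κ := Unit) (s := fun _ => i) (d := fun _ => j)
    (fun _ _ _ => rfl) (fun _ _ _ => rfl) (by simp [eq_comm]) (by simp [eq_comm])
    (fun r t => ?_) R T
  have hne : c' i * v' j ≠ 0 := mul_ne_zero hi hj
  -- The Schur complement of the entry `c' i * v' j` is a submatrix of `A`.
  set D := (Matrix.vecMulVec c' v').submatrix (fun _ : Unit => i) (fun _ : Unit => j) with hD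
  have hdet : D.det = c' i * v' j := by rw [Matrix.det_unique]; rfl
  have hinv : Invertible D := Matrix.invertibleOfIsUnitDet _ (by rw [hdet]; exact hne.isUnit)
  rw [submatrix_sumMap, ← hD, Matrix.det_fromBlocks₂₂, mul_comm, abs_mul]
  congr 2
  congr 1
  have hD' : ⅟D = Matrix.of fun _ _ => (c' i * v' j)⁻¹ := by
    rw [invOf_eq_left_inv]
    ext a b
    simp [Matrix.mul_apply, hD, Matrix.vecMulVec_apply]
    field_simp
  rw [hD']
  ext a b
  simp only [Matrix.sub_apply, Matrix.submatrix_apply, Matrix.add_apply, Matrix.vecMulVec_apply,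
    Matrix.mul_apply, Finset.univ_unique, Finset.sum_singleton, Matrix.of_apply]
  field_simp
  ring

end

/-! ### Torsion of acyclic sequences -/

section
variable {m n κ κ' : Type*} [Fintype κ] [Fintype κ']

/-- The case of the Cauchy–Binet formula in which the sum has a single term. -/
theorem absMinor_mul (A : Matrix m κ ℝ) (B : Matrix κ n ℝ) {R : Finset m} (C : Finset n)
    (hR : R.card = Fintype.card κ) :
    absMinor (A * B) R C = absMinor A R Finset.univ * absMinor B Finset.univ C := by
  classical
  by_cases h : R.card = C.card
  · obtain ⟨r, hr, hr'⟩ := R.exists_injective_range_eq hR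
    obtain ⟨c, hc, hc'⟩ := C.exists_injective_range_eq (h.symm.trans hR)
    let e : Fin (Fintype.card κ) ≃ κ := (Fintype.equivFin κ).symm
    have he : ∀ x, x ∈ Finset.univ ↔ ∃ k, e k = x := fun x => by simpa using e.surjective x
    rw [absMinor_eq_abs_det _ hr hc hr' hc', absMinor_eq_abs_det _ hr e.injective hr' he,
      absMinor_eq_abs_det _ e.injective hc he hc', ← abs_mul, ← Matrix.det_mul,
      Matrix.submatrix_mul_equiv]
  · rw [absMinor_eq_zero_of_card_ne _ h, absMinor_eq_zero_of_card_ne B, mul_zero]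
    rwa [Finset.card_univ, ← hR]

theorem exists_absMinor_ne_zero [Finite m] {U : Matrix m κ ℝ}
    (hU : Function.Injective U.mulVec) : ∃ B : Finset m, absMinor U B Finset.univ ≠ 0 := by
  classical
  obtain ⟨ι, a, ha, hspan, hli⟩ := exists_linearIndependent' ℝ U.row
  have : Finite ι := Finite.of_injective a ha
  have := Fintype.ofFinite ι
  have hcard : Fintype.card κ = Fintype.card ι := by
    rw [← finrank_span_eq_card hli, hspan, ← Matrix.rank_eq_finrank_span_row, Matrix.rank,
      LinearMap.finrank_range_of_inj (f := U.mulVecLin) hU, Module.finrank_fintype_fun_eq_card]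
  let e : κ ≃ ι := Fintype.equivOfCardEq hcard
  refine ⟨Finset.univ.image a, ?_⟩
  rw [absMinor_eq_abs_det U (r := a ∘ e) (c := id) (ha.comp e.injective) Function.injective_id
    (fun x => by simpa using e.surjective.exists) (fun x => by simp)]
  have hunit : IsUnit (U.submatrix (a ∘ e) id) :=
    Matrix.linearIndependent_rows_iff_isUnit.1 (hli.comp e e.injective)
  simpa using ((Matrix.isUnit_iff_isUnit_det _).1 hunit).ne_zero

/-- Jacobi's theorem on complementary minors, for a matrix `P` with columns indexed by `κ ⊕ κ'` and
its inverse `Q`. -/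
theorem absMinor_eq_mul_absMinor_compl [Fintype m] [DecidableEq m] [DecidableEq κ]
    [DecidableEq κ'] {P : Matrix m (κ ⊕ κ') ℝ} {Q : Matrix (κ ⊕ κ') m ℝ} (hPQ : P * Q = 1)
    (hQP : Q * P = 1) (B : Finset m) :
    absMinor (P.submatrix id Sum.inl) B Finset.univ =
      absMinor P Finset.univ Finset.univ * absMinor (Q.submatrix Sum.inr id) Finset.univ Bᶜ := by
  have hm : Fintype.card κ + Fintype.card κ' = Fintype.card m := by
    rw [← Fintype.card_sum]
    exact Matrix.square_of_invertible Q P hQP hPQ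
  have hB' : Bᶜ.card = Fintype.card m - B.card := Finset.card_compl B
  have hBm : B.card ≤ Fintype.card m := Finset.card_le_univ B
  by_cases hB : B.card = Fintype.card κ
  · obtain ⟨r₀, hr₀, hr₀'⟩ := B.exists_injective_range_eq hB
    obtain ⟨s₀, hs₀, hs₀'⟩ := Bᶜ.exists_injective_range_eq (k := Fintype.card κ') (by omega)
    let r := r₀ ∘ Fintype.equivFin κ
    let s := s₀ ∘ Fintype.equivFin κ'
    have hr : Function.Injective r := hr₀.comp (Equiv.injective _)
    have hs : Function.Injective s := hs₀.comp (Equiv.injective _)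
    have hr' : ∀ x, x ∈ B ↔ ∃ k, r k = x := fun x =>
      (hr₀' x).trans (Fintype.equivFin κ).surjective.exists
    have hs' : ∀ x, x ∈ Bᶜ ↔ ∃ k, s k = x := fun x =>
      (hs₀' x).trans (Fintype.equivFin κ').surjective.exists
    have hg : Function.Injective (Sum.elim r s) := by
      refine hr.sumElim hs fun a b hab => ?_
      have h1 := (hr' (r a)).2 ⟨a, rfl⟩
      rw [hab] at h1
      exact Finset.mem_compl.1 ((hs' (s b)).2 ⟨b, rfl⟩) h1
    have hg' : ∀ x, ∃ k, Sum.elim r s k = x := by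
      intro x
      by_cases hx : x ∈ B
      · obtain ⟨k, hk⟩ := (hr' x).1 hx
        exact ⟨Sum.inl k, hk⟩
      · obtain ⟨k, hk⟩ := (hs' x).1 (Finset.mem_compl.2 hx)
        exact ⟨Sum.inr k, hk⟩
    let g : κ ⊕ κ' ≃ m := Equiv.ofBijective _ ⟨hg, hg'⟩
    rw [absMinor_eq_abs_det _ hr Function.injective_id hr' (by simp),
      absMinor_eq_abs_det P (r := g) (c := id) hg Function.injective_id
        (fun x => ⟨fun _ => hg' x, fun _ => Finset.mem_univ x⟩) (by simp),
      absMinor_eq_abs_det _ Function.injective_id hs (by simp) hs']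
    have h1 : Q.submatrix id g * P.submatrix g id = 1 := by
      rw [Matrix.submatrix_mul_equiv, hQP, Matrix.submatrix_id_id]
    -- Multiply `Q` by the matrix `P` with its last columns replaced by those of the identity
    -- matrix.
    have h2 : Q.submatrix id g * Matrix.fromBlocks (P.submatrix r Sum.inl) 0
        (P.submatrix s Sum.inl) 1 =
        Matrix.fromBlocks 1 (Q.submatrix Sum.inl s) 0 (Q.submatrix Sum.inr s) := by
      ext i (j | j)
      · have h3 := congrFun (congrFun h1 i) (Sum.inl j)
        rw [Matrix.mul_apply, Fintype.sum_sum_type] at h3 ⊢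
        refine Eq.trans h3 ?_
        rcases i with i | i <;> simp [Matrix.one_apply]
      · rw [Matrix.mul_apply, Fintype.sum_sum_type]
        have hgs : g (Sum.inr j) = s j := rfl
        rcases i with i | i <;> simp [Matrix.one_apply, hgs]
    have h3 := congrArg Matrix.det h2
    have h4 := congrArg Matrix.det h1
    rw [Matrix.det_mul, Matrix.det_fromBlocks_zero₁₂, Matrix.det_fromBlocks_zero₂₁,
      Matrix.det_one, Matrix.det_one, mul_one, one_mul] at h3
    rw [Matrix.det_mul, Matrix.det_one] at h4
    rw [← abs_mul]
    simp only [Matrix.submatrix_submatrix, Function.id_comp, Function.comp_id]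
    rw [← h3, ← mul_assoc, mul_comm (P.submatrix g id).det, h4, one_mul]
  · rw [absMinor_eq_zero_of_card_ne _ (by rwa [Finset.card_univ]),
      absMinor_eq_zero_of_card_ne (Q.submatrix Sum.inr id) (by rw [Finset.card_univ]; omega),
      mul_zero]

theorem absMinor_one [Fintype m] [DecidableEq m] :
    absMinor (1 : Matrix m m ℝ) Finset.univ Finset.univ = 1 := by
  rw [absMinor_eq_abs_det _ (r := id) (c := id) Function.injective_id Function.injective_id
    (by simp) (by simp)]
  simp

/-- If the range of `U` is the kernel of `V`, then the maximal minors of `U` are proportional to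
the complementary maximal minors of `V`, and the coefficient survives a change of basis of
determinant `±1`: it is the determinant of the matrix that consists of `U` and of a right
inverse of `V`. -/
theorem exists_duality_constant [Fintype m] [DecidableEq m] {U : Matrix m κ ℝ}
    {V : Matrix κ' m ℝ} (hU : Function.Injective U.mulVec) (hV : Function.Surjective V.mulVec)
    (h : LinearMap.range U.mulVecLin = LinearMap.ker V.mulVecLin) :
    ∃ c : ℝ, 0 < c ∧ ∀ O O' : Matrix m m ℝ, O * O' = 1 → |O.det| = 1 → ∀ B : Finset m,
      absMinor (O * U) B Finset.univ = c * absMinor (V * O') Finset.univ Bᶜ := by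
  classical
  obtain ⟨W, hW⟩ := Matrix.mulVec_surjective_iff_exists_right_inverse.1 hV
  have hVU : V * U = 0 := by
    ext i j
    have h1 : U *ᵥ Pi.single j 1 ∈ LinearMap.ker V.mulVecLin := h ▸ ⟨_, rfl⟩
    have h2 := congrFun (LinearMap.mem_ker.1 h1) i
    rwa [Matrix.mulVecLin_apply, Matrix.mulVec_mulVec, Matrix.mulVec_single_one] at h2
  -- The columns of `U`, followed by those of a right inverse `W` of `V`. The lower part of the
  -- inverse of this matrix is `V`.
  let P : Matrix m (κ ⊕ κ') ℝ := Matrix.fromCols U W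
  have hVP : V * P = Matrix.fromCols 0 1 := by rw [Matrix.mul_fromCols, hVU, hW]
  have hP : Function.Surjective P.mulVec := by
    intro x
    have hx : x - W *ᵥ (V *ᵥ x) ∈ LinearMap.ker V.mulVecLin := by
      simp [Matrix.mulVec_sub, Matrix.mulVec_mulVec, ← Matrix.mul_assoc, hW]
    rw [← h] at hx
    obtain ⟨y, hy⟩ := hx
    refine ⟨Sum.elim y (V *ᵥ x), ?_⟩
    rw [Matrix.fromCols_mulVec_sumElim, show U *ᵥ y = _ from hy, sub_add_cancel]
  have hP' : Function.Injective P.mulVec := by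
    refine (injective_iff_map_eq_zero P.mulVecLin).2 fun x hx => ?_
    have hx' : P *ᵥ x = 0 := hx
    rw [← Sum.elim_comp_inl_inr x, Matrix.fromCols_mulVec_sumElim] at hx'
    have h1 := congrArg (V *ᵥ ·) hx'
    simp only [Matrix.mulVec_add, Matrix.mulVec_mulVec, hVU, hW, Matrix.zero_mulVec,
      Matrix.one_mulVec, zero_add, Matrix.mulVec_zero] at h1
    rw [h1, Matrix.mulVec_zero, add_zero] at hx'
    have h2 : x ∘ Sum.inl = 0 := hU (by rw [hx', Matrix.mulVec_zero])
    rw [← Sum.elim_comp_inl_inr x, h1, h2]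
    ext (i | i) <;> rfl
  obtain ⟨Q, hPQ⟩ := Matrix.mulVec_surjective_iff_exists_right_inverse.1 hP
  have hQP : Q * P = 1 := by
    refine Matrix.ext_of_mulVec_single fun i => hP' ?_
    rw [Matrix.mulVec_mulVec, ← Matrix.mul_assoc, hPQ, Matrix.one_mul, Matrix.one_mulVec]
  have hVQ : Q.submatrix Sum.inr id = V := by
    rw [← Matrix.mul_one V, ← hPQ, ← Matrix.mul_assoc, hVP]
    ext i j
    simp [Matrix.mul_apply, Matrix.one_apply]
  have hc : absMinor P Finset.univ Finset.univ ≠ 0 := by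
    intro h0
    have h1 := absMinor_mul Q P (R := Finset.univ) Finset.univ
      (by rw [Finset.card_univ]; exact Matrix.square_of_invertible Q P hQP hPQ)
    rw [hQP, absMinor_one, h0, mul_zero] at h1
    exact one_ne_zero h1
  refine ⟨_, (absMinor_nonneg _ _ _).lt_of_ne' hc, fun O O' hO hdet B => ?_⟩
  have hO' : O' * O = 1 := mul_eq_one_comm.1 hO
  have h1 := absMinor_eq_mul_absMinor_compl (P := O * P) (Q := Q * O')
    (by rw [Matrix.mul_assoc, ← Matrix.mul_assoc P, hPQ, Matrix.one_mul, hO])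
    (by rw [Matrix.mul_assoc, ← Matrix.mul_assoc O', hO', Matrix.one_mul, hQP]) B
  have h2 : (O * P).submatrix id Sum.inl = O * U := by
    ext i j
    simp [Matrix.mul_apply, P]
  have h3 : (Q * O').submatrix Sum.inr id = V * O' := by
    rw [← hVQ]
    ext i j
    simp [Matrix.mul_apply]
  have h4 : absMinor O Finset.univ Finset.univ = 1 := by
    rw [absMinor_eq_abs_det _ (r := id) (c := id) Function.injective_id Function.injective_id
      (by simp) (by simp), Matrix.submatrix_id_id, hdet]
  rw [h2, h3, absMinor_mul O P _ (by rw [Finset.card_univ]), h4, one_mul] at h1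
  exact h1

/-- The factorization of a linear map through its range. -/
theorem exists_full_rank_factorization [Fintype m] [Fintype n] (d : Matrix m n ℝ) :
    ∃ (r : ℕ) (U : Matrix m (Fin r) ℝ) (V : Matrix (Fin r) n ℝ), d = U * V ∧
      Function.Injective U.mulVec ∧ Function.Surjective V.mulVec := by
  classical
  let b := Module.finBasis ℝ (LinearMap.range d.mulVecLin)
  let f := (LinearMap.range d.mulVecLin).subtype ∘ₗ b.equivFun.symm.toLinearMap
  let g := b.equivFun.toLinearMap ∘ₗ d.mulVecLin.rangeRestrict
  have hf : (LinearMap.toMatrix' f).mulVec = f := by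
    ext x : 1
    exact LinearMap.toMatrix'_mulVec f x
  have hg : (LinearMap.toMatrix' g).mulVec = g := by
    ext x : 1
    exact LinearMap.toMatrix'_mulVec g x
  refine ⟨_, LinearMap.toMatrix' f, LinearMap.toMatrix' g, ?_, ?_, ?_⟩
  · rw [← LinearMap.toMatrix'_comp]
    refine Matrix.ext_of_mulVec_single fun i => ?_
    rw [LinearMap.toMatrix'_mulVec]
    simp [f, g]
  · rw [hf]
    exact Subtype.val_injective.comp b.equivFun.symm.injective
  · rw [hg]
    exact b.equivFun.surjective.comp d.mulVecLin.surjective_rangeRestrict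

end

theorem ker_mulVecLin_mul_of_injective {m n κ : Type*} [Fintype n] [Fintype κ]
    {U : Matrix m κ ℝ} {V : Matrix κ n ℝ} (hU : Function.Injective U.mulVec) :
    LinearMap.ker (U * V).mulVecLin = LinearMap.ker V.mulVecLin := by
  rw [Matrix.mulVecLin_mul, LinearMap.ker_comp_of_ker_eq_bot]
  exact LinearMap.ker_eq_bot.2 hU

theorem range_mulVecLin_mul_of_surjective {m n κ : Type*} [Fintype n] [Fintype κ]
    {U : Matrix m κ ℝ} {V : Matrix κ n ℝ} (hV : Function.Surjective V.mulVec) :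
    LinearMap.range (U * V).mulVecLin = LinearMap.range U.mulVecLin := by
  rw [Matrix.mulVecLin_mul, LinearMap.range_comp_of_range_eq_top]
  exact LinearMap.range_eq_top.2 hV

section
variable {ι₀ ι₁ ι₂ ι₃ ι₄ ι₅ ι₆ : Type*} [Fintype ι₀] [Fintype ι₁] [Fintype ι₂]
  [Fintype ι₃] [Fintype ι₄] [DecidableEq ι₄] [Fintype ι₅] [Fintype ι₆]
  {d₀ : Matrix ι₁ ι₀ ℝ} {d₁ : Matrix ι₂ ι₁ ℝ} {d₂ : Matrix ι₃ ι₂ ℝ}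
  {d₃ : Matrix ι₄ ι₃ ℝ} {d₄ : Matrix ι₅ ι₄ ℝ} {d₅ : Matrix ι₆ ι₅ ℝ}

/-- The torsion of an acyclic sequence: nonzero minors can be chosen, and their alternating
product depends neither on the choice nor on a change of the fourth basis of determinant `±1`.
The full rank factorisations `dₖ = Uₖ Vₖ` split every minor into a maximal minor of `Uₖ` and one
of `Vₖ`, and the two factors that belong to the same space are complementary. -/
theorem IsAcyclic.exists_torsion (h : IsAcyclic d₀ d₁ d₂ d₃ d₄ d₅) :
    ∃ τ : ℝ, 0 < τ ∧ ∀ O O' : Matrix ι₄ ι₄ ℝ, O * O' = 1 → |O.det| = 1 →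
      (∃ B, ∀ k, minors d₀ d₁ d₂ (O * d₃) (d₄ * O') d₅ B k ≠ 0) ∧
      ∀ B, (∀ k, minors d₀ d₁ d₂ (O * d₃) (d₄ * O') d₅ B k ≠ 0) →
        alternatingProduct (minors d₀ d₁ d₂ (O * d₃) (d₄ * O') d₅ B) = τ := by
  classical
  obtain ⟨h₀, h₁, h₂, h₃, h₄, h₅, h₆⟩ := h
  obtain ⟨r₁, U₁, V₁, rfl, hU₁, hV₁⟩ := exists_full_rank_factorization d₁
  obtain ⟨r₂, U₂, V₂, rfl, hU₂, hV₂⟩ := exists_full_rank_factorization d₂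
  obtain ⟨r₃, U₃, V₃, rfl, hU₃, hV₃⟩ := exists_full_rank_factorization d₃
  obtain ⟨r₄, U₄, V₄, rfl, hU₄, hV₄⟩ := exists_full_rank_factorization d₄
  simp only [ker_mulVecLin_mul_of_injective, range_mulVecLin_mul_of_surjective, *] at h₁ h₂ h₃ h₄ h₅
  -- The coefficient of proportionality of complementary minors, for each of the five middle spaces.
  obtain ⟨c₁, hc₁, e₁⟩ := exists_duality_constant h₀ hV₁ h₁
  obtain ⟨c₂, hc₂, e₂⟩ := exists_duality_constant hU₁ hV₂ h₂
  obtain ⟨c₃, hc₃, e₃⟩ := exists_duality_constant hU₂ hV₃ h₃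
  obtain ⟨c₄, hc₄, e₄⟩ := exists_duality_constant hU₃ hV₄ h₄
  obtain ⟨c₅, hc₅, e₅⟩ := exists_duality_constant hU₄ h₆ h₅
  replace e₁ := e₁ 1 1 (one_mul 1) (by simp)
  replace e₂ := e₂ 1 1 (one_mul 1) (by simp)
  replace e₃ := e₃ 1 1 (one_mul 1) (by simp)
  replace e₅ := e₅ 1 1 (one_mul 1) (by simp)
  simp only [Matrix.one_mul, Matrix.mul_one] at e₁ e₂ e₃ e₅
  refine ⟨c₂ * c₄ / (c₁ * c₃ * c₅), by positivity, fun O O' hO hdet => ?_⟩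
  replace e₄ := e₄ O O' hO hdet
  have hOU₃ : Function.Injective (O * U₃).mulVec := by
    intro x y hxy
    have h1 := congrArg (O' *ᵥ ·) hxy
    simp only [Matrix.mulVec_mulVec, ← Matrix.mul_assoc, mul_eq_one_comm.1 hO,
      Matrix.one_mul] at h1
    exact hU₃ h1
  rw [← Matrix.mul_assoc, Matrix.mul_assoc U₄]
  set U₃' := O * U₃
  set V₄' := V₄ * O'
  constructor
  -- Take nonzero maximal minors of the injective factors; the complementary minors of the
  -- surjective factors are nonzero by duality.
  · obtain ⟨B₁, b₁⟩ := exists_absMinor_ne_zero h₀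
    obtain ⟨B₂, b₂⟩ := exists_absMinor_ne_zero hU₁
    obtain ⟨B₃, b₃⟩ := exists_absMinor_ne_zero hU₂
    obtain ⟨B₄, b₄⟩ := exists_absMinor_ne_zero hOU₃
    obtain ⟨B₅, b₅⟩ := exists_absMinor_ne_zero hU₄
    have v₁ := right_ne_zero_of_mul (e₁ B₁ ▸ b₁)
    have v₂ := right_ne_zero_of_mul (e₂ B₂ ▸ b₂)
    have v₃ := right_ne_zero_of_mul (e₃ B₃ ▸ b₃)
    have v₄ := right_ne_zero_of_mul (e₄ B₄ ▸ b₄)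
    have v₅ := right_ne_zero_of_mul (e₅ B₅ ▸ b₅)
    refine ⟨⟨B₁, B₂, B₃, B₄, B₅⟩, fun k => ?_⟩
    fin_cases k
    · exact b₁
    · exact (absMinor_mul U₁ V₁ B₁ᶜ (card_eq_of_absMinor_ne_zero b₂)).trans_ne (mul_ne_zero b₂ v₁)
    · exact (absMinor_mul U₂ V₂ B₂ᶜ (card_eq_of_absMinor_ne_zero b₃)).trans_ne (mul_ne_zero b₃ v₂)
    · exact (absMinor_mul U₃' V₃ B₃ᶜ (card_eq_of_absMinor_ne_zero b₄)).trans_ne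
        (mul_ne_zero b₄ v₃)
    · convert (absMinor_mul U₄ V₄' B₄ᶜ (card_eq_of_absMinor_ne_zero b₅)).trans_ne
        (mul_ne_zero b₅ v₄) using 1
      change absMinor _ _ _ = _
      congr!
    · exact v₅
  -- From left to right, nonzero minors force the sizes for which the minors of `dₖ` split into
  -- those of its factors; in the alternating product the complementary factors leave the
  -- coefficients only.
  · rintro ⟨B₁, B₂, B₃, B₄, B₅⟩ hB
    have m₀ : absMinor d₀ B₁ Finset.univ ≠ 0 := hB 0
    have m₁ : absMinor (U₁ * V₁) B₂ B₁ᶜ ≠ 0 := hB 1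
    have m₂ : absMinor (U₂ * V₂) B₃ B₂ᶜ ≠ 0 := hB 2
    have m₃ : absMinor (U₃' * V₃) B₄ B₃ᶜ ≠ 0 := hB 3
    have m₄ : absMinor (U₄ * V₄') B₅ B₄ᶜ ≠ 0 := by
      convert hB 4
      change _ = absMinor _ _ _
      congr!
    have m₅ : absMinor d₅ Finset.univ B₅ᶜ ≠ 0 := hB 5
    have v₁ := right_ne_zero_of_mul (e₁ B₁ ▸ m₀)
    have f₁ := absMinor_mul U₁ V₁ B₁ᶜ
      ((card_eq_of_absMinor_ne_zero m₁).trans (card_eq_of_absMinor_ne_zero v₁).symm)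
    have v₂ := right_ne_zero_of_mul (e₂ B₂ ▸ left_ne_zero_of_mul (f₁ ▸ m₁))
    have f₂ := absMinor_mul U₂ V₂ B₂ᶜ
      ((card_eq_of_absMinor_ne_zero m₂).trans (card_eq_of_absMinor_ne_zero v₂).symm)
    have v₃ := right_ne_zero_of_mul (e₃ B₃ ▸ left_ne_zero_of_mul (f₂ ▸ m₂))
    have f₃ := absMinor_mul U₃' V₃ B₃ᶜ
      ((card_eq_of_absMinor_ne_zero m₃).trans (card_eq_of_absMinor_ne_zero v₃).symm)
    have v₄ := right_ne_zero_of_mul (e₄ B₄ ▸ left_ne_zero_of_mul (f₃ ▸ m₃))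
    have f₄ := absMinor_mul U₄ V₄' B₄ᶜ
      ((card_eq_of_absMinor_ne_zero m₄).trans (card_eq_of_absMinor_ne_zero v₄).symm)
    have v₅ := right_ne_zero_of_mul (e₅ B₅ ▸ left_ne_zero_of_mul (f₄ ▸ m₄))
    have hprod : alternatingProduct (minors d₀ (U₁ * V₁) (U₂ * V₂) (U₃' * V₃) (U₄ * V₄') d₅
        ⟨B₁, B₂, B₃, B₄, B₅⟩) =
        absMinor (U₁ * V₁) B₂ B₁ᶜ * absMinor (U₃' * V₃) B₄ B₃ᶜ * absMinor d₅ Finset.univ B₅ᶜ /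
        (absMinor d₀ B₁ Finset.univ * absMinor (U₂ * V₂) B₃ B₂ᶜ *
          absMinor (U₄ * V₄') B₅ B₄ᶜ) := by
      simp only [alternatingProduct, minors]
      congr! 3
      change absMinor _ _ _ = _
      congr!
    rw [hprod, f₁, f₂, f₃, f₄, e₁, e₂, e₃, e₄, e₅]
    field_simp

end

/-! ### Acyclicity of an extended sequence -/

/-- Exactness in terms of the solvability of linear systems. -/
theorem isAcyclic_iff {ι₀ ι₁ ι₂ ι₃ ι₄ ι₅ ι₆ : Type*} [Fintype ι₀] [Fintype ι₁] [Fintype ι₂]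
    [Fintype ι₃] [Fintype ι₄] [Fintype ι₅]
    {d₀ : Matrix ι₁ ι₀ ℝ} {d₁ : Matrix ι₂ ι₁ ℝ} {d₂ : Matrix ι₃ ι₂ ℝ}
    {d₃ : Matrix ι₄ ι₃ ℝ} {d₄ : Matrix ι₅ ι₄ ℝ} {d₅ : Matrix ι₆ ι₅ ℝ} :
    IsAcyclic d₀ d₁ d₂ d₃ d₄ d₅ ↔
      (∀ x, d₀ *ᵥ x = 0 → x = 0) ∧
      (∀ y, (∃ x, d₀ *ᵥ x = y) ↔ d₁ *ᵥ y = 0) ∧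
      (∀ y, (∃ x, d₁ *ᵥ x = y) ↔ d₂ *ᵥ y = 0) ∧
      (∀ y, (∃ x, d₂ *ᵥ x = y) ↔ d₃ *ᵥ y = 0) ∧
      (∀ y, (∃ x, d₃ *ᵥ x = y) ↔ d₄ *ᵥ y = 0) ∧
      (∀ y, (∃ x, d₄ *ᵥ x = y) ↔ d₅ *ᵥ y = 0) ∧
      (∀ y, ∃ x, d₅ *ᵥ x = y) := by
  unfold IsAcyclic
  refine and_congr (injective_iff_map_eq_zero _) (and_congr ?_ (and_congr ?_ (and_congr ?_
    (and_congr ?_ (and_congr ?_ Iff.rfl))))) <;>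
  exact SetLike.ext_iff

theorem forall_sum_fun {m p : Type*} {Q : (m ⊕ p → ℝ) → Prop} :
    (∀ x, Q x) ↔ ∀ a b, Q (Sum.elim a b) :=
  ⟨fun h _ _ => h _, fun h x => by rw [← Sum.elim_comp_inl_inr x]; exact h _ _⟩

theorem exists_sum_fun {m p : Type*} {Q : (m ⊕ p → ℝ) → Prop} :
    (∃ x, Q x) ↔ ∃ a b, Q (Sum.elim a b) :=
  ⟨fun ⟨x, h⟩ => ⟨_, _, (Sum.elim_comp_inl_inr x).symm ▸ h⟩, fun ⟨_, _, h⟩ => ⟨_, h⟩⟩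

theorem sumElim_eq_zero {m p : Type*} {a : m → ℝ} {b : p → ℝ} :
    Sum.elim a b = 0 ↔ a = 0 ∧ b = 0 := by
  rw [← Sum.elim_zero_zero, Sum.elim_eq_iff]

theorem fromBlocks_mulVec_sumElim {m n p q : Type*} [Fintype n] [Fintype q]
    (A : Matrix m n ℝ) (B : Matrix m q ℝ) (C : Matrix p n ℝ) (D : Matrix p q ℝ)
    (x : n → ℝ) (y : q → ℝ) :
    Matrix.fromBlocks A B C D *ᵥ Sum.elim x y =
      Sum.elim (A *ᵥ x + B *ᵥ y) (C *ᵥ x + D *ᵥ y) := by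
  rw [Matrix.fromBlocks_mulVec]
  simp

theorem exists_dotProduct_eq {q : Type*} [Fintype q] {v : q → ℝ} (hv : v ≠ 0) (t : ℝ) :
    ∃ y, v ⬝ᵥ y = t :=
  ⟨(t / (v ⬝ᵥ v)) • v, by
    rw [dotProduct_smul, smul_eq_mul, div_mul_cancel₀]
    rwa [Ne, dotProduct_self_eq_zero]⟩

section
variable {ι₀ ι₁ ι₂ ι₃ ι₄ ι₅ ι₆ p₁ p₂ p₃ p₄ p₅ : Type*} [Fintype ι₀] [Fintype ι₁] [Fintype ι₂]
  [Fintype ι₃] [Fintype ι₄] [Fintype ι₅]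
  [Fintype p₁] [Fintype p₂] [Fintype p₃] [Fintype p₄] [Fintype p₅]

/-- Every space is extended by a summand `pₖ`, the maps being block triangular, apart from the
perturbation of rank one of the third map with the factors `(c, c')` and `(v, v')`. If the added
parts form exact sequences `0 → p₁ → p₂ → ℝ → 0` and `0 → ℝ → p₃ → p₄ → p₅ → 0` on the two sides of
the perturbation, then the extended sequence is acyclic if and only if the given one is. -/
theorem isAcyclic_extension_iff
    {d₀ : Matrix ι₁ ι₀ ℝ} {d₁ : Matrix ι₂ ι₁ ℝ} {d₂ : Matrix ι₃ ι₂ ℝ}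
    {d₃ : Matrix ι₄ ι₃ ℝ} {d₄ : Matrix ι₅ ι₄ ℝ} {d₅ : Matrix ι₆ ι₅ ℝ}
    {e₀ : Matrix p₁ ι₀ ℝ} {e₁ : Matrix p₂ ι₁ ℝ} {n₁ : Matrix p₂ p₁ ℝ}
    {c : ι₃ → ℝ} {c' : p₃ → ℝ} {v : ι₂ → ℝ} {v' : p₂ → ℝ}
    {e₃ : Matrix ι₄ p₃ ℝ} {n₃ : Matrix p₄ p₃ ℝ} {e₄ : Matrix ι₅ p₄ ℝ} {n₄ : Matrix p₅ p₄ ℝ}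
    {e₅ : Matrix ι₆ p₅ ℝ}
    (h₁₀ : Matrix.fromBlocks d₁ 0 e₁ n₁ * Matrix.fromRows d₀ e₀ = 0)
    (hv : Sum.elim v v' ᵥ* Matrix.fromBlocks d₁ 0 e₁ n₁ = 0)
    (hc : Matrix.fromBlocks d₃ e₃ 0 n₃ *ᵥ Sum.elim c c' = 0)
    (h₄₃ : Matrix.fromBlocks d₄ e₄ 0 n₄ * Matrix.fromBlocks d₃ e₃ 0 n₃ = 0)
    (h₅₄ : Matrix.fromCols d₅ e₅ * Matrix.fromBlocks d₄ e₄ 0 n₄ = 0)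
    (hn₁ : ∀ x, n₁ *ᵥ x = 0 → x = 0) (hv' : v' ≠ 0)
    (hvn : ∀ y, v' ⬝ᵥ y = 0 → ∃ x, n₁ *ᵥ x = y)
    (hc' : c' ≠ 0) (hn₃ : ∀ y, n₃ *ᵥ y = 0 → ∃ s : ℝ, y = s • c')
    (hn₄ : ∀ y, n₄ *ᵥ y = 0 → ∃ x, n₃ *ᵥ x = y) (hn₄' : ∀ y, ∃ x, n₄ *ᵥ x = y) :
    IsAcyclic d₀ d₁ d₂ d₃ d₄ d₅ ↔
      IsAcyclic (Matrix.fromRows d₀ e₀) (Matrix.fromBlocks d₁ 0 e₁ n₁)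
        (Matrix.fromBlocks (d₂ + Matrix.vecMulVec c v) (Matrix.vecMulVec c v')
          (Matrix.vecMulVec c' v) (Matrix.vecMulVec c' v'))
        (Matrix.fromBlocks d₃ e₃ 0 n₃) (Matrix.fromBlocks d₄ e₄ 0 n₄)
        (Matrix.fromCols d₅ e₅) := by
  have H₁₀ : ∀ x, d₁ *ᵥ (d₀ *ᵥ x) = 0 ∧ e₁ *ᵥ (d₀ *ᵥ x) + n₁ *ᵥ (e₀ *ᵥ x) = 0 := by
    intro x
    have h := congrArg (· *ᵥ x) h₁₀
    simpa [← Matrix.mulVec_mulVec, Matrix.fromRows_mulVec, fromBlocks_mulVec_sumElim,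
      sumElim_eq_zero] using h
  have HV : ∀ x y, v ⬝ᵥ (d₁ *ᵥ x) + v' ⬝ᵥ (e₁ *ᵥ x + n₁ *ᵥ y) = 0 := by
    intro x y
    have h := congrArg (· ⬝ᵥ Sum.elim x y) hv
    simpa only [← Matrix.dotProduct_mulVec, fromBlocks_mulVec_sumElim, Matrix.zero_mulVec,
      add_zero, sumElim_dotProduct_sumElim, zero_dotProduct] using h
  have HC : d₃ *ᵥ c + e₃ *ᵥ c' = 0 := by
    simpa only [fromBlocks_mulVec_sumElim, sumElim_eq_zero, Matrix.zero_mulVec, zero_add]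
      using (sumElim_eq_zero.1 ((fromBlocks_mulVec_sumElim ..).symm.trans hc)).1
  have HC' : n₃ *ᵥ c' = 0 := by
    simpa using (sumElim_eq_zero.1 ((fromBlocks_mulVec_sumElim ..).symm.trans hc)).2
  have H₄₃ : ∀ x y, d₄ *ᵥ (d₃ *ᵥ x + e₃ *ᵥ y) + e₄ *ᵥ (n₃ *ᵥ y) = 0 ∧
      n₄ *ᵥ (n₃ *ᵥ y) = 0 := by
    intro x y
    have h := congrArg (· *ᵥ Sum.elim x y) h₄₃
    simpa [-Matrix.mulVec_mulVec, ← Matrix.mulVec_mulVec, fromBlocks_mulVec_sumElim,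
      sumElim_eq_zero] using h
  have H₅₄ : ∀ x y, d₅ *ᵥ (d₄ *ᵥ x + e₄ *ᵥ y) + e₅ *ᵥ (n₄ *ᵥ y) = 0 := by
    intro x y
    have h := congrArg (· *ᵥ Sum.elim x y) h₅₄
    simpa [-Matrix.mulVec_mulVec, ← Matrix.mulVec_mulVec, fromBlocks_mulVec_sumElim,
      Matrix.fromCols_mulVec_sumElim] using h
  have HS : ∀ t : ℝ, t • c' = 0 → t = 0 := fun t ht => (smul_eq_zero.1 ht).resolve_right hc'
  rw [isAcyclic_iff, isAcyclic_iff]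
  simp only [forall_sum_fun (m := ι₁), forall_sum_fun (m := ι₂), forall_sum_fun (m := ι₃),
    forall_sum_fun (m := ι₄), forall_sum_fun (m := ι₅), exists_sum_fun, Matrix.fromRows_mulVec,
    Matrix.fromCols_mulVec_sumElim, fromBlocks_mulVec_sumElim, Sum.elim_eq_iff, sumElim_eq_zero,
    Matrix.zero_mulVec, zero_add, add_zero, Matrix.add_mulVec, Matrix.vecMulVec_mulVec,
    op_smul_eq_smul, add_assoc, ← add_smul]
  constructor
  · rintro ⟨i₀, i₁, i₂, i₃, i₄, i₅, i₆⟩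
    refine ⟨fun x hx => i₀ x hx.1, fun a b => ⟨?_, ?_⟩, fun a b => ⟨?_, ?_⟩, fun a b => ⟨?_, ?_⟩,
      fun a b => ⟨?_, ?_⟩, fun a b => ⟨?_, ?_⟩, fun y => ?_⟩
    · rintro ⟨x, rfl, rfl⟩
      exact H₁₀ x
    · rintro ⟨ha, hb⟩
      obtain ⟨x, rfl⟩ := (i₁ a).2 ha
      refine ⟨x, rfl, ?_⟩
      have h := hn₁ (e₀ *ᵥ x - b) (by
        rw [Matrix.mulVec_sub, sub_eq_zero]
        exact add_left_cancel ((H₁₀ x).2.trans hb.symm))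
      exact sub_eq_zero.1 h
    · rintro ⟨x, y, rfl, rfl⟩
      rw [HV, zero_smul, zero_smul, (i₂ _).1 ⟨x, rfl⟩, add_zero]
      exact ⟨rfl, rfl⟩
    · rintro ⟨ha, hb⟩
      have ht := HS _ hb
      rw [ht, zero_smul, add_zero] at ha
      obtain ⟨x, rfl⟩ := (i₂ a).2 ha
      -- The relation `HV` makes the defect in the added coordinates a value of `n₁`.
      obtain ⟨y, hy⟩ := hvn (b - e₁ *ᵥ x) (by
        have h := HV x 0
        rw [Matrix.mulVec_zero, add_zero] at h
        rw [dotProduct_sub]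
        linarith)
      exact ⟨x, y, rfl, by rw [hy, add_sub_cancel]⟩
    · rintro ⟨x, y, rfl, rfl⟩
      rw [Matrix.mulVec_add, (i₃ _).1 ⟨x, rfl⟩, zero_add, Matrix.mulVec_smul, Matrix.mulVec_smul,
        ← smul_add, HC, Matrix.mulVec_smul, HC', smul_zero, smul_zero]
      exact ⟨rfl, rfl⟩
    · rintro ⟨ha, hb⟩
      obtain ⟨t, rfl⟩ := hn₃ b hb
      obtain ⟨x, hx⟩ := (i₃ (a - t • c)).2 (by
        rw [Matrix.mulVec_smul, eq_neg_of_add_eq_zero_right HC, smul_neg, ← Matrix.mulVec_smul,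
          ← sub_eq_add_neg, ← Matrix.mulVec_sub] at ha
        exact ha)
      -- Since `v' ≠ 0`, added coordinates can be chosen that give the functional `(v, v')` any
      -- value.
      obtain ⟨y, hy⟩ := exists_dotProduct_eq hv' (t - v ⬝ᵥ x)
      exact ⟨x, y, by rw [hy, hx, add_sub_cancel, sub_add_cancel], by rw [hy, add_sub_cancel]⟩
    · rintro ⟨x, y, rfl, rfl⟩
      exact H₄₃ x y
    · rintro ⟨ha, hb⟩
      obtain ⟨y, rfl⟩ := hn₄ b hb
      obtain ⟨x, hx⟩ := (i₄ (a - e₃ *ᵥ y)).2 (by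
        have h := (H₄₃ 0 y).1
        rw [Matrix.mulVec_zero, zero_add] at h
        rw [Matrix.mulVec_sub, sub_eq_zero]
        exact add_right_cancel (ha.trans h.symm))
      exact ⟨x, y, by rw [hx, sub_add_cancel], rfl⟩
    · rintro ⟨x, y, rfl, rfl⟩
      exact H₅₄ x y
    · intro h
      obtain ⟨y, rfl⟩ := hn₄' b
      obtain ⟨x, hx⟩ := (i₅ (a - e₄ *ᵥ y)).2 (by
        have h' := H₅₄ 0 y
        rw [Matrix.mulVec_zero, zero_add] at h'
        rw [Matrix.mulVec_sub, sub_eq_zero]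
        exact add_right_cancel (h.trans h'.symm))
      exact ⟨x, y, by rw [hx, sub_add_cancel], rfl⟩
    · obtain ⟨x, rfl⟩ := i₆ y
      exact ⟨x, 0, by simp⟩
  · rintro ⟨i₀, i₁, i₂, i₃, i₄, i₅, i₆⟩
    refine ⟨fun x hx => i₀ x ⟨hx, hn₁ _ ?_⟩, fun a => ⟨?_, fun ha => ?_⟩,
      fun a => ⟨?_, fun ha => ?_⟩, fun a => ⟨?_, fun ha => ?_⟩,
      fun a => ⟨?_, fun ha => ?_⟩, fun a => ⟨?_, fun ha => ?_⟩, fun y => ?_⟩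
    · have h := (H₁₀ x).2
      rwa [hx, Matrix.mulVec_zero, zero_add] at h
    · rintro ⟨x, rfl⟩
      exact (H₁₀ x).1
    · obtain ⟨y, hy⟩ := hvn (-(e₁ *ᵥ a)) (by
        have h := HV a 0
        rw [ha, dotProduct_zero, Matrix.mulVec_zero, add_zero, zero_add] at h
        rw [dotProduct_neg, h, neg_zero])
      obtain ⟨x, hx, -⟩ := (i₁ a y).2 ⟨ha, by rw [hy, add_neg_cancel]⟩
      exact ⟨x, hx⟩
    · rintro ⟨x, rfl⟩
      have h := ((i₂ _ _).1 ⟨x, 0, rfl, rfl⟩).1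
      rwa [HV, zero_smul, add_zero] at h
    -- Added coordinates that cancel the perturbation.
    · obtain ⟨b, hb⟩ := exists_dotProduct_eq hv' (-(v ⬝ᵥ a))
      obtain ⟨x, y, hx, -⟩ := (i₂ a b).2 (by simp [ha, hb])
      exact ⟨x, hx⟩
    · rintro ⟨x, rfl⟩
      obtain ⟨y, hy⟩ := exists_dotProduct_eq hv' (-(v ⬝ᵥ x))
      have h := ((i₃ _ _).1 ⟨x, y, rfl, rfl⟩).1
      simpa [hy] using h
    · obtain ⟨x, y, hx, hy⟩ := (i₃ a 0).2 (by simp [ha])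
      rw [HS _ hy, zero_smul, add_zero] at hx
      exact ⟨x, hx⟩
    · rintro ⟨x, rfl⟩
      simpa using (H₄₃ x 0).1
    · obtain ⟨x, y, hx, hy⟩ := (i₄ a 0).2 (by simp [ha])
      obtain ⟨t, rfl⟩ := hn₃ y hy
      refine ⟨x - t • c, ?_⟩
      rw [Matrix.mulVec_sub, Matrix.mulVec_smul, eq_neg_of_add_eq_zero_left HC, ← hx,
        Matrix.mulVec_smul, smul_neg, sub_neg_eq_add]
    · rintro ⟨x, rfl⟩
      simpa using H₅₄ x 0
    · obtain ⟨x, y, hx, hy⟩ := (i₅ a 0).2 (by simp [ha])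
      obtain ⟨z, rfl⟩ := hn₄ y hy
      refine ⟨x - e₃ *ᵥ z, ?_⟩
      have h := (H₄₃ 0 z).1
      rw [Matrix.mulVec_zero, zero_add] at h
      rw [Matrix.mulVec_sub, eq_neg_of_add_eq_zero_left h, sub_neg_eq_add, hx]
    · obtain ⟨a, b, rfl⟩ := i₆ y
      obtain ⟨z, rfl⟩ := hn₄' b
      refine ⟨a - e₄ *ᵥ z, ?_⟩
      have h := H₅₄ 0 z
      rw [Matrix.mulVec_zero, zero_add] at h
      rw [Matrix.mulVec_sub, eq_neg_of_add_eq_zero_left h, sub_neg_eq_add]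

end

theorem exact_submatrix_iff {m n p m' n' p' : Type*} [Fintype m] [Fintype n] [Fintype m']
    [Fintype n'] (A : Matrix m n ℝ) (B : Matrix p m ℝ) (e : m' ≃ m) (f : n' ≃ n) (g : p' ≃ p) :
    (∀ y, (∃ x, A.submatrix e f *ᵥ x = y) ↔ B.submatrix g e *ᵥ y = 0) ↔
      ∀ y, (∃ x, A *ᵥ x = y) ↔ B *ᵥ y = 0 := by
  simp only [Matrix.submatrix_mulVec_equiv]
  refine ((e.arrowCongr (Equiv.refl ℝ)).forall_congr fun {y} => ?_)
  refine iff_congr ((f.arrowCongr (Equiv.refl ℝ)).exists_congr fun x => ?_) ?_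
  · change (A *ᵥ (x ∘ f.symm)) ∘ e = y ↔ A *ᵥ (x ∘ f.symm) = y ∘ e.symm
    exact ⟨fun h => by rw [← h]; ext; simp, fun h => by rw [h]; ext; simp⟩
  · change (B *ᵥ (y ∘ e.symm)) ∘ g = 0 ↔ B *ᵥ (y ∘ e.symm) = 0
    exact ⟨fun h => funext fun i => by simpa using congrFun h (g.symm i),
      fun h => by rw [h]; rfl⟩

theorem isAcyclic_submatrix_iff {ι₀ ι₁ ι₂ ι₃ ι₄ ι₅ ι₆ κ₁ κ₂ κ₃ κ₄ κ₅ : Type*} [Fintype ι₀]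
    [Fintype ι₁] [Fintype ι₂] [Fintype ι₃] [Fintype ι₄] [Fintype ι₅]
    [Fintype κ₁] [Fintype κ₂] [Fintype κ₃] [Fintype κ₄] [Fintype κ₅]
    {d₀ : Matrix ι₁ ι₀ ℝ} {d₁ : Matrix ι₂ ι₁ ℝ} {d₂ : Matrix ι₃ ι₂ ℝ}
    {d₃ : Matrix ι₄ ι₃ ℝ} {d₄ : Matrix ι₅ ι₄ ℝ} {d₅ : Matrix ι₆ ι₅ ℝ}
    (e₁ : κ₁ ≃ ι₁) (e₂ : κ₂ ≃ ι₂) (e₃ : κ₃ ≃ ι₃) (e₄ : κ₄ ≃ ι₄) (e₅ : κ₅ ≃ ι₅) :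
    IsAcyclic (d₀.submatrix e₁ id) (d₁.submatrix e₂ e₁) (d₂.submatrix e₃ e₂)
      (d₃.submatrix e₄ e₃) (d₄.submatrix e₅ e₄) (d₅.submatrix id e₅) ↔
      IsAcyclic d₀ d₁ d₂ d₃ d₄ d₅ := by
  rw [isAcyclic_iff, isAcyclic_iff]
  refine and_congr (forall_congr' fun x => imp_congr_left ?_)
    (and_congr (exact_submatrix_iff d₀ d₁ e₁ (Equiv.refl _) e₂)
    (and_congr (exact_submatrix_iff d₁ d₂ e₂ e₁ e₃)
    (and_congr (exact_submatrix_iff d₂ d₃ e₃ e₂ e₄)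
    (and_congr (exact_submatrix_iff d₃ d₄ e₄ e₃ e₅)
    (and_congr (exact_submatrix_iff d₄ d₅ e₅ e₄ (Equiv.refl _))
    (forall_congr' fun y => (e₅.arrowCongr (Equiv.refl ℝ)).exists_congr fun x => ?_))))))
  · change (d₀ *ᵥ x) ∘ e₁ = 0 ↔ d₀ *ᵥ x = 0
    exact ⟨fun h => funext fun i => by simpa using congrFun h (e₁.symm i),
      fun h => by rw [h]; rfl⟩
  · rw [Matrix.submatrix_mulVec_equiv]
    rfl

/-- Acyclicity does not depend on the basis of the fourth space. -/
theorem isAcyclic_mul_iff {ι₀ ι₁ ι₂ ι₃ ι₄ ι₅ ι₆ : Type*} [Fintype ι₀] [Fintype ι₁] [Fintype ι₂]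
    [Fintype ι₃] [Fintype ι₄] [DecidableEq ι₄] [Fintype ι₅]
    {d₀ : Matrix ι₁ ι₀ ℝ} {d₁ : Matrix ι₂ ι₁ ℝ} {d₂ : Matrix ι₃ ι₂ ℝ}
    {d₃ : Matrix ι₄ ι₃ ℝ} {d₄ : Matrix ι₅ ι₄ ℝ} {d₅ : Matrix ι₆ ι₅ ℝ}
    {O O' : Matrix ι₄ ι₄ ℝ} (hO : O * O' = 1) :
    IsAcyclic d₀ d₁ d₂ (O * d₃) (d₄ * O') d₅ ↔ IsAcyclic d₀ d₁ d₂ d₃ d₄ d₅ := by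
  have hO' : O' * O = 1 := mul_eq_one_comm.1 hO
  have h1 : ∀ x, O *ᵥ (O' *ᵥ x) = x := fun x => by
    rw [Matrix.mulVec_mulVec, hO, Matrix.one_mulVec]
  have h2 : ∀ x, O' *ᵥ (O *ᵥ x) = x := fun x => by
    rw [Matrix.mulVec_mulVec, hO', Matrix.one_mulVec]
  let e : (ι₄ → ℝ) ≃ (ι₄ → ℝ) := ⟨O'.mulVec, O.mulVec, h1, h2⟩
  rw [isAcyclic_iff, isAcyclic_iff]
  simp only [← Matrix.mulVec_mulVec]
  refine and_congr Iff.rfl (and_congr Iff.rfl (and_congr Iff.rfl (and_congr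
    (forall_congr' fun y => iff_congr Iff.rfl ?_) (and_congr (e.forall_congr fun {y} =>
    iff_congr (exists_congr fun x => ?_) Iff.rfl)
    (and_congr (forall_congr' fun y => iff_congr (e.exists_congr fun x => Iff.rfl) Iff.rfl)
      Iff.rfl)))))
  · exact ⟨fun h => by rw [← h2 (d₃ *ᵥ y), h, Matrix.mulVec_zero],
      fun h => by rw [h, Matrix.mulVec_zero]⟩
  · change _ ↔ _ = O' *ᵥ y
    exact ⟨fun h => by rw [← h, h2], fun h => by rw [h, h1]⟩

/-! ### Simplices, gradients of barycentric coordinates and dihedral angles -/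

theorem inner_eq_dotProduct (x y : E4) : inner ℝ x y = x.ofLp ⬝ᵥ y.ofLp := by
  simp [PiLp.inner_apply, dotProduct, mul_comm]

/-- The matrix with rows `(1, p i)`. -/
noncomputable def affineMatrix (p : Fin 5 → E4) : Matrix (Fin 5) (Fin 5) ℝ :=
  Matrix.of fun i => Fin.cons 1 (p i).ofLp

theorem det_affineMatrix (p : Fin 5 → E4) : (affineMatrix p).det = 24 * signedVolume p := by
  have h := Matrix.det_eq_of_forall_row_eq_smul_add_const (A := affineMatrix p)
    (B := Matrix.of fun i => if i = 0 then affineMatrix p 0 else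
      affineMatrix p i - affineMatrix p 0) (fun i => if i = 0 then 0 else 1) 0 (by simp)
    (fun i j => by
      by_cases hi : i = 0
      · subst hi; simp
      · simp [hi])
  rw [h, Matrix.det_succ_column_zero, Fin.sum_univ_succ]
  have hz : ∀ i : Fin 4, (Matrix.of fun i => if i = 0 then affineMatrix p 0 else
      affineMatrix p i - affineMatrix p 0) i.succ 0 = (0 : ℝ) := by
    intro i
    simp [affineMatrix]
  simp only [hz]
  simp only [signedVolume, mul_zero, zero_mul, Finset.sum_const_zero, add_zero]
  rw [mul_div_cancel₀ _ (by norm_num)]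
  simp only [Fin.val_zero, pow_zero, one_mul]
  have h1 : (Matrix.of fun i => if i = 0 then affineMatrix p 0 else
      affineMatrix p i - affineMatrix p 0) 0 0 = (1 : ℝ) := by
    simp [affineMatrix]
  rw [h1, one_mul]
  congr 1

theorem abs_signedVolume_perm (p : Fin 5 → E4) (σ : Equiv.Perm (Fin 5)) :
    |signedVolume (p ∘ σ)| = |signedVolume p| := by
  have h : affineMatrix (p ∘ σ) = (affineMatrix p).submatrix σ id := rfl
  have h1 := det_affineMatrix (p ∘ σ)
  rw [h, Matrix.det_permute, det_affineMatrix] at h1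
  have h2 := congrArg abs h1
  rw [abs_mul, abs_mul, abs_mul] at h2
  have h3 : |((Equiv.Perm.sign σ : ℤ) : ℝ)| = 1 := by
    rcases Int.units_eq_one_or (Equiv.Perm.sign σ) with h | h <;> rw [h] <;> simp
  rw [h3, one_mul] at h2
  exact (mul_left_cancel₀ (by norm_num) h2).symm

/-- The vectors `g i` are the gradients of the barycentric coordinates of the simplex `p`. -/
def IsGradient (p g : Fin 5 → E4) : Prop :=
  ∀ i j m, inner ℝ (g i) (p j - p m) = (if i = j then 1 else 0) - if i = m then 1 else 0

/-- The gradients are columns of the inverse of the affine matrix, without its first row. -/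
theorem exists_isGradient {p : Fin 5 → E4} (hp : signedVolume p ≠ 0) : ∃ g, IsGradient p g := by
  have hdet : IsUnit (affineMatrix p).det := by
    rw [det_affineMatrix]
    exact (mul_ne_zero (by norm_num) hp).isUnit
  have h := Matrix.mul_nonsing_inv _ hdet
  refine ⟨fun i => WithLp.toLp 2 fun α => (affineMatrix p)⁻¹ α.succ i, fun i j m => ?_⟩
  have key : ∀ j, (affineMatrix p)⁻¹ 0 i + ∑ α : Fin 4, p j α * (affineMatrix p)⁻¹ α.succ i =
      if i = j then 1 else 0 := by
    intro j
    have h1 := congrFun (congrFun h j) i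
    rw [Matrix.mul_apply, Fin.sum_univ_succ, Matrix.one_apply] at h1
    simpa [affineMatrix, eq_comm] using h1
  rw [← key j, ← key m, inner_eq_dotProduct, add_sub_add_left_eq_sub, ← Finset.sum_sub_distrib]
  refine Finset.sum_congr rfl fun α _ => ?_
  simp
  ring

section
variable {p g : Fin 5 → E4}

/-- The matrix with rows `p 1 - p 0, …, p 4 - p 0`. -/
noncomputable def edgeMatrix (p : Fin 5 → E4) : Matrix (Fin 4) (Fin 4) ℝ :=
  Matrix.of fun i j : Fin 4 => (p i.succ - p 0) j

/-- The matrix with columns `g 1, …, g 4`. -/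
def gradientMatrix (g : Fin 5 → E4) : Matrix (Fin 4) (Fin 4) ℝ :=
  Matrix.of fun i j : Fin 4 => g j.succ i

theorem IsGradient.edgeMatrix_mul (h : IsGradient p g) :
    edgeMatrix p * gradientMatrix g = 1 := by
  ext i j
  have h1 := h j.succ i.succ 0
  rw [inner_eq_dotProduct, dotProduct_comm] at h1
  refine Eq.trans h1 ?_
  simp [Matrix.one_apply, eq_comm]

theorem IsGradient.signedVolume_ne_zero (h : IsGradient p g) : signedVolume p ≠ 0 := by
  have h1 := congrArg Matrix.det h.edgeMatrix_mul
  rw [Matrix.det_mul, Matrix.det_one] at h1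
  exact div_ne_zero (left_ne_zero_of_mul_eq_one h1) (by norm_num)

/-- A vector orthogonal to all the edges that issue from one vertex is zero. -/
theorem eq_zero_of_inner_edges (hp : signedVolume p ≠ 0) {x : E4} (m : Fin 5)
    (hx : ∀ i, inner ℝ x (p i - p m) = 0) : x = 0 := by
  have h : edgeMatrix p *ᵥ x.ofLp = 0 := by
    ext i
    have h1 : inner ℝ x (p i.succ - p 0) = 0 := by
      rw [← sub_sub_sub_cancel_right _ _ (p m), inner_sub_right, hx, hx, sub_zero]
    rwa [inner_eq_dotProduct, dotProduct_comm] at h1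
  have hdet : (edgeMatrix p).det ≠ 0 := fun h0 => hp (by
    unfold signedVolume
    unfold edgeMatrix at h0
    rw [h0, zero_div])
  have h2 := Matrix.eq_zero_of_mulVec_eq_zero hdet h
  ext i
  simpa using congrFun h2 i

theorem IsGradient.sum_eq_zero (h : IsGradient p g) : ∑ i, g i = 0 := by
  refine eq_zero_of_inner_edges h.signedVolume_ne_zero 0 fun j => ?_
  rw [sum_inner]
  simp [h _ _ _]

theorem gram_eq_edgeMatrix_mul (p : Fin 5 → E4) :
    gram (fun a b => dist (p a) (p b) ^ 2) = edgeMatrix p * (edgeMatrix p)ᵀ := by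
  ext i j
  have h1 : (edgeMatrix p * (edgeMatrix p)ᵀ) i j =
      inner ℝ (p i.succ - p 0) (p j.succ - p 0) := by
    rw [inner_eq_dotProduct]; rfl
  rw [h1, real_inner_eq_norm_mul_self_add_norm_mul_self_sub_norm_sub_mul_self_div_two,
    sub_sub_sub_cancel_right, ← dist_eq_norm, ← dist_eq_norm, ← dist_eq_norm,
    dist_comm (p i.succ) (p 0), dist_comm (p j.succ) (p 0)]
  simp only [gram, Matrix.of_apply]
  ring

theorem IsGradient.inv_gram (h : IsGradient p g) :
    (gram (fun a b => dist (p a) (p b) ^ 2))⁻¹ =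
      (gradientMatrix g)ᵀ * gradientMatrix g := by
  refine Matrix.inv_eq_right_inv ?_
  have h1 := h.edgeMatrix_mul
  have h2 := mul_eq_one_comm.1 h1
  rw [gram_eq_edgeMatrix_mul, Matrix.mul_assoc, ← Matrix.mul_assoc _ᵀ, ← Matrix.transpose_mul,
    h2, Matrix.transpose_one, Matrix.one_mul, h1]

/-- The normals that define the dihedral angles are the gradients of the barycentric coordinates. -/
theorem IsGradient.normalInner_eq (h : IsGradient p g) (i j : Fin 5) :
    normalInner (fun a b => dist (p a) (p b) ^ 2) i j = inner ℝ (g i) (g j) := by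
  have key : ∀ i, gradientMatrix g *ᵥ
      ((Fin.cons (fun _ => -1) (fun k => Pi.single k 1) : Fin 5 → Fin 4 → ℝ) i) =
      (g i).ofLp := by
    intro i
    refine Fin.cases ?_ (fun k => ?_) i
    · have h1 := h.sum_eq_zero
      rw [Fin.sum_univ_succ] at h1
      rw [Fin.cons_zero, eq_neg_of_add_eq_zero_left h1]
      ext α
      simp [Matrix.mulVec, dotProduct, gradientMatrix]
    · rw [Fin.cons_succ, Matrix.mulVec_single_one]
      rfl
  rw [inner_eq_dotProduct, ← key i, ← key j]
  simp only [normalInner, h.inv_gram]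
  rw [← Matrix.mulVec_mulVec, Matrix.dotProduct_mulVec, Matrix.vecMul_transpose]

end

theorem hasDerivAt_inv_add_smul {n : Type*} [Fintype n] [DecidableEq n] {G : Matrix n n ℝ}
    (hG : IsUnit G.det) (H : Matrix n n ℝ) (i j : n) :
    HasDerivAt (fun s : ℝ => (G + s • H)⁻¹ i j) (-(G⁻¹ * H * G⁻¹) i j) 0 := by
  have hcont : Continuous fun s : ℝ => G + s • H := by fun_prop
  have hdet : ∀ᶠ s in nhds (0 : ℝ), (G + s • H).det ≠ 0 :=
    hcont.matrix_det.continuousAt.eventually_ne (by simpa using hG.ne_zero)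
  have hinv : ContinuousAt (fun s : ℝ => (G + s • H)⁻¹) 0 := by
    simp only [Matrix.inv_def, Ring.inverse_eq_inv']
    exact (hcont.matrix_det.continuousAt.inv₀ (by simpa using hG.ne_zero)).smul
      hcont.matrix_adjugate.continuousAt
  rw [hasDerivAt_iff_tendsto_slope]
  have hlim : Filter.Tendsto (fun s : ℝ => -((G + s • H)⁻¹ * H * G⁻¹) i j)
      (nhdsWithin 0 {0}ᶜ) (nhds (-(G⁻¹ * H * G⁻¹) i j)) := by
    have h1 : ContinuousAt (fun s : ℝ => -((G + s • H)⁻¹ * H * G⁻¹) i j) 0 := by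
      have h2 : ContinuousAt (fun s : ℝ => (G + s • H)⁻¹ * H * G⁻¹) 0 :=
        (show Continuous fun A : Matrix n n ℝ => A * H * G⁻¹ by fun_prop).continuousAt.comp hinv
      exact ((continuousAt_pi.1 ((continuousAt_pi.1 h2) i)) j).neg
    have h3 := h1.tendsto
    simp only [zero_smul, add_zero] at h3
    exact h3.mono_left nhdsWithin_le_nhds
  refine hlim.congr' ?_
  filter_upwards [nhdsWithin_le_nhds hdet, self_mem_nhdsWithin] with s hs hs0
  have hs0' : s ≠ 0 := hs0
  -- The resolvent identity.
  have h1 : (G + s • H)⁻¹ - G⁻¹ = -(s • ((G + s • H)⁻¹ * H * G⁻¹)) := by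
    have h2 : (G + s • H)⁻¹ * (G + s • H) * G⁻¹ = G⁻¹ := by
      rw [Matrix.nonsing_inv_mul _ hs.isUnit, Matrix.one_mul]
    rw [Matrix.mul_add, Matrix.add_mul, Matrix.mul_assoc, Matrix.mul_nonsing_inv _ hG,
      Matrix.mul_one, Matrix.mul_smul, Matrix.smul_mul] at h2
    exact sub_eq_iff_eq_add.2 (by rw [← sub_eq_neg_add]; exact eq_sub_of_add_eq h2)
  have h2 := congrFun (congrFun h1 i) j
  rw [slope_def_field]
  simp only [Matrix.sub_apply, Matrix.neg_apply, Matrix.smul_apply, smul_eq_mul] at h2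
  rw [zero_smul, add_zero, h2, sub_zero]
  field_simp

/-- The differential of the inverse Gram matrix. The result is symmetric in the five vertices,
although the Gram matrix is formed at the vertex `0`. -/
theorem hasDerivAt_normalInner {ℓ : Fin 5 → Fin 5 → ℝ} (hℓ : IsUnit (gram ℓ).det)
    {E : Fin 5 → Fin 5 → ℝ} (hE : ∀ a b, E a b = E b a) (hE₀ : ∀ a, E a a = 0) (i j : Fin 5) :
    HasDerivAt (fun s : ℝ => normalInner (fun a b => ℓ a b + s * E a b) i j)
      (1 / 2 * ∑ a, ∑ b, E a b * normalInner ℓ i a * normalInner ℓ b j) 0 := by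
  have hgram : ∀ s : ℝ, gram (fun a b => ℓ a b + s * E a b) = gram ℓ + s • gram E := by
    intro s
    ext a b
    simp only [gram, Matrix.of_apply, Matrix.add_apply, Matrix.smul_apply, smul_eq_mul]
    ring
  simp only [normalInner, hgram]
  set c : Fin 5 → Fin 4 → ℝ := Fin.cons (fun _ => -1) (fun k => Pi.single k 1) with hc
  have h1 : HasDerivAt (fun s : ℝ => c i ⬝ᵥ ((gram ℓ + s • gram E)⁻¹ *ᵥ c j))
      (∑ a, c i a * ∑ b, (-((gram ℓ)⁻¹ * gram E * (gram ℓ)⁻¹) a b) * c j b) 0 := by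
    simp only [dotProduct, Matrix.mulVec]
    refine HasDerivAt.fun_sum fun a _ => HasDerivAt.const_mul _ ?_
    exact HasDerivAt.fun_sum fun b _ => (hasDerivAt_inv_add_smul hℓ _ a b).mul_const _
  convert h1 using 1
  have h2 : (∑ a, c i a * ∑ b, (-((gram ℓ)⁻¹ * gram E * (gram ℓ)⁻¹) a b) * c j b) =
      -((c i ᵥ* (gram ℓ)⁻¹) ⬝ᵥ (gram E *ᵥ ((gram ℓ)⁻¹ *ᵥ c j))) := by
    rw [← Matrix.dotProduct_mulVec, Matrix.mulVec_mulVec, Matrix.mulVec_mulVec]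
    simp only [dotProduct, Matrix.mulVec, neg_mul, Finset.sum_neg_distrib, mul_neg]
  rw [h2]
  simp only [Matrix.dotProduct_mulVec (c i)]
  set x := c i ᵥ* (gram ℓ)⁻¹
  set y := (gram ℓ)⁻¹ *ᵥ c j
  simp only [hc, Fin.sum_univ_succ, Fin.cons_zero, Fin.cons_succ, dotProduct_single,
    single_dotProduct, one_mul, mul_one]
  simp only [dotProduct, Matrix.mulVec, gram, Matrix.of_apply, Fin.sum_univ_succ,
    Fin.sum_univ_zero, hE₀, hE _ 0]
  ring

/-- The derivative of the interior dihedral angle between two hyperplanes whose normals have inner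
product `a` and squared norms `b`, `c`. -/
theorem hasDerivAt_arccos_neg_div_sqrt {a b c : ℝ → ℝ} {a' b' c' s : ℝ}
    (ha : HasDerivAt a a' s) (hb : HasDerivAt b b' s) (hc : HasDerivAt c c' s)
    (hb₀ : 0 < b s) (hc₀ : 0 < c s) (hpos : 0 < b s * c s - a s ^ 2) :
    HasDerivAt (fun x => Real.arccos (-a x / √(b x * c x)))
      ((a' - a s / 2 * (b' / b s + c' / c s)) / √(b s * c s - a s ^ 2)) s := by
  have hM : 0 < b s * c s := mul_pos hb₀ hc₀
  have hr : 0 < √(b s * c s) := Real.sqrt_pos.2 hM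
  have hsq : √(b s * c s) ^ 2 = b s * c s := Real.sq_sqrt hM.le
  have hD : 0 < √(b s * c s - a s ^ 2) := Real.sqrt_pos.2 hpos
  have hx2 : 1 - (-a s / √(b s * c s)) ^ 2 = (b s * c s - a s ^ 2) / √(b s * c s) ^ 2 := by
    field_simp
    rw [hsq]
  have hlt : (-a s / √(b s * c s)) ^ 2 < 1 := by
    have : 0 < (b s * c s - a s ^ 2) / √(b s * c s) ^ 2 := by positivity
    linarith
  have h1 := ((ha.neg).div ((hb.mul hc).sqrt hM.ne') hr.ne')
  have hne1 : -a s / √(b s * c s) ≠ -1 := fun h => by rw [h] at hlt; norm_num at hlt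
  have hne2 : -a s / √(b s * c s) ≠ 1 := fun h => by rw [h] at hlt; norm_num at hlt
  have h2 := (Real.hasDerivAt_arccos hne1 hne2).comp s h1
  refine h2.congr_deriv ?_
  rw [hx2, Real.sqrt_div' _ (by positivity), Real.sqrt_sq hr.le]
  simp only [Pi.mul_apply, Pi.neg_apply]
  set r := √(b s * c s)
  field_simp
  rw [hsq]
  ring

/-- The matrix with the coordinates of the vectors `w i` as rows. -/
def rowMatrix {n : Type*} (w : n → E4) : Matrix n (Fin 4) ℝ :=
  Matrix.of fun i j => w i j

theorem rowMatrix_mul_transpose {m n : Type*} (w : m → E4) (w' : n → E4) :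
    rowMatrix w * (rowMatrix w')ᵀ = Matrix.of fun i j => inner ℝ (w i) (w' j) := by
  ext i j
  rw [Matrix.of_apply, inner_eq_dotProduct]
  rfl

/-- The strict Cauchy–Schwarz inequality; `a` shows that `u` and `v` are not proportional. -/
theorem gram_det_pos {u v a : E4} (hau : inner ℝ a u ≠ 0) (hav : inner ℝ a v = 0) (hv : v ≠ 0) :
    0 < inner ℝ u u * inner ℝ v v - inner ℝ u v ^ 2 := by
  have hvv : 0 < inner ℝ v v := real_inner_self_pos.2 hv
  have hx : (inner ℝ v v • u - inner ℝ u v • v : E4) ≠ 0 := by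
    intro h0
    have h1 := congrArg (inner ℝ a) h0
    rw [inner_sub_right, inner_smul_right, inner_smul_right, hav, inner_zero_right, mul_zero,
      sub_zero] at h1
    exact mul_ne_zero hvv.ne' hau h1
  have h2 := real_inner_self_pos.2 hx
  simp only [inner_sub_left, inner_sub_right, real_inner_smul_left, real_inner_smul_right] at h2
  rw [real_inner_comm u v] at h2
  have h3 : 0 < inner ℝ v v * (inner ℝ u u * inner ℝ v v - inner ℝ u v ^ 2) := by
    nlinarith
  exact pos_of_mul_pos_right h3 hvv.le

section
variable {p g : Fin 5 → E4}

theorem IsGradient.gram_det_pos (h : IsGradient p g) {i j : Fin 5} (hij : i ≠ j) :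
    0 < inner ℝ (g i) (g i) * inner ℝ (g j) (g j) - inner ℝ (g i) (g j) ^ 2 := by
  obtain ⟨m, hmi, hmj⟩ : ∃ m, m ≠ i ∧ m ≠ j := by clear h; revert i j; decide
  have h1 := h i i m
  have h2 := h j i m
  have h3 := h j j m
  rw [if_pos rfl, if_neg hmi.symm] at h1
  rw [if_neg hij.symm, if_neg hmj.symm] at h2
  rw [if_pos rfl, if_neg hmj.symm] at h3
  refine _root_.gram_det_pos (a := p i - p m) ?_ ?_ ?_
  · rw [real_inner_comm, h1]; norm_num
  · rw [real_inner_comm, h2]; norm_num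
  · intro h0
    rw [h0, inner_zero_left] at h3
    norm_num at h3

theorem IsGradient.inner_self_pos (h : IsGradient p g) (i : Fin 5) :
    0 < inner ℝ (g i) (g i) := by
  obtain ⟨m, hmi⟩ : ∃ m, m ≠ i := exists_ne i
  refine real_inner_self_pos.2 fun h0 => ?_
  have h1 := h i i m
  rw [if_pos rfl, if_neg hmi.symm, h0, inner_zero_left] at h1
  norm_num at h1

/-- The derivative of the dihedral angle between the faces with normals `g i`, `g j` with respect
to the squared length of the edge `k l`. -/
noncomputable def dihedralRate {ι : Type*} (g : ι → E4) (i j k l : ι) : ℝ :=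
  ((inner ℝ (g i) (g k) * inner ℝ (g j) (g l) + inner ℝ (g i) (g l) * inner ℝ (g j) (g k)) / 2 -
    inner ℝ (g i) (g j) / 2 * (inner ℝ (g i) (g k) * inner ℝ (g i) (g l) / inner ℝ (g i) (g i) +
      inner ℝ (g j) (g k) * inner ℝ (g j) (g l) / inner ℝ (g j) (g j))) /
  √(inner ℝ (g i) (g i) * inner ℝ (g j) (g j) - inner ℝ (g i) (g j) ^ 2)

theorem dihedralRate_comm {ι : Type*} (g : ι → E4) (i j k l : ι) :
    dihedralRate g i j k l = dihedralRate g j i k l := by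
  unfold dihedralRate
  rw [real_inner_comm (g i) (g j), mul_comm (inner ℝ (g i) (g i))]
  ring

/-- Differentiation of the dihedral angle through the inner products of the normals, whose
derivatives are given by `hasDerivAt_normalInner`. -/
theorem IsGradient.hasDerivAt_dihedralAngle (h : IsGradient p g) {i j k l : Fin 5}
    (hij : i ≠ j) (hkl : k ≠ l) :
    HasDerivAt (fun x => dihedralAngle (fun a b => if (a = k ∧ b = l) ∨ (a = l ∧ b = k) then x
      else dist (p a) (p b) ^ 2) i j) (dihedralRate g i j k l) (dist (p k) (p l) ^ 2) := by
  set ℓ : Fin 5 → Fin 5 → ℝ := fun a b => dist (p a) (p b) ^ 2 with hℓ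
  -- The variation of the squared distances is the symmetric matrix supported on the edge `k l`.
  let E : Fin 5 → Fin 5 → ℝ := fun a b => if (a = k ∧ b = l) ∨ (a = l ∧ b = k) then 1 else 0
  have hfun : (fun x => dihedralAngle (fun a b => if (a = k ∧ b = l) ∨ (a = l ∧ b = k) then x
      else ℓ a b) i j) =
      fun x => dihedralAngle (fun a b => ℓ a b + (x - ℓ k l) * E a b) i j := by
    ext x
    congr 1
    ext a b
    simp only [E]
    split_ifs with hab
    · rcases hab with ⟨rfl, rfl⟩ | ⟨rfl, rfl⟩
      · ring
      · simp only [hℓ, dist_comm (p a) (p b)]; ring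
    · ring
  have hdet : IsUnit (gram ℓ).det := by
    rw [hℓ, gram_eq_edgeMatrix_mul, Matrix.det_mul, Matrix.det_transpose]
    have h0 : (edgeMatrix p).det ≠ 0 := by
      have h1 := congrArg Matrix.det h.edgeMatrix_mul
      rw [Matrix.det_mul, Matrix.det_one] at h1
      exact left_ne_zero_of_mul_eq_one h1
    exact (mul_ne_zero h0 h0).isUnit
  have hE : ∀ a b, E a b = E b a := by
    intro a b
    simp only [E]
    exact if_congr (by tauto) rfl rfl
  have hE₀ : ∀ a, E a a = 0 := by
    intro a
    simp only [E]
    refine if_neg ?_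
    rintro (⟨rfl, h⟩ | ⟨rfl, h⟩)
    exacts [hkl h, hkl h.symm]
  have hN : ∀ i j, HasDerivAt (fun s : ℝ => normalInner (fun a b => ℓ a b + s * E a b) i j)
      ((inner ℝ (g i) (g k) * inner ℝ (g j) (g l) +
        inner ℝ (g i) (g l) * inner ℝ (g j) (g k)) / 2) 0 := by
    intro i j
    convert hasDerivAt_normalInner hdet hE hE₀ i j using 1
    have hsum : ∀ F : Fin 5 → Fin 5 → ℝ, ∑ a, ∑ b, E a b * F a b = F k l + F l k := by
      intro F
      have h1 : ∀ a b, E a b * F a b = (if b = l then if a = k then F a b else 0 else 0) +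
          (if b = k then if a = l then F a b else 0 else 0) := by
        intro a b
        simp only [E]
        by_cases h1 : a = k <;> by_cases h2 : b = l <;> by_cases h3 : a = l <;>
          by_cases h4 : b = k <;> simp_all
      simp [h1, Finset.sum_add_distrib]
    simp only [mul_assoc]
    rw [hsum, hℓ, h.normalInner_eq, h.normalInner_eq, h.normalInner_eq, h.normalInner_eq,
      real_inner_comm (g j) (g l), real_inner_comm (g j) (g k)]
    ring
  have h0 : ∀ i j, normalInner (fun a b => ℓ a b + 0 * E a b) i j = inner ℝ (g i) (g j) := by
    intro i j
    simp only [zero_mul, add_zero]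
    exact h.normalInner_eq i j
  have h1 := hasDerivAt_arccos_neg_div_sqrt (hN i j) (hN i i) (hN j j)
    (by rw [h0]; exact h.inner_self_pos i) (by rw [h0]; exact h.inner_self_pos j)
    (by rw [h0, h0, h0]; exact h.gram_det_pos hij)
  simp only [h0] at h1
  have h2 : HasDerivAt (fun s => dihedralAngle (fun a b => ℓ a b + s * E a b) i j)
      (dihedralRate g i j k l) (ℓ k l - ℓ k l) := by
    rw [sub_self]
    refine h1.congr_deriv ?_
    unfold dihedralRate
    ring
  rw [hfun]
  exact h2.comp_sub_const (ℓ k l) (ℓ k l)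

end

theorem norm_perp_sq (x y : E4) :
    ‖y‖ ^ 2 * ‖perp x y‖ ^ 2 = inner ℝ y y * inner ℝ x x - inner ℝ y x ^ 2 := by
  rw [← real_inner_self_eq_norm_sq, ← real_inner_self_eq_norm_sq]
  by_cases hy : y = 0
  · simp [hy]
  have hyy : inner ℝ y y ≠ 0 := (real_inner_self_pos.2 hy).ne'
  simp only [perp, inner_sub_left, inner_sub_right, real_inner_smul_left, real_inner_smul_right,
    real_inner_comm y x]
  field_simp
  ring

theorem four_mul_triangleArea_sq (p q r : E4) :
    4 * triangleArea p q r ^ 2 = inner ℝ (q - p) (q - p) * inner ℝ (r - p) (r - p) -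
      inner ℝ (q - p) (r - p) ^ 2 := by
  rw [← norm_perp_sq, triangleArea]
  ring

theorem triangleArea_nonneg (p q r : E4) : 0 ≤ triangleArea p q r := by
  unfold triangleArea; positivity

section
variable {p g : Fin 5 → E4}

/-- The area of the face `p 0 p 1 p 2` from the normals `g 3`, `g 4` of the hyperplanes that meet in
it: the plane of the face and that of the normals are orthogonal complements of each other. -/
theorem IsGradient.sqrt_gram_det_three_four (h : IsGradient p g) :
    √(inner ℝ (g 3) (g 3) * inner ℝ (g 4) (g 4) - inner ℝ (g 3) (g 4) ^ 2) =
      triangleArea (p 0) (p 1) (p 2) / (12 * |signedVolume p|) := by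
  set K := inner ℝ (p 1 - p 0) (p 1 - p 0) * inner ℝ (p 2 - p 0) (p 2 - p 0) -
      inner ℝ (p 1 - p 0) (p 2 - p 0) ^ 2 with hK
  set N := inner ℝ (g 3) (g 3) * inner ℝ (g 4) (g 4) - inner ℝ (g 3) (g 4) ^ 2 with hN
  -- The rows are two edges of the face and the two normals, which are orthogonal to them.
  -- Comparison of `A.det * (edgeMatrix p).det = K` with `A.det ^ 2 = K * N` gives
  -- `K = N * (24 V) ^ 2`.
  let A : Matrix (Fin 4) (Fin 4) ℝ := rowMatrix ![p 1 - p 0, p 2 - p 0, g 3, g 4]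
  have hM : (edgeMatrix p).det = 24 * signedVolume p := by
    rw [signedVolume, mul_div_cancel₀ _ (by norm_num)]; rfl
  have hgu : ∀ {i j : Fin 5}, i ≠ j → i ≠ 0 → inner ℝ (g i) (p j - p 0) = 0 := by
    intro i j hij hi
    rw [h, if_neg hij, if_neg hi, sub_zero]
  have hgg : ∀ {i : Fin 5}, i ≠ 0 → inner ℝ (g i) (p i - p 0) = 1 := by
    intro i hi
    rw [h, if_pos rfl, if_neg hi, sub_zero]
  have h1 : A * (edgeMatrix p)ᵀ =
      !![inner ℝ (p 1 - p 0) (p 1 - p 0), inner ℝ (p 1 - p 0) (p 2 - p 0),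
          inner ℝ (p 1 - p 0) (p 3 - p 0), inner ℝ (p 1 - p 0) (p 4 - p 0);
        inner ℝ (p 1 - p 0) (p 2 - p 0), inner ℝ (p 2 - p 0) (p 2 - p 0),
          inner ℝ (p 2 - p 0) (p 3 - p 0), inner ℝ (p 2 - p 0) (p 4 - p 0);
        0, 0, 1, 0; 0, 0, 0, 1] := by
    have h2 : ∀ i j, (A * (edgeMatrix p)ᵀ) i j =
        inner ℝ ((![p 1 - p 0, p 2 - p 0, g 3, g 4] : Fin 4 → E4) i) (p j.succ - p 0) := by
      intro i j
      exact congrFun (congrFun (rowMatrix_mul_transpose _ _) i) j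
    ext i j
    rw [h2]
    fin_cases i
    · fin_cases j <;> simp
    · fin_cases j
      · simp [real_inner_comm]
      all_goals simp
    · fin_cases j
      · exact hgu (by decide) (by decide)
      · exact hgu (by decide) (by decide)
      · exact hgg (by decide)
      · exact hgu (by decide) (by decide)
    · fin_cases j
      · exact hgu (by decide) (by decide)
      · exact hgu (by decide) (by decide)
      · exact hgu (by decide) (by decide)
      · exact hgg (by decide)
  have h2 : A * Aᵀ =
      !![inner ℝ (p 1 - p 0) (p 1 - p 0), inner ℝ (p 1 - p 0) (p 2 - p 0), 0, 0;
        inner ℝ (p 1 - p 0) (p 2 - p 0), inner ℝ (p 2 - p 0) (p 2 - p 0), 0, 0;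
        0, 0, inner ℝ (g 3) (g 3), inner ℝ (g 3) (g 4);
        0, 0, inner ℝ (g 3) (g 4), inner ℝ (g 4) (g 4)] := by
    have h2 : ∀ i j, (A * Aᵀ) i j =
        inner ℝ ((![p 1 - p 0, p 2 - p 0, g 3, g 4] : Fin 4 → E4) i)
          ((![p 1 - p 0, p 2 - p 0, g 3, g 4] : Fin 4 → E4) j) := by
      intro i j
      exact congrFun (congrFun (rowMatrix_mul_transpose _ _) i) j
    have hgu' : ∀ {i j : Fin 5}, i ≠ j → i ≠ 0 → inner ℝ (p j - p 0) (g i) = 0 := by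
      intro i j hij hi
      rw [real_inner_comm, hgu hij hi]
    have e1 : inner ℝ (g 3) (p 1 - p 0) = 0 := hgu (by decide) (by decide)
    have e2 : inner ℝ (g 3) (p 2 - p 0) = 0 := hgu (by decide) (by decide)
    have e3 : inner ℝ (g 4) (p 1 - p 0) = 0 := hgu (by decide) (by decide)
    have e4 : inner ℝ (g 4) (p 2 - p 0) = 0 := hgu (by decide) (by decide)
    have e5 : inner ℝ (p 1 - p 0) (g 3) = 0 := hgu' (by decide) (by decide)
    have e6 : inner ℝ (p 2 - p 0) (g 3) = 0 := hgu' (by decide) (by decide)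
    have e7 : inner ℝ (p 1 - p 0) (g 4) = 0 := hgu' (by decide) (by decide)
    have e8 : inner ℝ (p 2 - p 0) (g 4) = 0 := hgu' (by decide) (by decide)
    ext i j
    rw [h2]
    fin_cases i <;> fin_cases j <;> first | rfl | assumption | exact real_inner_comm _ _
  have d1 := congrArg Matrix.det h1
  have d2 := congrArg Matrix.det h2
  rw [Matrix.det_mul, Matrix.det_transpose] at d1 d2
  have e1 : A.det * (edgeMatrix p).det = K := by
    rw [d1, hK]
    simp [Matrix.det_succ_row_zero, Fin.sum_univ_succ, Fin.succAbove]
    ring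
  have e2 : A.det * A.det = K * N := by
    rw [d2, hK, hN]
    simp [Matrix.det_succ_row_zero, Fin.sum_univ_succ, Fin.succAbove]
    ring
  have hNpos : 0 < N := h.gram_det_pos (by decide)
  have hKpos : 0 < K := by
    refine _root_.gram_det_pos (a := g 1) ?_ (hgu (by decide) (by decide)) ?_
    · rw [hgg (by decide)]; norm_num
    · intro h0
      have := hgg (i := 2) (by decide)
      rw [h0, inner_zero_right] at this
      norm_num at this
  have e3 : K = N * (24 * signedVolume p) ^ 2 := by
    have : K * K = K * (N * (24 * signedVolume p) ^ 2) := by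
      rw [← hM]
      calc K * K = (A.det * A.det) * (edgeMatrix p).det ^ 2 := by rw [← e1]; ring
        _ = _ := by rw [e2]; ring
    exact mul_left_cancel₀ hKpos.ne' this
  have hV : 0 < |signedVolume p| := abs_pos.2 h.signedVolume_ne_zero
  have e4 : N = (triangleArea (p 0) (p 1) (p 2) / (12 * |signedVolume p|)) ^ 2 := by
    have e5 := four_mul_triangleArea_sq (p 0) (p 1) (p 2)
    rw [← hK, e3] at e5
    rw [div_pow, mul_pow, sq_abs]
    have hV' := h.signedVolume_ne_zero
    field_simp
    linarith
  rw [e4, Real.sqrt_sq]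
  exact div_nonneg (triangleArea_nonneg _ _ _) (by positivity)

theorem IsGradient.comp_perm (h : IsGradient p g) (σ : Equiv.Perm (Fin 5)) :
    IsGradient (p ∘ σ) (g ∘ σ) := by
  intro i j m
  simp only [Function.comp_apply, h _ _ _, σ.injective.eq_iff]

/-- The area of a two-dimensional face in terms of the normals to the two three-dimensional faces
that intersect in it. -/
theorem IsGradient.sqrt_gram_det (h : IsGradient p g) {x y z i j : Fin 5}
    (hd : [x, y, z, i, j].Nodup) :
    √(inner ℝ (g i) (g i) * inner ℝ (g j) (g j) - inner ℝ (g i) (g j) ^ 2) =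
      triangleArea (p x) (p y) (p z) / (12 * |signedVolume p|) := by
  have hinj : Function.Injective ![x, y, z, i, j] := by
    rw [← List.nodup_ofFn]
    simpa [List.ofFn_succ] using hd
  let σ : Equiv.Perm (Fin 5) :=
    Equiv.ofBijective _ (Finite.injective_iff_bijective.1 hinj)
  have h1 := (h.comp_perm σ).sqrt_gram_det_three_four
  rw [abs_signedVolume_perm] at h1
  exact h1

end

/-! ### Six points in four-space -/

/-- The barycentric coordinates of the point `q` with respect to the simplex `p`. -/
noncomputable def baryCoord (p : Fin 5 → E4) (q : E4) : Fin 5 → ℝ :=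
  (Fin.cons 1 q.ofLp : Fin 5 → ℝ) ᵥ* (affineMatrix p)⁻¹

/-- The coefficients of the affine dependence of the five vertices `p i` (labelled by `some i`)
and of the point `q` (labelled by `none`), normalized so that the coefficient of `q` is `-1`. -/
noncomputable def depCoeff (p : Fin 5 → E4) (q : E4) (o : Option (Fin 5)) : ℝ :=
  o.elim (-1) (baryCoord p q)

/-- The five vertices and the additional point, with their labels. -/
def sixPoint (p : Fin 5 → E4) (q : E4) (o : Option (Fin 5)) : E4 := o.elim q p

/-- The labels of the vertices of the simplex that does not contain the point labelled by `k`: the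
original simplex, or the one in which the additional point replaces a vertex. -/
def simplexLabel (k : Option (Fin 5)) : Fin 5 → Option (Fin 5) :=
  k.elim some fun k => Function.update some k none

theorem simplexLabel_injective (k : Option (Fin 5)) : Function.Injective (simplexLabel k) := by
  rw [Function.Injective]
  revert k; decide

theorem simplexLabel_ne (k : Option (Fin 5)) (i : Fin 5) : simplexLabel k i ≠ k := by
  revert k i; decide

theorem exists_simplexLabel_eq {k o : Option (Fin 5)} (h : o ≠ k) :
    ∃ i, simplexLabel k i = o := by
  revert k o; decide

theorem sixPoint_comp_some (p : Fin 5 → E4) (q : E4) (k : Fin 5) :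
    sixPoint p q ∘ simplexLabel (some k) = Function.update p k q := by
  ext1 i
  by_cases h : i = k
  · subst h; simp [sixPoint, simplexLabel]
  · simp [sixPoint, simplexLabel, h]

section
variable {p : Fin 5 → E4} (q : E4)

theorem baryCoord_vecMul (hp : signedVolume p ≠ 0) :
    baryCoord p q ᵥ* affineMatrix p = Fin.cons 1 q.ofLp := by
  have hdet : IsUnit (affineMatrix p).det := by
    rw [det_affineMatrix]
    exact (mul_ne_zero (by norm_num) hp).isUnit
  rw [baryCoord, Matrix.vecMul_vecMul, Matrix.nonsing_inv_mul _ hdet, Matrix.vecMul_one]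

theorem sum_baryCoord (hp : signedVolume p ≠ 0) : ∑ i, baryCoord p q i = 1 := by
  have h := congrFun (baryCoord_vecMul q hp) 0
  simpa [Matrix.vecMul, dotProduct, affineMatrix] using h

theorem sum_baryCoord_smul (hp : signedVolume p ≠ 0) : ∑ i, baryCoord p q i • p i = q := by
  ext α
  have h := congrFun (baryCoord_vecMul q hp) α.succ
  simpa [Matrix.vecMul, dotProduct, affineMatrix] using h

theorem sum_depCoeff (hp : signedVolume p ≠ 0) : ∑ o, depCoeff p q o = 0 := by
  rw [Fintype.sum_option]
  simp only [depCoeff, Option.elim]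
  rw [sum_baryCoord q hp]
  norm_num

theorem sum_depCoeff_smul (hp : signedVolume p ≠ 0) :
    ∑ o, depCoeff p q o • sixPoint p q o = 0 := by
  rw [Fintype.sum_option]
  simp only [depCoeff, sixPoint, Option.elim]
  rw [sum_baryCoord_smul q hp]
  simp

theorem sum_depCoeff_smul_sub (hp : signedVolume p ≠ 0) (x : E4) :
    ∑ o, depCoeff p q o • (sixPoint p q o - x) = 0 := by
  simp only [smul_sub, Finset.sum_sub_distrib]
  rw [sum_depCoeff_smul q hp, ← Finset.sum_smul, sum_depCoeff q hp, zero_smul, sub_zero]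

/-- Cramer's rule for the barycentric coordinates. -/
theorem signedVolume_update (hp : signedVolume p ≠ 0) (k : Fin 5) :
    signedVolume (Function.update p k q) = baryCoord p q k * signedVolume p := by
  have h : affineMatrix (Function.update p k q) =
      (affineMatrix p).updateRow k (∑ i, baryCoord p q i • affineMatrix p i) := by
    have h1 : ∑ i, baryCoord p q i • affineMatrix p i = Fin.cons 1 q.ofLp := by
      rw [← baryCoord_vecMul q hp, Matrix.vecMul_eq_sum]
    rw [h1]
    ext i j
    by_cases hi : i = k
    · subst hi; simp [affineMatrix]
    · simp [affineMatrix, hi]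
  have h1 := congrArg Matrix.det h
  rw [Matrix.det_updateRow_sum, det_affineMatrix, det_affineMatrix, smul_eq_mul] at h1
  linarith

/-- The gradients of the barycentric coordinates of the simplex without the point labelled by
`k`, indexed by the labels; they are expressed in those of the original simplex. -/
noncomputable def sixGradient (p : Fin 5 → E4) (q : E4) (g : Fin 5 → E4) (k o : Option (Fin 5)) :
    E4 :=
  (o.elim 0 g) - (depCoeff p q o / depCoeff p q k) • (k.elim 0 g)

/-- The relation between the gradients in any two of the six simplices. -/
theorem sixGradient_eq (g : Fin 5 → E4) {c k : Option (Fin 5)}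
    (hk : depCoeff p q k ≠ 0) (o : Option (Fin 5)) :
    sixGradient p q g k o = sixGradient p q g c o -
      (depCoeff p q o / depCoeff p q k) • sixGradient p q g c k := by
  simp only [sixGradient, smul_sub, smul_smul]
  rw [div_mul_div_cancel₀ hk]
  abel

theorem sixGradient_self (g : Fin 5 → E4) {k : Option (Fin 5)} (hk : depCoeff p q k ≠ 0) :
    sixGradient p q g k k = 0 := by
  simp [sixGradient, hk]

/-- Subtracting multiples of `g k` makes the gradient of the missing vertex `k` zero and keeps the
others dual to the vertices. -/
theorem IsGradient.sixGradient {g : Fin 5 → E4} (h : IsGradient p g) {k : Option (Fin 5)}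
    (hk : depCoeff p q k ≠ 0) :
    IsGradient (sixPoint p q ∘ simplexLabel k) (sixGradient p q g k ∘ simplexLabel k) := by
  have hp := h.signedVolume_ne_zero
  -- Inner products with differences of any two of the six points.
  have base : ∀ o o' o'' : Option (Fin 5), inner ℝ ((o.elim 0 g : E4))
      (sixPoint p q o' - sixPoint p q o'') =
      ((if o = o' then 1 else 0) + if o' = none then depCoeff p q o else 0) -
      ((if o = o'' then 1 else 0) + if o'' = none then depCoeff p q o else 0) := by
    have base0 : ∀ i o', inner ℝ (g i) (sixPoint p q o' - p 0) =
        ((if some i = o' then 1 else 0) + if o' = none then depCoeff p q (some i) else 0) -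
          if i = 0 then 1 else 0 := by
      intro i o'
      rcases o' with _ | j
      · have h1 : q - p 0 = ∑ j, baryCoord p q j • (p j - p 0) := by
          simp only [smul_sub, Finset.sum_sub_distrib]
          rw [sum_baryCoord_smul q hp, ← Finset.sum_smul, sum_baryCoord q hp, one_smul]
        simp only [sixPoint, Option.elim]
        rw [h1, inner_sum]
        simp only [inner_smul_right, h _ _ _, mul_sub, Finset.sum_sub_distrib]
        rw [← Finset.sum_mul, sum_baryCoord q hp]
        simp [depCoeff]
      · simp [sixPoint, h _ _ _]
    intro o o' o''
    rcases o with _ | i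
    · rcases o' with _ | j <;> rcases o'' with _ | l <;> simp [depCoeff]
    · have h1 := base0 i o'
      have h2 := base0 i o''
      rw [← sub_sub_sub_cancel_right (sixPoint p q o') _ (p 0), inner_sub_right]
      simp only [Option.elim]
      rw [h1, h2]
      ring
  intro i j m
  have hj := simplexLabel_ne k j
  have hm := simplexLabel_ne k m
  simp only [Function.comp_apply, _root_.sixGradient, inner_sub_left, real_inner_smul_left, base]
  rw [if_neg hj.symm, if_neg hm.symm]
  simp only [(simplexLabel_injective k).eq_iff]
  have hdiv := div_mul_cancel₀ (depCoeff p q (simplexLabel k i)) hk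
  by_cases h1 : simplexLabel k j = none <;> by_cases h2 : simplexLabel k m = none <;>
    simp only [h1, h2, if_true, if_false]
  · ring
  · linear_combination -hdiv
  · linear_combination hdiv
  · ring

end

/-- The algebraic identity behind the sum of the derivatives of three dihedral angles, in terms
of the inner products of the normals of one of the three simplices. -/
theorem sum_three_rates_aux {A B C M la lb lc li lj xi xj yi yj : ℝ} (hA : A ≠ 0)
    (hC : C ≠ 0) (ha : la ≠ 0) (hb : lb ≠ 0) (hM : M ≠ 0)
    (hM' : M = lb ^ 2 * A - 2 * la * lb * B + la ^ 2 * C) :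
    lc * ((xi * yj + xj * yi) / 2 - B / 2 * (xi * xj / A + yi * yj / C)) +
    la * (-(lc / la) * ((yi - li / la * B - lb / la * (xi - li / la * A)) * (xj - lj / la * A) +
        (yj - lj / la * B - lb / la * (xj - lj / la * A)) * (xi - li / la * A)) / 2 -
      -(lc / la) * (B - lb / la * A) / 2 *
        ((yi - li / la * B - lb / la * (xi - li / la * A)) *
          (yj - lj / la * B - lb / la * (xj - lj / la * A)) /
          (M / la ^ 2) +
        (xi - li / la * A) * (xj - lj / la * A) / A)) +
    lb * (-(lc / lb) * ((yi - li / lb * C) * (xj - lj / lb * B - la / lb * (yj - lj / lb * C)) +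
        (yj - lj / lb * C) * (xi - li / lb * B - la / lb * (yi - li / lb * C))) / 2 -
      -(lc / lb) * (B - la / lb * C) / 2 *
        ((yi - li / lb * C) * (yj - lj / lb * C) / C +
        (xi - li / lb * B - la / lb * (yi - li / lb * C)) *
          (xj - lj / lb * B - la / lb * (yj - lj / lb * C)) /
          (M / lb ^ 2))) =
    (A * C - B ^ 2) * lc / (2 * la * lb) * (li * lj) := by
  field_simp
  subst hM'
  ring

theorem sign_eq_div_abs {x : ℝ} (hx : x ≠ 0) : Real.sign x = x / |x| := by
  rcases hx.lt_or_gt with h | h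
  · rw [Real.sign_of_neg h, abs_of_neg h, div_neg, div_self hx]
  · rw [Real.sign_of_pos h, abs_of_pos h, div_self hx]

/-- Three simplices on six points have a common two-dimensional face. The sum of the derivatives of
their dihedral angles at this face, taken with orientations, is a multiple of the product of the
coefficients of the affine dependence that belong to the ends of the edge. -/
theorem IsGradient.sum_three_rates {p g : Fin 5 → E4} (h : IsGradient p g) {q : E4}
    (hne : ∀ o, depCoeff p q o ≠ 0) {a b c : Option (Fin 5)} (hab : a ≠ b) (hac : a ≠ c)
    (hbc : b ≠ c) (i j : Option (Fin 5)) :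
    Real.sign (depCoeff p q c) * dihedralRate (_root_.sixGradient p q g c) a b i j +
      Real.sign (depCoeff p q a) * dihedralRate (_root_.sixGradient p q g a) b c i j +
      Real.sign (depCoeff p q b) * dihedralRate (_root_.sixGradient p q g b) c a i j =
    |depCoeff p q c| *
      √(inner ℝ (_root_.sixGradient p q g c a) (_root_.sixGradient p q g c a) *
        inner ℝ (_root_.sixGradient p q g c b) (_root_.sixGradient p q g c b) -
        inner ℝ (_root_.sixGradient p q g c a) (_root_.sixGradient p q g c b) ^ 2) /
      (2 * depCoeff p q a * depCoeff p q b * depCoeff p q c) *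
      (depCoeff p q i * depCoeff p q j) := by
  have ea := fun o => sixGradient_eq q g (c := c) (hne a) o
  have eb := fun o => sixGradient_eq q g (c := c) (hne b) o
  have ec := sixGradient_self q g (hne c)
  have hc := h.sixGradient q (hne c)
  obtain ⟨a', ha'⟩ := exists_simplexLabel_eq hac
  obtain ⟨b', hb'⟩ := exists_simplexLabel_eq hbc
  have hab' : a' ≠ b' := fun h0 => hab (by rw [← ha', ← hb', h0])
  have hA := hc.inner_self_pos a'
  have hC := hc.inner_self_pos b'
  have hD := hc.gram_det_pos hab'
  simp only [Function.comp_apply, ha', hb'] at hA hC hD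
  -- The gradients of `a` and `b` in the simplex without `c` are independent. Up to a factor, the
  -- combination is the gradient of `b` in the simplex without `a`, and that of `a` in the one
  -- without `b`.
  have hM₀ : (depCoeff p q b • _root_.sixGradient p q g c a -
      depCoeff p q a • _root_.sixGradient p q g c b : E4) ≠ 0 := by
    intro h0
    obtain ⟨m, hma, hmb⟩ : ∃ m, m ≠ a' ∧ m ≠ b' := by
      clear h0 hab' hb' ha'; revert a' b'; decide
    have h1 := hc a' a' m
    have h2 := hc b' a' m
    simp only [Function.comp_apply, ha', hb'] at h1 h2
    have h3 := congrArg (fun x : E4 => inner ℝ x (sixPoint p q a -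
      sixPoint p q (simplexLabel c m))) h0
    simp only [inner_sub_left, real_inner_smul_left, h1, h2, inner_zero_left] at h3
    simp [hma.symm, hmb.symm, hab'.symm, hne] at h3
  have hM := real_inner_self_pos.2 hM₀
  generalize depCoeff p q = l at *
  generalize _root_.sixGradient p q g = G at *
  simp only [inner_sub_left, inner_sub_right, real_inner_smul_left, real_inner_smul_right] at hM
  rw [real_inner_comm (G c a) (G c b)] at hM
  set A := inner ℝ (G c a) (G c a) with hA'
  set B := inner ℝ (G c a) (G c b) with hB'
  set C := inner ℝ (G c b) (G c b) with hC'
  have hBc : inner ℝ (G c b) (G c a) = B := real_inner_comm _ _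
  have key := sum_three_rates_aux (A := A) (B := B) (C := C) (M := _) (la := l a) (lb := l b)
    (lc := l c) (li := l i) (lj := l j) (xi := inner ℝ (G c a) (G c i))
    (xj := inner ℝ (G c a) (G c j)) (yi := inner ℝ (G c b) (G c i))
    (yj := inner ℝ (G c b) (G c j)) hA.ne' hC.ne' (hne a) (hne b) hM.ne' (by ring)
  generalize hMM : l b * (l b * A) - l b * (l a * B) - (l a * (l b * B) - l a * (l a * C)) = M
    at *
  have na := hne a
  have nb := hne b
  have nc := hne c
  -- The inner products of the gradients in the simplices without `a` and without `b` are expressed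
  -- in those in the simplex without `c`.
  have abo : ∀ o, inner ℝ (G a b) (G a o) = inner ℝ (G c b) (G c o) - l o / l a * B -
      l b / l a * (inner ℝ (G c a) (G c o) - l o / l a * A) := by
    intro o
    rw [ea b, ea o]
    simp only [inner_sub_left, inner_sub_right, real_inner_smul_left, real_inner_smul_right, hBc,
      ← hA']
    ring
  have aco : ∀ o, inner ℝ (G a c) (G a o) =
      -(l c / l a) * (inner ℝ (G c a) (G c o) - l o / l a * A) := by
    intro o
    rw [ea c, ea o, ec]
    simp only [inner_sub_left, inner_sub_right, real_inner_smul_left, real_inner_smul_right,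
      ← hA', inner_zero_left]
    ring
  have bco : ∀ o, inner ℝ (G b c) (G b o) =
      -(l c / l b) * (inner ℝ (G c b) (G c o) - l o / l b * C) := by
    intro o
    rw [eb c, eb o, ec]
    simp only [inner_sub_left, inner_sub_right, real_inner_smul_left, real_inner_smul_right,
      ← hC', inner_zero_left]
    ring
  have bao : ∀ o, inner ℝ (G b a) (G b o) = inner ℝ (G c a) (G c o) - l o / l b * B -
      l a / l b * (inner ℝ (G c b) (G c o) - l o / l b * C) := by
    intro o
    rw [eb a, eb o]
    simp only [inner_sub_left, inner_sub_right, real_inner_smul_left, real_inner_smul_right,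
      ← hC', ← hB']
    ring
  have hsqrt : ∀ t : ℝ, √(t ^ 2 * (A * C - B ^ 2)) = |t| * √(A * C - B ^ 2) := fun t => by
    rw [Real.sqrt_mul (sq_nonneg t), Real.sqrt_sq_eq_abs]
  -- The Gram determinants of the normals in the three simplices differ by squares, so that the
  -- three rates have the same square root as a denominator.
  have ra1 : inner ℝ (G a b) (G a b) = M / l a ^ 2 := by
    rw [abo, ← hC', ← hB', ← hMM]
    field_simp
    ring
  have ra2 : inner ℝ (G a c) (G a c) = (l c / l a) ^ 2 * A := by
    rw [aco, ec, inner_zero_right]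
    ring
  have ra3 : inner ℝ (G a b) (G a c) = -(l c / l a) * (B - l b / l a * A) := by
    rw [real_inner_comm, aco, ← hB']
  have ra4 : M / l a ^ 2 * ((l c / l a) ^ 2 * A) - (-(l c / l a) * (B - l b / l a * A)) ^ 2 =
      (l c / l a) ^ 2 * (A * C - B ^ 2) := by
    rw [← hMM]
    field_simp
    ring
  have ra := dihedralRate.eq_1 (G a) b c i j
  rw [ra1, ra2, ra3, ra4] at ra
  simp only [abo, aco] at ra
  have rb1 : inner ℝ (G b a) (G b a) = M / l b ^ 2 := by
    rw [bao, hBc, ← hA', ← hMM]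
    field_simp
  have rb2 : inner ℝ (G b c) (G b c) = (l c / l b) ^ 2 * C := by
    rw [bco, ec, inner_zero_right]
    ring
  have rb3 : inner ℝ (G b c) (G b a) = -(l c / l b) * (B - l a / l b * C) := by
    rw [bco, hBc]
  have rb4 : (l c / l b) ^ 2 * C * (M / l b ^ 2) - (-(l c / l b) * (B - l a / l b * C)) ^ 2 =
      (l c / l b) ^ 2 * (A * C - B ^ 2) := by
    rw [← hMM]
    field_simp
    ring
  have rb := dihedralRate.eq_1 (G b) c a i j
  rw [rb1, rb2, rb3, rb4] at rb
  simp only [bao, bco] at rb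
  have rc := dihedralRate.eq_1 (G c) a b i j
  rw [ra, rb, rc, hsqrt, hsqrt, sign_eq_div_abs na, sign_eq_div_abs nb, sign_eq_div_abs nc,
    abs_div, abs_div]
  simp only [← hA', ← hB', ← hC']
  have hDD : √(A * C - B ^ 2) * √(A * C - B ^ 2) = A * C - B ^ 2 := Real.mul_self_sqrt hD.le
  have hDpos : 0 < √(A * C - B ^ 2) := Real.sqrt_pos.2 hD
  generalize √(A * C - B ^ 2) = D at *
  have na' := abs_pos.2 na
  have nb' := abs_pos.2 nb
  have nc' := abs_pos.2 nc
  have habs : |l c| ^ 2 = l c ^ 2 := sq_abs _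
  rw [← hDD] at key
  refine mul_left_cancel₀ (mul_pos nc' hDpos).ne' (Eq.trans ?_ (key.trans ?_))
  · field_simp
    ring
  · field_simp
    rw [habs]
    field_simp

namespace Triangulation4

variable {Γ : Type*} [Group Γ] {V T J : Type*} [LinearOrder V]
variable (R : Representation4 Γ J) (X : Triangulation4 Γ V T)

/-! ### Coordinate systems of a 4-simplex -/

theorem hol_self (t : T) (i : Fin 5) : X.hol (X.vert t i) (X.vert t i) = 1 :=
  mul_eq_left.1 (X.hol_mul t i i i)

/-- The linear part of the transition from the coordinate system of `v` to that of `u`. -/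
noncomputable def lin (u v : V) : E4 ≃ₗᵢ[ℝ] E4 := (R.ρ (X.hol u v)).linearIsometryEquiv

theorem lin_self (t : T) (i : Fin 5) (x : E4) :
    X.lin R (X.vert t i) (X.vert t i) x = x := by
  rw [lin, hol_self, map_one]
  rfl

theorem lin_lin (t : T) (i j k : Fin 5) (x : E4) :
    X.lin R (X.vert t i) (X.vert t j) (X.lin R (X.vert t j) (X.vert t k) x) =
      X.lin R (X.vert t i) (X.vert t k) x := by
  rw [lin, lin, lin, ← X.hol_mul t i j k, map_mul]
  rfl

theorem lin_sub (u v : V) (x y : E4) :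
    X.lin R u v (x - y) = R.ρ (X.hol u v) x - R.ρ (X.hol u v) y := by
  rw [lin, ← vsub_eq_sub, AffineIsometryEquiv.map_vsub, vsub_eq_sub]

theorem motion_coord (t : T) (i : Fin 5) :
    R.ρ (X.hol (X.vert t 0) (X.vert t i)) (X.coord (X.vert t i)) = X.simplexPlace R t i :=
  rfl

theorem motion_place (t : T) (i j : Fin 5) :
    R.ρ (X.hol (X.vert t 0) (X.vert t i)) (X.place R (X.vert t i) (X.vert t j)) =
      X.simplexPlace R t j := by
  rw [simplexPlace, place, place, ← X.hol_mul t 0 i j, map_mul]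
  rfl

theorem lin_edgeVec (t : T) (i j : Fin 5) :
    X.lin R (X.vert t 0) (X.vert t i) (X.edgeVec R (X.vert t i) (X.vert t j)) =
      X.simplexPlace R t j - X.simplexPlace R t i := by
  rw [edgeVec, lin_sub, motion_place, motion_coord]

theorem norm_edgeVec (t : T) (i j : Fin 5) :
    ‖X.edgeVec R (X.vert t i) (X.vert t j)‖ =
      dist (X.simplexPlace R t i) (X.simplexPlace R t j) := by
  rw [← (X.lin R (X.vert t 0) (X.vert t i)).norm_map, lin_edgeVec, dist_comm, dist_eq_norm]

theorem simplexPlace_injective {t : T} (ht : X.volume R t ≠ 0) :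
    Function.Injective (X.simplexPlace R t) := by
  intro i j hij
  obtain ⟨g, hg⟩ := exists_isGradient (abs_ne_zero.1 ht)
  by_contra hne
  have h := hg i i j
  rw [hij, sub_self, inner_zero_right, if_pos rfl, if_neg hne] at h
  norm_num at h

theorem edgeVec_ne_zero (hX : X.IsNondegenerate R) (e : X.Edge) :
    X.edgeVec R e.1.1 e.1.2 ≠ 0 := by
  obtain ⟨⟨u, v⟩, huv, t, ⟨i, hi⟩, ⟨j, hj⟩⟩ := e
  dsimp only at hi hj
  subst hi hj
  rw [← norm_ne_zero_iff, norm_edgeVec, dist_ne_zero]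
  intro h
  have := X.simplexPlace_injective R (hX t) h
  subst this
  exact lt_irrefl _ huv

/-! ### Edges, faces and positions after the move -/

variable (t₀ : T) (q : E4)

theorem mem_range_of_coe_mem_range_move {v : V} {t' : {t : T // t ≠ t₀} ⊕ Fin 5}
    (h : (v : WithTop V) ∈ Set.range ((X.move t₀ q).vert t')) :
    v ∈ Set.range (X.vert (t'.elim Subtype.val fun _ => t₀)) := by
  obtain ⟨i, hi⟩ := h
  rcases t' with t | k
  · exact ⟨i, WithTop.coe_injective hi⟩
  · refine ⟨i, ?_⟩
    by_cases hik : i = k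
    · subst hik; simp [move] at hi
    · simpa [move, hik] using hi

theorem exists_eq_inr_of_top_mem_range_move {t' : {t : T // t ≠ t₀} ⊕ Fin 5}
    (h : ⊤ ∈ Set.range ((X.move t₀ q).vert t')) : ∃ k, t' = Sum.inr k := by
  obtain ⟨i, hi⟩ := h
  rcases t' with t | k
  · simp [move] at hi
  · exact ⟨k, rfl⟩

theorem oldEdge_injective : Function.Injective (X.oldEdge t₀ q) := by
  intro e e' h
  have h1 := congrArg Subtype.val h
  simp only [oldEdge, Prod.mk.injEq, WithTop.coe_inj] at h1
  exact Subtype.ext (Prod.ext h1.1 h1.2)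

theorem oldFace_injective : Function.Injective (X.oldFace t₀ q) := by
  intro e e' h
  have h1 := congrArg Subtype.val h
  simp only [oldFace, Prod.mk.injEq, WithTop.coe_inj] at h1
  exact Subtype.ext (Prod.ext h1.1 (Prod.ext h1.2.1 h1.2.2))

theorem newEdge_injective : Function.Injective (X.newEdge t₀ q) := by
  intro i j h
  have h1 := congrArg Subtype.val h
  simp only [newEdge, Prod.mk.injEq, WithTop.coe_inj, and_true] at h1
  exact X.vert_injective t₀ h1

/-- The edges after the move: the old ones, and those that join the vertices of `t₀` and the
new vertex. -/
noncomputable def edgeEquiv : X.Edge ⊕ Fin 5 ≃ (X.move t₀ q).Edge :=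
  Equiv.ofBijective (Sum.elim (X.oldEdge t₀ q) (X.newEdge t₀ q)) <| by
    refine ⟨(X.oldEdge_injective t₀ q).sumElim (X.newEdge_injective t₀ q) ?_, ?_⟩
    · intro e i h
      have h1 := congrArg (fun e : (X.move t₀ q).Edge => e.1.2) h
      exact WithTop.coe_ne_top h1
    · rintro ⟨⟨u, v⟩, huv, t', hu, hv⟩
      induction u using WithTop.recTopCoe with
      | top => exact absurd huv not_top_lt
      | coe u =>
      have hu' := X.mem_range_of_coe_mem_range_move t₀ q hu
      induction v using WithTop.recTopCoe with
      | top =>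
        obtain ⟨k, rfl⟩ := X.exists_eq_inr_of_top_mem_range_move t₀ q hv
        obtain ⟨i, rfl⟩ := hu'
        exact ⟨Sum.inr i, rfl⟩
      | coe v =>
        exact ⟨Sum.inl ⟨(u, v), WithTop.coe_lt_coe.1 huv, _, hu',
          X.mem_range_of_coe_mem_range_move t₀ q hv⟩, rfl⟩

/-- The pairs of vertices of a 4-simplex, or the new 2-faces. -/
abbrev IndexPair : Type := {p : Fin 5 × Fin 5 // p.1 < p.2}

theorem newFace_injective : Function.Injective
    fun p : IndexPair => X.newFace t₀ q p.1.1 p.1.2 p.2.ne := by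
  rintro ⟨⟨i, j⟩, hij⟩ ⟨⟨k, l⟩, hkl⟩ h
  have h1 := congrArg Subtype.val h
  simp only [newFace, Prod.mk.injEq, WithTop.coe_inj, and_true] at h1
  have hinj := X.vert_injective t₀
  simp only at hij hkl
  obtain ⟨h2, h3⟩ := h1
  rcases le_total (X.vert t₀ i) (X.vert t₀ j) with h4 | h4 <;>
    rcases le_total (X.vert t₀ k) (X.vert t₀ l) with h5 | h5 <;>
    simp only [h4, h5, min_eq_left, min_eq_right, max_eq_left, max_eq_right, hinj.eq_iff]
      at h2 h3 <;> subst h2 <;> subst h3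
  · rfl
  · exact absurd hij hkl.asymm
  · exact absurd hij hkl.asymm
  · rfl

theorem newFace_comm (i j : Fin 5) (h : i ≠ j) :
    X.newFace t₀ q i j h = X.newFace t₀ q j i h.symm := by
  refine Subtype.ext ?_
  simp only [newFace, min_comm, max_comm]

/-- The 2-faces after the move. -/
noncomputable def faceEquiv : X.Face ⊕ IndexPair ≃ (X.move t₀ q).Face :=
  Equiv.ofBijective (Sum.elim (X.oldFace t₀ q)
      fun p : IndexPair => X.newFace t₀ q p.1.1 p.1.2 p.2.ne) <| by
    refine ⟨(X.oldFace_injective t₀ q).sumElim (X.newFace_injective t₀ q) ?_, ?_⟩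
    · intro e i h
      have h1 := congrArg (fun e : (X.move t₀ q).Face => e.1.2.2) h
      exact WithTop.coe_ne_top h1
    · rintro ⟨⟨u, v, w⟩, huv, hvw, t', hu, hv, hw⟩
      induction v using WithTop.recTopCoe with
      | top => exact absurd hvw not_top_lt
      | coe v =>
      induction u using WithTop.recTopCoe with
      | top => exact absurd huv not_top_lt
      | coe u =>
      have hu' := X.mem_range_of_coe_mem_range_move t₀ q hu
      have hv' := X.mem_range_of_coe_mem_range_move t₀ q hv
      have huv' : u < v := WithTop.coe_lt_coe.1 huv
      induction w using WithTop.recTopCoe with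
      | top =>
        obtain ⟨k, rfl⟩ := X.exists_eq_inr_of_top_mem_range_move t₀ q hw
        obtain ⟨i, rfl⟩ := hu'
        obtain ⟨j, rfl⟩ := hv'
        have huv'' : X.vert t₀ i < X.vert t₀ j := huv'
        have hij : i ≠ j := fun h => by subst h; exact lt_irrefl _ huv'
        have key : X.newFace t₀ q i j hij = ⟨((X.vert t₀ i : WithTop V),
            (X.vert t₀ j : WithTop V), ⊤), huv, hvw, _, hu, hv, hw⟩ :=
          Subtype.ext (by
            simp only [newFace, min_eq_left huv''.le, max_eq_right huv''.le])
        rcases hij.lt_or_gt with h | h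
        · exact ⟨Sum.inr ⟨(i, j), h⟩, key⟩
        · exact ⟨Sum.inr ⟨(j, i), h⟩, (X.newFace_comm t₀ q j i h.ne).trans key⟩
      | coe w =>
        exact ⟨Sum.inl ⟨(u, v, w), huv', WithTop.coe_lt_coe.1 hvw, _, hu', hv',
          X.mem_range_of_coe_mem_range_move t₀ q hw⟩, rfl⟩

/-- The coordinates of vertices and the parameters after the move. -/
noncomputable def coordEquiv (V J : Type*) :
    ((V × Fin 4) ⊕ J) ⊕ Fin 4 ≃ (WithTop V × Fin 4) ⊕ J :=
  Equiv.ofBijective (Sum.elim (Sum.map (Prod.map (fun v : V => (v : WithTop V)) id) id)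
      fun α => Sum.inl (⊤, α)) <| by
    constructor
    · rintro ((⟨v, α⟩ | j) | α) ((⟨v', α'⟩ | j') | α') h <;> simp_all
    · rintro (⟨v, α⟩ | j)
      · induction v using WithTop.recTopCoe with
        | top => exact ⟨Sum.inr α, rfl⟩
        | coe v => exact ⟨Sum.inl (Sum.inl (v, α)), rfl⟩
      · exact ⟨Sum.inl (Sum.inr j), rfl⟩

/-- The components of the deviations of edges after the move. -/
noncomputable def edgeAxisEquiv :
    (X.Edge × Fin 3) ⊕ (Fin 5 × Fin 3) ≃ (X.move t₀ q).Edge × Fin 3 :=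
  (Equiv.sumProdDistrib _ _ _).symm.trans ((X.edgeEquiv t₀ q).prodCongr (Equiv.refl _))

/-- The components of the deviations of vertices after the move. -/
noncomputable def vertexPairEquiv (V : Type*) :
    (V × Pair) ⊕ Pair ≃ WithTop V × Pair :=
  Equiv.ofBijective (Sum.elim (Prod.map (fun v : V => (v : WithTop V)) id) fun c => (⊤, c)) <| by
    constructor
    · rintro (⟨v, α⟩ | α) (⟨v', α'⟩ | α') h <;> simp_all
    · rintro ⟨v, α⟩
      induction v using WithTop.recTopCoe with
      | top => exact ⟨Sum.inr α, rfl⟩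
      | coe v => exact ⟨Sum.inl (v, α), rfl⟩

/-- The vertices of `t₀` and the new vertex, by their labels. -/
def sixVertex (o : Option (Fin 5)) : WithTop V := o.elim ⊤ fun i => (X.vert t₀ i : WithTop V)

theorem sixVertex_injective : Function.Injective (X.sixVertex t₀) := by
  rintro (_ | i) (_ | j) h
  · rfl
  · exact absurd h.symm WithTop.coe_ne_top
  · exact absurd h WithTop.coe_ne_top
  · rw [X.vert_injective t₀ (WithTop.coe_injective h)]

theorem move_vert_inr (k : Fin 5) :
    (X.move t₀ q).vert (Sum.inr k) = X.sixVertex t₀ ∘ simplexLabel (some k) := by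
  ext1 i
  by_cases h : i = k
  · subst h; simp [move, sixVertex, simplexLabel]
  · simp [move, sixVertex, simplexLabel, h]

theorem move_hol_sixVertex (o o' : Option (Fin 5)) :
    (X.move t₀ q).hol (X.sixVertex t₀ o) (X.sixVertex t₀ o') =
      X.hol (X.vert t₀ (o.getD 0)) (X.vert t₀ (o'.getD 0)) := by
  rcases o with _ | i <;> rcases o' with _ | j <;> rfl

/-- The linear part of the transition to the coordinate system of `t₀`, for the six vertices. -/
theorem move_lin_sixVertex (o o' : Option (Fin 5)) :
    (X.move t₀ q).lin R (X.sixVertex t₀ o) (X.sixVertex t₀ o') =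
      X.lin R (X.vert t₀ (o.getD 0)) (X.vert t₀ (o'.getD 0)) := by
  rw [lin, lin, move_hol_sixVertex]

/-- In the coordinate system of the first vertex of `t₀`, the six vertices are at `sixPoint`. -/
theorem motion_move_coord (o : Option (Fin 5)) :
    R.ρ (X.hol (X.vert t₀ 0) (X.vert t₀ (o.getD 0))) ((X.move t₀ q).coord (X.sixVertex t₀ o)) =
      sixPoint (X.simplexPlace R t₀) q o := by
  rcases o with _ | i
  · rw [Option.getD_none, hol_self, map_one]
    rfl
  · rfl

theorem motion_move_place (o o' : Option (Fin 5)) :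
    R.ρ (X.hol (X.vert t₀ 0) (X.vert t₀ (o.getD 0)))
      ((X.move t₀ q).place R (X.sixVertex t₀ o) (X.sixVertex t₀ o')) =
      sixPoint (X.simplexPlace R t₀) q o' := by
  rw [place, move_hol_sixVertex, ← motion_move_coord, ← X.hol_mul t₀ 0 (o.getD 0) (o'.getD 0), map_mul]
  rfl

theorem lin_move_edgeVec (o o' : Option (Fin 5)) :
    X.lin R (X.vert t₀ 0) (X.vert t₀ (o.getD 0))
      ((X.move t₀ q).edgeVec R (X.sixVertex t₀ o) (X.sixVertex t₀ o')) =
      sixPoint (X.simplexPlace R t₀) q o' - sixPoint (X.simplexPlace R t₀) q o := by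
  rw [edgeVec, lin_sub, motion_move_place, motion_move_coord]

theorem move_simplexPlace_inr (k : Fin 5) :
    (X.move t₀ q).simplexPlace R (Sum.inr k) =
      sixPoint (X.simplexPlace R t₀) q ∘ simplexLabel (some k) := by
  ext1 i
  rw [simplexPlace, move_vert_inr]
  simp only [Function.comp_apply]
  rw [← motion_move_place R X t₀ q (simplexLabel (some k) 0)]
  have : ((simplexLabel (some k) 0).getD 0 : Fin 5) = 0 := by revert k; decide
  rw [this, hol_self, map_one]
  rfl

end Triangulation4

/-! ### The compositions of consecutive maps -/

/-- The matrix of a linear map in the basis of axes, applied to components along these axes. -/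
theorem sum_apply_single_mul {ι κ M : Type*} [Fintype ι] [DecidableEq ι] [Fintype κ]
    [AddCommGroup M] [Module ℝ M] {φ : (ι → M) → ℝ} (hφ : IsLinearMap ℝ φ) (w : ι → κ → M)
    (c : ι × κ → ℝ) :
    ∑ p : ι × κ, φ (Pi.single p.1 (w p.1 p.2)) * c p = φ fun i => ∑ k, c (i, k) • w i k := by
  have h : (fun i => ∑ k, c (i, k) • w i k) =
      ∑ p : ι × κ, c p • (Pi.single p.1 (w p.1 p.2) : ι → M) := by
    ext1 i
    rw [Finset.sum_apply, Fintype.sum_prod_type, Finset.sum_eq_single i]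
    · simp
    · intro j _ hj
      simp [Pi.single_eq_of_ne hj.symm]
    · simp
  rw [h, show φ = hφ.mk' φ from rfl, map_sum]
  refine Finset.sum_congr rfl fun p _ => ?_
  rw [map_smul, smul_eq_mul, mul_comm]

theorem triangleArea_swap (P Q O : E4) : triangleArea P O Q = triangleArea P Q O := by
  have h1 := four_mul_triangleArea_sq P Q O
  have h2 := four_mul_triangleArea_sq P O Q
  rw [← sq_eq_sq₀ (triangleArea_nonneg _ _ _) (triangleArea_nonneg _ _ _)]
  rw [real_inner_comm (Q - P) (O - P)] at h2
  linarith

theorem triangleArea_rotate (P Q O : E4) : triangleArea Q O P = triangleArea P Q O := by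
  have h1 := four_mul_triangleArea_sq P Q O
  have h2 := four_mul_triangleArea_sq Q O P
  rw [← sq_eq_sq₀ (triangleArea_nonneg _ _ _) (triangleArea_nonneg _ _ _)]
  have e1 : O - Q = (O - P) - (Q - P) := by abel
  have e2 : P - Q = -(Q - P) := by abel
  rw [e1, e2] at h2
  generalize O - P = y at *
  generalize Q - P = x at *
  simp only [inner_sub_left, inner_sub_right, inner_neg_left, inner_neg_right] at h2
  rw [real_inner_comm x y] at h2
  linarith

theorem triangleArea_map (g : E4 ≃ᵃⁱ[ℝ] E4) (P Q O : E4) :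
    triangleArea (g P) (g Q) (g O) = triangleArea P Q O := by
  have h1 := four_mul_triangleArea_sq P Q O
  have h2 := four_mul_triangleArea_sq (g P) (g Q) (g O)
  rw [← sq_eq_sq₀ (triangleArea_nonneg _ _ _) (triangleArea_nonneg _ _ _)]
  simp only [← vsub_eq_sub, ← AffineIsometryEquiv.map_vsub,
    LinearIsometryEquiv.inner_map_map] at h2
  simp only [vsub_eq_sub] at h2
  linarith

/-- The area grows at the rate `l ⟨n, y⟩` when the edge `P Q` deviates by `y`; in terms of the
third vertex, the normal `n` is proportional to the altitude. -/
theorem inner_outerNormal {P Q O y : E4} (hy : inner ℝ y (Q - P) = 0) :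
    inner ℝ (outerNormal P Q O) y =
      -(‖Q - P‖ ^ 2 / (2 * triangleArea P Q O)) * inner ℝ (O - P) y := by
  have hp : perp (P - O) (Q - P) = -perp (O - P) (Q - P) := by
    rw [perp, perp, ← neg_sub O P, inner_neg_left, neg_div, neg_smul]
    abel
  have hy' : inner ℝ (Q - P) y = 0 := by rw [real_inner_comm, hy]
  have hi : inner ℝ (perp (O - P) (Q - P)) y = inner ℝ (O - P) y := by
    rw [perp, inner_sub_left, inner_smul_left, hy', mul_zero, sub_zero]
  rw [outerNormal, hp, norm_neg, inner_smul_left, inner_neg_left, hi, triangleArea]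
  simp only [conj_trivial]
  -- For a degenerate triangle both sides are zero, since division by zero gives zero.
  by_cases h : ‖Q - P‖ = 0
  · rw [h]; simp
  · by_cases h' : ‖perp (O - P) (Q - P)‖ = 0
    · rw [h']; simp
    · field_simp

/-- Three orthonormal vectors orthogonal to a nonzero vector span its orthogonal
complement. -/
theorem sum_inner_smul_of_orthonormal {w : Fin 3 → E4} {l y : E4} (hw : Orthonormal ℝ w)
    (hwl : ∀ k, inner ℝ (w k) l = 0) (hl : l ≠ 0) (hy : inner ℝ y l = 0) :
    ∑ k, inner ℝ (w k) y • w k = y := by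
  have hn : ‖l‖ ≠ 0 := norm_ne_zero_iff.2 hl
  have ho : Orthonormal ℝ (Fin.cons (‖l‖⁻¹ • l) w : Fin 4 → E4) := by
    rw [orthonormal_iff_ite] at hw ⊢
    intro i j
    refine Fin.cases ?_ (fun i => ?_) i <;> refine Fin.cases ?_ (fun j => ?_) j
    · simp only [Fin.cons_zero, inner_smul_left, inner_smul_right, real_inner_self_eq_norm_sq,
        conj_trivial, if_true]
      field_simp
    · simp only [Fin.cons_zero, Fin.cons_succ, inner_smul_left,
        real_inner_comm (w j) l, hwl, mul_zero]
      rw [if_neg (Fin.succ_ne_zero j).symm]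
    · simp only [Fin.cons_zero, Fin.cons_succ, inner_smul_right, hwl, mul_zero]
      rw [if_neg (Fin.succ_ne_zero i)]
    · simp only [Fin.cons_succ, hw, Fin.succ_inj]
  have hcard : Fintype.card (Fin 4) = Module.finrank ℝ E4 := by simp
  have hsp : ⊤ ≤ Submodule.span ℝ (Set.range (Fin.cons (‖l‖⁻¹ • l) w : Fin 4 → E4)) :=
    (ho.linearIndependent.span_eq_top_of_card_eq_finrank' hcard).ge
  have h := (OrthonormalBasis.mk ho hsp).sum_repr' y
  rw [OrthonormalBasis.coe_mk, Fin.sum_univ_succ] at h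
  simp only [Fin.cons_zero, Fin.cons_succ] at h
  rw [inner_smul_left, real_inner_comm, hy, mul_zero, zero_smul, zero_add] at h
  exact h

theorem inner_mulVec_of_skew {A : Matrix (Fin 4) (Fin 4) ℝ} (hA : Aᵀ = -A) (x : Fin 4 → ℝ) :
    x ⬝ᵥ (A *ᵥ x) = 0 := by
  have h : x ⬝ᵥ (A *ᵥ x) = -(x ⬝ᵥ (A *ᵥ x)) := by
    conv_lhs => rw [Matrix.dotProduct_mulVec, ← Matrix.mulVec_transpose, hA, Matrix.neg_mulVec,
      neg_dotProduct, dotProduct_comm]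
  linarith

theorem affineField_sub (Y : Matrix (Fin 4) (Fin 4) ℝ × E4) (p p' : E4) :
    affineField Y p - affineField Y p' = WithLp.toLp 2 (Y.1 *ᵥ (p - p').ofLp) := by
  simp only [affineField, WithLp.ofLp_sub, Matrix.mulVec_sub, WithLp.toLp_sub]
  abel

theorem inner_affineField_sub {Y : Matrix (Fin 4) (Fin 4) ℝ × E4} (hY : Y.1ᵀ = -Y.1)
    (p p' : E4) : inner ℝ (p - p') (affineField Y p - affineField Y p') = 0 := by
  rw [affineField_sub, inner_eq_dotProduct]
  exact inner_mulVec_of_skew hY _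

theorem rot_mulVec (g : E4 ≃ᵃⁱ[ℝ] E4) (x : E4) :
    rot g *ᵥ x.ofLp = (g.linearIsometryEquiv x).ofLp := by
  conv_rhs => rw [← (EuclideanSpace.basisFun (Fin 4) ℝ).sum_repr x]
  ext α
  simp [rot, Matrix.mulVec, dotProduct, mul_comm]

theorem rot_transpose_mul_self (g : E4 ≃ᵃⁱ[ℝ] E4) : (rot g)ᵀ * rot g = 1 := by
  ext α β
  have h := g.linearIsometryEquiv.inner_map_map (EuclideanSpace.single α 1)
    (EuclideanSpace.single β 1)
  rw [inner_eq_dotProduct] at h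
  have : ((rot g)ᵀ * rot g) α β = (g.linearIsometryEquiv (EuclideanSpace.single α 1)).ofLp ⬝ᵥ
      (g.linearIsometryEquiv (EuclideanSpace.single β 1)).ofLp := rfl
  rw [this, h, EuclideanSpace.inner_single_left, Matrix.one_apply]
  simp

/-- Conjugating a bilinear form by a rotation amounts to rotating its arguments. -/
theorem dotProduct_conj_mulVec (g : E4 ≃ᵃⁱ[ℝ] E4) (A : Matrix (Fin 4) (Fin 4) ℝ) (x y : E4) :
    (g.linearIsometryEquiv x).ofLp ⬝ᵥ
      ((rot g * A * (rot g)ᵀ) *ᵥ (g.linearIsometryEquiv y).ofLp) =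
      x.ofLp ⬝ᵥ (A *ᵥ y.ofLp) := by
  rw [← rot_mulVec, ← rot_mulVec, Matrix.mulVec_mulVec, Matrix.mul_assoc, Matrix.mul_assoc,
    rot_transpose_mul_self, Matrix.mul_one, ← Matrix.mulVec_mulVec, Matrix.dotProduct_mulVec,
    ← Matrix.mulVec_transpose, Matrix.mulVec_mulVec, rot_transpose_mul_self, Matrix.one_mulVec]

theorem conj_transpose_skew {A : Matrix (Fin 4) (Fin 4) ℝ} (hA : Aᵀ = -A)
    (g : Matrix (Fin 4) (Fin 4) ℝ) : (g * A * gᵀ)ᵀ = -(g * A * gᵀ) := by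
  rw [Matrix.transpose_mul, Matrix.transpose_mul, Matrix.transpose_transpose, hA,
    Matrix.neg_mul, Matrix.mul_neg, Matrix.mul_assoc]

theorem basisBivector_skew (c : Triangulation4.Pair) :
    (Triangulation4.basisBivector c)ᵀ = -Triangulation4.basisBivector c := by
  rw [Triangulation4.basisBivector, Matrix.transpose_sub, Matrix.transpose_single,
    Matrix.transpose_single, neg_sub]

theorem sum_smul_basisBivector {A : Matrix (Fin 4) (Fin 4) ℝ} (hA : Aᵀ = -A) :
    ∑ c : Triangulation4.Pair, A c.1.1 c.1.2 • Triangulation4.basisBivector c = A := by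
  have hs : ∀ i j, A j i = -A i j := fun i j => congrFun (congrFun hA i) j
  have h0 : ∀ i, A i i = 0 := fun i => by linarith [hs i i]
  ext i j
  rw [Matrix.sum_apply]
  simp only [Matrix.smul_apply, Triangulation4.basisBivector, Matrix.sub_apply,
    Matrix.single_apply, smul_eq_mul]
  rcases lt_trichotomy i j with h | h | h
  · rw [Finset.sum_eq_single (⟨(i, j), h⟩ : Triangulation4.Pair)]
    · simp [h.ne']
    · rintro ⟨⟨k, l⟩, hkl⟩ _ hne
      have h1 : ¬(k = i ∧ l = j) := by rintro ⟨rfl, rfl⟩; exact hne rfl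
      have h2 : ¬(l = i ∧ k = j) := by rintro ⟨rfl, rfl⟩; exact absurd hkl h.asymm
      simp [h1, h2]
    · simp
  · subst h
    rw [h0]
    refine Finset.sum_eq_zero ?_
    rintro ⟨⟨k, l⟩, hkl⟩ _
    simp [and_comm]
  · rw [Finset.sum_eq_single (⟨(j, i), h⟩ : Triangulation4.Pair)]
    · simp [h.ne', hs j i]
    · rintro ⟨⟨k, l⟩, hkl⟩ _ hne
      have h1 : ¬(l = i ∧ k = j) := by rintro ⟨rfl, rfl⟩; exact hne rfl
      have h2 : ¬(k = i ∧ l = j) := by rintro ⟨rfl, rfl⟩; exact absurd hkl h.asymm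
      simp [h1, h2]
    · simp

theorem rot_mul (g h : E4 ≃ᵃⁱ[ℝ] E4) : rot (g * h) = rot g * rot h := by
  refine Matrix.ext_of_mulVec_single fun α => ?_
  rw [← Matrix.mulVec_mulVec, show (Pi.single α 1 : Fin 4 → ℝ) =
    (EuclideanSpace.single α 1 : E4).ofLp from rfl, rot_mulVec, rot_mulVec, rot_mulVec]
  rfl

theorem leviCivita_comp_swap (i j : Fin 4) (hij : i ≠ j) (v w : Fin 4 → Fin 4)
    (h : w = v ∘ Equiv.swap i j) :
    leviCivita (w 0) (w 1) (w 2) (w 3) = -leviCivita (v 0) (v 1) (v 2) (v 3) := by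
  have hv : ∀ v : Fin 4 → Fin 4, ![v 0, v 1, v 2, v 3] = v := fun v => by
    ext1 i; fin_cases i <;> rfl
  have := Matrix.det_permute (Equiv.swap i j)
    (Matrix.of fun i j : Fin 4 => if v i = j then (1 : ℝ) else 0)
  rw [Equiv.Perm.sign_swap hij] at this
  simp only [leviCivita, hv, h]
  simpa [Matrix.submatrix] using this

theorem leviCivita_swap₀₁ (α β γ δ : Fin 4) :
    leviCivita β α γ δ = -leviCivita α β γ δ :=
  leviCivita_comp_swap 0 1 (by decide) ![α, β, γ, δ] ![β, α, γ, δ] (by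
    ext1 i; fin_cases i <;> rfl)

theorem leviCivita_swap₀₂ (α β γ δ : Fin 4) :
    leviCivita γ β α δ = -leviCivita α β γ δ :=
  leviCivita_comp_swap 0 2 (by decide) ![α, β, γ, δ] ![γ, β, α, δ] (by
    ext1 i; fin_cases i <;> rfl)

theorem dotProduct_mulVec_comm_of_skew {A : Matrix (Fin 4) (Fin 4) ℝ} (hA : Aᵀ = -A)
    (x y : Fin 4 → ℝ) : x ⬝ᵥ (A *ᵥ y) = -(y ⬝ᵥ (A *ᵥ x)) := by
  rw [Matrix.dotProduct_mulVec, ← Matrix.mulVec_transpose, hA, Matrix.neg_mulVec,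
    neg_dotProduct, dotProduct_comm]

/-- The difference of a trivial deviation at two points is the dual of a bivector that contains the
direction from one to the other. -/
theorem vecMul_trivialDeviation_sub (Y : Matrix (Fin 4) (Fin 4) ℝ × E4) (p p' : E4) :
    (p' - p).ofLp ᵥ* (trivialDeviation Y p - trivialDeviation Y p') = 0 := by
  ext β
  have h : ∀ α, (trivialDeviation Y p - trivialDeviation Y p') α β =
      -∑ γ, ∑ δ, leviCivita α β γ δ * (p' - p) γ * Y.2 δ := by
    intro α
    simp only [trivialDeviation, Matrix.sub_apply, Matrix.of_apply, add_sub_add_left_eq_sub,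
      ← Finset.sum_sub_distrib, ← Finset.sum_neg_distrib]
    refine Finset.sum_congr rfl fun γ _ => Finset.sum_congr rfl fun δ _ => ?_
    rw [PiLp.sub_apply]
    ring
  simp only [Matrix.vecMul, dotProduct, h, Pi.zero_apply]
  have h2 : ∑ α, (p' - p) α * -∑ γ, ∑ δ, leviCivita α β γ δ * (p' - p) γ * Y.2 δ =
      -∑ α, (p' - p) α * -∑ γ, ∑ δ, leviCivita α β γ δ * (p' - p) γ * Y.2 δ := by
    simp only [mul_neg, Finset.sum_neg_distrib, neg_neg, Finset.mul_sum]
    conv_rhs => rw [Finset.sum_comm]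
    rw [← Finset.sum_neg_distrib]
    refine Finset.sum_congr rfl fun α _ => ?_
    rw [← Finset.sum_neg_distrib]
    refine Finset.sum_congr rfl fun γ _ => ?_
    rw [← Finset.sum_neg_distrib]
    refine Finset.sum_congr rfl fun δ _ => ?_
    rw [leviCivita_swap₀₂ α β γ δ]
    ring
  linarith

namespace Triangulation4

variable {Γ : Type*} [Group Γ] {V T J : Type*} [LinearOrder V]
variable (R : Representation4 Γ J) (X : Triangulation4 Γ V T)

theorem isLinearMap_dL_left [Fintype J] (e : X.Edge) :
    IsLinearMap ℝ fun dx : V → E4 => X.dL R dx 0 e := by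
  constructor
  · intro x y
    simp only [dL, Pi.add_apply, map_add, Pi.zero_apply, zero_smul, Finset.sum_const_zero,
      add_zero, inner_sub_right, inner_add_right]
    ring
  · intro c x
    simp only [dL, Pi.smul_apply, map_smul, Pi.zero_apply, zero_smul, Finset.sum_const_zero,
      add_zero, inner_sub_right, inner_smul_right, smul_eq_mul]
    ring

theorem isLinearMap_dS (f : X.Face) : IsLinearMap ℝ fun y : X.Edge → E4 => X.dS R y f := by
  constructor
  · intro x y
    simp only [dS, Pi.add_apply, map_add, inner_add_right]
    ring
  · intro c x
    simp only [dS, Pi.smul_apply, map_smul, inner_smul_right, smul_eq_mul]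
    ring

theorem isLinearMap_inner_dv (y : E4) (e : X.Edge) :
    IsLinearMap ℝ fun σ : V → Matrix (Fin 4) (Fin 4) ℝ => inner ℝ y (X.dv R σ e) := by
  constructor
  · intro σ σ'
    simp only [dv, inner_smul_right, inner_eq_dotProduct, Pi.add_apply, Matrix.mul_add,
      Matrix.add_mul, Matrix.vecMul_sub, Matrix.vecMul_add, dotProduct_sub, dotProduct_add]
    ring
  · intro c σ
    simp only [dv, inner_smul_right, inner_eq_dotProduct, Pi.smul_apply, Matrix.mul_smul,
      Matrix.smul_mul, Matrix.vecMul_sub, Matrix.vecMul_smul, dotProduct_sub, dotProduct_smul,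
      smul_eq_mul]
    ring

theorem inner_dv (σ : V → Matrix (Fin 4) (Fin 4) ℝ) (e : X.Edge) (y : E4) :
    inner ℝ y (X.dv R σ e) = 1 / X.sqLength R e *
      ((X.edgeVec R e.1.1 e.1.2).ofLp ⬝ᵥ ((σ e.1.1 -
        rot (R.ρ (X.hol e.1.1 e.1.2)) * σ e.1.2 * (rot (R.ρ (X.hol e.1.1 e.1.2)))ᵀ) *ᵥ
          y.ofLp)) := by
  rw [dv, inner_smul_right, real_inner_comm, inner_eq_dotProduct, ← Matrix.dotProduct_mulVec]

theorem inner_dv_edgeVec {σ : V → Matrix (Fin 4) (Fin 4) ℝ} (hσ : ∀ v, (σ v)ᵀ = -σ v)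
    (e : X.Edge) : inner ℝ (X.dv R σ e) (X.edgeVec R e.1.1 e.1.2) = 0 := by
  rw [real_inner_comm, inner_dv, inner_mulVec_of_skew, mul_zero]
  rw [Matrix.transpose_sub, conj_transpose_skew (hσ _), hσ]
  abel

theorem place_sub_place (u v w : V) :
    X.lin R u v (X.edgeVec R v w) = R.ρ (X.hol u v) (X.place R v w) - X.place R u v := by
  rw [edgeVec, lin_sub, place]
  rfl

section Common

variable {X} {t : T} {u v w : V} (hu : u ∈ Set.range (X.vert t)) (hv : v ∈ Set.range (X.vert t))
  (hw : w ∈ Set.range (X.vert t))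

include hu

theorem place_self_of_mem : X.place R u u = X.coord u := by
  obtain ⟨i, rfl⟩ := hu
  rw [place, hol_self, map_one]
  rfl

theorem edgeVec_self_of_mem : X.edgeVec R u u = 0 := by
  rw [edgeVec, place_self_of_mem R hu, sub_self]

include hv hw

theorem motion_place_of_mem :
    R.ρ (X.hol u v) (X.place R v w) = X.place R u w := by
  obtain ⟨i, rfl⟩ := hu
  obtain ⟨j, rfl⟩ := hv
  obtain ⟨k, rfl⟩ := hw
  rw [place, place, ← X.hol_mul t i j k, map_mul]
  rfl

theorem lin_edgeVec_of_mem :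
    X.lin R u v (X.edgeVec R v w) = X.edgeVec R u w - X.edgeVec R u v := by
  rw [place_sub_place, motion_place_of_mem R hu hv hw, edgeVec, edgeVec]
  abel

end Common

theorem hol_mul_of_mem {X : Triangulation4 Γ V T} {t : T} {u v w : V}
    (hu : u ∈ Set.range (X.vert t)) (hv : v ∈ Set.range (X.vert t))
    (hw : w ∈ Set.range (X.vert t)) : X.hol u v * X.hol v w = X.hol u w := by
  obtain ⟨i, rfl⟩ := hu
  obtain ⟨j, rfl⟩ := hv
  obtain ⟨k, rfl⟩ := hw
  exact X.hol_mul t i j k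

theorem lin_edgeVec_swap {X : Triangulation4 Γ V T} {t : T} {u v : V}
    (hu : u ∈ Set.range (X.vert t)) (hv : v ∈ Set.range (X.vert t)) :
    X.lin R u v (X.edgeVec R v u) = -X.edgeVec R u v := by
  rw [lin_edgeVec_of_mem R hu hv hu, edgeVec_self_of_mem R hu, zero_sub]

theorem area_eq_of_mem {X : Triangulation4 Γ V T} (f : X.Face) :
    triangleArea (X.place R f.1.1 f.1.2.1) (X.place R f.1.1 f.1.2.2) (X.coord f.1.1) =
      X.area R f :=
  triangleArea_rotate _ _ _

theorem area_eq_of_swap {X : Triangulation4 Γ V T} (f : X.Face) :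
    triangleArea (X.coord f.1.1) (X.place R f.1.1 f.1.2.2) (X.place R f.1.1 f.1.2.1) =
      X.area R f :=
  triangleArea_swap _ _ _

/-- The derivative of an area with respect to the deviation of an edge, in terms of the vertex
opposite to this edge. -/
theorem dS_single {e : X.Edge} {x : E4} (hx : inner ℝ x (X.edgeVec R e.1.1 e.1.2) = 0)
    (f : X.Face) :
    X.dS R (Pi.single e x) f = -(X.sqLength R e / (2 * X.area R f)) *
      ((if f.edge₀₁ = e then inner ℝ (X.edgeVec R e.1.1 f.1.2.2) x else 0) +
       (if f.edge₀₂ = e then inner ℝ (X.edgeVec R e.1.1 f.1.2.1) x else 0) +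
       (if f.edge₁₂ = e then inner ℝ (X.edgeVec R e.1.1 f.1.1) x else 0)) := by
  have hs : ∀ e' : X.Edge, (Pi.single e x : X.Edge → E4) e' = if e' = e then x else 0 :=
    fun e' => Pi.single_apply _ _ _
  obtain ⟨t, h0, h1, h2⟩ := f.2.2.2
  simp only [dS, hs]
  rw [mul_add, mul_add]
  refine congrArg₂ _ (congrArg₂ _ ?_ ?_) ?_
  · by_cases h : f.edge₀₁ = e
    · subst h
      rw [if_pos rfl, if_pos rfl]
      exact inner_outerNormal hx
    · rw [if_neg h, if_neg h, inner_zero_right, mul_zero]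
  · by_cases h : f.edge₀₂ = e
    · subst h
      rw [if_pos rfl, if_pos rfl]
      rw [← area_eq_of_swap]
      exact inner_outerNormal hx
    · rw [if_neg h, if_neg h, inner_zero_right, mul_zero]
  · by_cases h : f.edge₁₂ = e
    · subst h
      have e1 : X.place R f.1.1 f.1.2.2 - X.place R f.1.1 f.1.2.1 =
          X.lin R f.1.1 f.1.2.1 (X.edgeVec R f.1.2.1 f.1.2.2) := by
        rw [place_sub_place, motion_place_of_mem R h0 h1 h2]
      have e2 : X.coord f.1.1 - X.place R f.1.1 f.1.2.1 =
          X.lin R f.1.1 f.1.2.1 (X.edgeVec R f.1.2.1 f.1.1) := by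
        rw [lin_edgeVec_swap R h0 h1, edgeVec, neg_sub]
      rw [if_pos rfl, if_pos rfl]
      change inner ℝ _ (X.lin R f.1.1 f.1.2.1 x) = _
      rw [inner_outerNormal, area_eq_of_mem, e1, e2, LinearIsometryEquiv.inner_map_map,
        LinearIsometryEquiv.norm_map]
      · rfl
      · rw [e1, LinearIsometryEquiv.inner_map_map]
        exact hx
    · rw [if_neg h, if_neg h, map_zero, inner_zero_right, mul_zero]

section Compositions

variable [Fintype V] [Fintype T] [Fintype J] {ι₀ ι₆ : Type*} [Fintype ι₀] [Fintype ι₆]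
  (a : Module.Basis ι₀ ℝ R.motions) (s : Module.Basis ι₆ ℝ R.trivialDeviations)

/-- Infinitesimal motions do not change the lengths. -/
theorem matrix₁_mul_matrix₀ : X.matrix₁ R * X.matrix₀ R a = 0 := by
  ext e i
  rw [Matrix.mul_apply, Fintype.sum_sum_type]
  simp only [matrix₁, matrix₀, Matrix.of_apply, Sum.elim_inl, Sum.elim_inr, mul_zero,
    Finset.sum_const_zero, add_zero, Matrix.zero_apply]
  rw [sum_apply_single_mul (X.isLinearMap_dL_left R e) (fun _ α => EuclideanSpace.single α 1)
    fun p : V × Fin 4 => affineField (a i).1 (X.coord p.1) p.2]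
  have h : (fun v => ∑ α : Fin 4, affineField (a i).1 (X.coord v) α •
      (EuclideanSpace.single α 1 : E4)) = fun v => affineField (a i).1 (X.coord v) := by
    ext1 v
    have := (EuclideanSpace.basisFun (Fin 4) ℝ).sum_repr (affineField (a i).1 (X.coord v))
    simpa using this
  rw [h, dL, ← (a i).2.2]
  simp only [Pi.zero_apply, zero_smul, Finset.sum_const_zero, add_zero]
  rw [edgeVec, place, inner_affineField_sub (a i).2.1, mul_zero]

/-- The areas do not change, to first order, under the deviations of edges that come from
deviations of vertices. -/
theorem areaMatrix_mul_deviationMatrix (hX : X.IsNondegenerate R) {fr : X.Edge → Fin 3 → E4}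
    (hfr : X.IsFraming R fr) : X.areaMatrix R fr * X.deviationMatrix R fr = 0 := by
  ext f c
  rw [Matrix.mul_apply, Matrix.zero_apply]
  simp only [areaMatrix, deviationMatrix, Matrix.of_apply]
  set σ : V → Matrix (Fin 4) (Fin 4) ℝ := Pi.single c.1 (basisBivector c.2) with hσ
  have hskew : ∀ v, (σ v)ᵀ = -σ v := by
    intro v
    rw [hσ]
    by_cases h : v = c.1
    · subst h; rw [Pi.single_eq_same, basisBivector_skew]
    · rw [Pi.single_eq_of_ne h, Matrix.transpose_zero, neg_zero]
  have hy := fun e => X.inner_dv_edgeVec R hskew e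
  rw [sum_apply_single_mul (X.isLinearMap_dS R f) fr
    fun p : X.Edge × Fin 3 => inner ℝ (fr p.1 p.2) (X.dv R σ p.1)]
  simp only [sum_inner_smul_of_orthonormal (hfr _).1 (hfr _).2 (X.edgeVec_ne_zero R hX _) (hy _)]
  clear_value σ
  have hsum : ∀ y : X.Edge → E4, X.dS R y f = X.dS R (Pi.single f.edge₀₁ (y f.edge₀₁)) f +
      X.dS R (Pi.single f.edge₀₂ (y f.edge₀₂)) f + X.dS R (Pi.single f.edge₁₂ (y f.edge₁₂)) f := by
    have h1 : f.edge₀₁ ≠ f.edge₀₂ := fun h =>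
      f.2.2.1.ne (congrArg (fun e : X.Edge => e.1.2) h)
    have h2 : f.edge₀₁ ≠ f.edge₁₂ := fun h => f.2.1.ne (congrArg (fun e : X.Edge => e.1.1) h)
    have h3 : f.edge₀₂ ≠ f.edge₁₂ := fun h => f.2.1.ne (congrArg (fun e : X.Edge => e.1.1) h)
    intro y
    simp only [dS, Pi.single_apply, h1, h2, h3, h1.symm, h2.symm, h3.symm, if_true, if_false,
      inner_zero_right, map_zero]
    ring
  have hL : ∀ e, X.sqLength R e ≠ 0 := fun e =>
    pow_ne_zero 2 (norm_ne_zero_iff.2 (X.edgeVec_ne_zero R hX e))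
  rw [hsum, dS_single R X (hy _), dS_single R X (hy _), dS_single R X (hy _)]
  have h1 : f.edge₀₁ ≠ f.edge₀₂ := fun h =>
    f.2.2.1.ne (congrArg (fun e : X.Edge => e.1.2) h)
  have h2 : f.edge₀₁ ≠ f.edge₁₂ := fun h => f.2.1.ne (congrArg (fun e : X.Edge => e.1.1) h)
  have h3 : f.edge₀₂ ≠ f.edge₁₂ := fun h => f.2.1.ne (congrArg (fun e : X.Edge => e.1.1) h)
  simp only [h1, h2, h3, h1.symm, h2.symm, h3.symm, if_true, if_false, add_zero, zero_add,
    inner_dv]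
  obtain ⟨t, h0, h1, h2⟩ := f.2.2.2
  -- The term of the edge that does not issue from the first vertex, in the coordinate system of the
  -- first vertex.
  have hlin : X.edgeVec R f.1.2.1 f.1.2.2 ⬝ᵥ ((σ f.1.2.1 -
      rot (R.ρ (X.hol f.1.2.1 f.1.2.2)) * σ f.1.2.2 * (rot (R.ρ (X.hol f.1.2.1 f.1.2.2)))ᵀ) *ᵥ
        (X.edgeVec R f.1.2.1 f.1.1).ofLp) =
      (X.edgeVec R f.1.1 f.1.2.2 - X.edgeVec R f.1.1 f.1.2.1) ⬝ᵥ
      ((rot (R.ρ (X.hol f.1.1 f.1.2.1)) * σ f.1.2.1 * (rot (R.ρ (X.hol f.1.1 f.1.2.1)))ᵀ -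
        rot (R.ρ (X.hol f.1.1 f.1.2.2)) * σ f.1.2.2 * (rot (R.ρ (X.hol f.1.1 f.1.2.2)))ᵀ) *ᵥ
        (-X.edgeVec R f.1.1 f.1.2.1)) := by
    rw [← dotProduct_conj_mulVec (R.ρ (X.hol f.1.1 f.1.2.1))]
    change (X.lin R _ _ _).ofLp ⬝ᵥ (_ *ᵥ (X.lin R _ _ _).ofLp) = _
    rw [lin_edgeVec_of_mem R h0 h1 h2, lin_edgeVec_swap R h0 h1, Matrix.mul_sub, Matrix.sub_mul,
      ← hol_mul_of_mem h0 h1 h2, map_mul, rot_mul, Matrix.transpose_mul]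
    simp only [Matrix.mul_assoc]
    rfl
  have hA := hskew f.1.1
  have hB := conj_transpose_skew (hskew f.1.2.1) (rot (R.ρ (X.hol f.1.1 f.1.2.1)))
  have hC := conj_transpose_skew (hskew f.1.2.2) (rot (R.ρ (X.hol f.1.1 f.1.2.2)))
  have hcancel : ∀ L S z : ℝ, L ≠ 0 → -(L / (2 * S)) * (1 / L * z) = -(1 / (2 * S)) * z := by
    intro L S z h
    field_simp
  rw [hcancel _ _ _ (hL _), hcancel _ _ _ (hL _), hcancel _ _ _ (hL _)]
  simp only [Face.edge₀₁, Face.edge₀₂, Face.edge₁₂, hlin]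
  rw [← mul_add, ← mul_add]
  refine mul_eq_zero_of_right _ ?_
  generalize rot (R.ρ (X.hol f.1.1 f.1.2.1)) * σ f.1.2.1 * (rot (R.ρ (X.hol f.1.1 f.1.2.1)))ᵀ
    = B at *
  generalize rot (R.ρ (X.hol f.1.1 f.1.2.2)) * σ f.1.2.2 * (rot (R.ρ (X.hol f.1.1 f.1.2.2)))ᵀ
    = C at *
  generalize σ f.1.1 = A at *
  generalize X.edgeVec R f.1.1 f.1.2.1 = x
  generalize X.edgeVec R f.1.1 f.1.2.2 = y
  -- As the bivectors are antisymmetric, the terms of each of the three vertices cancel.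
  have hAxy := dotProduct_mulVec_comm_of_skew hA x.ofLp y.ofLp
  have hBxy := dotProduct_mulVec_comm_of_skew hB x.ofLp y.ofLp
  have hCxy := dotProduct_mulVec_comm_of_skew hC x.ofLp y.ofLp
  have hBx := inner_mulVec_of_skew hB x.ofLp
  have hCx := inner_mulVec_of_skew hC x.ofLp
  simp only [Matrix.sub_mulVec, dotProduct_sub, WithLp.ofLp_sub, sub_dotProduct,
    Matrix.mulVec_neg, dotProduct_neg]
  linarith

/-- A trivial deviation differs at the ends of an edge by a bivector orthogonal to it. -/
theorem deviationMatrix_mul_trivialMatrix (fr : X.Edge → Fin 3 → E4) :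
    X.deviationMatrix R fr * X.trivialMatrix R s = 0 := by
  ext ⟨e, k⟩ i
  rw [Matrix.mul_apply, Matrix.zero_apply]
  simp only [trivialMatrix, deviationMatrix, Matrix.of_apply]
  rw [sum_apply_single_mul (X.isLinearMap_inner_dv R (fr e k) e) (fun _ c => basisBivector c)
    fun p : V × Pair => trivialDeviation (s i).1 (X.coord p.1) p.2.1.1 p.2.1.2]
  have hs : ∀ p, (trivialDeviation (s i).1 p)ᵀ = -trivialDeviation (s i).1 p := by
    intro p
    have h1 : ∀ α β, (s i).1.1 β α = -(s i).1.1 α β := fun α β =>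
      congrFun (congrFun (s i).2.1 α) β
    ext α β
    simp only [trivialDeviation, Matrix.transpose_apply, Matrix.neg_apply, Matrix.of_apply,
      h1 α β, leviCivita_swap₀₁ α β, neg_mul, Finset.sum_neg_distrib, neg_add]
  simp only [sum_smul_basisBivector (hs _)]
  rw [inner_dv, ← (s i).2.2]
  change _ * (_ ⬝ᵥ ((_ - trivialDeviation (s i).1 (X.place R e.1.1 e.1.2)) *ᵥ _)) = 0
  rw [Matrix.dotProduct_mulVec, edgeVec, vecMul_trivialDeviation_sub, zero_dotProduct, mul_zero]

end Compositions

end Triangulation4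

/-! ### The affine dependence of the six vertices -/

theorem sum_extend_mul {ι κ : Type*} [Fintype ι] [Fintype κ] {f : ι → κ}
    (hf : Function.Injective f) (g : ι → ℝ) (H : κ → ℝ) :
    ∑ v, Function.extend f g 0 v * H v = ∑ o, g o * H (f o) := by
  refine (Finset.sum_of_injOn f hf.injOn (by simp) ?_ ?_).symm
  · intro v _ hv
    rw [Function.extend_apply' _ _ _ (by simpa using hv)]
    simp
  · intro o _
    rw [hf.extend_apply]

/-- The differential of `∑ l o * l o' * ‖P o' - P o‖²`, for constant `l`, along the displacement `y`
of the points is zero. -/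
theorem sum_mul_inner_sub {ι : Type*} [Fintype ι] {l : ι → ℝ} {P : ι → E4} (y : ι → E4)
    (hl : ∑ o, l o = 0) (hP : ∑ o, l o • P o = 0) :
    ∑ o, l o * ∑ o', l o' * inner ℝ (P o' - P o) (y o' - y o) = 0 := by
  have h : ∀ o, ∑ o', l o' * inner ℝ (P o' - P o) (y o' - y o) =
      ∑ o', l o' * inner ℝ (P o') (y o') - inner ℝ (P o) (∑ o', l o' • y o') := by
    intro o
    have h1 : ∑ o', l o' * inner ℝ (P o') (y o) = 0 := by
      rw [← inner_zero_left (𝕜 := ℝ) (y o), ← hP, sum_inner]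
      exact Finset.sum_congr rfl fun _ _ => (real_inner_smul_left _ _ _).symm
    have h2 : ∑ o', l o' * inner ℝ (P o) (y o) = 0 := by
      rw [← Finset.sum_mul, hl, zero_mul]
    simp only [inner_sub_left, inner_sub_right, mul_sub, Finset.sum_sub_distrib, h1, h2,
      inner_sum, inner_smul_right]
    ring
  simp only [h, mul_sub, Finset.sum_sub_distrib]
  rw [← Finset.sum_mul, hl, zero_mul, zero_sub, neg_eq_zero]
  rw [← inner_zero_left (𝕜 := ℝ) (∑ o', l o' • y o'), ← hP, sum_inner]
  exact Finset.sum_congr rfl fun _ _ => (real_inner_smul_left _ _ _).symm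

namespace Triangulation4

variable {Γ : Type*} [Group Γ] {V T J : Type*} [LinearOrder V]
variable (R : Representation4 Γ J) (X : Triangulation4 Γ V T) (t₀ : T) (q : E4)

/-- The coefficients of the affine dependence of the vertices of `t₀` and of the new vertex,
extended by zero to the other vertices. -/
noncomputable def moveCoeff : WithTop V → ℝ :=
  Function.extend (X.sixVertex t₀) (depCoeff (X.simplexPlace R t₀) q) 0

theorem moveCoeff_sixVertex (o : Option (Fin 5)) :
    X.moveCoeff R t₀ q (X.sixVertex t₀ o) = depCoeff (X.simplexPlace R t₀) q o :=
  (X.sixVertex_injective t₀).extend_apply _ _ _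

theorem exists_sixVertex_of_moveCoeff_ne_zero {v : WithTop V} (h : X.moveCoeff R t₀ q v ≠ 0) :
    ∃ o, X.sixVertex t₀ o = v := by
  by_contra hv
  exact h (Function.extend_apply' _ _ _ hv)

theorem sixVertex_mem_range {o : Option (Fin 5)} {k : Fin 5} (h : o ≠ some k) :
    X.sixVertex t₀ o ∈ Set.range ((X.move t₀ q).vert (Sum.inr k)) := by
  obtain ⟨i, hi⟩ := exists_simplexLabel_eq h
  exact ⟨i, by rw [move_vert_inr, Function.comp_apply, hi]⟩

/-- Any three of the six labels belong to one of the five new simplices. -/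
theorem exists_ne_three (o o' o'' : Option (Fin 5)) :
    ∃ k : Fin 5, o ≠ some k ∧ o' ≠ some k ∧ o'' ≠ some k := by
  revert o o' o''; decide

/-- The coefficients are ratios of volumes of nondegenerate simplices. -/
theorem moveCoeff_ne_zero (hX : X.IsNondegenerate R) (hX' : (X.move t₀ q).IsNondegenerate R)
    (o : Option (Fin 5)) : depCoeff (X.simplexPlace R t₀) q o ≠ 0 := by
  rcases o with _ | k
  · simp [depCoeff]
  · have h := abs_ne_zero.1 (hX' (Sum.inr k))
    rw [move_simplexPlace_inr, sixPoint_comp_some,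
      signedVolume_update q (abs_ne_zero.1 (hX t₀))] at h
    exact left_ne_zero_of_mul h

theorem sum_edge_eq [Fintype V] (F : V → V → ℝ) (hF : ∀ u v, F u v ≠ 0 →
      ∃ t, u ∈ Set.range (X.vert t) ∧ v ∈ Set.range (X.vert t)) :
    ∑ e : X.Edge, F e.1.1 e.1.2 = ∑ u, ∑ v, if u < v then F u v else 0 := by
  classical
  rw [← Fintype.sum_prod_type' (f := fun u v => if u < v then F u v else 0)]
  refine Finset.sum_of_injOn (fun e : X.Edge => e.1) (Subtype.val_injective.injOn) (by simp) ?_ ?_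
  · rintro ⟨u, v⟩ _ h
    by_contra hne
    obtain ⟨huv, h0⟩ := (ite_ne_right_iff (b := (0 : ℝ))).1 hne
    exact h ⟨⟨(u, v), huv, hF u v h0⟩, Finset.mem_coe.2 (Finset.mem_univ _), rfl⟩
  · intro e _
    exact (if_pos e.2.1).symm

theorem two_mul_sum_lt {V : Type*} [LinearOrder V] [Fintype V] (F : V → V → ℝ)
    (hs : ∀ u v, F u v = F v u) (h0 : ∀ u, F u u = 0) :
    2 * (∑ u, ∑ v, if u < v then F u v else 0) = ∑ u, ∑ v, F u v := by
  rw [two_mul]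
  conv_lhs =>
    rhs
    rw [Finset.sum_comm]
  simp only [← Finset.sum_add_distrib]
  refine Finset.sum_congr rfl fun u _ => Finset.sum_congr rfl fun v _ => ?_
  rcases lt_trichotomy u v with h | h | h
  · simp [h, h.asymm]
  · subst h; simp [h0]
  · simp [h, h.asymm, hs u v]

/-- The affine dependence of six points in four-space forces a linear relation on the
differentials of their mutual squared distances. -/
theorem sum_moveCoeff_mul_dL [Fintype V] [Fintype J] (hX : X.IsNondegenerate R)
    (dx : WithTop V → E4) (dg : J → ℝ) :
    ∑ e : (X.move t₀ q).Edge, X.moveCoeff R t₀ q e.1.1 * X.moveCoeff R t₀ q e.1.2 *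
      (X.move t₀ q).dL R dx dg e = 0 := by
  set X' := X.move t₀ q with hX'
  set c := X.moveCoeff R t₀ q
  let p := X.simplexPlace R t₀
  let P := sixPoint p q
  -- `y o` is the displacement of the vertex `o` in the coordinate system of the first vertex of
  -- `t₀`, and `G u v` is the differential of the squared distance of `u` and `v`.
  let h (o : Option (Fin 5)) : Γ := X.hol (X.vert t₀ 0) (X.vert t₀ (o.getD 0))
  let y (o : Option (Fin 5)) : E4 := (R.ρ (h o)).linearIsometryEquiv (dx (X.sixVertex t₀ o)) +
    ∑ j, dg j • affineField (R.dρ j (h o)) (P o)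
  let G (u v : WithTop V) : ℝ := 2 * inner ℝ (X'.edgeVec R u v)
    (X'.lin R u v (dx v) + ∑ j, dg j • affineField (R.dρ j (X'.hol u v)) (X'.place R u v) - dx u)
  have hG : ∀ o o', G (X.sixVertex t₀ o) (X.sixVertex t₀ o') =
      2 * inner ℝ (P o' - P o) (y o' - y o) := by
    intro o o'
    have hho : h o * X'.hol (X.sixVertex t₀ o) (X.sixVertex t₀ o') = h o' := by
      rw [hX', move_hol_sixVertex]
      exact X.hol_mul t₀ _ _ _
    have h1 : X.lin R (X.vert t₀ 0) (X.vert t₀ (o.getD 0))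
        (X'.edgeVec R (X.sixVertex t₀ o) (X.sixVertex t₀ o')) = P o' - P o :=
      X.lin_move_edgeVec R t₀ q o o'
    have h2 : X.lin R (X.vert t₀ 0) (X.vert t₀ (o.getD 0))
        (X'.lin R (X.sixVertex t₀ o) (X.sixVertex t₀ o') (dx (X.sixVertex t₀ o'))) =
        (R.ρ (h o')).linearIsometryEquiv (dx (X.sixVertex t₀ o')) := by
      rw [hX', move_lin_sixVertex, X.lin_lin R t₀ 0 (o.getD 0) (o'.getD 0)]
      rfl
    -- The cocycle identity for the deformations.
    have h3 : ∀ j, X.lin R (X.vert t₀ 0) (X.vert t₀ (o.getD 0))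
        (affineField (R.dρ j (X'.hol (X.sixVertex t₀ o) (X.sixVertex t₀ o')))
          (X'.place R (X.sixVertex t₀ o) (X.sixVertex t₀ o'))) =
        affineField (R.dρ j (h o')) (P o') - affineField (R.dρ j (h o)) (P o') := by
      intro j
      have h5 := R.dρ_mul j (h o) (X'.hol (X.sixVertex t₀ o) (X.sixVertex t₀ o'))
        (X'.place R (X.sixVertex t₀ o) (X.sixVertex t₀ o'))
      have h6 : R.ρ (h o) (X'.place R (X.sixVertex t₀ o) (X.sixVertex t₀ o')) = P o' :=
        X.motion_move_place R t₀ q o o'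
      rw [hho, h6] at h5
      rw [h5, add_sub_cancel_left]
      rfl
    -- The deformation of the transition to the vertex `o` is an infinitesimal motion of all the
    -- points, which does not change their distances.
    have h4 : inner ℝ (P o' - P o) (∑ j, dg j • (affineField (R.dρ j (h o)) (P o') -
        affineField (R.dρ j (h o)) (P o))) = 0 := by
      rw [inner_sum]
      refine Finset.sum_eq_zero fun j _ => ?_
      rw [inner_smul_right, inner_affineField_sub (R.dρ_skew j (h o)), mul_zero]
    simp only [G]
    rw [← (X.lin R (X.vert t₀ 0) (X.vert t₀ (o.getD 0))).inner_map_map, h1, map_sub, map_add, h2,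
      map_sum]
    simp only [map_smul, h3]
    have h7 : (R.ρ (h o')).linearIsometryEquiv (dx (X.sixVertex t₀ o')) +
        ∑ j, dg j • (affineField (R.dρ j (h o')) (P o') - affineField (R.dρ j (h o)) (P o')) -
        X.lin R (X.vert t₀ 0) (X.vert t₀ (o.getD 0)) (dx (X.sixVertex t₀ o)) =
        y o' - y o - ∑ j, dg j • (affineField (R.dρ j (h o)) (P o') -
          affineField (R.dρ j (h o)) (P o)) := by
      simp only [y, smul_sub, Finset.sum_sub_distrib]
      change _ - (R.ρ (h o)).linearIsometryEquiv _ = _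
      abel
    rw [h7, inner_sub_right, h4, sub_zero]
  have hrange : ∀ u v, c u * c v ≠ 0 → ∃ t, u ∈ Set.range (X'.vert t) ∧ v ∈ Set.range (X'.vert t) := by
    intro u v huv
    obtain ⟨o, rfl⟩ := X.exists_sixVertex_of_moveCoeff_ne_zero R t₀ q (left_ne_zero_of_mul huv)
    obtain ⟨o', rfl⟩ := X.exists_sixVertex_of_moveCoeff_ne_zero R t₀ q (right_ne_zero_of_mul huv)
    obtain ⟨k, h1, h2, -⟩ := exists_ne_three o o' o'
    exact ⟨_, X.sixVertex_mem_range t₀ q h1, X.sixVertex_mem_range t₀ q h2⟩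
  -- The sum over the edges is half the sum over all the ordered pairs of vertices.
  have hsum := X'.sum_edge_eq (fun u v => c u * c v * G u v)
    fun u v huv => hrange u v (left_ne_zero_of_mul huv)
  have htwo := two_mul_sum_lt (fun u v => c u * c v * G u v) (by
      intro u v
      by_cases huv : c u * c v = 0
      · rw [huv, mul_comm (c v), huv, zero_mul, zero_mul]
      · obtain ⟨o, rfl⟩ := X.exists_sixVertex_of_moveCoeff_ne_zero R t₀ q (left_ne_zero_of_mul huv)
        obtain ⟨o', rfl⟩ :=
          X.exists_sixVertex_of_moveCoeff_ne_zero R t₀ q (right_ne_zero_of_mul huv)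
        rw [hG, hG, ← neg_sub (P o'), ← neg_sub (y o'), inner_neg_neg]
        ring) (by
      intro u
      by_cases huv : c u * c u = 0
      · rw [huv, zero_mul]
      · obtain ⟨o, rfl⟩ := X.exists_sixVertex_of_moveCoeff_ne_zero R t₀ q (left_ne_zero_of_mul huv)
        rw [hG, sub_self, inner_zero_left, mul_zero, mul_zero])
  have hfin : ∑ u, ∑ v, c u * c v * G u v = 0 := by
    have hp := abs_ne_zero.1 (hX t₀)
    have h0 := sum_mul_inner_sub y (sum_depCoeff q hp) (sum_depCoeff_smul q hp)
    simp only [mul_assoc, ← Finset.mul_sum]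
    simp only [c, moveCoeff, sum_extend_mul (X.sixVertex_injective t₀)]
    simp only [hG]
    rw [← mul_zero (2 : ℝ), ← h0, Finset.mul_sum]
    refine Finset.sum_congr rfl fun o _ => ?_
    have h6 : ∀ o', depCoeff (X.simplexPlace R t₀) q o' * (2 * inner ℝ (P o' - P o) (y o' - y o)) =
        2 * (depCoeff (X.simplexPlace R t₀) q o' * inner ℝ (P o' - P o) (y o' - y o)) :=
      fun o' => mul_left_comm _ _ _
    simp only [h6, ← Finset.mul_sum]
    rw [mul_left_comm]
  rw [hfin] at htwo
  change ∑ e : X'.Edge, c e.1.1 * c e.1.2 * G e.1.1 e.1.2 = 0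
  rw [hsum]
  linarith

/-- The faces that contain a given edge correspond to their vertices opposite to it. -/
theorem sum_face_of_edge [Fintype V] (e : X.Edge) (H : V → ℝ)
    (hH : ∀ w, H w ≠ 0 → w ≠ e.1.1 ∧ w ≠ e.1.2 ∧ ∃ t, e.1.1 ∈ Set.range (X.vert t) ∧
      e.1.2 ∈ Set.range (X.vert t) ∧ w ∈ Set.range (X.vert t)) :
    ∑ f : X.Face, ((if f.edge₀₁ = e then H f.1.2.2 else 0) +
      (if f.edge₀₂ = e then H f.1.2.1 else 0) + (if f.edge₁₂ = e then H f.1.1 else 0)) =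
    ∑ w, H w := by
  -- The three sums belong to the three positions of the opposite vertex with respect to the ends of
  -- the edge in the order of the vertices.
  have h1 : ∑ f : X.Face, (if f.edge₀₁ = e then H f.1.2.2 else 0) =
      ∑ w, if e.1.2 < w then H w else 0 := by
    refine Finset.sum_bij_ne_zero (fun f _ _ => f.1.2.2) (fun _ _ _ => Finset.mem_univ _) ?_ ?_ ?_
    · intro f _ hf f' _ hf' h
      have e1 := (ite_ne_right_iff.1 hf).1
      have e2 := (ite_ne_right_iff.1 hf').1
      have e3 : f.1.1 = f'.1.1 := congrArg (fun e : X.Edge => e.1.1) (e1.trans e2.symm)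
      have e4 : f.1.2.1 = f'.1.2.1 := congrArg (fun e : X.Edge => e.1.2) (e1.trans e2.symm)
      exact Subtype.ext (Prod.ext e3 (Prod.ext e4 h))
    · intro w _ hw
      obtain ⟨hlt, hw⟩ := (ite_ne_right_iff (b := (0 : ℝ))).1 hw
      obtain ⟨-, -, t, h1, h2, h3⟩ := hH w hw
      refine ⟨⟨(e.1.1, e.1.2, w), e.2.1, hlt, t, h1, h2, h3⟩, Finset.mem_univ _, ?_, rfl⟩
      exact ne_of_eq_of_ne (if_pos rfl) hw
    · intro f _ hf
      have e1 := (ite_ne_right_iff.1 hf).1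
      rw [if_pos e1, if_pos]
      rw [← e1]
      exact f.2.2.1
  have h2 : ∑ f : X.Face, (if f.edge₀₂ = e then H f.1.2.1 else 0) =
      ∑ w, if e.1.1 < w ∧ w < e.1.2 then H w else 0 := by
    refine Finset.sum_bij_ne_zero (fun f _ _ => f.1.2.1) (fun _ _ _ => Finset.mem_univ _) ?_ ?_ ?_
    · intro f _ hf f' _ hf' h
      have e1 := (ite_ne_right_iff.1 hf).1
      have e2 := (ite_ne_right_iff.1 hf').1
      have e3 : f.1.1 = f'.1.1 := congrArg (fun e : X.Edge => e.1.1) (e1.trans e2.symm)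
      have e4 : f.1.2.2 = f'.1.2.2 := congrArg (fun e : X.Edge => e.1.2) (e1.trans e2.symm)
      exact Subtype.ext (Prod.ext e3 (Prod.ext h e4))
    · intro w _ hw
      obtain ⟨hlt, hw⟩ := (ite_ne_right_iff (b := (0 : ℝ))).1 hw
      obtain ⟨-, -, t, h1, h2, h3⟩ := hH w hw
      refine ⟨⟨(e.1.1, w, e.1.2), hlt.1, hlt.2, t, h1, h3, h2⟩, Finset.mem_univ _, ?_, rfl⟩
      exact ne_of_eq_of_ne (if_pos rfl) hw
    · intro f _ hf
      have e1 := (ite_ne_right_iff.1 hf).1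
      rw [if_pos e1, if_pos]
      rw [← e1]
      exact ⟨f.2.1, f.2.2.1⟩
  have h3 : ∑ f : X.Face, (if f.edge₁₂ = e then H f.1.1 else 0) =
      ∑ w, if w < e.1.1 then H w else 0 := by
    refine Finset.sum_bij_ne_zero (fun f _ _ => f.1.1) (fun _ _ _ => Finset.mem_univ _) ?_ ?_ ?_
    · intro f _ hf f' _ hf' h
      have e1 := (ite_ne_right_iff.1 hf).1
      have e2 := (ite_ne_right_iff.1 hf').1
      have e3 : f.1.2.1 = f'.1.2.1 := congrArg (fun e : X.Edge => e.1.1) (e1.trans e2.symm)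
      have e4 : f.1.2.2 = f'.1.2.2 := congrArg (fun e : X.Edge => e.1.2) (e1.trans e2.symm)
      exact Subtype.ext (Prod.ext h (Prod.ext e3 e4))
    · intro w _ hw
      obtain ⟨hlt, hw⟩ := (ite_ne_right_iff (b := (0 : ℝ))).1 hw
      obtain ⟨-, -, t, h1, h2, h3⟩ := hH w hw
      refine ⟨⟨(w, e.1.1, e.1.2), hlt, e.2.1, t, h3, h1, h2⟩, Finset.mem_univ _, ?_, rfl⟩
      exact ne_of_eq_of_ne (if_pos rfl) hw
    · intro f _ hf
      have e1 := (ite_ne_right_iff.1 hf).1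
      rw [if_pos e1, if_pos]
      rw [← e1]
      exact f.2.1
  rw [Finset.sum_add_distrib, Finset.sum_add_distrib, h1, h2, h3, ← Finset.sum_add_distrib,
    ← Finset.sum_add_distrib]
  refine Finset.sum_congr rfl fun w _ => ?_
  have he := e.2.1
  by_cases hw : H w = 0
  · simp [hw]
  · obtain ⟨h4, h5, -⟩ := hH w hw
    rcases h4.lt_or_gt with h6 | h6
    · simp [h6, (h6.trans he).asymm, h6.asymm]
    · rcases h5.lt_or_gt with h7 | h7
      · simp [h6, h7, h7.asymm, h6.asymm]
      · simp [h6, h7, h7.asymm, h6.asymm]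

/-- The product of the area of a face and of the three coefficients of its vertices. -/
noncomputable def faceCoeff (f : (X.move t₀ q).Face) : ℝ :=
  (X.move t₀ q).area R f * (X.moveCoeff R t₀ q f.1.1 * X.moveCoeff R t₀ q f.1.2.1 *
    X.moveCoeff R t₀ q f.1.2.2)

/-- The linear relation on the differentials of the areas of the 2-faces with vertices among the
six points. -/
theorem sum_areaMatrix_mul_faceCoeff [Fintype V] (hX : X.IsNondegenerate R)
    (harea : ∀ f, (X.move t₀ q).area R f ≠ 0)
    {fr' : (X.move t₀ q).Edge → Fin 3 → E4} (hfr : (X.move t₀ q).IsFraming R fr')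
    (r : (X.move t₀ q).Edge × Fin 3) :
    ∑ f, (X.move t₀ q).areaMatrix R fr' f r * X.faceCoeff R t₀ q f = 0 := by
  obtain ⟨e, k⟩ := r
  set c := X.moveCoeff R t₀ q with hc
  let H (w : WithTop V) : ℝ := c e.1.1 * c e.1.2 * c w * inner ℝ ((X.move t₀ q).edgeVec R e.1.1 w) (fr' e k)
  have hx := (hfr e).2 k
  have h1 : ∀ f : (X.move t₀ q).Face, (X.move t₀ q).areaMatrix R fr' f (e, k) * X.faceCoeff R t₀ q f =
      -((X.move t₀ q).sqLength R e / 2) * ((if f.edge₀₁ = e then H f.1.2.2 else 0) +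
      (if f.edge₀₂ = e then H f.1.2.1 else 0) + (if f.edge₁₂ = e then H f.1.1 else 0)) := by
    intro f
    rw [areaMatrix, Matrix.of_apply]
    dsimp only
    rw [dS_single R (X.move t₀ q) hx, faceCoeff]
    have hS := harea f
    have hterm : ∀ S L i : ℝ, S ≠ 0 → ∀ d : ℝ, -(L / (2 * S)) * i * (S * d) = -(L / 2) * (d * i) := by
      intro S L i hS d
      field_simp
    rw [hterm _ _ _ hS]
    congr 1
    rw [mul_add, mul_add]
    simp only [mul_ite, mul_zero]
    refine congrArg₂ _ (congrArg₂ _ ?_ ?_) ?_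
    · split_ifs with h
      · have e1 : e.1.1 = f.1.1 := congrArg (fun e : (X.move t₀ q).Edge => e.1.1) h.symm
        have e2 : e.1.2 = f.1.2.1 := congrArg (fun e : (X.move t₀ q).Edge => e.1.2) h.symm
        simp only [H, ← hc, e1, e2]
      · rfl
    · split_ifs with h
      · have e1 : e.1.1 = f.1.1 := congrArg (fun e : (X.move t₀ q).Edge => e.1.1) h.symm
        have e2 : e.1.2 = f.1.2.2 := congrArg (fun e : (X.move t₀ q).Edge => e.1.2) h.symm
        simp only [H, ← hc, e1, e2]
        ring
      · rfl
    · split_ifs with h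
      · have e1 : e.1.1 = f.1.2.1 := congrArg (fun e : (X.move t₀ q).Edge => e.1.1) h.symm
        have e2 : e.1.2 = f.1.2.2 := congrArg (fun e : (X.move t₀ q).Edge => e.1.2) h.symm
        simp only [H, ← hc, e1, e2]
        ring
      · rfl
  simp only [h1, ← Finset.mul_sum]
  by_cases he : c e.1.1 * c e.1.2 = 0
  · have : ∀ w, H w = 0 := fun w => by simp only [H, he, zero_mul]
    simp [this]
  obtain ⟨o, ho⟩ := X.exists_sixVertex_of_moveCoeff_ne_zero R t₀ q (left_ne_zero_of_mul he)
  obtain ⟨o', ho'⟩ := X.exists_sixVertex_of_moveCoeff_ne_zero R t₀ q (right_ne_zero_of_mul he)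
  -- At the edge `o o'` the sum reduces to that of `λ_w ⟨P_w - P_o, y⟩` over the six points `w`.
  rw [(X.move t₀ q).sum_face_of_edge e H ?_]
  · refine mul_eq_zero_of_right _ ?_
    simp only [H, mul_assoc, ← Finset.mul_sum]
    refine mul_eq_zero_of_right _ (mul_eq_zero_of_right _ ?_)
    rw [hc, moveCoeff, sum_extend_mul (X.sixVertex_injective t₀)]
    have h2 : ∀ o'', inner ℝ ((X.move t₀ q).edgeVec R e.1.1 (X.sixVertex t₀ o'')) (fr' e k) =
        inner ℝ (sixPoint (X.simplexPlace R t₀) q o'' - sixPoint (X.simplexPlace R t₀) q o)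
          (X.lin R (X.vert t₀ 0) (X.vert t₀ (o.getD 0)) (fr' e k)) := by
      intro o''
      rw [← X.lin_move_edgeVec R t₀ q o o'', LinearIsometryEquiv.inner_map_map, ho]
    simp only [h2, ← real_inner_smul_left]
    rw [← sum_inner, sum_depCoeff_smul_sub q (abs_ne_zero.1 (hX t₀)), inner_zero_left]
  · intro w hw
    have hw1 := right_ne_zero_of_mul hw
    have hw2 := right_ne_zero_of_mul (left_ne_zero_of_mul hw)
    obtain ⟨o'', rfl⟩ := X.exists_sixVertex_of_moveCoeff_ne_zero R t₀ q hw2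
    obtain ⟨k', h3, h4, h5⟩ := exists_ne_three o o' o''
    have m1 := X.sixVertex_mem_range t₀ q h3
    rw [ho] at m1
    -- The terms of the ends of the edge vanish, because the axes are orthogonal to it.
    refine ⟨?_, ?_, Sum.inr k', m1, ?_, X.sixVertex_mem_range t₀ q h5⟩
    · intro h
      rw [h, edgeVec_self_of_mem R m1, inner_zero_left] at hw1
      exact hw1 rfl
    · intro h
      rw [h, real_inner_comm, hx] at hw1
      exact hw1 rfl
    · rw [← ho']
      exact X.sixVertex_mem_range t₀ q h4

end Triangulation4

/-! ### The derivatives of the deficit angles -/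

section AngleSum

variable {W W' : Type*} [DecidableEq W] [DecidableEq W']

/-- The derivative, with respect to the squared length of the edge `u v`, of the dihedral angle at
the face `F` in the simplex with vertices `w i` and gradients `g i` of the barycentric
coordinates; zero if the face or the edge does not belong to the simplex. -/
noncomputable def angleSum (w : Fin 5 → W) (g : Fin 5 → E4) (F : Finset W) (u v : W) : ℝ :=
  ∑ i : Fin 5, ∑ j ∈ Finset.Ioi i, if ({i, j}ᶜ : Finset (Fin 5)).image w = F then
    ∑ k, ∑ l, if u = w k ∧ v = w l then dihedralRate g i j k l else 0 else 0

theorem angleSum_comp {φ : W → W'} (hφ : Function.Injective φ) (w : Fin 5 → W) (g : Fin 5 → E4)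
    (F : Finset W) (u v : W) :
    angleSum (φ ∘ w) g (F.image φ) (φ u) (φ v) = angleSum w g F u v := by
  simp only [angleSum, ← Finset.image_image, (Finset.image_injective hφ).eq_iff,
    Function.comp_apply, hφ.eq_iff]

theorem angleSum_eq_zero_of_face {w : Fin 5 → W} {g : Fin 5 → E4} {F : Finset W} {x : W}
    (hx : x ∈ F) (hx' : x ∉ Set.range w) (u v : W) : angleSum w g F u v = 0 := by
  refine Finset.sum_eq_zero fun i _ => Finset.sum_eq_zero fun j _ => if_neg ?_
  rintro rfl
  obtain ⟨k, -, hk⟩ := Finset.mem_image.1 hx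
  exact hx' ⟨k, hk⟩

theorem angleSum_eq_zero_of_edge {w : Fin 5 → W} {g : Fin 5 → E4} {F : Finset W} {u v : W}
    (h : u ∉ Set.range w ∨ v ∉ Set.range w) : angleSum w g F u v = 0 := by
  refine Finset.sum_eq_zero fun i _ => Finset.sum_eq_zero fun j _ => ?_
  rw [ite_eq_right_iff]
  intro _
  refine Finset.sum_eq_zero fun k _ => Finset.sum_eq_zero fun l _ => if_neg ?_
  rintro ⟨rfl, rfl⟩
  simp at h

theorem dihedralRate_eq_zero_left {ι : Type*} {g : ι → E4} {i j k l : ι} (h : g k = 0) :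
    dihedralRate g i j k l = 0 := by
  simp [dihedralRate, h]

theorem dihedralRate_eq_zero_right {ι : Type*} {g : ι → E4} {i j k l : ι} (h : g l = 0) :
    dihedralRate g i j k l = 0 := by
  simp [dihedralRate, h]

theorem mem_of_nodup_six {a b c x y z : Option (Fin 5)} (h : [c, a, b, x, y, z].Nodup)
    (o : Option (Fin 5)) : o ∈ [c, a, b, x, y, z] := by
  have h1 := List.toFinset_card_of_nodup h
  have h2 : [c, a, b, x, y, z].toFinset = Finset.univ :=
    (Finset.card_eq_iff_eq_univ _).1 (by rw [h1]; rfl)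
  rw [← List.mem_toFinset, h2]
  exact Finset.mem_univ _

theorem sum_of_nodup_six {a b c x y z : Option (Fin 5)} (h : [c, a, b, x, y, z].Nodup)
    (F : Option (Fin 5) → ℝ) : ∑ o, F o = F c + F a + F b + F x + F y + F z := by
  have h2 : [c, a, b, x, y, z].toFinset = Finset.univ := by
    ext o
    simpa using mem_of_nodup_six h o
  rw [← h2, List.sum_toFinset _ h]
  simp [add_assoc]

/-- The only angle of a simplex at its face `x y z` is the one between the faces opposite to the
remaining two vertices `a`, `b`. -/
theorem sum_simplexLabel {a b c x y z : Option (Fin 5)} (h : [c, a, b, x, y, z].Nodup)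
    (F : Fin 5 → Fin 5 → ℝ) (hF : ∀ i j, F i j = F j i) {i₀ j₀ : Fin 5}
    (hi₀ : simplexLabel c i₀ = a) (hj₀ : simplexLabel c j₀ = b) :
    (∑ i : Fin 5, ∑ j ∈ Finset.Ioi i,
      if ({i, j}ᶜ : Finset (Fin 5)).image (simplexLabel c) = {x, y, z} then F i j else 0) =
      F i₀ j₀ := by
  have hinj := simplexLabel_injective c
  have himage : ({i₀, j₀}ᶜ : Finset (Fin 5)).image (simplexLabel c) = {x, y, z} := by
    ext o
    constructor
    · intro ho
      obtain ⟨m, hm, rfl⟩ := Finset.mem_image.1 ho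
      have h1 := mem_of_nodup_six h (simplexLabel c m)
      simp only [Finset.mem_compl, Finset.mem_insert, Finset.mem_singleton, not_or] at hm
      have h2 : simplexLabel c m ≠ a := fun h => hm.1 (hinj (h.trans hi₀.symm))
      have h3 : simplexLabel c m ≠ b := fun h => hm.2 (hinj (h.trans hj₀.symm))
      simpa [simplexLabel_ne, h2, h3] using h1
    · intro ho
      simp only [List.nodup_cons, List.mem_cons, not_or] at h
      simp only [Finset.mem_insert, Finset.mem_singleton] at ho
      obtain ⟨m, rfl⟩ := exists_simplexLabel_eq (k := c) (o := o) (by grind)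
      refine Finset.mem_image_of_mem _ ?_
      simp only [Finset.mem_compl, Finset.mem_insert, Finset.mem_singleton, not_or]
      constructor
      · rintro rfl
        grind
      · rintro rfl
        grind
  have hne : i₀ ≠ j₀ := by
    rintro rfl
    rw [hi₀] at hj₀
    subst hj₀
    simp at h
  have hiff : ∀ i j, (({i, j}ᶜ : Finset (Fin 5)).image (simplexLabel c) = {x, y, z}) ↔
      (({i, j} : Finset (Fin 5)) = {i₀, j₀}) := by
    intro i j
    rw [← himage, (Finset.image_injective hinj).eq_iff, compl_inj_iff]
  simp only [hiff]
  clear hiff himage hi₀ hj₀ h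
  rcases hne.lt_or_gt with hlt | hlt
  · rw [Finset.sum_eq_single i₀, Finset.sum_eq_single j₀]
    · simp
    · intro j hj hjj
      rw [if_neg]
      intro h
      exact hjj (by revert i₀ j₀ j; decide)
    · intro h
      exact absurd (Finset.mem_Ioi.2 hlt) h
    · intro i _ hi
      refine Finset.sum_eq_zero fun j hj => if_neg ?_
      rw [Finset.mem_Ioi] at hj
      revert i₀ j₀ i j; decide
    · simp
  · rw [Finset.sum_eq_single j₀, Finset.sum_eq_single i₀]
    · simp [Finset.pair_comm, hF]
    · intro j hj hjj
      rw [if_neg]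
      intro h
      exact hjj (by revert i₀ j₀ j; decide)
    · intro h
      exact absurd (Finset.mem_Ioi.2 hlt) h
    · intro i _ hi
      refine Finset.sum_eq_zero fun j hj => if_neg ?_
      rw [Finset.mem_Ioi] at hj
      revert i₀ j₀ i j; decide
    · simp

/-- The two normals at the face `x y z` of the simplex without `c` are those of the vertices `a`,
`b`. -/
theorem angleSum_simplexLabel {a b c x y z : Option (Fin 5)} (h : [c, a, b, x, y, z].Nodup)
    (G : Option (Fin 5) → E4) (hG : G c = 0) (o o' : Option (Fin 5)) :
    angleSum (simplexLabel c) (G ∘ simplexLabel c) {x, y, z} o o' = dihedralRate G a b o o' := by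
  have hnd := h
  simp only [List.nodup_cons, List.mem_cons, not_or] at h
  obtain ⟨i₀, hi₀⟩ := exists_simplexLabel_eq (k := c) (o := a) (Ne.symm h.1.1)
  obtain ⟨j₀, hj₀⟩ := exists_simplexLabel_eq (k := c) (o := b) (Ne.symm h.1.2.1)
  rw [angleSum, sum_simplexLabel hnd (fun i j => ∑ k, ∑ l,
    if o = simplexLabel c k ∧ o' = simplexLabel c l then
      dihedralRate (G ∘ simplexLabel c) i j k l else 0) ?_ hi₀ hj₀]
  · by_cases ho : o = c
    · rw [dihedralRate_eq_zero_left (ho ▸ hG)]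
      refine Finset.sum_eq_zero fun k _ => Finset.sum_eq_zero fun l _ => if_neg ?_
      rw [ho]
      exact fun h => simplexLabel_ne c k h.1.symm
    by_cases ho' : o' = c
    · rw [dihedralRate_eq_zero_right (ho' ▸ hG)]
      refine Finset.sum_eq_zero fun k _ => Finset.sum_eq_zero fun l _ => if_neg ?_
      rw [ho']
      exact fun h => simplexLabel_ne c l h.2.symm
    obtain ⟨k, rfl⟩ := exists_simplexLabel_eq ho
    obtain ⟨l, rfl⟩ := exists_simplexLabel_eq ho'
    have hinj := simplexLabel_injective c
    simp only [hinj.eq_iff, ite_and]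
    simp only [Finset.sum_ite_eq, Finset.sum_ite_irrel, Finset.sum_const_zero,
      Finset.mem_univ, if_true]
    rw [← hi₀, ← hj₀]
    rfl
  · intro i j
    simp only [dihedralRate_comm _ i j]

end AngleSum

namespace Triangulation4

variable {Γ : Type*} [Group Γ] {V T J : Type*} [LinearOrder V]
variable (R : Representation4 Γ J) (X : Triangulation4 Γ V T)

theorem sqDist_comm (L : X.Edge → ℝ) (u v : V) : X.sqDist L u v = X.sqDist L v u := by
  classical
  have key : ∀ m M m' M' : V, m = m' → M = M' →
      (if h : m < M ∧ ∃ t, m ∈ Set.range (X.vert t) ∧ M ∈ Set.range (X.vert t) then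
        L ⟨(m, M), h⟩ else 0) =
      if h : m' < M' ∧ ∃ t, m' ∈ Set.range (X.vert t) ∧ M' ∈ Set.range (X.vert t) then
        L ⟨(m', M'), h⟩ else 0 := by
    rintro m M _ _ rfl rfl
    rfl
  exact key _ _ _ _ (min_comm u v) (max_comm u v)

theorem sqDist_eq (L : X.Edge → ℝ) (e : X.Edge) : X.sqDist L e.1.1 e.1.2 = L e := by
  have h := e.2.1.le
  rw [sqDist, dif_pos (by rw [min_eq_left h, max_eq_right h]; exact e.2)]
  exact congrArg L (Subtype.ext (Prod.ext (min_eq_left h) (max_eq_right h)))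

theorem sqDist_vert (e : X.Edge) (ℓ : ℝ) (t : T) (a b : Fin 5) :
    X.sqDist (Function.update (X.sqLength R) e ℓ) (X.vert t a) (X.vert t b) =
      if (e.1.1 = X.vert t a ∧ e.1.2 = X.vert t b) ∨ (e.1.1 = X.vert t b ∧ e.1.2 = X.vert t a)
        then ℓ else dist (X.simplexPlace R t a) (X.simplexPlace R t b) ^ 2 := by
  have key : ∀ {a b : Fin 5}, X.vert t a < X.vert t b →
      X.sqDist (Function.update (X.sqLength R) e ℓ) (X.vert t a) (X.vert t b) =
      if (e.1.1 = X.vert t a ∧ e.1.2 = X.vert t b) ∨ (e.1.1 = X.vert t b ∧ e.1.2 = X.vert t a)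
        then ℓ else dist (X.simplexPlace R t a) (X.simplexPlace R t b) ^ 2 := by
    intro a b h
    obtain ⟨e₀, h1, h2⟩ : ∃ e₀ : X.Edge, e₀.1.1 = X.vert t a ∧ e₀.1.2 = X.vert t b :=
      ⟨⟨(X.vert t a, X.vert t b), h, t, ⟨a, rfl⟩, ⟨b, rfl⟩⟩, rfl, rfl⟩
    rw [← norm_edgeVec, ← h1, ← h2, sqDist_eq, Function.update_apply]
    refine if_congr ⟨?_, ?_⟩ rfl rfl
    · rintro rfl
      exact Or.inl ⟨rfl, rfl⟩
    · rintro (⟨h3, h4⟩ | ⟨h3, h4⟩)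
      · exact Subtype.ext (Prod.ext h3.symm h4.symm)
      · exact absurd e₀.2.1 (h3 ▸ h4 ▸ e.2.1).asymm
  rcases lt_trichotomy (X.vert t a) (X.vert t b) with h | h | h
  · exact key h
  · have hab := X.vert_injective t h
    subst hab
    rw [if_neg, sqDist, dif_neg (by simp), dist_self]
    · simp
    · rintro (h | h) <;> exact e.2.1.ne (h.1.trans h.2.symm)
  · rw [sqDist_comm, key h, dist_comm]
    exact if_congr or_comm rfl rfl

/-- The derivative of a dihedral angle of `t` with respect to a squared length of the triangulation;
it is zero if the edge does not belong to `t`. -/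
theorem hasDerivAt_simplexAngle {t : T} {g : Fin 5 → E4} (hg : IsGradient (X.simplexPlace R t) g)
    (e : X.Edge) {i j : Fin 5} (hij : i ≠ j) :
    HasDerivAt (fun ℓ : ℝ => dihedralAngle (fun a b => X.sqDist
      (Function.update (X.sqLength R) e ℓ) (X.vert t a) (X.vert t b)) i j)
      (∑ k, ∑ l, if e.1.1 = X.vert t k ∧ e.1.2 = X.vert t l then dihedralRate g i j k l else 0)
      (X.sqLength R e) := by
  have hinj := X.vert_injective t
  simp only [sqDist_vert]
  by_cases h : ∃ k l, e.1.1 = X.vert t k ∧ e.1.2 = X.vert t l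
  · obtain ⟨k, l, hk, hl⟩ := h
    have hkl : k ≠ l := by
      rintro rfl
      exact e.2.1.ne (hk.trans hl.symm)
    have hd := hg.hasDerivAt_dihedralAngle hij hkl
    have hL : X.sqLength R e = dist (X.simplexPlace R t k) (X.simplexPlace R t l) ^ 2 := by
      rw [sqLength, length, hk, hl, norm_edgeVec]
    rw [hL]
    simp only [hk, hl, hinj.eq_iff, ite_and]
    simp only [Finset.sum_ite_eq, Finset.sum_ite_irrel, Finset.sum_const_zero,
      Finset.mem_univ, if_true]
    refine hd.congr_of_eventuallyEq (Filter.Eventually.of_forall fun x => ?_)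
    refine congrArg (fun ℓ => dihedralAngle ℓ i j) ?_
    ext a b
    refine if_congr ?_ rfl rfl
    simp only [eq_comm (a := k), eq_comm (a := l)]
    tauto
  · push Not at h
    have h1 : ∀ k l, ¬(e.1.1 = X.vert t k ∧ e.1.2 = X.vert t l) := fun k l hkl => h k l hkl.1 hkl.2
    rw [Finset.sum_eq_zero fun k _ => Finset.sum_eq_zero fun l _ => if_neg (h1 k l)]
    refine (hasDerivAt_const _ (dihedralAngle (fun a b => dist (X.simplexPlace R t a)
      (X.simplexPlace R t b) ^ 2) i j)).congr_of_eventuallyEq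
        (Filter.Eventually.of_forall fun x => ?_)
    refine congrArg (fun ℓ => dihedralAngle ℓ i j) (funext₂ fun a b => if_neg ?_)
    rintro (h | h) <;> exact h1 _ _ h

/-- The deficit angles are differentiable, so that the entries of the matrix are genuine
derivatives, not default values of `deriv`. -/
theorem matrix₂_apply [Fintype T] {g : T → Fin 5 → E4}
    (hg : ∀ t, IsGradient (X.simplexPlace R t) (g t)) (f : X.Face) (e : X.Edge) :
    X.matrix₂ R f e = -∑ t, Real.sign (signedVolume (X.simplexPlace R t)) *
      angleSum (X.vert t) (g t) {f.1.1, f.1.2.1, f.1.2.2} e.1.1 e.1.2 := by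
  rw [matrix₂, Matrix.of_apply]
  refine HasDerivAt.deriv ?_
  refine HasDerivAt.neg (HasDerivAt.fun_sum fun t _ => ?_)
  simp only [angleSum, Finset.mul_sum]
  refine HasDerivAt.fun_sum fun i _ => HasDerivAt.fun_sum fun j hj => ?_
  have hij : i ≠ j := (Finset.mem_Ioi.1 hj).ne
  split_ifs
  · exact (X.hasDerivAt_simplexAngle R (hg t) e hij).const_mul _
  · rw [mul_zero]
    exact hasDerivAt_const _ _

end Triangulation4

/-- The three simplices on six points that contain the triangle `x y z`: the derivatives of their
angles at this triangle add up to a matrix of rank one. -/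
theorem sum_sign_mul_angleSum {p g : Fin 5 → E4} (h : IsGradient p g) {q : E4}
    (hne : ∀ o, depCoeff p q o ≠ 0) {x y z : Option (Fin 5)} (hxy : x ≠ y) (hxz : x ≠ z)
    (hyz : y ≠ z) (o o' : Option (Fin 5)) :
    ∑ k, Real.sign (depCoeff p q k) *
      angleSum (simplexLabel k) (sixGradient p q g k ∘ simplexLabel k) {x, y, z} o o' =
    triangleArea (sixPoint p q x) (sixPoint p q y) (sixPoint p q z) *
      (depCoeff p q x * depCoeff p q y * depCoeff p q z) /
      (24 * |signedVolume p| * ∏ k, depCoeff p q k) * (depCoeff p q o * depCoeff p q o') := by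
  have hp := h.signedVolume_ne_zero
  -- The simplices that contain the triangle are those without one of the other labels `a`, `b`,
  -- `c`.
  obtain ⟨a, b, c, hnd⟩ : ∃ a b c, [c, a, b, x, y, z].Nodup := by
    obtain ⟨a, b, c, hab, hac, hbc, habc⟩ := Finset.card_eq_three.1
      (show ({x, y, z}ᶜ : Finset (Option (Fin 5))).card = 3 by
        rw [Finset.card_compl, Finset.card_eq_three.2 ⟨x, y, z, hxy, hxz, hyz, rfl⟩]
        rfl)
    have hm : ∀ o, o = a ∨ o = b ∨ o = c ↔ ¬(o = x ∨ o = y ∨ o = z) := fun o => by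
      have := Finset.ext_iff.1 habc o
      simpa using this.symm
    refine ⟨a, b, c, ?_⟩
    have ha := (hm a).1 (Or.inl rfl)
    have hb := (hm b).1 (Or.inr (Or.inl rfl))
    have hc := (hm c).1 (Or.inr (Or.inr rfl))
    simp only [List.nodup_cons, List.mem_cons, List.not_mem_nil, or_false, not_or,
      List.nodup_nil, and_true, not_false_eq_true]
    grind
  have hnd1 : [a, b, c, x, y, z].Nodup := by
    refine (List.Perm.nodup_iff ?_).1 hnd
    exact (List.Perm.swap a c [b, x, y, z]).trans ((List.Perm.swap b c _).cons a)
  have hnd2 : [b, c, a, x, y, z].Nodup := by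
    refine (List.Perm.nodup_iff ?_).1 hnd1
    exact (List.Perm.swap b a [c, x, y, z]).trans ((List.Perm.swap c a _).cons b)
  have hzero : ∀ k, k = x ∨ k = y ∨ k = z →
      angleSum (simplexLabel k) (sixGradient p q g k ∘ simplexLabel k) {x, y, z} o o' = 0 := by
    intro k hk
    refine angleSum_eq_zero_of_face (x := k) (by simpa using hk) ?_ o o'
    rintro ⟨i, hi⟩
    exact simplexLabel_ne k i hi
  rw [sum_of_nodup_six hnd, hzero x (by simp), hzero y (by simp), hzero z (by simp),
    angleSum_simplexLabel hnd _ (sixGradient_self q g (hne c)),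
    angleSum_simplexLabel hnd1 _ (sixGradient_self q g (hne a)),
    angleSum_simplexLabel hnd2 _ (sixGradient_self q g (hne b))]
  have hprod : ∏ k, depCoeff p q k = depCoeff p q c * depCoeff p q a * depCoeff p q b *
      depCoeff p q x * depCoeff p q y * depCoeff p q z := by
    have h2 : [c, a, b, x, y, z].toFinset = Finset.univ := by
      ext o
      simpa using mem_of_nodup_six hnd o
    rw [← h2, List.prod_toFinset _ hnd]
    simp [mul_assoc]
  have hndc := hnd
  simp only [List.nodup_cons, List.mem_cons, List.not_mem_nil, or_false, not_or,
    List.nodup_nil, and_true, not_false_eq_true] at hnd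
  obtain ⟨⟨hca, hcb, hcx, hcy, hcz⟩, ⟨hab, hax, hay, haz⟩, ⟨hbx, hby, hbz⟩, -⟩ := hnd
  have hthree := h.sum_three_rates hne hab (Ne.symm hca) (Ne.symm hcb) o o'
  obtain ⟨a', ha'⟩ := exists_simplexLabel_eq (Ne.symm hca)
  obtain ⟨b', hb'⟩ := exists_simplexLabel_eq (Ne.symm hcb)
  obtain ⟨x', hx'⟩ := exists_simplexLabel_eq (Ne.symm hcx)
  obtain ⟨y', hy'⟩ := exists_simplexLabel_eq (Ne.symm hcy)
  obtain ⟨z', hz'⟩ := exists_simplexLabel_eq (Ne.symm hcz)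
  have hnd' : [x', y', z', a', b'].Nodup := by
    have h1 : ([x', y', z', a', b'].map (simplexLabel c)).Nodup := by
      simp only [List.map_cons, List.map_nil, ha', hb', hx', hy', hz']
      simp only [List.nodup_cons, List.mem_cons, List.not_mem_nil, or_false, not_or,
        List.nodup_nil, and_true, not_false_eq_true]
      grind
    exact List.Nodup.of_map _ h1
  have hsqrt := (h.sixGradient q (hne c)).sqrt_gram_det hnd'
  simp only [Function.comp_apply, ha', hb', hx', hy', hz'] at hsqrt
  have hvol : |signedVolume (sixPoint p q ∘ simplexLabel c)| =
      |depCoeff p q c| * |signedVolume p| := by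
    rcases c with _ | c
    · have : sixPoint p q ∘ simplexLabel none = p := rfl
      rw [this]
      simp [depCoeff]
    · rw [sixPoint_comp_some, signedVolume_update q hp, abs_mul]
      rfl
  rw [hvol] at hsqrt
  rw [hsqrt] at hthree
  have ha := hne a
  have hb := hne b
  have hc := abs_ne_zero.2 (hne c)
  have hc' := hne c
  have hx := hne x
  have hy := hne y
  have hz := hne z
  have hV := abs_ne_zero.2 hp
  rw [hprod]
  have e1 : ∀ A B C : ℝ, A + B + C + Real.sign (depCoeff p q x) * 0 +
      Real.sign (depCoeff p q y) * 0 + Real.sign (depCoeff p q z) * 0 = A + B + C := by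
    intros; ring
  rw [e1, hthree]
  field_simp
  ring

namespace Triangulation4

variable {Γ : Type*} [Group Γ] {V T J : Type*} [LinearOrder V]
variable (R : Representation4 Γ J) (X : Triangulation4 Γ V T) (t₀ : T) (q : E4)

/-- The constant in the change of the derivatives of the deficit angles under the move. -/
noncomputable def moveConst : ℝ :=
  -1 / (24 * signedVolume (X.simplexPlace R t₀) * ∏ k, depCoeff (X.simplexPlace R t₀) q k)

theorem triangleArea_sixPoint (f : (X.move t₀ q).Face) {x y z : Option (Fin 5)}
    (hx : X.sixVertex t₀ x = f.1.1) (hy : X.sixVertex t₀ y = f.1.2.1)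
    (hz : X.sixVertex t₀ z = f.1.2.2) :
    triangleArea (sixPoint (X.simplexPlace R t₀) q x) (sixPoint (X.simplexPlace R t₀) q y)
      (sixPoint (X.simplexPlace R t₀) q z) = (X.move t₀ q).area R f := by
  rw [← motion_move_coord, ← motion_move_place R X t₀ q x y, ← motion_move_place R X t₀ q x z,
    triangleArea_map, hx, hy, hz]
  rfl

theorem signedVolume_sixPoint {p : Fin 5 → E4} (hp : signedVolume p ≠ 0) (q : E4) (k : Fin 5) :
    signedVolume (sixPoint p q ∘ simplexLabel (some k)) =
      depCoeff p q (some k) * signedVolume p := by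
  rw [sixPoint_comp_some, signedVolume_update q hp]
  rfl

theorem sign_mul (x y : ℝ) : Real.sign (x * y) = Real.sign x * Real.sign y := by
  rcases lt_trichotomy x 0 with hx | rfl | hx
  · rcases lt_trichotomy y 0 with hy | rfl | hy
    · rw [Real.sign_of_pos (mul_pos_of_neg_of_neg hx hy), Real.sign_of_neg hx, Real.sign_of_neg hy]
      norm_num
    · simp
    · rw [Real.sign_of_neg (mul_neg_of_neg_of_pos hx hy), Real.sign_of_neg hx, Real.sign_of_pos hy]
      norm_num
  · simp
  · rcases lt_trichotomy y 0 with hy | rfl | hy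
    · rw [Real.sign_of_neg (mul_neg_of_pos_of_neg hx hy), Real.sign_of_pos hx, Real.sign_of_neg hy]
      norm_num
    · simp
    · rw [Real.sign_of_pos (mul_pos hx hy), Real.sign_of_pos hx, Real.sign_of_pos hy]
      norm_num

/-- The sum of the derivatives of angles over the six simplices on the vertices of `t₀` and the new
vertex, for an arbitrary face and edge. Both sides vanish if a vertex of the face or of the edge is
not among the six. -/
theorem sum_sign_mul_angleSum_sixVertex (hX : X.IsNondegenerate R)
    (hX' : (X.move t₀ q).IsNondegenerate R) {g : Fin 5 → E4}
    (hg : IsGradient (X.simplexPlace R t₀) g) (f : (X.move t₀ q).Face) (e : (X.move t₀ q).Edge) :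
    -(Real.sign (signedVolume (X.simplexPlace R t₀)) *
      ∑ k, Real.sign (depCoeff (X.simplexPlace R t₀) q k) *
        angleSum (X.sixVertex t₀ ∘ simplexLabel k)
          (sixGradient (X.simplexPlace R t₀) q g k ∘ simplexLabel k)
          {f.1.1, f.1.2.1, f.1.2.2} e.1.1 e.1.2) =
      X.moveConst R t₀ q * X.faceCoeff R t₀ q f *
        (X.moveCoeff R t₀ q e.1.1 * X.moveCoeff R t₀ q e.1.2) := by
  set c := X.moveCoeff R t₀ q with hc
  have hp := abs_ne_zero.1 (hX t₀)
  have hne := X.moveCoeff_ne_zero R t₀ q hX hX'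
  have hnr : ∀ {v : WithTop V}, c v = 0 → ∀ k, v ∉ Set.range (X.sixVertex t₀ ∘ simplexLabel k) := by
    rintro _ hv k ⟨i, rfl⟩
    rw [hc, Function.comp_apply, moveCoeff_sixVertex] at hv
    exact hne _ hv
  by_cases he : c e.1.1 * c e.1.2 = 0
  · rw [he, mul_zero, neg_eq_zero]
    refine mul_eq_zero_of_right _ (Finset.sum_eq_zero fun k _ => ?_)
    rw [angleSum_eq_zero_of_edge, mul_zero]
    exact (mul_eq_zero.1 he).imp (fun h => hnr h k) fun h => hnr h k
  by_cases hf : c f.1.1 * c f.1.2.1 * c f.1.2.2 = 0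
  · rw [faceCoeff, ← hc, hf, mul_zero, mul_zero, zero_mul, neg_eq_zero]
    refine mul_eq_zero_of_right _ (Finset.sum_eq_zero fun k _ => ?_)
    rcases mul_eq_zero.1 hf with hf | hf
    · rcases mul_eq_zero.1 hf with hf | hf
      · rw [angleSum_eq_zero_of_face (by simp) (hnr hf k), mul_zero]
      · rw [angleSum_eq_zero_of_face (by simp) (hnr hf k), mul_zero]
    · rw [angleSum_eq_zero_of_face (by simp) (hnr hf k), mul_zero]
  obtain ⟨o, ho⟩ := X.exists_sixVertex_of_moveCoeff_ne_zero R t₀ q (left_ne_zero_of_mul he)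
  obtain ⟨o', ho'⟩ := X.exists_sixVertex_of_moveCoeff_ne_zero R t₀ q (right_ne_zero_of_mul he)
  obtain ⟨x, hx⟩ := X.exists_sixVertex_of_moveCoeff_ne_zero R t₀ q
    (left_ne_zero_of_mul (left_ne_zero_of_mul hf))
  obtain ⟨y, hy⟩ := X.exists_sixVertex_of_moveCoeff_ne_zero R t₀ q
    (right_ne_zero_of_mul (left_ne_zero_of_mul hf))
  obtain ⟨z, hz⟩ := X.exists_sixVertex_of_moveCoeff_ne_zero R t₀ q (right_ne_zero_of_mul hf)
  have hxy : x ≠ y := fun h => f.2.1.ne (by rw [← hx, ← hy, h])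
  have hyz : y ≠ z := fun h => f.2.2.1.ne (by rw [← hy, ← hz, h])
  have hxz : x ≠ z := fun h => (f.2.1.trans f.2.2.1).ne (by rw [← hx, ← hz, h])
  have hF : ({f.1.1, f.1.2.1, f.1.2.2} : Finset (WithTop V)) =
      ({x, y, z} : Finset _).image (X.sixVertex t₀) := by
    rw [Finset.image_insert, Finset.image_insert, Finset.image_singleton, hx, hy, hz]
  have hcv : ∀ o, c (X.sixVertex t₀ o) = depCoeff (X.simplexPlace R t₀) q o :=
    fun o => X.moveCoeff_sixVertex R t₀ q o
  rw [faceCoeff, ← hc, hF, ← X.triangleArea_sixPoint R t₀ q f hx hy hz, ← ho, ← ho', ← hx, ← hy,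
    ← hz]
  simp only [hcv, angleSum_comp (X.sixVertex_injective t₀)]
  rw [sum_sign_mul_angleSum hg hne hxy hxz hyz, moveConst, sign_eq_div_abs hp]
  have hpr : ∏ k, depCoeff (X.simplexPlace R t₀) q k ≠ 0 := Finset.prod_ne_zero_iff.2
    fun k _ => hne k
  have habs : |signedVolume (X.simplexPlace R t₀)| * |signedVolume (X.simplexPlace R t₀)| =
    signedVolume (X.simplexPlace R t₀) * signedVolume (X.simplexPlace R t₀) := abs_mul_abs_self _
  have h2 := abs_ne_zero.2 hp
  field_simp
  rw [← sq_abs (signedVolume (X.simplexPlace R t₀))]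

/-- The move adds the five new simplices and removes `t₀`. Since the coefficient of the new vertex
is `-1`, these are the six simplices of `sum_sign_mul_angleSum_sixVertex`, with their signs. -/
theorem matrix₂_move_apply [Fintype T] [DecidableEq T] (hX : X.IsNondegenerate R)
    (hX' : (X.move t₀ q).IsNondegenerate R) {g : T → Fin 5 → E4}
    (hg : ∀ t, IsGradient (X.simplexPlace R t) (g t)) (f : (X.move t₀ q).Face)
    (e : (X.move t₀ q).Edge) :
    (X.move t₀ q).matrix₂ R f e =
      -(∑ t, Real.sign (signedVolume (X.simplexPlace R t)) *
        angleSum (fun i => (X.vert t i : WithTop V)) (g t) {f.1.1, f.1.2.1, f.1.2.2} e.1.1 e.1.2) +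
      X.moveConst R t₀ q * X.faceCoeff R t₀ q f *
        (X.moveCoeff R t₀ q e.1.1 * X.moveCoeff R t₀ q e.1.2) := by
  have hp := abs_ne_zero.1 (hX t₀)
  have hne := X.moveCoeff_ne_zero R t₀ q hX hX'
  let g' : {t : T // t ≠ t₀} ⊕ Fin 5 → Fin 5 → E4 := Sum.elim (fun t => g t.1)
    fun k => sixGradient (X.simplexPlace R t₀) q (g t₀) (some k) ∘ simplexLabel (some k)
  have hg' : ∀ t, IsGradient ((X.move t₀ q).simplexPlace R t) (g' t) := by
    rintro (t | k)
    · exact hg t.1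
    · rw [move_simplexPlace_inr]
      exact (hg t₀).sixGradient q (hne _)
  rw [← X.sum_sign_mul_angleSum_sixVertex R t₀ q hX hX' (hg t₀), matrix₂_apply R _ hg',
    Fintype.sum_sum_type, Fintype.sum_option]
  have h1 : ∀ k, Real.sign (signedVolume ((X.move t₀ q).simplexPlace R (Sum.inr k))) =
      Real.sign (signedVolume (X.simplexPlace R t₀)) *
        Real.sign (depCoeff (X.simplexPlace R t₀) q (some k)) := by
    intro k
    rw [move_simplexPlace_inr, signedVolume_sixPoint hp, sign_mul, mul_comm]
  have h2 : sixGradient (X.simplexPlace R t₀) q (g t₀) none ∘ simplexLabel none = g t₀ := by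
    ext1 i
    simp [sixGradient, simplexLabel]
  have h3 : Real.sign (depCoeff (X.simplexPlace R t₀) q none) = -1 :=
    Real.sign_of_neg (by simp [depCoeff])
  have h4 : ∑ t, Real.sign (signedVolume (X.simplexPlace R t)) *
        angleSum (fun i => (X.vert t i : WithTop V)) (g t) {f.1.1, f.1.2.1, f.1.2.2} e.1.1 e.1.2 =
      ∑ t : {t : T // t ≠ t₀}, Real.sign (signedVolume (X.simplexPlace R t)) *
        angleSum (fun i => (X.vert t i : WithTop V)) (g t) {f.1.1, f.1.2.1, f.1.2.2} e.1.1 e.1.2 +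
      Real.sign (signedVolume (X.simplexPlace R t₀)) *
        angleSum (X.sixVertex t₀ ∘ simplexLabel none) (g t₀) {f.1.1, f.1.2.1, f.1.2.2}
          e.1.1 e.1.2 := by
    rw [Fintype.sum_eq_add_sum_subtype_ne _ t₀, add_comm]
    rfl
  simp only [h1, h4, g', Sum.elim_inr, Sum.elim_inl, move_vert_inr]
  rw [h2, h3]
  simp only [mul_assoc, ← Finset.mul_sum]
  have h5 : ∀ t : {t : T // t ≠ t₀}, (X.move t₀ q).simplexPlace R (Sum.inl t) =
    X.simplexPlace R t.1 := fun _ => rfl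
  have h6 : ∀ t : {t : T // t ≠ t₀}, (X.move t₀ q).vert (Sum.inl t) =
    fun i => (X.vert t.1 i : WithTop V) := fun _ => rfl
  simp only [h5, h6]
  ring

/-- Under the move, the matrix of derivatives of deficit angles is extended by zeros and changed by
a matrix of rank one. -/
theorem matrix₂_move [Fintype T] [DecidableEq T] (hX : X.IsNondegenerate R)
    (hX' : (X.move t₀ q).IsNondegenerate R) :
    ((X.move t₀ q).matrix₂ R).submatrix (X.faceEquiv t₀ q) (X.edgeEquiv t₀ q) =
      Matrix.fromBlocks (X.matrix₂ R) 0 0 0 + Matrix.vecMulVec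
        (fun f => X.moveConst R t₀ q * X.faceCoeff R t₀ q (X.faceEquiv t₀ q f))
        (fun e => X.moveCoeff R t₀ q (X.edgeEquiv t₀ q e).1.1 *
          X.moveCoeff R t₀ q (X.edgeEquiv t₀ q e).1.2) := by
  choose g hg using fun t => exists_isGradient (abs_ne_zero.1 (hX t))
  ext f e
  rw [Matrix.submatrix_apply, X.matrix₂_move_apply R t₀ q hX hX' hg, Matrix.add_apply,
    Matrix.vecMulVec_apply]
  refine congrArg (· + _) ?_
  have htop : ∀ t, (⊤ : WithTop V) ∉ Set.range fun i => (X.vert t i : WithTop V) := by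
    rintro t ⟨i, hi⟩
    exact WithTop.coe_ne_top hi
  rcases e with e | k
  · rcases f with f | p
    · rw [Matrix.fromBlocks_apply₁₁, matrix₂_apply R X hg]
      refine congrArg Neg.neg (Finset.sum_congr rfl fun t _ => congrArg _ ?_)
      rw [← angleSum_comp WithTop.coe_injective (X.vert t), Finset.image_insert,
        Finset.image_insert, Finset.image_singleton]
      rfl
    · rw [Matrix.fromBlocks_apply₂₁, Matrix.zero_apply, neg_eq_zero]
      refine Finset.sum_eq_zero fun t _ => mul_eq_zero_of_right _ ?_
      refine angleSum_eq_zero_of_face (x := ⊤) ?_ (htop t) _ _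
      rw [Finset.mem_insert, Finset.mem_insert, Finset.mem_singleton]
      exact Or.inr (Or.inr rfl)
  · have h0 : Matrix.fromBlocks (X.matrix₂ R) 0 0 0 f (Sum.inr k) = (0 : ℝ) := by
      rcases f with f | p <;> rfl
    rw [h0, neg_eq_zero]
    refine Finset.sum_eq_zero fun t _ => mul_eq_zero_of_right _ ?_
    exact angleSum_eq_zero_of_edge (Or.inr (htop t))

end Triangulation4

namespace Triangulation4

variable {Γ : Type*} [Group Γ] {V T J : Type*} [LinearOrder V]
variable (R : Representation4 Γ J) (X : Triangulation4 Γ V T) (t₀ : T) (q : E4)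

/-! ### The blocks of the matrices that belong to the new vertex -/

theorem lin_newEdge (i : Fin 5) :
    X.lin R (X.vert t₀ 0) (X.vert t₀ i) ((X.move t₀ q).edgeVec R (X.vert t₀ i) ⊤) =
      -X.spoke R t₀ q i := by
  rw [spoke, neg_sub]
  exact X.lin_move_edgeVec R t₀ q (some i) none

theorem lin_newEdge_old {i j : Fin 5} :
    X.lin R (X.vert t₀ 0) (X.vert t₀ i) ((X.move t₀ q).edgeVec R (X.vert t₀ i) (X.vert t₀ j)) =
      X.spoke R t₀ q j - X.spoke R t₀ q i := by
  rw [spoke, spoke, sub_sub_sub_cancel_right]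
  exact X.lin_move_edgeVec R t₀ q (some i) (some j)

theorem newLength_eq (i : Fin 5) : X.newLength R t₀ q i = ‖X.spoke R t₀ q i‖ := by
  rw [← norm_neg, ← lin_newEdge, LinearIsometryEquiv.norm_map]
  rfl

theorem newArea_eq {i j : Fin 5} (h : i ≠ j) :
    X.newArea R t₀ q i j h = triangleArea 0 (X.spoke R t₀ q i) (X.spoke R t₀ q j) := by
  have key : ∀ {i j : Fin 5} (h : i ≠ j), X.vert t₀ i ≤ X.vert t₀ j →
      X.newArea R t₀ q i j h = triangleArea 0 (X.spoke R t₀ q i) (X.spoke R t₀ q j) := by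
    intro i j h hle
    have h1 := X.triangleArea_sixPoint R t₀ q (X.newFace t₀ q i j h) (x := some i) (y := some j)
      (z := none) (by simp [newFace, hle, sixVertex]) (by simp [newFace, hle, sixVertex]) rfl
    rw [newArea, ← h1, ← triangleArea_rotate, ← triangleArea_rotate]
    simp only [triangleArea, spoke, sixPoint, Option.elim, sub_zero]
  rcases le_total (X.vert t₀ i) (X.vert t₀ j) with hle | hle
  · exact key h hle
  · rw [triangleArea_swap, ← key h.symm hle, newArea, newFace_comm]
    rfl

section Framing

variable {R X t₀ q} {fr' : (X.move t₀ q).Edge → Fin 3 → E4}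
  (hfr : (X.move t₀ q).IsFraming R fr')
include hfr

theorem IsFraming.orthonormal_newAxis (i : Fin 5) :
    Orthonormal ℝ (X.newAxis R t₀ q fr' i) :=
  (hfr (X.newEdge t₀ q i)).1.comp_linearIsometryEquiv
    (X.lin R (X.vert t₀ 0) (X.vert t₀ i))

theorem IsFraming.inner_newAxis_spoke (i : Fin 5) (k : Fin 3) :
    inner ℝ (X.newAxis R t₀ q fr' i k) (X.spoke R t₀ q i) = 0 := by
  have h := (hfr (X.newEdge t₀ q i)).2 k
  rw [← neg_neg (X.spoke R t₀ q i), ← lin_newEdge, inner_neg_right, neg_eq_zero]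
  exact ((X.lin R (X.vert t₀ 0) (X.vert t₀ i)).inner_map_map _ _).trans h

end Framing

/-- The derivatives of the squared lengths of the new edges with respect to the coordinates of
the new vertex. -/
noncomputable def spokeLengthMatrix : Matrix (Fin 5) (Fin 4) ℝ :=
  Matrix.of fun i α => -2 * X.spoke R t₀ q i α

/-- The derivatives of the areas of the new faces with respect to the deviations of the new
edges. -/
noncomputable def spokeAreaMatrix (fr' : (X.move t₀ q).Edge → Fin 3 → E4) :
    Matrix (Fin 5 × Fin 3) IndexPair ℝ :=
  Matrix.of fun r p => -(X.newLength R t₀ q r.1 ^ 2 / (2 * X.newArea R t₀ q p.1.1 p.1.2 p.2.ne)) *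
    ((if r.1 = p.1.1 then inner ℝ (X.spoke R t₀ q p.1.2) (X.newAxis R t₀ q fr' r.1 r.2) else 0) +
      if r.1 = p.1.2 then inner ℝ (X.spoke R t₀ q p.1.1) (X.newAxis R t₀ q fr' r.1 r.2) else 0)

/-- The derivatives of the deviations of the new edges with respect to that of the new vertex. -/
noncomputable def spokeDeviationMatrix (fr' : (X.move t₀ q).Edge → Fin 3 → E4) :
    Matrix Pair (Fin 5 × Fin 3) ℝ :=
  Matrix.of fun c r => 1 / X.newLength R t₀ q r.1 ^ 2 *
    (X.spoke R t₀ q r.1 c.1.1 * X.newAxis R t₀ q fr' r.1 r.2 c.1.2 -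
      X.spoke R t₀ q r.1 c.1.2 * X.newAxis R t₀ q fr' r.1 r.2 c.1.1)

theorem dL_newEdge [Fintype J] (i : Fin 5) (x : E4) :
    (X.move t₀ q).dL R (Pi.single ⊤ x) 0 (X.newEdge t₀ q i) =
      -2 * inner ℝ (X.spoke R t₀ q i) x := by
  have h1 : (Pi.single ⊤ x : WithTop V → E4) (X.vert t₀ i) = 0 :=
    Pi.single_eq_of_ne WithTop.coe_ne_top _
  have h2 : (Pi.single ⊤ x : WithTop V → E4) ⊤ = x := Pi.single_eq_same _ _
  simp only [dL, newEdge, h1, h2, Pi.zero_apply, zero_smul, Finset.sum_const_zero, add_zero,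
    sub_zero]
  rw [← (X.lin R (X.vert t₀ 0) (X.vert t₀ i)).inner_map_map, lin_newEdge]
  have h3 : X.lin R (X.vert t₀ 0) (X.vert t₀ i)
      ((R.ρ ((X.move t₀ q).hol (X.vert t₀ i) ⊤)).linearIsometryEquiv x) = x := by
    exact (X.lin_lin R t₀ 0 i 0 x).trans (X.lin_self R t₀ 0 x)
  rw [h3, inner_neg_left]
  ring

/-- In the derivative of the area of the face `i j F` with respect to the deviation of an edge from
`F`, the altitude may be replaced by the spoke to the other vertex. -/
theorem areaMatrix_newFace {fr' : (X.move t₀ q).Edge → Fin 3 → E4}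
    (hfr : (X.move t₀ q).IsFraming R fr') {i j : Fin 5} (h : i ≠ j) (m : Fin 5) (k : Fin 3) :
    (X.move t₀ q).areaMatrix R fr' (X.newFace t₀ q i j h) (X.newEdge t₀ q m, k) =
      -(X.newLength R t₀ q m ^ 2 / (2 * X.newArea R t₀ q i j h)) *
    ((if m = i then inner ℝ (X.spoke R t₀ q j) (X.newAxis R t₀ q fr' m k) else 0) +
      if m = j then inner ℝ (X.spoke R t₀ q i) (X.newAxis R t₀ q fr' m k) else 0) := by
  have key : ∀ {i j : Fin 5} (h : i ≠ j), X.vert t₀ i ≤ X.vert t₀ j →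
      (X.move t₀ q).areaMatrix R fr' (X.newFace t₀ q i j h) (X.newEdge t₀ q m, k) =
      -(X.newLength R t₀ q m ^ 2 / (2 * X.newArea R t₀ q i j h)) *
    ((if m = i then inner ℝ (X.spoke R t₀ q j) (X.newAxis R t₀ q fr' m k) else 0) +
      if m = j then inner ℝ (X.spoke R t₀ q i) (X.newAxis R t₀ q fr' m k) else 0) := by
    intro i j h hle
    have hf1 : (X.newFace t₀ q i j h).1.1 = X.vert t₀ i := congrArg _ (min_eq_left hle)
    have hf2 : (X.newFace t₀ q i j h).1.2.1 = X.vert t₀ j := congrArg _ (max_eq_right hle)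
    have h1 : (X.newFace t₀ q i j h).edge₀₁ ≠ X.newEdge t₀ q m := fun h' =>
      WithTop.coe_ne_top (congrArg (fun e : (X.move t₀ q).Edge => e.1.2) h')
    have h2 : (X.newFace t₀ q i j h).edge₀₂ = X.newEdge t₀ q m ↔ m = i := by
      constructor
      · intro h'
        have := hf1.symm.trans (congrArg (fun e : (X.move t₀ q).Edge => e.1.1) h')
        exact (X.vert_injective t₀ (WithTop.coe_injective this)).symm
      · rintro rfl
        exact Subtype.ext (Prod.ext hf1 rfl)
    have h3 : (X.newFace t₀ q i j h).edge₁₂ = X.newEdge t₀ q m ↔ m = j := by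
      constructor
      · intro h'
        have := hf2.symm.trans (congrArg (fun e : (X.move t₀ q).Edge => e.1.1) h')
        exact (X.vert_injective t₀ (WithTop.coe_injective this)).symm
      · rintro rfl
        exact Subtype.ext (Prod.ext hf2 rfl)
    have h4 : ∀ l, inner ℝ ((X.move t₀ q).edgeVec R (X.vert t₀ m) (X.vert t₀ l))
        (fr' (X.newEdge t₀ q m) k) =
        inner ℝ (X.spoke R t₀ q l) (X.newAxis R t₀ q fr' m k) := by
      intro l
      have h5 := IsFraming.inner_newAxis_spoke hfr m k
      rw [real_inner_comm] at h5
      rw [← (X.lin R (X.vert t₀ 0) (X.vert t₀ m)).inner_map_map, lin_newEdge_old, inner_sub_left]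
      change _ - inner ℝ _ (X.newAxis R t₀ q fr' m k) = _
      rw [h5, sub_zero]
      rfl
    rw [areaMatrix, Matrix.of_apply]
    dsimp only
    rw [dS_single R (X.move t₀ q) ((hfr (X.newEdge t₀ q m)).2 k), if_neg h1, zero_add, hf1, hf2]
    rw [if_congr h2 rfl rfl, if_congr h3 rfl rfl]
    refine congrArg₂ _ rfl (congrArg₂ _ (if_congr Iff.rfl (h4 _) rfl)
      (if_congr Iff.rfl (h4 _) rfl))
  rcases le_total (X.vert t₀ i) (X.vert t₀ j) with hle | hle
  · exact key h hle
  · have h1 := key h.symm hle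
    rw [newFace_comm, h1, add_comm, newArea, newArea, newFace_comm]

theorem dotProduct_basisBivector_mulVec (c : Pair) (x y : Fin 4 → ℝ) :
    x ⬝ᵥ (basisBivector c *ᵥ y) = x c.1.1 * y c.1.2 - x c.1.2 * y c.1.1 := by
  rw [basisBivector, Matrix.sub_mulVec, dotProduct_sub, Matrix.single_mulVec,
    Matrix.single_mulVec]
  simp [dotProduct, Function.update_apply]

theorem deviationMatrix_newEdge {fr' : (X.move t₀ q).Edge → Fin 3 → E4} (i : Fin 5) (k : Fin 3)
    (c : Pair) :
    (X.move t₀ q).deviationMatrix R fr' (X.newEdge t₀ q i, k) (⊤, c) =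
      X.spokeDeviationMatrix R t₀ q fr' c (i, k) := by
  rw [deviationMatrix, Matrix.of_apply, inner_dv]
  have h1 : (Pi.single ⊤ (basisBivector c) : WithTop V → Matrix (Fin 4) (Fin 4) ℝ)
      (X.vert t₀ i) = 0 := Pi.single_eq_of_ne WithTop.coe_ne_top _
  have h2 : (Pi.single ⊤ (basisBivector c) : WithTop V → Matrix (Fin 4) (Fin 4) ℝ) ⊤ =
      basisBivector c := Pi.single_eq_same _ _
  have hy : X.newAxis R t₀ q fr' i k =
    X.lin R (X.vert t₀ 0) (X.vert t₀ i) (fr' (X.newEdge t₀ q i) k) := rfl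
  dsimp only
  rw [spokeDeviationMatrix, Matrix.of_apply, hy]
  generalize fr' (X.newEdge t₀ q i) k = y
  simp only [newEdge, h1, h2, zero_sub]
  have h3 : ∀ x : E4, x = (R.ρ ((X.move t₀ q).hol (X.vert t₀ i) ⊤)).linearIsometryEquiv
      (X.lin R (X.vert t₀ 0) (X.vert t₀ i) x) := fun x =>
    ((X.lin_lin R t₀ i 0 i x).trans (X.lin_self R t₀ i x)).symm
  rw [h3 ((X.move t₀ q).edgeVec R (X.vert t₀ i) ⊤), Matrix.neg_mulVec, dotProduct_neg]
  rw [h3 y, dotProduct_conj_mulVec, lin_newEdge, dotProduct_basisBivector_mulVec, ← h3 y]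
  change 1 / X.newLength R t₀ q i ^ 2 * _ = _
  simp only [PiLp.neg_apply]
  ring

section Blocks

variable {ι₀ ι₆ : Type*} (a : Module.Basis ι₀ ℝ R.motions)
  (s : Module.Basis ι₆ ℝ R.trivialDeviations)

/-- The displacements of the old vertices remain the same. -/
theorem matrix₀_move :
    ((X.move t₀ q).matrix₀ R a).submatrix (coordEquiv V J) id =
      Matrix.fromRows (X.matrix₀ R a)
        (((X.move t₀ q).matrix₀ R a).submatrix (coordEquiv V J) id).toRows₂ := by
  ext (r | r) i
  · rcases r with r | r <;> rfl
  · rfl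

/-- The old lengths do not depend on the position of the new vertex. -/
theorem matrix₁_move [Fintype J] :
    ((X.move t₀ q).matrix₁ R).submatrix (X.edgeEquiv t₀ q) (coordEquiv V J) =
      Matrix.fromBlocks (X.matrix₁ R) 0
        (((X.move t₀ q).matrix₁ R).submatrix (X.edgeEquiv t₀ q) (coordEquiv V J)).toBlocks₂₁
        (X.spokeLengthMatrix R t₀ q) := by
  have hs : ∀ (v w : V) (x : E4), (Pi.single (v : WithTop V) x : WithTop V → E4) (w : WithTop V) =
      (Pi.single v x : V → E4) w := by
    intro v w x
    simp [Pi.single_apply]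
  ext (e | i) (c | α)
  · rcases c with ⟨v, α⟩ | j
    · change (X.move t₀ q).dL R (Pi.single (v : WithTop V) _) 0 (X.oldEdge t₀ q e) =
        X.dL R (Pi.single v _) 0 e
      simp only [dL, oldEdge, hs]
      rfl
    · rfl
  · change (X.move t₀ q).dL R (Pi.single (⊤ : WithTop V) _) 0 (X.oldEdge t₀ q e) = 0
    have h : ∀ (w : V) (x : E4), (Pi.single (⊤ : WithTop V) x : WithTop V → E4) w = 0 :=
      fun w x => Pi.single_eq_of_ne WithTop.coe_ne_top _
    simp only [dL, oldEdge, h, map_zero, Pi.zero_apply, zero_smul, Finset.sum_const_zero,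
      add_zero, sub_zero, inner_zero_right, mul_zero]
  · rfl
  · change (X.move t₀ q).dL R (Pi.single (⊤ : WithTop V) _) 0 (X.newEdge t₀ q i) = _
    rw [dL_newEdge, Matrix.fromBlocks_apply₂₂, spokeLengthMatrix, Matrix.of_apply]
    simp [EuclideanSpace.inner_single_right]

/-- The areas of the old faces do not depend on the deviations of the new edges. -/
theorem areaMatrix_move {fr : X.Edge → Fin 3 → E4} {fr' : (X.move t₀ q).Edge → Fin 3 → E4}
    (hfr : (X.move t₀ q).IsFraming R fr') (hold : ∀ e, fr' (X.oldEdge t₀ q e) = fr e) :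
    ((X.move t₀ q).areaMatrix R fr')ᵀ.submatrix (X.edgeAxisEquiv t₀ q) (X.faceEquiv t₀ q) =
      Matrix.fromBlocks (X.areaMatrix R fr)ᵀ
        (((X.move t₀ q).areaMatrix R fr')ᵀ.submatrix (X.edgeAxisEquiv t₀ q)
          (X.faceEquiv t₀ q)).toBlocks₁₂ 0 (X.spokeAreaMatrix R t₀ q fr') := by
  ext (⟨e, k⟩ | ⟨i, k⟩) (f | p)
  · change (X.move t₀ q).dS R (Pi.single (X.oldEdge t₀ q e) (fr' (X.oldEdge t₀ q e) k))
      (X.oldFace t₀ q f) = X.dS R (Pi.single e (fr e k)) f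
    rw [hold]
    have hs : ∀ (e' : X.Edge) (x : E4), (Pi.single (X.oldEdge t₀ q e) x : _ → E4)
        (X.oldEdge t₀ q e') = (Pi.single e x : X.Edge → E4) e' := by
      intro e' x
      simp only [Pi.single_apply, (X.oldEdge_injective t₀ q).eq_iff]
    rw [dS, dS, ← hs, ← hs, ← hs]
    rfl
  · rfl
  · change (X.move t₀ q).dS R (Pi.single (X.newEdge t₀ q i) _) (X.oldFace t₀ q f) = 0
    have hs : ∀ (e' : X.Edge) (x : E4), (Pi.single (X.newEdge t₀ q i) x : _ → E4)
        (X.oldEdge t₀ q e') = 0 := by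
      intro e' x
      refine Pi.single_eq_of_ne (fun h => ?_) _
      exact WithTop.coe_ne_top (congrArg (fun e : (X.move t₀ q).Edge => e.1.2) h)
    have h1 := hs f.edge₀₁ (fr' (X.newEdge t₀ q i) k)
    have h2 := hs f.edge₀₂ (fr' (X.newEdge t₀ q i) k)
    have h3 := hs f.edge₁₂ (fr' (X.newEdge t₀ q i) k)
    have h4 : (X.oldFace t₀ q f).edge₀₁ = X.oldEdge t₀ q f.edge₀₁ := rfl
    have h5 : (X.oldFace t₀ q f).edge₀₂ = X.oldEdge t₀ q f.edge₀₂ := rfl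
    have h6 : (X.oldFace t₀ q f).edge₁₂ = X.oldEdge t₀ q f.edge₁₂ := rfl
    simp only [dS, h4, h5, h6]
    erw [h1, h2, h3]
    simp only [map_zero, inner_zero_right, add_zero]
  · exact X.areaMatrix_newFace R t₀ q hfr p.2.ne i k

/-- The deviations of the old edges do not depend on the deviation of the new vertex. -/
theorem deviationMatrix_move {fr : X.Edge → Fin 3 → E4}
    {fr' : (X.move t₀ q).Edge → Fin 3 → E4} (hold : ∀ e, fr' (X.oldEdge t₀ q e) = fr e) :
    ((X.move t₀ q).deviationMatrix R fr')ᵀ.submatrix (vertexPairEquiv V) (X.edgeAxisEquiv t₀ q) =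
      Matrix.fromBlocks (X.deviationMatrix R fr)ᵀ
        (((X.move t₀ q).deviationMatrix R fr')ᵀ.submatrix (vertexPairEquiv V)
          (X.edgeAxisEquiv t₀ q)).toBlocks₁₂ 0 (X.spokeDeviationMatrix R t₀ q fr') := by
  ext (⟨v, c⟩ | c) (⟨e, k⟩ | ⟨i, k⟩)
  · change inner ℝ (fr' (X.oldEdge t₀ q e) k)
      ((X.move t₀ q).dv R (Pi.single (v : WithTop V) (basisBivector c)) (X.oldEdge t₀ q e)) =
      inner ℝ (fr e k) (X.dv R (Pi.single v (basisBivector c)) e)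
    have hs : ∀ (w : V) (x : Matrix (Fin 4) (Fin 4) ℝ),
        (Pi.single (v : WithTop V) x : WithTop V → _) (w : WithTop V) =
        (Pi.single v x : V → _) w := by
      intro w x
      simp [Pi.single_apply]
    rw [hold]
    simp only [dv, oldEdge, hs]
    rfl
  · rfl
  · change inner ℝ (fr' (X.oldEdge t₀ q e) k)
      ((X.move t₀ q).dv R (Pi.single (⊤ : WithTop V) (basisBivector c)) (X.oldEdge t₀ q e)) = 0
    have hs : ∀ (w : V) (x : Matrix (Fin 4) (Fin 4) ℝ),
        (Pi.single (⊤ : WithTop V) x : WithTop V → _) (w : WithTop V) = 0 :=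
      fun w x => Pi.single_eq_of_ne WithTop.coe_ne_top _
    simp only [dv, oldEdge, hs, Matrix.mul_zero, Matrix.zero_mul, sub_zero, Matrix.vecMul_zero,
      WithLp.toLp_zero, smul_zero, inner_zero_right]
  · exact X.deviationMatrix_newEdge R t₀ q i k c

/-- The values of a trivial deviation at the old vertices remain the same. -/
theorem trivialMatrix_move :
    ((X.move t₀ q).trivialMatrix R s)ᵀ.submatrix id (vertexPairEquiv V) =
      Matrix.fromCols (X.trivialMatrix R s)ᵀ
        (((X.move t₀ q).trivialMatrix R s)ᵀ.submatrix id (vertexPairEquiv V)).toCols₂ := by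
  ext i (c | c) <;> rfl

end Blocks

end Triangulation4

/-! ### Exactness for the new vertex -/

/-- Five vectors spanning four-space, with their linear dependence `l`, which has no zero
coefficient. -/
structure IsSpokeSystem (s : Fin 5 → E4) (l : Fin 5 → ℝ) : Prop where
  ne_zero : ∀ i, l i ≠ 0
  sum_smul : ∑ i, l i • s i = 0
  exists_dual : ∃ h : Fin 4 → E4, ∀ i j : Fin 4, inner ℝ (h i) (s j.castSucc) = if i = j then 1 else 0
  eq_zero : ∀ x, (∀ i, inner ℝ x (s i) = 0) → x = 0

namespace IsSpokeSystem

variable {s : Fin 5 → E4} {l : Fin 5 → ℝ} (hs : IsSpokeSystem s l)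
include hs

/-- The linear dependence is unique up to a factor. -/
theorem exists_eq_smul {y : Fin 5 → ℝ} (hy : ∑ i, y i • s i = 0) : ∃ r : ℝ, ∀ i, y i = r * l i := by
  obtain ⟨h, hh⟩ := hs.exists_dual
  refine ⟨y 4 / l 4, fun i => ?_⟩
  have h4 := hs.ne_zero 4
  have hz : ∑ i, (y i - y 4 / l 4 * l i) • s i = 0 := by
    simp only [sub_smul, Finset.sum_sub_distrib, hy, mul_smul, ← Finset.smul_sum, hs.sum_smul]
    simp
  rw [← sub_eq_zero]
  rcases Fin.eq_castSucc_or_eq_last i with ⟨j, rfl⟩ | rfl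
  · have h1 := congrArg (inner ℝ (h j)) hz
    rw [Fin.sum_univ_castSucc, inner_add_right, inner_sum, inner_zero_right] at h1
    simp only [inner_smul_right, hh] at h1
    have h5 : y (Fin.last 4) - y 4 / l 4 * l (Fin.last 4) = 0 := by
      change y 4 - y 4 / l 4 * l 4 = 0
      field_simp
      ring
    rw [h5, zero_mul, add_zero] at h1
    simpa using h1
  · change y 4 - y 4 / l 4 * l 4 = 0
    field_simp
    ring

/-- The dependence is the only condition on the inner products of a vector with the five spokes. -/
theorem exists_inner_eq {y : Fin 5 → ℝ} (hy : ∑ i, l i * y i = 0) :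
    ∃ x : E4, ∀ i, inner ℝ x (s i) = y i := by
  obtain ⟨h, hh⟩ := hs.exists_dual
  have h4 := hs.ne_zero 4
  have h1 : ∀ j : Fin 4, inner ℝ (∑ i, y i.castSucc • h i) (s j.castSucc) = y j.castSucc := by
    intro j
    simp [sum_inner, real_inner_smul_left, hh]
  refine ⟨∑ i, y i.castSucc • h i, fun i => ?_⟩
  rcases Fin.eq_castSucc_or_eq_last i with ⟨j, rfl⟩ | rfl
  · exact h1 j
  · have h2 := congrArg (inner ℝ (∑ i, y i.castSucc • h i)) hs.sum_smul
    rw [inner_sum, Fin.sum_univ_castSucc, inner_zero_right] at h2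
    simp only [inner_smul_right, h1] at h2
    rw [Fin.sum_univ_castSucc] at hy
    exact mul_left_cancel₀ h4 (add_left_cancel (h2.trans hy.symm))

theorem spoke_ne_zero (i : Fin 5) : s i ≠ 0 := by
  intro h0
  obtain ⟨r, hr⟩ := hs.exists_eq_smul (y := Pi.single i 1) (by
    rw [Finset.sum_eq_single i]
    · simp [h0]
    · intro j _ hj
      simp [Pi.single_eq_of_ne hj]
    · simp)
  have h1 := hr i
  have h2 := hr (i + 1)
  rw [Pi.single_eq_same] at h1
  rw [Pi.single_eq_of_ne (by fin_cases i <;> decide)] at h2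
  rcases mul_eq_zero.1 h2.symm with h3 | h3
  · rw [h3] at h1
    norm_num at h1
  · exact hs.ne_zero _ h3

variable {w : Fin 5 → Fin 3 → E4} (hw : ∀ i, Orthonormal ℝ (w i))
  (hws : ∀ i k, inner ℝ (w i k) (s i) = 0)
include hw hws

theorem eq_zero_of_inner_axis {i : Fin 5} {x : E4} (hx : inner ℝ x (s i) = 0)
    (hxw : ∀ k, inner ℝ (w i k) x = 0) : x = 0 := by
  rw [← sum_inner_smul_of_orthonormal (hw i) (hws i) (hs.spoke_ne_zero i) hx]
  simp [hxw]

/-- A symmetric matrix such that every row is, up to its diagonal entry, a linear dependence of the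
spokes, is a multiple of `l lᵀ` off the diagonal. -/
theorem exists_eq_mul_mul {z : Fin 5 → Fin 5 → ℝ} (hz : ∀ i j, z i j = z j i)
    (hzw : ∀ i k, inner ℝ (∑ j, z i j • s j) (w i k) = 0) :
    ∃ r : ℝ, ∀ i j, i ≠ j → z i j = r * (l i * l j) := by
  have h1 : ∀ i, ∃ r : ℝ, ∀ j, i ≠ j → z i j = r * l j := by
    intro i
    have hsi : inner ℝ (s i) (s i) ≠ 0 := by
      rw [Ne, inner_self_eq_zero]
      exact hs.spoke_ne_zero i
    set x := ∑ j, z i j • s j with hx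
    set m := inner ℝ x (s i) / inner ℝ (s i) (s i) with hm
    have h2 : x - m • s i = 0 := by
      refine hs.eq_zero_of_inner_axis hw hws (i := i) ?_ fun k => ?_
      · rw [inner_sub_left, real_inner_smul_left, hm, div_mul_cancel₀ _ hsi, sub_self]
      · rw [inner_sub_right, inner_smul_right, hws, real_inner_comm, hzw, mul_zero, sub_zero]
    obtain ⟨r, hr⟩ := hs.exists_eq_smul (y := fun j => z i j - if j = i then m else 0) (by
      simp only [sub_smul, Finset.sum_sub_distrib, ite_smul, zero_smul, Finset.sum_ite_eq',
        Finset.mem_univ, if_true]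
      exact h2)
    refine ⟨r, fun j hj => ?_⟩
    have := hr j
    simpa [hj.symm] using this
  choose r hr using h1
  have h0 := hs.ne_zero 0
  refine ⟨r 0 / l 0, fun i j hij => ?_⟩
  have h2 : ∀ i, r i = r 0 / l 0 * l i := by
    intro i
    by_cases hi : i = 0
    · rw [hi, div_mul_cancel₀ _ h0]
    · have h3 := hz i 0
      rw [hr i 0 hi, hr 0 i (Ne.symm hi)] at h3
      field_simp
      linarith
  rw [hr i j hij, h2 i]
  ring

end IsSpokeSystem

theorem eq_zero_of_forall_vecMul_eq_zero {s : Fin 5 → E4} {l : Fin 5 → ℝ} (hs : IsSpokeSystem s l)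
    {B : Matrix (Fin 4) (Fin 4) ℝ} (h : ∀ i, (s i).ofLp ᵥ* B = 0) : B = 0 := by
  ext α β
  have h1 := hs.eq_zero (WithLp.toLp 2 fun α => B α β) fun i => by
    rw [real_inner_comm, inner_eq_dotProduct]
    exact congrFun (h i) β
  exact congrFun (congrArg WithLp.ofLp h1) α

/-- The bivector with given components. -/
def bivectorOf (σ : Triangulation4.Pair → ℝ) : Matrix (Fin 4) (Fin 4) ℝ :=
  Matrix.of fun α β => if h : α < β then σ ⟨(α, β), h⟩ else if h : β < α then -σ ⟨(β, α), h⟩ else 0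

theorem bivectorOf_skew (σ : Triangulation4.Pair → ℝ) : (bivectorOf σ)ᵀ = -bivectorOf σ := by
  ext α β
  rw [Matrix.transpose_apply, Matrix.neg_apply, bivectorOf, Matrix.of_apply, Matrix.of_apply]
  rcases lt_trichotomy α β with h | h | h
  · simp [h, h.asymm]
  · subst h; simp
  · simp [h, h.asymm]

theorem bivectorOf_apply (σ : Triangulation4.Pair → ℝ) (c : Triangulation4.Pair) :
    bivectorOf σ c.1.1 c.1.2 = σ c := by
  rw [bivectorOf, Matrix.of_apply, dif_pos c.2]

theorem dotProduct_bivectorOf_mulVec (σ : Triangulation4.Pair → ℝ) (x y : Fin 4 → ℝ) :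
    x ⬝ᵥ (bivectorOf σ *ᵥ y) = ∑ c, σ c * (x c.1.1 * y c.1.2 - x c.1.2 * y c.1.1) := by
  rw [← sum_smul_basisBivector (bivectorOf_skew σ), Matrix.sum_mulVec, dotProduct_sum]
  refine Finset.sum_congr rfl fun c _ => ?_
  rw [Matrix.smul_mulVec, dotProduct_smul, Triangulation4.dotProduct_basisBivector_mulVec,
    bivectorOf_apply, smul_eq_mul]

theorem mulVec_surjective_of_vecMul_injective {m n : Type*} [Fintype m] [Fintype n]
    (M : Matrix m n ℝ) (h : ∀ y, y ᵥ* M = 0 → y = 0) (y : m → ℝ) : ∃ x, M *ᵥ x = y := by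
  have h1 : Mᵀ.rank = Fintype.card m := by
    classical
    have h2 : LinearMap.ker Mᵀ.mulVecLin = ⊥ := by
      rw [LinearMap.ker_eq_bot']
      intro y hy
      rw [Matrix.mulVecLin_apply, Matrix.mulVec_transpose] at hy
      exact h y hy
    have h3 := Mᵀ.mulVecLin.finrank_range_add_finrank_ker
    rw [h2, finrank_bot, add_zero, Module.finrank_fintype_fun_eq_card] at h3
    exact h3
  rw [Matrix.rank_transpose] at h1
  have h4 : LinearMap.range M.mulVecLin = ⊤ := by
    apply Submodule.eq_top_of_finrank_eq
    rw [Module.finrank_fintype_fun_eq_card]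
    exact h1
  have h5 : y ∈ LinearMap.range M.mulVecLin := h4 ▸ Submodule.mem_top
  exact h5

/-- A dimension count for the exactness of a sequence of two matrices. -/
theorem exists_mulVec_eq_of_card {m n p : Type*} [Fintype m] [Fintype n] [Fintype p]
    {A : Matrix m n ℝ} {B : Matrix n p ℝ} {c : p → ℝ} (hAB : A * B = 0)
    (hA : ∀ y, ∃ x, A *ᵥ x = y) (hB : ∀ y, B *ᵥ y = 0 → ∃ r : ℝ, y = r • c)
    (hcard : Fintype.card n + 1 ≤ Fintype.card m + Fintype.card p) {y : n → ℝ}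
    (hy : A *ᵥ y = 0) : ∃ x, B *ᵥ x = y := by
  have h1 := A.mulVecLin.finrank_range_add_finrank_ker
  have h2 := B.mulVecLin.finrank_range_add_finrank_ker
  have h3 : Module.finrank ℝ (LinearMap.ker B.mulVecLin) ≤ 1 := by
    refine (Submodule.finrank_mono (t := Submodule.span ℝ {c}) ?_).trans
      ((finrank_span_le_card ({c} : Set (p → ℝ))).trans (by simp))
    intro y hy
    obtain ⟨r, rfl⟩ := hB y hy
    exact Submodule.mem_span_singleton.2 ⟨r, rfl⟩
  have h4 : LinearMap.range A.mulVecLin = ⊤ := LinearMap.range_eq_top.2 hA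
  have h5 : LinearMap.range B.mulVecLin ≤ LinearMap.ker A.mulVecLin := by
    rintro _ ⟨x, rfl⟩
    rw [LinearMap.mem_ker, Matrix.mulVecLin_apply, Matrix.mulVecLin_apply, Matrix.mulVec_mulVec,
      hAB, Matrix.zero_mulVec]
  rw [h4, finrank_top, Module.finrank_fintype_fun_eq_card, Module.finrank_fintype_fun_eq_card]
    at h1
  rw [Module.finrank_fintype_fun_eq_card] at h2
  have h6 := Submodule.eq_of_le_of_finrank_le h5 (by omega)
  have h7 : y ∈ LinearMap.range B.mulVecLin := h6 ▸ LinearMap.mem_ker.2 hy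
  exact h7

theorem sum_indexPair (F : Fin 5 → Fin 5 → ℝ) :
    ∑ p : Triangulation4.IndexPair, F p.1.1 p.1.2 = ∑ i, ∑ j, if i < j then F i j else 0 := by
  rw [← Fintype.sum_prod_type' (f := fun i j => if i < j then F i j else 0), ← Finset.sum_filter]
  exact (Finset.sum_subtype _ (by simp) fun p : Fin 5 × Fin 5 => F p.1 p.2).symm

namespace Triangulation4

variable {Γ : Type*} [Group Γ] {V T J : Type*} [LinearOrder V]
variable {R : Representation4 Γ J} {X : Triangulation4 Γ V T} {t₀ : T} {q : E4}

theorem IsNondegenerate.area_ne_zero (hX : X.IsNondegenerate R)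
    (f : X.Face) : X.area R f ≠ 0 := by
  obtain ⟨t, ⟨i, hi⟩, ⟨j, hj⟩, ⟨k, hk⟩⟩ := f.2.2.2
  have hij : i ≠ j := fun h => f.2.1.ne (by rw [← hi, ← hj, h])
  have hjk : j ≠ k := fun h => f.2.2.1.ne (by rw [← hj, ← hk, h])
  have hik : i ≠ k := fun h => (f.2.1.trans f.2.2.1).ne (by rw [← hi, ← hk, h])
  have harea : X.area R f =
      triangleArea (X.simplexPlace R t i) (X.simplexPlace R t j) (X.simplexPlace R t k) := by
    rw [← motion_coord, ← motion_place R X t i j, ← motion_place R X t i k, triangleArea_map, hi,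
      hj, hk]
    rfl
  obtain ⟨g, hg⟩ := exists_isGradient (abs_ne_zero.1 (hX t))
  obtain ⟨m, n, hnd⟩ : ∃ m n : Fin 5, [i, j, k, m, n].Nodup := by
    clear harea hi hj hk
    revert i j k
    decide
  have hmn : m ≠ n := by
    simp only [List.nodup_cons, List.mem_cons, List.not_mem_nil, or_false] at hnd
    tauto
  have h1 := hg.sqrt_gram_det hnd
  have h2 := Real.sqrt_pos.2 (hg.gram_det_pos hmn)
  rw [h1, ← harea] at h2
  intro h0
  rw [h0, zero_div] at h2
  exact lt_irrefl _ h2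

variable (hX : X.IsNondegenerate R) (hX' : (X.move t₀ q).IsNondegenerate R)
include hX hX'

/-- Four of the spokes are a basis because the new simplices are nondegenerate. -/
theorem isSpokeSystem : IsSpokeSystem (X.spoke R t₀ q) (baryCoord (X.simplexPlace R t₀) q) := by
  have hV := abs_ne_zero.1 (hX' (Sum.inr 4))
  rw [move_simplexPlace_inr, sixPoint_comp_some] at hV
  have hP : ∀ j : Fin 4, Function.update (X.simplexPlace R t₀) 4 q j.castSucc -
      Function.update (X.simplexPlace R t₀) 4 q 4 = X.spoke R t₀ q j.castSucc := by
    intro j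
    rw [Function.update_self, Function.update_of_ne (show j.castSucc ≠ 4 from
      (Fin.castSucc_lt_last j).ne), spoke]
  refine ⟨fun i => X.moveCoeff_ne_zero R t₀ q hX hX' (some i), ?_, ?_, ?_⟩
  · have h := sum_depCoeff_smul_sub q (abs_ne_zero.1 (hX t₀)) q
    rw [Fintype.sum_option] at h
    simpa [sixPoint, depCoeff, spoke] using h
  · obtain ⟨g, hg⟩ := exists_isGradient hV
    refine ⟨fun i => g i.castSucc, fun i j => ?_⟩
    rw [← hP, hg, if_neg (show i.castSucc ≠ 4 from (Fin.castSucc_lt_last i).ne), sub_zero]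
    simp only [Fin.castSucc_inj]
  · intro x hx
    refine eq_zero_of_inner_edges hV 4 fun i => ?_
    rcases Fin.eq_castSucc_or_eq_last i with ⟨j, rfl⟩ | rfl
    · rw [hP, hx]
    · change inner ℝ x (Function.update (X.simplexPlace R t₀) 4 q 4 - _) = 0
      rw [sub_self, inner_zero_right]

theorem newLength_ne_zero (i : Fin 5) : X.newLength R t₀ q i ≠ 0 := by
  rw [newLength_eq, norm_ne_zero_iff]
  exact (isSpokeSystem hX hX').spoke_ne_zero i

omit hX in
theorem newArea_ne_zero {i j : Fin 5} (h : i ≠ j) : X.newArea R t₀ q i j h ≠ 0 :=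
  hX'.area_ne_zero _

variable {fr' : (X.move t₀ q).Edge → Fin 3 → E4} (hfr : (X.move t₀ q).IsFraming R fr')

theorem spokeLengthMatrix_mulVec (x : Fin 4 → ℝ) (i : Fin 5) :
    (X.spokeLengthMatrix R t₀ q *ᵥ x) i = -2 * inner ℝ (WithLp.toLp 2 x) (X.spoke R t₀ q i) := by
  rw [real_inner_comm, inner_eq_dotProduct]
  simp only [Matrix.mulVec, spokeLengthMatrix, dotProduct, Matrix.of_apply, mul_assoc,
    ← Finset.mul_sum]

theorem spokeLengthMatrix_injective (x : Fin 4 → ℝ) (hx : X.spokeLengthMatrix R t₀ q *ᵥ x = 0) :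
    x = 0 := by
  have h := (isSpokeSystem hX hX').eq_zero (WithLp.toLp 2 x) fun i => by
    have h1 := congrFun hx i
    rw [spokeLengthMatrix_mulVec hX hX', Pi.zero_apply] at h1
    linarith
  exact congrArg WithLp.ofLp h

theorem exists_spokeLengthMatrix_mulVec_eq (y : Fin 5 → ℝ)
    (hy : (fun i => -baryCoord (X.simplexPlace R t₀) q i) ⬝ᵥ y = 0) :
    ∃ x, X.spokeLengthMatrix R t₀ q *ᵥ x = y := by
  obtain ⟨x, hx⟩ := (isSpokeSystem hX hX').exists_inner_eq (y := fun i => -(y i / 2)) (by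
    simp only [dotProduct, neg_mul, Finset.sum_neg_distrib, neg_eq_zero] at hy
    simp only [mul_neg, mul_div_assoc', Finset.sum_neg_distrib, ← Finset.sum_div, hy]
    simp)
  refine ⟨x.ofLp, funext fun i => ?_⟩
  rw [spokeLengthMatrix_mulVec hX hX', WithLp.toLp_ofLp, hx]
  ring

include hfr

/-- The kernel of the block of areas is spanned by the numbers `S_{ijF} λ_i λ_j`. -/
theorem exists_eq_smul_of_spokeAreaMatrix (y : IndexPair → ℝ)
    (hy : X.spokeAreaMatrix R t₀ q fr' *ᵥ y = 0) :
    ∃ r : ℝ, y = r • fun p : IndexPair => X.newArea R t₀ q p.1.1 p.1.2 p.2.ne *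
      (baryCoord (X.simplexPlace R t₀) q p.1.1 * baryCoord (X.simplexPlace R t₀) q p.1.2) := by
  -- The components of `y` divided by the areas, as a symmetric matrix.
  let z (i j : Fin 5) : ℝ := if h : i < j then y ⟨(i, j), h⟩ / X.newArea R t₀ q i j h.ne else
    if h : j < i then y ⟨(j, i), h⟩ / X.newArea R t₀ q j i h.ne else 0
  have hlt : ∀ {i j : Fin 5} (h : i < j), z i j = y ⟨(i, j), h⟩ / X.newArea R t₀ q i j h.ne :=
    fun h => dif_pos h
  have hsymm : ∀ i j, z i j = z j i := by
    intro i j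
    rcases lt_trichotomy i j with h | rfl | h
    · simp only [z, h, h.asymm, dite_true, dite_false]
    · rfl
    · simp only [z, h, h.asymm, dite_true, dite_false]
  have hz0 : ∀ i, z i i = 0 := fun i => by simp [z]
  obtain ⟨r, hr⟩ := (isSpokeSystem hX hX').exists_eq_mul_mul (IsFraming.orthonormal_newAxis hfr)
    (IsFraming.inner_newAxis_spoke hfr) hsymm (by
      intro i k
      have h1 := congrFun hy (i, k)
      have h2 : (X.spokeAreaMatrix R t₀ q fr' *ᵥ y) (i, k) = -(X.newLength R t₀ q i ^ 2 / 2) *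
          ∑ p : IndexPair, ((if i = p.1.1 then z p.1.1 p.1.2 * inner ℝ (X.spoke R t₀ q p.1.2)
            (X.newAxis R t₀ q fr' i k) else 0) + (if i = p.1.2 then z p.1.1 p.1.2 *
              inner ℝ (X.spoke R t₀ q p.1.1) (X.newAxis R t₀ q fr' i k) else 0)) := by
        rw [Finset.mul_sum, Matrix.mulVec, dotProduct]
        refine Finset.sum_congr rfl fun p _ => ?_
        rw [spokeAreaMatrix, Matrix.of_apply, hlt p.2]
        dsimp only
        split_ifs <;> field_simp <;> ring
      have h3 : ∑ p : IndexPair, ((if i = p.1.1 then z p.1.1 p.1.2 *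
            inner ℝ (X.spoke R t₀ q p.1.2)
            (X.newAxis R t₀ q fr' i k) else 0) + (if i = p.1.2 then z p.1.1 p.1.2 *
              inner ℝ (X.spoke R t₀ q p.1.1) (X.newAxis R t₀ q fr' i k) else 0)) =
          ∑ j, z i j * inner ℝ (X.spoke R t₀ q j) (X.newAxis R t₀ q fr' i k) := by
        rw [sum_indexPair (fun a b => (if i = a then z a b * inner ℝ (X.spoke R t₀ q b)
            (X.newAxis R t₀ q fr' i k) else 0) + (if i = b then z a b *
              inner ℝ (X.spoke R t₀ q a) (X.newAxis R t₀ q fr' i k) else 0))]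
        have h4 : ∀ a b : Fin 5, (if a < b then (if i = a then z a b *
            inner ℝ (X.spoke R t₀ q b) (X.newAxis R t₀ q fr' i k) else 0) + (if i = b then z a b *
              inner ℝ (X.spoke R t₀ q a) (X.newAxis R t₀ q fr' i k) else 0) else 0) =
            (if i = a then if a < b then z a b *
            inner ℝ (X.spoke R t₀ q b) (X.newAxis R t₀ q fr' i k) else 0 else 0) +
            (if i = b then if a < b then z a b *
              inner ℝ (X.spoke R t₀ q a) (X.newAxis R t₀ q fr' i k) else 0 else 0) := by
          intro a b
          split_ifs <;> simp
        simp only [h4, Finset.sum_add_distrib]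
        simp only [Finset.sum_ite_irrel, Finset.sum_const_zero, Finset.sum_ite_eq,
          Finset.mem_univ, if_true]
        rw [← Finset.sum_add_distrib]
        refine Finset.sum_congr rfl fun j _ => ?_
        rcases lt_trichotomy i j with h | rfl | h
        · simp [h, h.asymm]
        · simp [hz0]
        · simp [h, h.asymm, hsymm j i]
      rw [h2, h3, Pi.zero_apply] at h1
      have h5 := newLength_ne_zero hX hX' i
      rw [sum_inner]
      simp only [real_inner_smul_left]
      refine (mul_eq_zero.1 h1).resolve_left ?_
      simp [h5])
  refine ⟨r, funext fun p => ?_⟩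
  have h1 := hr p.1.1 p.1.2 p.2.ne
  rw [hlt p.2, div_eq_iff (newArea_ne_zero hX' _)] at h1
  rw [Pi.smul_apply, smul_eq_mul]
  linear_combination h1

/-- Dually, a bivector at the new vertex that causes no deviation of the new edges is zero: its
contraction with every spoke is orthogonal to the spoke and to its axes. -/
theorem exists_spokeDeviationMatrix_mulVec_eq (y : Pair → ℝ) :
    ∃ x, X.spokeDeviationMatrix R t₀ q fr' *ᵥ x = y := by
  refine mulVec_surjective_of_vecMul_injective _ (fun σ hσ => ?_) y
  have hs := isSpokeSystem hX hX'
  have h1 : ∀ i k, (X.spoke R t₀ q i).ofLp ⬝ᵥ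
      (bivectorOf σ *ᵥ (X.newAxis R t₀ q fr' i k).ofLp) = 0 := by
    intro i k
    have h2 := congrFun hσ (i, k)
    rw [dotProduct_bivectorOf_mulVec]
    have h3 : (σ ᵥ* X.spokeDeviationMatrix R t₀ q fr') (i, k) = 1 / X.newLength R t₀ q i ^ 2 *
        ∑ c : Pair, σ c * (X.spoke R t₀ q i c.1.1 * X.newAxis R t₀ q fr' i k c.1.2 -
          X.spoke R t₀ q i c.1.2 * X.newAxis R t₀ q fr' i k c.1.1) := by
      rw [Finset.mul_sum, Matrix.vecMul, dotProduct]
      refine Finset.sum_congr rfl fun c _ => ?_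
      rw [spokeDeviationMatrix, Matrix.of_apply]
      ring
    rw [h3, Pi.zero_apply] at h2
    refine (mul_eq_zero.1 h2).resolve_left ?_
    have := newLength_ne_zero hX hX' i
    simp [this]
  have h4 : bivectorOf σ = 0 := eq_zero_of_forall_vecMul_eq_zero hs fun i => by
    have h5 := hs.eq_zero_of_inner_axis (IsFraming.orthonormal_newAxis hfr)
      (IsFraming.inner_newAxis_spoke hfr) (i := i)
      (x := WithLp.toLp 2 ((X.spoke R t₀ q i).ofLp ᵥ* bivectorOf σ)) (by
        rw [inner_eq_dotProduct, ← Matrix.dotProduct_mulVec]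
        exact inner_mulVec_of_skew (bivectorOf_skew σ) _) (fun k => by
        rw [real_inner_comm, inner_eq_dotProduct, ← Matrix.dotProduct_mulVec]
        exact h1 i k)
    exact congrArg WithLp.ofLp h5
  ext c
  rw [← bivectorOf_apply σ c, h4]
  rfl

end Triangulation4

namespace Triangulation4

/-! ### Acyclicity and the move -/

section Reframing

variable {Γ : Type*} [Group Γ] {V T J : Type*} [LinearOrder V] [Fintype V]
variable {R : Representation4 Γ J} {X : Triangulation4 Γ V T}

/-- A change of the axes for the deviations of the edges is a change of basis by an orthogonal
matrix in one term of the sequence. -/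
theorem exists_reframing (hX : X.IsNondegenerate R) {fr fr₁ : X.Edge → Fin 3 → E4}
    (hfr : X.IsFraming R fr) (hfr₁ : X.IsFraming R fr₁) :
    ∃ O O' : Matrix (X.Edge × Fin 3) (X.Edge × Fin 3) ℝ, O * O' = 1 ∧ |O.det| = 1 ∧
      (X.areaMatrix R fr)ᵀ = O * (X.areaMatrix R fr₁)ᵀ ∧
      (X.deviationMatrix R fr)ᵀ = (X.deviationMatrix R fr₁)ᵀ * O' := by
  -- The transition matrix of the axes, block diagonal with respect to the edges.
  let Q : Matrix (X.Edge × Fin 3) (X.Edge × Fin 3) ℝ := Matrix.of fun r c =>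
    if r.1 = c.1 then inner ℝ (fr₁ r.1 r.2) (fr c.1 c.2) else 0
  have hexp : ∀ e k, ∑ l, inner ℝ (fr₁ e l) (fr e k) • fr₁ e l = fr e k := fun e k =>
    sum_inner_smul_of_orthonormal (hfr₁ e).1 (hfr₁ e).2 (X.edgeVec_ne_zero R hX e) ((hfr e).2 k)
  have hsum : ∀ (F : X.Edge × Fin 3 → ℝ) (c : X.Edge × Fin 3), ∑ r, F r * Q r c =
      ∑ l, F (c.1, l) * inner ℝ (fr₁ c.1 l) (fr c.1 c.2) := by
    intro F c
    simp only [Q, Matrix.of_apply, mul_ite, mul_zero]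
    rw [Fintype.sum_prod_type, Finset.sum_eq_single c.1]
    · simp
    · intro e _ he
      simp [he]
    · simp
  have hQ : Qᵀ * Q = 1 := by
    ext ⟨e, k⟩ ⟨e', k'⟩
    rw [Matrix.mul_apply, hsum, Matrix.one_apply]
    simp only [Matrix.transpose_apply, Q, Matrix.of_apply]
    by_cases he : e' = e
    · subst he
      simp only [if_true]
      have h1 := congrArg (inner ℝ (fr e' k)) (hexp e' k')
      rw [inner_sum, orthonormal_iff_ite.1 (hfr e').1 k k'] at h1
      simp only [inner_smul_right] at h1
      simp only [Prod.mk.injEq, true_and]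
      rw [← h1]
      refine Finset.sum_congr rfl fun l _ => ?_
      rw [mul_comm, real_inner_comm (fr e' k)]
    · have he' : (e, k) ≠ (e', k') := fun h => he (congrArg Prod.fst h).symm
      rw [if_neg he']
      simp only [if_neg he, zero_mul, Finset.sum_const_zero]
  refine ⟨Qᵀ, Q, hQ, ?_, ?_, ?_⟩
  · have h1 := congrArg Matrix.det hQ
    rw [Matrix.det_mul, Matrix.det_transpose, Matrix.det_one] at h1
    rw [Matrix.det_transpose, abs_eq (by norm_num)]
    exact mul_self_eq_one_iff.1 h1
  · rw [← Matrix.transpose_mul]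
    congr 1
    ext f c
    rw [Matrix.mul_apply, hsum]
    have hlin := X.isLinearMap_dS R f
    have h1 : (Pi.single c.1 (fr c.1 c.2) : X.Edge → E4) =
        ∑ l, inner ℝ (fr₁ c.1 l) (fr c.1 c.2) • (Pi.single c.1 (fr₁ c.1 l) : X.Edge → E4) := by
      conv_lhs => rw [← hexp c.1 c.2]
      ext1 e
      rw [Finset.sum_apply]
      simp only [Pi.smul_apply, Pi.single_apply]
      split_ifs
      · rfl
      · simp
    have h2 : X.dS R (Pi.single c.1 (fr c.1 c.2)) f =
        ∑ l, inner ℝ (fr₁ c.1 l) (fr c.1 c.2) * X.dS R (Pi.single c.1 (fr₁ c.1 l)) f := by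
      rw [h1]
      have h3 := map_sum (hlin.mk' _) (fun l => inner ℝ (fr₁ c.1 l) (fr c.1 c.2) •
        (Pi.single c.1 (fr₁ c.1 l) : X.Edge → E4)) Finset.univ
      simp only [map_smul] at h3
      exact h3
    rw [areaMatrix, Matrix.of_apply, h2]
    exact Finset.sum_congr rfl fun l _ => mul_comm _ _
  · ext c r
    rw [Matrix.mul_apply, hsum]
    simp only [Matrix.transpose_apply, deviationMatrix, Matrix.of_apply]
    conv_lhs => rw [← hexp r.1 r.2]
    rw [sum_inner]
    refine Finset.sum_congr rfl fun l _ => ?_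
    rw [real_inner_smul_left, mul_comm]

end Reframing

variable {Γ : Type*} [Group Γ] {V T J ι₀ ι₆ : Type*} [LinearOrder V] [Fintype V]
  [Fintype T] [Fintype J] [Fintype ι₀] [Fintype ι₆]
variable {R : Representation4 Γ J} {X : Triangulation4 Γ V T} {t₀ : T} {q : E4}

theorem acyclic_iff_of_isFraming (hX : X.IsNondegenerate R) (a : Module.Basis ι₀ ℝ R.motions)
    (s : Module.Basis ι₆ ℝ R.trivialDeviations) {fr fr₁ : X.Edge → Fin 3 → E4}
    (hfr : X.IsFraming R fr) (hfr₁ : X.IsFraming R fr₁) :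
    X.Acyclic R a s fr ↔ X.Acyclic R a s fr₁ := by
  obtain ⟨O, O', hO, -, h1, h2⟩ := exists_reframing hX hfr hfr₁
  rw [Acyclic, Acyclic, h1, h2, isAcyclic_mul_iff hO]

section Move

variable [DecidableEq T] (hX : X.IsNondegenerate R) (hX' : (X.move t₀ q).IsNondegenerate R)
  (a : Module.Basis ι₀ ℝ R.motions) (s : Module.Basis ι₆ ℝ R.trivialDeviations)

theorem moveCoeff_newEdge (i : Fin 5) :
    X.moveCoeff R t₀ q (X.newEdge t₀ q i).1.1 * X.moveCoeff R t₀ q (X.newEdge t₀ q i).1.2 =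
      -baryCoord (X.simplexPlace R t₀) q i := by
  have h1 : X.moveCoeff R t₀ q (X.newEdge t₀ q i).1.1 = _ :=
    X.moveCoeff_sixVertex R t₀ q (some i)
  have h2 : X.moveCoeff R t₀ q (X.newEdge t₀ q i).1.2 = _ := X.moveCoeff_sixVertex R t₀ q none
  rw [h1, h2]
  simp [depCoeff]

theorem faceCoeff_newFace {i j : Fin 5} (h : i ≠ j) :
    X.faceCoeff R t₀ q (X.newFace t₀ q i j h) = -(X.newArea R t₀ q i j h *
      (baryCoord (X.simplexPlace R t₀) q i * baryCoord (X.simplexPlace R t₀) q j)) := by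
  have key : ∀ {i j : Fin 5} (h : i ≠ j), X.vert t₀ i ≤ X.vert t₀ j →
      X.faceCoeff R t₀ q (X.newFace t₀ q i j h) = -(X.newArea R t₀ q i j h *
      (baryCoord (X.simplexPlace R t₀) q i * baryCoord (X.simplexPlace R t₀) q j)) := by
    intro i j h hle
    have hf1 : (X.newFace t₀ q i j h).1.1 = X.sixVertex t₀ (some i) := congrArg _ (min_eq_left hle)
    have hf2 : (X.newFace t₀ q i j h).1.2.1 = X.sixVertex t₀ (some j) :=
      congrArg _ (max_eq_right hle)
    have hf3 : (X.newFace t₀ q i j h).1.2.2 = X.sixVertex t₀ none := rfl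
    rw [faceCoeff, hf1, hf2, hf3, moveCoeff_sixVertex, moveCoeff_sixVertex, moveCoeff_sixVertex,
      newArea]
    simp [depCoeff]
  rcases le_total (X.vert t₀ i) (X.vert t₀ j) with hle | hle
  · exact key h hle
  · have h1 := key h.symm hle
    rw [newFace_comm, h1, newArea, newArea, newFace_comm, mul_comm (baryCoord _ _ i)]

include hX in
/-- The row factor of the matrix of rank one vanishes on the range of `(dx and dg) → (dL)`. -/
theorem vecMul_matrix₁_move :
    (fun e => X.moveCoeff R t₀ q (X.edgeEquiv t₀ q e).1.1 *
      X.moveCoeff R t₀ q (X.edgeEquiv t₀ q e).1.2) ᵥ*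
      ((X.move t₀ q).matrix₁ R).submatrix (X.edgeEquiv t₀ q) (coordEquiv V J) = 0 := by
  classical
  ext c
  rw [Matrix.vecMul, dotProduct, Pi.zero_apply]
  simp only [Matrix.submatrix_apply]
  rw [(X.edgeEquiv t₀ q).sum_comp fun e => X.moveCoeff R t₀ q e.1.1 *
    X.moveCoeff R t₀ q e.1.2 * (X.move t₀ q).matrix₁ R e (coordEquiv V J c)]
  rcases coordEquiv V J c with ⟨v, α⟩ | j
  · exact X.sum_moveCoeff_mul_dL R t₀ q hX _ _
  · exact X.sum_moveCoeff_mul_dL R t₀ q hX _ _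

include hX hX' in
theorem moveConst_ne_zero : X.moveConst R t₀ q ≠ 0 := by
  have h1 := abs_ne_zero.1 (hX t₀)
  have h2 : ∏ k, depCoeff (X.simplexPlace R t₀) q k ≠ 0 :=
    Finset.prod_ne_zero_iff.2 fun k _ => X.moveCoeff_ne_zero R t₀ q hX hX' k
  rw [moveConst]
  exact div_ne_zero (by norm_num) (mul_ne_zero (mul_ne_zero (by norm_num) h1) h2)

/-- The form of `matrix₂_move` in which the four blocks are explicit. -/
theorem matrix₂_move_eq_fromBlocks (hX : X.IsNondegenerate R)
    (hX' : (X.move t₀ q).IsNondegenerate R) :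
    ((X.move t₀ q).matrix₂ R).submatrix (X.faceEquiv t₀ q) (X.edgeEquiv t₀ q) =
      Matrix.fromBlocks
        (X.matrix₂ R + Matrix.vecMulVec
          (fun f => X.moveConst R t₀ q * X.faceCoeff R t₀ q (X.oldFace t₀ q f))
          (fun e => X.moveCoeff R t₀ q e.1.1 * X.moveCoeff R t₀ q e.1.2))
        (Matrix.vecMulVec
          (fun f => X.moveConst R t₀ q * X.faceCoeff R t₀ q (X.oldFace t₀ q f))
          (fun i => -baryCoord (X.simplexPlace R t₀) q i))
        (Matrix.vecMulVec
          (fun p : IndexPair => -X.moveConst R t₀ q * (X.newArea R t₀ q p.1.1 p.1.2 p.2.ne *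
            (baryCoord (X.simplexPlace R t₀) q p.1.1 * baryCoord (X.simplexPlace R t₀) q p.1.2)))
          (fun e => X.moveCoeff R t₀ q e.1.1 * X.moveCoeff R t₀ q e.1.2))
        (Matrix.vecMulVec
          (fun p : IndexPair => -X.moveConst R t₀ q * (X.newArea R t₀ q p.1.1 p.1.2 p.2.ne *
            (baryCoord (X.simplexPlace R t₀) q p.1.1 * baryCoord (X.simplexPlace R t₀) q p.1.2)))
          (fun i => -baryCoord (X.simplexPlace R t₀) q i)) := by
  rw [matrix₂_move R X t₀ q hX hX']
  have hc : ∀ p : IndexPair, X.moveConst R t₀ q * X.faceCoeff R t₀ q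
      (X.faceEquiv t₀ q (Sum.inr p)) = -X.moveConst R t₀ q *
      (X.newArea R t₀ q p.1.1 p.1.2 p.2.ne *
        (baryCoord (X.simplexPlace R t₀) q p.1.1 * baryCoord (X.simplexPlace R t₀) q p.1.2)) := by
    intro p
    have h1 : X.faceCoeff R t₀ q (X.faceEquiv t₀ q (Sum.inr p)) = _ := faceCoeff_newFace p.2.ne
    rw [h1, mul_neg, neg_mul]
  have hv : ∀ i, X.moveCoeff R t₀ q (X.edgeEquiv t₀ q (Sum.inr i)).1.1 *
      X.moveCoeff R t₀ q (X.edgeEquiv t₀ q (Sum.inr i)).1.2 =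
      -baryCoord (X.simplexPlace R t₀) q i := moveCoeff_newEdge
  ext (f | p) (e | i)
  · rfl
  · rw [Matrix.add_apply, Matrix.vecMulVec_apply, hv, Matrix.fromBlocks_apply₁₂,
      Matrix.fromBlocks_apply₁₂, Matrix.zero_apply, zero_add, Matrix.vecMulVec_apply]
    rfl
  · rw [Matrix.add_apply, Matrix.vecMulVec_apply, hc, Matrix.fromBlocks_apply₂₁,
      Matrix.fromBlocks_apply₂₁, Matrix.zero_apply, zero_add, Matrix.vecMulVec_apply]
    rfl
  · rw [Matrix.add_apply, Matrix.vecMulVec_apply, hc, hv, Matrix.fromBlocks_apply₂₂,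
      Matrix.fromBlocks_apply₂₂, Matrix.zero_apply, zero_add, Matrix.vecMulVec_apply]

/-- The case in which the axes for the old edges are kept. The added blocks satisfy the conditions
of `isAcyclic_extension_iff`, with `-λ_i` and a multiple of `S_{ijF} λ_i λ_j` as the added parts of
the factors of the matrix of rank one. -/
theorem acyclic_move_iff_of_old (hX : X.IsNondegenerate R)
    (hX' : (X.move t₀ q).IsNondegenerate R) {fr : X.Edge → Fin 3 → E4}
    {fr' : (X.move t₀ q).Edge → Fin 3 → E4} (hfr' : (X.move t₀ q).IsFraming R fr')
    (hold : ∀ e, fr' (X.oldEdge t₀ q e) = fr e) :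
    X.Acyclic R a s fr ↔ (X.move t₀ q).Acyclic R a s fr' := by
  have hK := moveConst_ne_zero hX hX'
  have hs := isSpokeSystem hX hX'
  rw [Acyclic, Acyclic, ← isAcyclic_submatrix_iff (coordEquiv V J) (X.edgeEquiv t₀ q)
    (X.faceEquiv t₀ q) (X.edgeAxisEquiv t₀ q) (vertexPairEquiv V), matrix₂_move_eq_fromBlocks hX hX']
  have h₀ := matrix₀_move R X t₀ q a
  have h₁ := matrix₁_move R X t₀ q
  have h₃ := areaMatrix_move R X t₀ q hfr' hold
  have h₄ := deviationMatrix_move R X t₀ q hold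
  have h₅ := trivialMatrix_move R X t₀ q s
  have h₄₃ : ((X.move t₀ q).deviationMatrix R fr')ᵀ.submatrix (vertexPairEquiv V)
      (X.edgeAxisEquiv t₀ q) * ((X.move t₀ q).areaMatrix R fr')ᵀ.submatrix (X.edgeAxisEquiv t₀ q)
        (X.faceEquiv t₀ q) = 0 := by
    rw [Matrix.submatrix_mul_equiv, ← Matrix.transpose_mul,
      areaMatrix_mul_deviationMatrix R _ hX' hfr', Matrix.transpose_zero]
    rfl
  have hN : X.spokeDeviationMatrix R t₀ q fr' * X.spokeAreaMatrix R t₀ q fr' = 0 := by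
    rw [h₃, h₄, Matrix.fromBlocks_multiply] at h₄₃
    have h := congrArg Matrix.toBlocks₂₂ h₄₃
    rw [Matrix.toBlocks_fromBlocks₂₂, Matrix.zero_mul, zero_add] at h
    exact h
  have h₁₀ : ((X.move t₀ q).matrix₁ R).submatrix (X.edgeEquiv t₀ q) (coordEquiv V J) *
      ((X.move t₀ q).matrix₀ R a).submatrix (coordEquiv V J) id = 0 := by
    rw [Matrix.submatrix_mul_equiv, matrix₁_mul_matrix₀]
    rfl
  have h₅₄ : ((X.move t₀ q).trivialMatrix R s)ᵀ.submatrix id (vertexPairEquiv V) *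
      ((X.move t₀ q).deviationMatrix R fr')ᵀ.submatrix (vertexPairEquiv V)
        (X.edgeAxisEquiv t₀ q) = 0 := by
    rw [Matrix.submatrix_mul_equiv, ← Matrix.transpose_mul, deviationMatrix_mul_trivialMatrix,
      Matrix.transpose_zero]
    rfl
  have hv := vecMul_matrix₁_move (t₀ := t₀) (q := q) (J := J) hX
  have hc : ((X.move t₀ q).areaMatrix R fr')ᵀ.submatrix (X.edgeAxisEquiv t₀ q)
      (X.faceEquiv t₀ q) *ᵥ (fun f => X.moveConst R t₀ q *
        X.faceCoeff R t₀ q (X.faceEquiv t₀ q f)) = 0 := by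
    ext r
    rw [Matrix.mulVec, dotProduct, Pi.zero_apply]
    simp only [Matrix.submatrix_apply, Matrix.transpose_apply]
    rw [(X.faceEquiv t₀ q).sum_comp fun f => (X.move t₀ q).areaMatrix R fr' f
      (X.edgeAxisEquiv t₀ q r) * (X.moveConst R t₀ q * X.faceCoeff R t₀ q f)]
    simp only [mul_left_comm _ (X.moveConst R t₀ q), ← Finset.mul_sum]
    rw [X.sum_areaMatrix_mul_faceCoeff R t₀ q hX (fun f => hX'.area_ne_zero f) hfr', mul_zero]
  rw [h₀, h₁, h₃, h₄, h₅]
  rw [h₁, h₀] at h₁₀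
  rw [h₁] at hv
  rw [h₃] at hc
  rw [h₃, h₄] at h₄₃
  rw [h₄, h₅] at h₅₄
  have ev : (fun e => X.moveCoeff R t₀ q (X.edgeEquiv t₀ q e).1.1 *
      X.moveCoeff R t₀ q (X.edgeEquiv t₀ q e).1.2) = Sum.elim
        (fun e => X.moveCoeff R t₀ q e.1.1 * X.moveCoeff R t₀ q e.1.2)
        (fun i => -baryCoord (X.simplexPlace R t₀) q i) := by
    ext (e | i)
    · rfl
    · exact moveCoeff_newEdge i
  have ec : (fun f => X.moveConst R t₀ q * X.faceCoeff R t₀ q (X.faceEquiv t₀ q f)) = Sum.elim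
        (fun f => X.moveConst R t₀ q * X.faceCoeff R t₀ q (X.oldFace t₀ q f))
        (fun p : IndexPair => -X.moveConst R t₀ q * (X.newArea R t₀ q p.1.1 p.1.2 p.2.ne *
          (baryCoord (X.simplexPlace R t₀) q p.1.1 *
            baryCoord (X.simplexPlace R t₀) q p.1.2))) := by
    ext (f | p)
    · rfl
    · refine (congrArg _ (faceCoeff_newFace p.2.ne)).trans ?_
      exact (mul_neg _ _).trans (neg_mul _ _).symm
  rw [ev] at hv
  rw [ec] at hc
  have hker : ∀ y, X.spokeAreaMatrix R t₀ q fr' *ᵥ y = 0 → ∃ r : ℝ, y = r •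
      fun p : IndexPair => -X.moveConst R t₀ q * (X.newArea R t₀ q p.1.1 p.1.2 p.2.ne *
        (baryCoord (X.simplexPlace R t₀) q p.1.1 *
          baryCoord (X.simplexPlace R t₀) q p.1.2)) := by
    intro y hy
    obtain ⟨r, rfl⟩ := exists_eq_smul_of_spokeAreaMatrix hX hX' hfr' y hy
    refine ⟨-(r / X.moveConst R t₀ q), funext fun p => ?_⟩
    simp only [Pi.smul_apply, smul_eq_mul]
    field_simp
  refine isAcyclic_extension_iff h₁₀ hv hc h₄₃ h₅₄ (spokeLengthMatrix_injective hX hX') ?_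
    (exists_spokeLengthMatrix_mulVec_eq hX hX') ?_ hker (fun y hy => ?_)
    (exists_spokeDeviationMatrix_mulVec_eq hX hX' hfr')
  · intro h
    have := congrFun h 0
    simp only [Pi.zero_apply, neg_eq_zero] at this
    exact hs.ne_zero 0 this
  · intro h
    have h1 := congrFun h (⟨(0, 1), by decide⟩ : IndexPair)
    exact mul_ne_zero (neg_ne_zero.2 hK) (mul_ne_zero (newArea_ne_zero hX' _)
      (mul_ne_zero (hs.ne_zero 0) (hs.ne_zero 1))) h1
  -- The count of dimensions is `15 = 6 + (10 - 1)`.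
  · refine exists_mulVec_eq_of_card hN (exists_spokeDeviationMatrix_mulVec_eq hX hX' hfr') hker ?_ hy
    have h1 : Fintype.card Pair = 6 := by decide
    have h2 : Fintype.card IndexPair = 10 := by decide
    rw [h1, h2]
    simp

end Move

end Triangulation4

/-! ### Existence of adapted axes -/

/-- As the dependence has no zero coefficient, any four of the five vectors are independent. -/
theorem IsSpokeSystem.linearIndependent_comp {s : Fin 5 → E4} {l : Fin 5 → ℝ}
    (hs : IsSpokeSystem s l) {σ : Fin 4 → Fin 5} (hσ : Function.Injective σ) :
    LinearIndependent ℝ (s ∘ σ) := by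
  obtain ⟨m, hm⟩ : ∃ m, ∀ k, σ k ≠ m := by
    by_contra! h
    have := Fintype.card_le_of_surjective σ h
    simp at this
  rw [Fintype.linearIndependent_iff]
  intro g hg k
  obtain ⟨r, hr⟩ := hs.exists_eq_smul (y := fun i => ∑ k, if σ k = i then g k else 0) (by
    simp only [Finset.sum_smul, ite_smul, zero_smul]
    rw [Finset.sum_comm]
    simpa using hg)
  have h1 := hr m
  simp only [hm, if_false, Finset.sum_const_zero] at h1
  have h2 : r = 0 := (mul_eq_zero.1 h1.symm).resolve_right (hs.ne_zero m)
  have h3 := hr (σ k)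
  simpa [hσ.eq_iff, h2] using h3

/-- The Gram–Schmidt process for four vectors, with the first of the resulting vectors left
out. -/
theorem exists_orthonormal_triple {u : Fin 4 → E4} (hu : LinearIndependent ℝ u) :
    ∃ e : Fin 3 → E4, Orthonormal ℝ e ∧ (∀ k, inner ℝ (e k) (u 0) = 0) ∧
      e 0 ∈ Submodule.span ℝ {u 0, u 1} ∧ e 1 ∈ Submodule.span ℝ {u 0, u 1, u 2} ∧
      inner ℝ (e 1) (u 1) = 0 := by
  have hperp : ∀ i j, i < j → inner ℝ (InnerProductSpace.gramSchmidtNormed ℝ u j) (u i) = 0 := by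
    intro i j h
    rw [InnerProductSpace.gramSchmidtNormed, inner_smul_left,
      InnerProductSpace.gramSchmidt_inv_triangular ℝ u h, mul_zero]
  have hmem : ∀ j, InnerProductSpace.gramSchmidtNormed ℝ u j ∈
      Submodule.span ℝ (u '' Set.Iic j) := fun j =>
    Submodule.smul_mem _ _ (InnerProductSpace.gramSchmidt_mem_span ℝ u le_rfl)
  refine ⟨fun k => InnerProductSpace.gramSchmidtNormed ℝ u k.succ,
    (InnerProductSpace.gramSchmidtNormed_orthonormal hu).comp _ (Fin.succ_injective 3),
    fun k => hperp 0 _ (Fin.succ_pos k), ?_, ?_, hperp 1 2 (by decide)⟩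
  · refine Submodule.span_mono ?_ (hmem 1)
    rintro _ ⟨i, hi, rfl⟩
    fin_cases i <;> simp_all
  · refine Submodule.span_mono ?_ (hmem 2)
    rintro _ ⟨i, hi, rfl⟩
    fin_cases i <;> simp_all

namespace Triangulation4

variable {Γ : Type*} [Group Γ] {V T J : Type*} [LinearOrder V]
variable {R : Representation4 Γ J} {X : Triangulation4 Γ V T} {t₀ : T} {q : E4}

/-- Gram–Schmidt orthogonalization of four spokes, beginning with the edge in question. -/
theorem exists_isAdaptedFraming (hX : X.IsNondegenerate R)
    (hX' : (X.move t₀ q).IsNondegenerate R) {fr : X.Edge → Fin 3 → E4} (hfr : X.IsFraming R fr) :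
    ∃ fr', X.IsAdaptedFraming R t₀ q fr fr' := by
  have hs := isSpokeSystem hX hX'
  have key : ∀ σ : Fin 4 → Fin 5, Function.Injective σ → ∃ e : Fin 3 → E4, Orthonormal ℝ e ∧
      (∀ k, inner ℝ (e k) (X.spoke R t₀ q (σ 0)) = 0) ∧
      e 0 ∈ Submodule.span ℝ {X.spoke R t₀ q (σ 0), X.spoke R t₀ q (σ 1)} ∧
      e 1 ∈ Submodule.span ℝ
        {X.spoke R t₀ q (σ 0), X.spoke R t₀ q (σ 1), X.spoke R t₀ q (σ 2)} ∧
      inner ℝ (e 1) (X.spoke R t₀ q (σ 1)) = 0 := fun σ hσ =>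
    exists_orthonormal_triple (hs.linearIndependent_comp hσ)
  -- The order of the spokes is dictated by the conditions on the axes. For `CF` the order `C`, `B`,
  -- `A` gives first the `y` axis, in the plane `BCF`, and then the `x` axis, orthogonal to this
  -- plane; hence the transposition in `ax`.
  obtain ⟨eA, hA, hA0, hAx, hAy, -⟩ := key ![0, 1, 2, 3] (by decide)
  obtain ⟨eB, hB, hB0, hBx, hBy, -⟩ := key ![1, 0, 2, 3] (by decide)
  obtain ⟨eC, hC, hC0, hCy, hCx, hCp⟩ := key ![2, 1, 0, 3] (by decide)
  obtain ⟨eD, hD, hD0, -⟩ := key ![3, 0, 1, 2] (by decide)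
  obtain ⟨eE, hE, hE0, -⟩ := key ![4, 0, 1, 2] (by decide)
  let ax : Fin 5 → Fin 3 → E4 := ![eA, eB, eC ∘ Equiv.swap 0 1, eD, eE]
  have hax : ∀ i, Orthonormal ℝ (ax i) ∧ ∀ k, inner ℝ (ax i k) (X.spoke R t₀ q i) = 0 := by
    intro i
    fin_cases i
    · exact ⟨hA, hA0⟩
    · exact ⟨hB, hB0⟩
    · exact ⟨hC.comp _ (Equiv.injective _), fun k => hC0 _⟩
    · exact ⟨hD, hD0⟩
    · exact ⟨hE, hE0⟩
  let fr' : (X.move t₀ q).Edge → Fin 3 → E4 := fun e => Sum.elim fr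
    (fun i k => (X.lin R (X.vert t₀ 0) (X.vert t₀ i)).symm (ax i k)) ((X.edgeEquiv t₀ q).symm e)
  have hnew : ∀ i, fr' (X.newEdge t₀ q i) =
      fun k => (X.lin R (X.vert t₀ 0) (X.vert t₀ i)).symm (ax i k) := by
    intro i
    change fr' (X.edgeEquiv t₀ q (Sum.inr i)) = _
    simp only [fr', Equiv.symm_apply_apply, Sum.elim_inr]
  have hold : ∀ e, fr' (X.oldEdge t₀ q e) = fr e := by
    intro e
    change fr' (X.edgeEquiv t₀ q (Sum.inl e)) = _
    simp only [fr', Equiv.symm_apply_apply, Sum.elim_inl]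
  have haxis : ∀ i k, X.newAxis R t₀ q fr' i k = ax i k := by
    intro i k
    rw [newAxis, hnew]
    exact (X.lin R (X.vert t₀ 0) (X.vert t₀ i)).apply_symm_apply _
  refine ⟨fr', ?_, hold, ?_, ?_, ?_, ?_, ?_, ?_, ?_⟩
  · intro e
    obtain ⟨e | i, rfl⟩ := (X.edgeEquiv t₀ q).surjective e
    · change Orthonormal ℝ (fr' (X.oldEdge t₀ q e)) ∧ ∀ k, inner ℝ (fr' (X.oldEdge t₀ q e) k) _ = 0
      rw [hold]
      exact hfr e
    · change Orthonormal ℝ (fr' (X.newEdge t₀ q i)) ∧ ∀ k, inner ℝ (fr' (X.newEdge t₀ q i) k)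
        ((X.move t₀ q).edgeVec R (X.vert t₀ i) ⊤) = 0
      rw [hnew]
      refine ⟨(hax i).1.comp_linearIsometryEquiv _, fun k => ?_⟩
      rw [← (X.lin R (X.vert t₀ 0) (X.vert t₀ i)).inner_map_map, lin_newEdge,
        LinearIsometryEquiv.apply_symm_apply, inner_neg_right, (hax i).2 k, neg_zero]
  · rw [haxis]
    exact hAx
  · rw [haxis, Set.pair_comm]
    exact hBx
  · rw [haxis]
    exact hAy
  · rw [haxis, Set.insert_comm]
    exact hBy
  · rw [haxis]
    refine Submodule.span_mono ?_ hCx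
    intro x hx
    simp at hx ⊢
    tauto
  · rw [haxis]
    exact hCp
  · rw [haxis]
    refine Submodule.span_mono ?_ hCy
    intro x hx
    simp at hx ⊢
    tauto

end Triangulation4

/-! ### Determinants in orthogonal frames -/

section Frame

variable {s : E4} {w : Fin 3 → E4} (hs : s ≠ 0) (hw : Orthonormal ℝ w)
  (hws : ∀ k, inner ℝ (w k) s = 0)

/-- A vector followed by three axes orthogonal to it. -/
def axisFrame (s : E4) (w : Fin 3 → E4) : Fin 4 → E4 := Fin.cons s w

include hw hws in
theorem inner_axisFrame (i j : Fin 4) : inner ℝ (axisFrame s w i) (axisFrame s w j) =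
    if i = j then (if i = 0 then ‖s‖ ^ 2 else 1) else 0 := by
  refine Fin.cases ?_ (fun i => ?_) i <;> refine Fin.cases ?_ (fun j => ?_) j
  · simp [axisFrame]
  · simpa [axisFrame, (Fin.succ_ne_zero j).symm, real_inner_comm] using hws j
  · simpa [axisFrame] using hws i
  · simpa [axisFrame] using orthonormal_iff_ite.1 hw i j

include hw hws in
theorem abs_det_axisFrame : |(rowMatrix (axisFrame s w)).det| = ‖s‖ := by
  have h : rowMatrix (axisFrame s w) * (rowMatrix (axisFrame s w))ᵀ =
      Matrix.diagonal fun i => if i = 0 then ‖s‖ ^ 2 else 1 := by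
    rw [rowMatrix_mul_transpose]
    ext i j
    rw [Matrix.of_apply, inner_axisFrame hw hws, Matrix.diagonal_apply]
  have h1 := congrArg Matrix.det h
  rw [Matrix.det_mul, Matrix.det_transpose, Matrix.det_diagonal, Fin.prod_univ_succ] at h1
  simp only [if_true, Fin.succ_ne_zero, if_false, Finset.prod_const_one, mul_one] at h1
  rw [← abs_norm s, ← sq_eq_sq_iff_abs_eq_abs, sq, h1]

include hs hw hws in
theorem perp_eq_sum (x : E4) : perp x s = ∑ k, inner ℝ (w k) x • w k := by
  have hss : inner ℝ s s ≠ 0 := (real_inner_self_pos.2 hs).ne'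
  have h : ∀ i, inner ℝ (axisFrame s w i) (perp x s - ∑ k, inner ℝ (w k) x • w k) = 0 := by
    refine Fin.cases ?_ fun i => ?_
    · simp only [axisFrame, Fin.cons_zero, perp, inner_sub_right, inner_sum, inner_smul_right]
      simp only [real_inner_comm _ s, hws, mul_zero, Finset.sum_const_zero, sub_zero]
      field_simp
      ring
    · simp only [axisFrame, Fin.cons_succ, perp, inner_sub_right, inner_sum, inner_smul_right, hws,
        orthonormal_iff_ite.1 hw]
      simp
  have hdet : (rowMatrix (axisFrame s w)).det ≠ 0 := by
    rw [← abs_ne_zero, abs_det_axisFrame hw hws]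
    exact norm_ne_zero_iff.2 hs
  have h0 : rowMatrix (axisFrame s w) *ᵥ (perp x s - ∑ k, inner ℝ (w k) x • w k).ofLp = 0 := by
    ext i
    exact (inner_eq_dotProduct _ _).symm.trans (h i)
  have h1 := Matrix.eq_zero_of_mulVec_eq_zero hdet h0
  rw [← sub_eq_zero]
  exact (WithLp.ofLp_eq_zero 2).1 h1

include hs hw hws in
theorem inner_perp_perp (x y : E4) :
    inner ℝ (perp x s) (perp y s) = ∑ k, inner ℝ (w k) x * inner ℝ (w k) y := by
  rw [perp_eq_sum hs hw hws, perp_eq_sum hs hw hws]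
  simp only [sum_inner, inner_sum, real_inner_smul_left, real_inner_smul_right,
    orthonormal_iff_ite.1 hw]
  simp [mul_comm]

include hs in
theorem inner_eq_add_inner_perp (x y : E4) : inner ℝ x y =
    inner ℝ x s * inner ℝ y s / ‖s‖ ^ 2 + inner ℝ (perp x s) (perp y s) := by
  have hss : inner ℝ s s ≠ 0 := (real_inner_self_pos.2 hs).ne'
  rw [← real_inner_self_eq_norm_sq]
  simp only [perp, inner_sub_left, inner_sub_right, real_inner_smul_left, real_inner_smul_right,
    real_inner_comm y s]
  field_simp
  ring

include hs hw hws in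
/-- Three vectors measured along the axes orthogonal to a fourth one. -/
theorem abs_det_inner_axis (u : Fin 3 → E4) :
    |(Matrix.of fun k a => inner ℝ (u a) (w k)).det| * ‖s‖ =
      |(rowMatrix (Fin.cons s u : Fin 4 → E4)).det| := by
  have hpos : 0 < ‖s‖ := norm_pos_iff.2 hs
  set G : Matrix (Fin 4) (Fin 4) ℝ := Matrix.of fun i j =>
    inner ℝ ((Fin.cons s u : Fin 4 → E4) i) (axisFrame s w j) with hG
  have h1 : rowMatrix (Fin.cons s u : Fin 4 → E4) * (rowMatrix (axisFrame s w))ᵀ = G :=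
    rowMatrix_mul_transpose _ _
  have h2 := congrArg abs (congrArg Matrix.det h1)
  rw [Matrix.det_mul, Matrix.det_transpose, abs_mul, abs_det_axisFrame hw hws,
    Matrix.det_succ_row_zero G, Fin.sum_univ_succ] at h2
  have h3 : ∀ j : Fin 3, G 0 j.succ = 0 := fun j => by
    simpa [hG, axisFrame, real_inner_comm] using hws j
  have h4 : G 0 0 = ‖s‖ ^ 2 := by
    simp [hG, axisFrame]
  simp only [h3, h4, mul_zero, zero_mul, Finset.sum_const_zero, add_zero, Fin.val_zero, pow_zero,
    one_mul] at h2
  have h5 : G.submatrix Fin.succ (Fin.succAbove 0) =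
      (Matrix.of fun k a => inner ℝ (u a) (w k))ᵀ := by
    ext i j
    simp [hG, axisFrame]
  rw [h5, Matrix.det_transpose, abs_mul, abs_of_pos (pow_pos hpos 2)] at h2
  refine mul_right_cancel₀ hpos.ne' ?_
  rw [h2]
  ring

end Frame

/-- The components of the bivector `x ∧ y`. -/
def wedge (x y : E4) (c : Triangulation4.Pair) : ℝ := x c.1.1 * y c.1.2 - x c.1.2 * y c.1.1

/-- The six index pairs in lexicographic order. -/
def pairList : Fin 6 → Triangulation4.Pair :=
  ![⟨(0, 1), by decide⟩, ⟨(0, 2), by decide⟩, ⟨(0, 3), by decide⟩, ⟨(1, 2), by decide⟩,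
    ⟨(1, 3), by decide⟩, ⟨(2, 3), by decide⟩]

theorem pairList_bijective : Function.Bijective pairList := by decide

theorem wedge_dotProduct_wedge (x y z t : E4) :
    ∑ k, wedge x y (pairList k) * wedge z t (pairList k) =
      inner ℝ x z * inner ℝ y t - inner ℝ x t * inner ℝ y z := by
  simp only [inner_eq_dotProduct, dotProduct, Fin.sum_univ_succ, Fin.sum_univ_zero, wedge, pairList]
  simp
  ring

/-- The determinant of six bivectors in terms of their products with those of an orthogonal
frame. -/
theorem abs_det_wedge {s : E4} {w : Fin 3 → E4} (hw : Orthonormal ℝ w)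
    (hws : ∀ k, inner ℝ (w k) s = 0) (x y : Fin 6 → E4) :
    ‖s‖ ^ 3 * |(Matrix.of fun k r => wedge (x r) (y r) (pairList k)).det| =
      |(Matrix.of fun k r =>
        inner ℝ (axisFrame s w (pairList k).1.1) (x r) *
          inner ℝ (axisFrame s w (pairList k).1.2) (y r) -
        inner ℝ (axisFrame s w (pairList k).1.1) (y r) *
          inner ℝ (axisFrame s w (pairList k).1.2) (x r)).det| := by
  set U : Matrix (Fin 6) (Fin 6) ℝ := Matrix.of fun r k =>
    wedge (axisFrame s w (pairList r).1.1) (axisFrame s w (pairList r).1.2) (pairList k) with hU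
  have h1 : U * (Matrix.of fun k r => wedge (x r) (y r) (pairList k)) = Matrix.of fun k r =>
        inner ℝ (axisFrame s w (pairList k).1.1) (x r) *
          inner ℝ (axisFrame s w (pairList k).1.2) (y r) -
        inner ℝ (axisFrame s w (pairList k).1.1) (y r) *
          inner ℝ (axisFrame s w (pairList k).1.2) (x r) := by
    ext k r
    exact wedge_dotProduct_wedge _ _ _ _
  have h2 : U * Uᵀ = Matrix.diagonal ![‖s‖ ^ 2, ‖s‖ ^ 2, ‖s‖ ^ 2, 1, 1, 1] := by
    ext k r
    refine (wedge_dotProduct_wedge _ _ _ _).trans ?_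
    simp only [inner_axisFrame hw hws]
    fin_cases k <;> fin_cases r <;> simp [pairList]
  have h3 := congrArg Matrix.det h2
  rw [Matrix.det_mul, Matrix.det_transpose, Matrix.det_diagonal, Fin.prod_univ_six] at h3
  have h4 : |U.det| = ‖s‖ ^ 3 := by
    rw [← abs_of_nonneg (pow_nonneg (norm_nonneg s) 3), ← sq_eq_sq_iff_abs_eq_abs, sq, h3]
    simp
    ring
  rw [← h1, Matrix.det_mul, abs_mul, h4]

/-! ### Adapted axes -/

/-- In the plane of `a` and `b`, the nonzero vector `x` spans the orthogonal complement of `a`. -/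
theorem inner_eq_zero_of_mem_span_pair {a b x y : E4} (hx : x ∈ Submodule.span ℝ {a, b})
    (hx₀ : x ≠ 0) (hxa : inner ℝ x a = 0) (hyx : inner ℝ y x = 0) (hya : inner ℝ y a = 0) :
    inner ℝ y b = 0 := by
  obtain ⟨α, β, rfl⟩ := Submodule.mem_span_pair.1 hx
  have h1 : inner ℝ (α • a + β • b) (α • a + β • b) ≠ 0 := (real_inner_self_pos.2 hx₀).ne'
  rw [inner_add_right, inner_smul_right, inner_smul_right, hxa, mul_zero, zero_add] at h1
  rw [inner_add_right, inner_smul_right, inner_smul_right, hya, mul_zero, zero_add] at hyx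
  exact (mul_eq_zero.1 hyx).resolve_left (left_ne_zero_of_mul h1)

/-- In the span of `a`, `b`, `c`, the nonzero vector `x` spans the orthogonal complement of the
plane of `a` and `b`. -/
theorem inner_eq_zero_of_mem_span_triple {a b c x y : E4} (hx : x ∈ Submodule.span ℝ {a, b, c})
    (hx₀ : x ≠ 0) (hxa : inner ℝ x a = 0) (hxb : inner ℝ x b = 0) (hyx : inner ℝ y x = 0)
    (hya : inner ℝ y a = 0) (hyb : inner ℝ y b = 0) : inner ℝ y c = 0 := by
  obtain ⟨α, β, γ, rfl⟩ := Submodule.mem_span_triple.1 hx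
  have h1 : inner ℝ (α • a + β • b + γ • c) (α • a + β • b + γ • c) ≠ 0 :=
    (real_inner_self_pos.2 hx₀).ne'
  rw [inner_add_right, inner_add_right, inner_smul_right, inner_smul_right, inner_smul_right, hxa,
    hxb, mul_zero, mul_zero, zero_add, zero_add] at h1
  rw [inner_add_right, inner_add_right, inner_smul_right, inner_smul_right, inner_smul_right, hya,
    hyb, mul_zero, mul_zero, zero_add, zero_add] at hyx
  exact (mul_eq_zero.1 hyx).resolve_left (left_ne_zero_of_mul h1)

theorem inner_eq_zero_of_mem_span {S : Set E4} {x y : E4} (hx : x ∈ Submodule.span ℝ S)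
    (h : ∀ z ∈ S, inner ℝ y z = 0) : inner ℝ y x = 0 := by
  induction hx using Submodule.span_induction with
  | mem z hz => exact h z hz
  | zero => exact inner_zero_right _
  | add u v _ _ hu hv => rw [inner_add_right, hu, hv, add_zero]
  | smul c u _ hu => rw [inner_smul_right, hu, mul_zero]

/-- In the span of `a`, `b`, `c`, the orthogonal complement of a normal `x` to the plane of `a` and
`b` is this plane. -/
theorem mem_span_pair_of_mem_span_triple {a b c x y : E4} (hx : x ∈ Submodule.span ℝ {a, b, c})
    (hx₀ : x ≠ 0) (hxa : inner ℝ x a = 0) (hxb : inner ℝ x b = 0)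
    (hy : y ∈ Submodule.span ℝ {a, b, c}) (hxy : inner ℝ x y = 0) :
    y ∈ Submodule.span ℝ {a, b} := by
  obtain ⟨α, β, γ, rfl⟩ := Submodule.mem_span_triple.1 hy
  have hxc : inner ℝ x c ≠ 0 := fun h => hx₀ <| (inner_self_eq_zero (𝕜 := ℝ)).1 <|
    by
      refine inner_eq_zero_of_mem_span hx ?_
      simp [hxa, hxb, h]
  rw [inner_add_right, inner_add_right, inner_smul_right, inner_smul_right, inner_smul_right, hxa,
    hxb, mul_zero, mul_zero, zero_add, zero_add] at hxy
  rw [(mul_eq_zero.1 hxy).resolve_right hxc, zero_smul, add_zero]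
  exact Submodule.mem_span_pair.2 ⟨α, β, rfl⟩

/-- Vectors `s 0`, `s 1`, `s 2` with axes orthogonal to each of them: the `x` axes of `s 0` and
`s 1` lie in the plane of these two vectors, the `x` axis of `s 2` is orthogonal to `s 1`, and the
`x` and `y` axes lie in the span of the three vectors. -/
structure IsAdaptedSystem (s : Fin 5 → E4) (w : Fin 5 → Fin 3 → E4) : Prop where
  ne_zero : ∀ i, s i ≠ 0
  orthonormal : ∀ i, Orthonormal ℝ (w i)
  inner_axis : ∀ i k, inner ℝ (w i k) (s i) = 0
  x_zero : w 0 0 ∈ Submodule.span ℝ {s 0, s 1}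
  x_one : w 1 0 ∈ Submodule.span ℝ {s 0, s 1}
  y_zero : w 0 1 ∈ Submodule.span ℝ {s 0, s 1, s 2}
  y_one : w 1 1 ∈ Submodule.span ℝ {s 0, s 1, s 2}
  x_two : w 2 0 ∈ Submodule.span ℝ {s 0, s 1, s 2}
  x_two_inner : inner ℝ (w 2 0) (s 1) = 0
  y_two : w 2 1 ∈ Submodule.span ℝ {s 0, s 1, s 2}

namespace IsAdaptedSystem

variable {s : Fin 5 → E4} {w : Fin 5 → Fin 3 → E4} (h : IsAdaptedSystem s w)
include h

theorem inner_ne {i : Fin 5} {k l : Fin 3} (hkl : k ≠ l) : inner ℝ (w i k) (w i l) = 0 :=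
  (h.orthonormal i).2 hkl

theorem axis_ne_zero (i : Fin 5) (k : Fin 3) : w i k ≠ 0 := (h.orthonormal i).ne_zero k

theorem inner_axis_zero_one {k : Fin 3} (hk : k ≠ 0) : inner ℝ (w 0 k) (s 1) = 0 :=
  inner_eq_zero_of_mem_span_pair h.x_zero (h.axis_ne_zero 0 0) (h.inner_axis 0 0)
    (h.inner_ne hk) (h.inner_axis 0 k)

theorem inner_axis_zero_two : inner ℝ (w 0 2) (s 2) = 0 :=
  inner_eq_zero_of_mem_span_triple h.y_zero (h.axis_ne_zero 0 1) (h.inner_axis 0 1)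
    (h.inner_axis_zero_one (by decide)) (h.inner_ne (by decide)) (h.inner_axis 0 2)
    (h.inner_axis_zero_one (by decide))

theorem inner_axis_one_zero {k : Fin 3} (hk : k ≠ 0) : inner ℝ (w 1 k) (s 0) = 0 :=
  inner_eq_zero_of_mem_span_pair (Set.pair_comm _ _ ▸ h.x_one) (h.axis_ne_zero 1 0)
    (h.inner_axis 1 0) (h.inner_ne hk) (h.inner_axis 1 k)

theorem inner_axis_one_two : inner ℝ (w 1 2) (s 2) = 0 :=
  inner_eq_zero_of_mem_span_triple h.y_one (h.axis_ne_zero 1 1)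
    (h.inner_axis_one_zero (by decide)) (h.inner_axis 1 1) (h.inner_ne (by decide))
    (h.inner_axis_one_zero (by decide)) (h.inner_axis 1 2)

theorem x_two' : w 2 0 ∈ Submodule.span ℝ {s 2, s 1, s 0} := by
  refine Submodule.span_mono ?_ h.x_two
  intro x hx
  simp only [Set.mem_insert_iff, Set.mem_singleton_iff] at hx ⊢
  tauto

/-- The `y` axis of `s 2` is orthogonal to the `x` axis, hence lies in the plane of `s 2` and `s 1`.
-/
theorem y_two' : w 2 1 ∈ Submodule.span ℝ {s 2, s 1} := by
  refine mem_span_pair_of_mem_span_triple h.x_two' (h.axis_ne_zero 2 0) (h.inner_axis 2 0)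
    h.x_two_inner ?_ (h.inner_ne (by decide))
  refine Submodule.span_mono ?_ h.y_two
  intro x hx
  simp only [Set.mem_insert_iff, Set.mem_singleton_iff] at hx ⊢
  tauto

theorem inner_axis_two_one {k : Fin 3} (hk : k ≠ 1) : inner ℝ (w 2 k) (s 1) = 0 :=
  inner_eq_zero_of_mem_span_pair h.y_two' (h.axis_ne_zero 2 1) (h.inner_axis 2 1)
    (h.inner_ne hk) (h.inner_axis 2 k)

theorem inner_axis_two_zero : inner ℝ (w 2 2) (s 0) = 0 :=
  inner_eq_zero_of_mem_span_triple h.x_two' (h.axis_ne_zero 2 0) (h.inner_axis 2 0)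
    h.x_two_inner (h.inner_ne (by decide)) (h.inner_axis 2 2)
    (h.inner_axis_two_one (by decide))

theorem inner_eq_sum_axis (i : Fin 5) (x y : E4) : inner ℝ x y =
    inner ℝ x (s i) * inner ℝ y (s i) / ‖s i‖ ^ 2 +
      ∑ k, inner ℝ (w i k) x * inner ℝ (w i k) y := by
  rw [inner_eq_add_inner_perp (h.ne_zero i),
    inner_perp_perp (h.ne_zero i) (h.orthonormal i) (h.inner_axis i)]

/-- A unit vector orthogonal to `s i` and to two of its axes is plus or minus the third one. -/
theorem sq_inner_eq_one {i : Fin 5} {k : Fin 3} {x : E4} (hx : inner ℝ x x = (1 : ℝ))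
    (hxs : inner ℝ x (s i) = 0) (hk : ∀ l, l ≠ k → inner ℝ (w i l) x = 0) :
    inner ℝ (w i k) x ^ 2 = 1 := by
  rw [h.inner_eq_sum_axis i, hxs, zero_mul, zero_div, zero_add, Finset.sum_eq_single k] at hx
  · rw [sq, hx]
  · intro l _ hl
    rw [hk l hl, zero_mul]
  · simp

theorem inner_z_zero_y_one : inner ℝ (w 0 2) (w 1 1) = 0 := by
  refine inner_eq_zero_of_mem_span h.y_one ?_
  simpa [h.inner_axis_zero_two] using
    ⟨h.inner_axis 0 2, h.inner_axis_zero_one (k := 2) (by decide)⟩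

/-- The `y` axes of `s 0` and `s 1` agree up to sign: both are normal to the plane of `s 0` and `s
1` in the span of the three vectors. -/
theorem abs_inner_y : |inner ℝ (w 0 1) (w 1 1)| = 1 := by
  have h0 : inner ℝ (w 1 1) (s 0) = 0 := h.inner_axis_one_zero (by decide)
  have h1 := h.inner_axis 1 1
  rw [← abs_one, ← sq_eq_sq_iff_abs_eq_abs, one_pow]
  refine h.sq_inner_eq_one (by simp [(h.orthonormal 1).1 1]) h0 fun l hl => ?_
  fin_cases l
  · change inner ℝ (w 0 0) (w 1 1) = 0
    rw [real_inner_comm]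
    refine inner_eq_zero_of_mem_span h.x_zero ?_
    simp [h0, h1]
  · exact absurd rfl hl
  · exact h.inner_z_zero_y_one

/-- The unit normals to the hyperplane of the three vectors agree up to sign. -/
theorem abs_inner_z {z : E4} (hz : ‖z‖ = 1) (h0 : inner ℝ z (s 0) = 0) (h1 : inner ℝ z (s 1) = 0)
    (h2 : inner ℝ z (s 2) = 0) : |inner ℝ (w 0 2) z| = 1 := by
  rw [← abs_one, ← sq_eq_sq_iff_abs_eq_abs, one_pow]
  refine h.sq_inner_eq_one (by simp [hz]) h0 fun l hl => ?_
  rw [real_inner_comm]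
  fin_cases l
  · refine inner_eq_zero_of_mem_span h.x_zero ?_
    simp [h0, h1]
  · refine inner_eq_zero_of_mem_span h.y_zero ?_
    simp [h0, h1, h2]
  · exact absurd rfl hl

/-- The area of a triangle from the only component of `x` orthogonal to `s i`. -/
theorem two_mul_triangleArea {i : Fin 5} {k : Fin 3} {x : E4}
    (hk : ∀ l, l ≠ k → inner ℝ (w i l) x = 0) :
    2 * triangleArea 0 (s i) x = ‖s i‖ * |inner ℝ (w i k) x| := by
  rw [triangleArea, sub_zero, sub_zero, mul_div_cancel₀ _ two_ne_zero]
  congr 1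
  rw [← abs_norm (perp x (s i)), ← sq_eq_sq_iff_abs_eq_abs, ← real_inner_self_eq_norm_sq,
    inner_perp_perp (h.ne_zero i) (h.orthonormal i) (h.inner_axis i), Finset.sum_eq_single k]
  · rw [sq]
  · intro l _ hl
    rw [hk l hl, zero_mul]
  · simp

/-- In the axes of `s 2`, the projection of `s 1` is directed along the `y` axis, and that of `s 0`
has no `z` component. -/
theorem sin_angle_mul : Real.sin (InnerProductGeometry.angle (perp (s 0) (s 2)) (perp (s 1) (s 2)))
      * (4 * triangleArea 0 (s 2) (s 0) * triangleArea 0 (s 2) (s 1)) =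
    ‖s 2‖ ^ 2 * (|inner ℝ (w 2 0) (s 0)| * |inner ℝ (w 2 1) (s 1)|) := by
  have h1 := InnerProductGeometry.sin_angle_mul_norm_mul_norm (perp (s 0) (s 2)) (perp (s 1) (s 2))
  simp only [inner_perp_perp (h.ne_zero 2) (h.orthonormal 2) (h.inner_axis 2),
    Fin.sum_univ_three, h.inner_axis_two_one (k := 0) (by decide),
    h.inner_axis_two_one (k := 2) (by decide), h.inner_axis_two_zero, mul_zero, add_zero,
    zero_add] at h1
  have h2 : ∀ x y z : ℝ, (x * x + y * y) * (z * z) - y * z * (y * z) = (x * z) ^ 2 := by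
    intros; ring
  rw [h2, Real.sqrt_sq_eq_abs, abs_mul] at h1
  rw [← h1, triangleArea, triangleArea]
  simp only [sub_zero]
  ring

/-- The volume of the parallelepiped on `s 0`, `s 1`, `s 2` computed in two ways. -/
theorem norm_mul_abs_inner_mul : ‖s 0‖ * (|inner ℝ (w 0 0) (s 1)| * |inner ℝ (w 0 1) (s 2)|) =
    ‖s 2‖ * (|inner ℝ (w 2 0) (s 0)| * |inner ℝ (w 2 1) (s 1)|) := by
  have hz0 := h.inner_axis_two_zero
  have hz1 := h.inner_axis_two_one (k := 2) (by decide)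
  -- The unit normal `w 2 2` is added to the three vectors. The matrices of their components along
  -- the axes of `s 0` and of `s 2` are triangular.
  have h1 := abs_det_inner_axis (h.ne_zero 0) (h.orthonormal 0) (h.inner_axis 0) ![s 1, s 2, w 2 2]
  have h2 := abs_det_inner_axis (h.ne_zero 2) (h.orthonormal 2) (h.inner_axis 2) ![s 0, s 1, w 2 2]
  have h3 : |(rowMatrix (Fin.cons (s 0) ![s 1, s 2, w 2 2] : Fin 4 → E4)).det| =
      |(rowMatrix (Fin.cons (s 2) ![s 0, s 1, w 2 2] : Fin 4 → E4)).det| := by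
    have h4 : rowMatrix (Fin.cons (s 0) ![s 1, s 2, w 2 2] : Fin 4 → E4) =
        (rowMatrix (Fin.cons (s 2) ![s 0, s 1, w 2 2] : Fin 4 → E4)).submatrix
          (Equiv.swap 0 1 * Equiv.swap 1 2 : Equiv.Perm (Fin 4)) id := by
      ext i j
      fin_cases i <;> rfl
    rw [h4, Matrix.det_permute, abs_mul]
    simp
  rw [← h2, ← h1] at h3
  have e1 : |(Matrix.of fun k a => inner ℝ (![s 1, s 2, w 2 2] a) (w 0 k)).det| =
      |inner ℝ (w 0 0) (s 1)| * |inner ℝ (w 0 1) (s 2)| := by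
    rw [Matrix.det_of_isUpperTriangular]
    · rw [Fin.prod_univ_three, abs_mul, abs_mul]
      simp only [Matrix.of_apply]
      change |inner ℝ (s 1) (w 0 0)| * |inner ℝ (s 2) (w 0 1)| * |inner ℝ (w 2 2) (w 0 2)| = _
      rw [real_inner_comm (w 0 2), h.abs_inner_z ((h.orthonormal 2).1 2) hz0 hz1 (h.inner_axis 2 2),
        mul_one, real_inner_comm (w 0 0), real_inner_comm (w 0 1)]
    · intro i j hij
      simp only [id] at hij
      rw [Matrix.of_apply, real_inner_comm]
      have ha := h.inner_axis_zero_one (k := 1) (by decide)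
      have hb := h.inner_axis_zero_one (k := 2) (by decide)
      have hc := h.inner_axis_zero_two
      revert hij
      fin_cases i <;> fin_cases j <;> simp [ha, hb, hc]
  have e2 : |(Matrix.of fun k a => inner ℝ (![s 0, s 1, w 2 2] a) (w 2 k)).det| =
      |inner ℝ (w 2 0) (s 0)| * |inner ℝ (w 2 1) (s 1)| := by
    rw [Matrix.det_of_isLowerTriangular]
    · rw [Fin.prod_univ_three, abs_mul, abs_mul]
      simp only [Matrix.of_apply]
      change |inner ℝ (s 0) (w 2 0)| * |inner ℝ (s 1) (w 2 1)| * |inner ℝ (w 2 2) (w 2 2)| = _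
      rw [real_inner_self_eq_norm_sq, (h.orthonormal 2).1 2, real_inner_comm (w 2 0),
        real_inner_comm (w 2 1)]
      simp
    · intro i j hij
      change i < j at hij
      rw [Matrix.of_apply, real_inner_comm]
      have ha := h.inner_axis_two_one (k := 0) (by decide)
      have hb : inner ℝ (w 2 0) (w 2 2) = 0 := h.inner_ne (by decide)
      have hc : inner ℝ (w 2 1) (w 2 2) = 0 := h.inner_ne (by decide)
      revert hij
      fin_cases i <;> fin_cases j <;> simp [ha, hb, hc]
  rw [e1, e2] at h3
  rw [mul_comm, h3, mul_comm]

end IsAdaptedSystem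

/-! ### The blocks of the minors that belong to the new vertex -/

/-- The components of the deviations of the edges `AF`, `BF`, `CF` that are columns of the minor
of `(dv)* → (dσ)*`. -/
def remainingAxis : Fin 6 → Fin 5 × Fin 3 := ![(0, 0), (0, 1), (0, 2), (1, 1), (1, 2), (2, 2)]

namespace IsAdaptedSystem

variable {s : Fin 5 → E4} {w : Fin 5 → Fin 3 → E4} (h : IsAdaptedSystem s w)
include h

theorem norm_pos (i : Fin 5) : 0 < ‖s i‖ := norm_pos_iff.2 (h.ne_zero i)

/-- The six bivectors form an upper triangular matrix in the frame that consists of `s 0` and of its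
axes. -/
theorem abs_det_wedge_remainingAxis :
    |(Matrix.of fun k r => wedge (s (remainingAxis r).1)
      (w (remainingAxis r).1 (remainingAxis r).2) (pairList k)).det| =
      ‖s 0‖ ^ 3 * (|inner ℝ (w 0 0) (s 1)| ^ 2 * |inner ℝ (w 0 1) (s 2)|) := by
  have h1 := abs_det_wedge (h.orthonormal 0) (h.inner_axis 0)
    (fun r => s (remainingAxis r).1) (fun r => w (remainingAxis r).1 (remainingAxis r).2)
  have hpos := h.norm_pos 0
  refine mul_left_cancel₀ (pow_pos hpos 3).ne' (h1.trans ?_)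
  have c0 : ∀ k, inner ℝ (s 0) (w 0 k) = 0 := fun k => (real_inner_comm _ _).trans (h.inner_axis 0 k)
  have c1 : ∀ k, inner ℝ (w 0 k) (s 0) = 0 := h.inner_axis 0
  have c2 : inner ℝ (w 0 1) (s 1) = 0 := h.inner_axis_zero_one (by decide)
  have c3 : inner ℝ (w 0 2) (s 1) = 0 := h.inner_axis_zero_one (by decide)
  have c4 := h.inner_axis_zero_two
  have c5 := h.inner_z_zero_y_one
  have c6 : ∀ k l, inner ℝ (w 0 k) (w 0 l) = if k = l then (1 : ℝ) else 0 :=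
    orthonormal_iff_ite.1 (h.orthonormal 0)
  -- On the diagonal, the products of the remaining axes are `±1`.
  have c7 := h.abs_inner_y
  have c8 : |inner ℝ (w 0 2) (w 1 2)| = 1 := h.abs_inner_z ((h.orthonormal 1).1 2)
    (h.inner_axis_one_zero (by decide)) (h.inner_axis 1 2) h.inner_axis_one_two
  have c9 : |inner ℝ (w 0 2) (w 2 2)| = 1 := h.abs_inner_z ((h.orthonormal 2).1 2)
    h.inner_axis_two_zero (h.inner_axis_two_one (by decide)) (h.inner_axis 2 2)
  rw [Matrix.det_of_isUpperTriangular]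
  · rw [Fin.prod_univ_six]
    simp only [Matrix.of_apply, axisFrame, pairList, remainingAxis, Matrix.cons_val]
    change |(inner ℝ (s 0) (s 0) * inner ℝ (w 0 0) (w 0 0) -
      inner ℝ (s 0) (w 0 0) * inner ℝ (w 0 0) (s 0)) *
      (inner ℝ (s 0) (s 0) * inner ℝ (w 0 1) (w 0 1) -
      inner ℝ (s 0) (w 0 1) * inner ℝ (w 0 1) (s 0)) *
      (inner ℝ (s 0) (s 0) * inner ℝ (w 0 2) (w 0 2) -
      inner ℝ (s 0) (w 0 2) * inner ℝ (w 0 2) (s 0)) *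
      (inner ℝ (w 0 0) (s 1) * inner ℝ (w 0 1) (w 1 1) -
      inner ℝ (w 0 0) (w 1 1) * inner ℝ (w 0 1) (s 1)) *
      (inner ℝ (w 0 0) (s 1) * inner ℝ (w 0 2) (w 1 2) -
      inner ℝ (w 0 0) (w 1 2) * inner ℝ (w 0 2) (s 1)) *
      (inner ℝ (w 0 1) (s 2) * inner ℝ (w 0 2) (w 2 2) -
      inner ℝ (w 0 1) (w 2 2) * inner ℝ (w 0 2) (s 2))| = _
    simp only [c0, c1, c2, c3, c4, c6, if_true, mul_one, mul_zero, sub_zero, abs_mul, c7, c8, c9,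
      real_inner_self_eq_norm_sq, abs_of_nonneg (sq_nonneg ‖s 0‖)]
    ring
  · intro i j hij
    simp only [id] at hij
    rw [Matrix.of_apply]
    revert hij
    have f0 : axisFrame (s 0) (w 0) 0 = s 0 := rfl
    have f1 : axisFrame (s 0) (w 0) 1 = w 0 0 := rfl
    have f2 : axisFrame (s 0) (w 0) 2 = w 0 1 := rfl
    have f3 : axisFrame (s 0) (w 0) 3 = w 0 2 := rfl
    fin_cases i <;> fin_cases j <;>
      simp [pairList, remainingAxis, f0, f1, f2, f3, c0, c1, c2, c3, c4, c5, c6]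

/-- The sine of the angle enters through the volume of the parallelepiped on the three vectors,
according to `norm_mul_abs_inner_mul` and `sin_angle_mul`. -/
theorem abs_det_remainingAxis :
    |(Matrix.of fun k r => 1 / ‖s (remainingAxis r).1‖ ^ 2 * wedge (s (remainingAxis r).1)
      (w (remainingAxis r).1 (remainingAxis r).2) (pairList k)).det| =
      8 * triangleArea 0 (s 0) (s 2) * triangleArea 0 (s 1) (s 2) * triangleArea 0 (s 0) (s 1) /
        (‖s 0‖ ^ 5 * ‖s 1‖ ^ 4 * ‖s 2‖ ^ 3) *
      Real.sin (InnerProductGeometry.angle (perp (s 0) (s 2)) (perp (s 1) (s 2))) := by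
  have h1 := Matrix.det_mul_row (fun r => 1 / ‖s (remainingAxis r).1‖ ^ 2)
    (Matrix.of fun k r => wedge (s (remainingAxis r).1)
      (w (remainingAxis r).1 (remainingAxis r).2) (pairList k))
  refine (congrArg abs h1).trans ?_
  rw [abs_mul, h.abs_det_wedge_remainingAxis, Fin.prod_univ_six]
  simp only [remainingAxis, Matrix.cons_val]
  have hS : 2 * triangleArea 0 (s 0) (s 1) = ‖s 0‖ * |inner ℝ (w 0 0) (s 1)| :=
    h.two_mul_triangleArea fun l hl => h.inner_axis_zero_one hl
  have hv := h.norm_mul_abs_inner_mul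
  have hsin := h.sin_angle_mul
  rw [triangleArea_swap 0 (s 0) (s 2), triangleArea_swap 0 (s 1) (s 2)] at hsin
  have hp0 := h.norm_pos 0
  have hp1 := h.norm_pos 1
  have hp2 := h.norm_pos 2
  rw [abs_of_pos (by positivity)]
  generalize |inner ℝ (w 0 0) (s 1)| = a at *
  generalize |inner ℝ (w 0 1) (s 2)| = b at *
  generalize |inner ℝ (w 2 0) (s 0)| * |inner ℝ (w 2 1) (s 1)| = c at *
  generalize Real.sin _ = σ at *
  generalize triangleArea 0 (s 0) (s 2) = S02 at *
  generalize triangleArea 0 (s 1) (s 2) = S12 at *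
  obtain rfl : a = 2 * triangleArea 0 (s 0) (s 1) / ‖s 0‖ := by
    rw [hS]; field_simp
  generalize triangleArea 0 (s 0) (s 1) = S01 at *
  have hb : 2 * S01 * b = ‖s 2‖ * c := by
    rw [← hv]; field_simp
  field_simp
  linear_combination (2 * S01 * ‖s 2‖) * hb - 2 * S01 * hsin

/-- The case of `abs_det_inner_axis` in which the columns have factors. -/
theorem abs_det_axis_three (c : Fin 3 → ℝ) (i : Fin 5) :
    |(Matrix.of fun k a => c a * inner ℝ (![s 0, s 1, s 2] a) (w i k)).det| * ‖s i‖ =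
      |∏ a, c a| * |(rowMatrix ![s i, s 0, s 1, s 2]).det| := by
  have h1 := Matrix.det_mul_row c (Matrix.of fun k a => inner ℝ (![s 0, s 1, s 2] a) (w i k))
  have h2 := congrArg abs h1
  rw [abs_mul] at h2
  refine (congrArg (· * ‖s i‖) h2).trans ?_
  rw [mul_assoc, abs_det_inner_axis (h.ne_zero i) (h.orthonormal i) (h.inner_axis i)]
  rfl

/-- The product of the three components along which the remaining new areas change. -/
theorem abs_inner_mul_eq :
    ‖s 1‖ * |inner ℝ (w 1 0) (s 0)| * (‖s 2‖ ^ 2 * (|inner ℝ (w 2 0) (s 0)| *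
      |inner ℝ (w 2 1) (s 1)|)) = 8 * triangleArea 0 (s 0) (s 1) *
      triangleArea 0 (s 0) (s 2) * triangleArea 0 (s 1) (s 2) *
      Real.sin (InnerProductGeometry.angle (perp (s 0) (s 2)) (perp (s 1) (s 2))) := by
  have hS : 2 * triangleArea 0 (s 1) (s 0) = ‖s 1‖ * |inner ℝ (w 1 0) (s 0)| :=
    h.two_mul_triangleArea fun l hl => h.inner_axis_one_zero hl
  rw [← hS, ← h.sin_angle_mul, triangleArea_swap 0 (s 0) (s 2), triangleArea_swap 0 (s 1) (s 2),
    triangleArea_swap 0 (s 0) (s 1)]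
  ring

end IsAdaptedSystem

namespace Triangulation4

variable {Γ : Type*} [Group Γ] {V T J : Type*} [LinearOrder V]
variable {R : Representation4 Γ J} {X : Triangulation4 Γ V T} {t₀ : T} {q : E4}

/-- The new simplex without the vertex `σ 0` has `F` and the other four vertices as its vertices. -/
theorem newVolume_eq (σ : Equiv.Perm (Fin 5)) : 24 * X.newVolume R t₀ q (σ 0) =
    |(rowMatrix fun j => X.spoke R t₀ q (σ j.succ)).det| := by
  rw [newVolume, volume, move_simplexPlace_inr, ← abs_signedVolume_perm _ σ, sixPoint_comp_some,
    signedVolume, abs_div, abs_of_pos (show (0 : ℝ) < 24 by norm_num), mul_div_cancel₀ _ (by norm_num)]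
  congr 3
  ext i j
  have h1 : σ i.succ ≠ σ 0 := fun h => Fin.succ_ne_zero i (σ.injective h)
  simp [spoke, h1]

/-- The volumes of the new simplices as multiples of the old volume. -/
theorem newVolume_eq_mul (hX : X.IsNondegenerate R) (k : Fin 5) : X.newVolume R t₀ q k =
    |baryCoord (X.simplexPlace R t₀) q k| * X.volume R t₀ := by
  rw [newVolume, volume, move_simplexPlace_inr,
    signedVolume_sixPoint (abs_ne_zero.1 (hX t₀)), abs_mul]
  rfl

/-- Four rows of the factor `-2` and a determinant equal to `4!` times a volume: `384 = 2⁴ · 4!`. -/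
theorem abs_det_spokeLengthMatrix :
    |((X.spokeLengthMatrix R t₀ q).submatrix Fin.castSucc id).det| =
      384 * X.newVolume R t₀ q 4 := by
  have h1 := newVolume_eq (R := R) (X := X) (t₀ := t₀) (q := q) (finRotate 5).symm
  have h2 : (X.spokeLengthMatrix R t₀ q).submatrix Fin.castSucc id =
      (-2 : ℝ) • rowMatrix fun j => X.spoke R t₀ q ((finRotate 5).symm j.succ) := by
    ext i j
    fin_cases i <;> rfl
  rw [h2, Matrix.det_smul, abs_mul, ← h1, Fintype.card_fin]
  have h3 : (finRotate 5).symm 0 = 4 := by decide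
  rw [h3]
  norm_num
  ring

/-- The entry `∂ω_{DEF} / ∂L_{EF}` after the move. -/
theorem abs_mul_newFace_newEdge (hX : X.IsNondegenerate R) (hX' : (X.move t₀ q).IsNondegenerate R) :
    |-X.moveConst R t₀ q * (X.newArea R t₀ q 3 4 * (baryCoord (X.simplexPlace R t₀) q 3 *
      baryCoord (X.simplexPlace R t₀) q 4)) * -baryCoord (X.simplexPlace R t₀) q 4| =
    X.newArea R t₀ q 3 4 / 24 * (X.newVolume R t₀ q 4 * X.volume R t₀ /
      (X.newVolume R t₀ q 0 * X.newVolume R t₀ q 1 * X.newVolume R t₀ q 2)) := by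
  have hb : ∀ i, |baryCoord (X.simplexPlace R t₀) q i| ≠ 0 := fun i =>
    abs_ne_zero.2 ((isSpokeSystem hX hX').ne_zero i)
  have hV := hX t₀
  have hA : |X.newArea R t₀ q 3 4| = X.newArea R t₀ q 3 4 := by
    rw [newArea_eq, abs_of_nonneg (triangleArea_nonneg _ _ _)]
  -- All the volumes are multiples `|λ_k| V` of the old one.
  simp only [newVolume_eq_mul hX, moveConst, Fintype.prod_option, Fin.prod_univ_five]
  have h0 : depCoeff (X.simplexPlace R t₀) q none = -1 := rfl
  have h1 : ∀ i, depCoeff (X.simplexPlace R t₀) q (some i) =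
    baryCoord (X.simplexPlace R t₀) q i := fun i => rfl
  have h2 : |signedVolume (X.simplexPlace R t₀)| = X.volume R t₀ := rfl
  simp only [h0, h1, abs_mul, abs_neg, abs_div, abs_one, h2, hA,
    abs_of_pos (show (0 : ℝ) < 24 by norm_num)]
  have := hb 0
  have := hb 1
  have := hb 2
  have := hb 3
  have := hb 4
  field_simp

variable {fr : X.Edge → Fin 3 → E4} {fr' : (X.move t₀ q).Edge → Fin 3 → E4}

theorem IsAdaptedFraming.isAdaptedSystem (h : X.IsAdaptedFraming R t₀ q fr fr')
    (hX : X.IsNondegenerate R) (hX' : (X.move t₀ q).IsNondegenerate R) :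
    IsAdaptedSystem (X.spoke R t₀ q) (X.newAxis R t₀ q fr') where
  ne_zero := (isSpokeSystem hX hX').spoke_ne_zero
  orthonormal := h.isFraming.orthonormal_newAxis
  inner_axis := h.isFraming.inner_newAxis_spoke
  x_zero := h.x_AF
  x_one := h.x_BF
  y_zero := h.y_AF
  y_one := h.y_BF
  x_two := h.x_CF
  x_two_inner := h.x_CF_perp
  y_two := h.y_CF

theorem abs_det_spokeDeviationMatrix (h : X.IsAdaptedFraming R t₀ q fr fr')
    (hX : X.IsNondegenerate R) (hX' : (X.move t₀ q).IsNondegenerate R) :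
    |((X.spokeDeviationMatrix R t₀ q fr').submatrix pairList remainingAxis).det| =
      8 * X.newArea R t₀ q 0 2 * X.newArea R t₀ q 1 2 * X.newArea R t₀ q 0 1 /
        (X.newLength R t₀ q 0 ^ 5 * X.newLength R t₀ q 1 ^ 4 * X.newLength R t₀ q 2 ^ 3) *
      Real.sin (X.planeAngle R t₀ q) := by
  rw [newArea_eq, newArea_eq, newArea_eq, newLength_eq, newLength_eq, newLength_eq, planeAngle,
    ← (h.isAdaptedSystem hX hX').abs_det_remainingAxis]
  congr 3
  ext k r
  rw [Matrix.of_apply, ← newLength_eq]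
  rfl

/-- The components of the deviations of the new edges that are rows of the minor of
`(dω) → (dv)*`, grouped by edges: `DF`, `EF`, then `BF` and `CF`. -/
def addedAxis : Fin 3 ⊕ (Fin 3 ⊕ Fin 3) → Fin 5 × Fin 3 :=
  Sum.elim (fun k => (3, k)) (Sum.elim (fun k => (4, k)) ![(1, 0), (2, 0), (2, 1)])

/-- The new faces other than `DEF`: those at `DF`, those at `EF`, and the remaining three. -/
def addedFace : Fin 3 ⊕ (Fin 3 ⊕ Fin 3) → IndexPair :=
  Sum.elim ![⟨(0, 3), by decide⟩, ⟨(1, 3), by decide⟩, ⟨(2, 3), by decide⟩]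
    (Sum.elim ![⟨(0, 4), by decide⟩, ⟨(1, 4), by decide⟩, ⟨(2, 4), by decide⟩]
      ![⟨(0, 1), by decide⟩, ⟨(0, 2), by decide⟩, ⟨(1, 2), by decide⟩])

/-- The minor belonging to one edge and to the three faces that join it to `A`, `B`, `C`. -/
theorem abs_det_axisBlock (hs : IsAdaptedSystem (X.spoke R t₀ q) (X.newAxis R t₀ q fr'))
    {i k : Fin 5} {A₀ A₁ A₂ : ℝ} (hl : 0 < X.newLength R t₀ q i) (h₀ : 0 < A₀) (h₁ : 0 < A₁)
    (h₂ : 0 < A₂) (hσ : Function.Bijective ![k, i, 0, 1, 2]) {N : Matrix (Fin 3) (Fin 3) ℝ}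
    (hN : ∀ m a, N m a = ![-(X.newLength R t₀ q i ^ 2 / (2 * A₀)),
      -(X.newLength R t₀ q i ^ 2 / (2 * A₁)), -(X.newLength R t₀ q i ^ 2 / (2 * A₂))] a *
        inner ℝ (![X.spoke R t₀ q 0, X.spoke R t₀ q 1, X.spoke R t₀ q 2] a)
          (X.newAxis R t₀ q fr' i m)) :
    |N.det| = 3 * X.newVolume R t₀ q k * X.newLength R t₀ q i ^ 5 / (A₀ * A₁ * A₂) := by
  have h1 := hs.abs_det_axis_three ![-(X.newLength R t₀ q i ^ 2 / (2 * A₀)),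
    -(X.newLength R t₀ q i ^ 2 / (2 * A₁)), -(X.newLength R t₀ q i ^ 2 / (2 * A₂))] i
  have h2 := newVolume_eq (R := R) (X := X) (t₀ := t₀) (q := q) (Equiv.ofBijective _ hσ)
  have h3 : (fun j : Fin 4 => X.spoke R t₀ q (Equiv.ofBijective _ hσ j.succ)) =
      ![X.spoke R t₀ q i, X.spoke R t₀ q 0, X.spoke R t₀ q 1, X.spoke R t₀ q 2] := by
    ext1 j
    fin_cases j <;> rfl
  have h4 : Equiv.ofBijective _ hσ 0 = k := rfl
  rw [h3, h4] at h2
  rw [← h2, ← newLength_eq] at h1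
  obtain rfl : N = Matrix.of fun m a => _ := Matrix.ext hN
  refine mul_right_cancel₀ hl.ne' (h1.trans ?_)
  rw [Fin.prod_univ_three]
  simp only [Matrix.cons_val, abs_mul, abs_neg, abs_div, abs_pow, abs_of_pos hl, abs_of_pos h₀,
    abs_of_pos h₁, abs_of_pos h₂, abs_of_pos (two_pos (α := ℝ))]
  field_simp
  ring

/-- The block is lower triangular with respect to the groups of `addedAxis` and `addedFace`. The
groups of `DF` and `EF` give the volumes, and the third diagonal block is triangular itself. -/
theorem abs_det_spokeAreaMatrix (h : X.IsAdaptedFraming R t₀ q fr fr')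
    (hX : X.IsNondegenerate R) (hX' : (X.move t₀ q).IsNondegenerate R) :
    |((X.spokeAreaMatrix R t₀ q fr').submatrix addedAxis addedFace).det| =
      9 * X.newVolume R t₀ q 4 * X.newVolume R t₀ q 3 * X.newLength R t₀ q 3 ^ 5 *
        X.newLength R t₀ q 4 ^ 5 / (X.newArea R t₀ q 0 3 * X.newArea R t₀ q 1 3 *
          X.newArea R t₀ q 2 3 * X.newArea R t₀ q 0 4 * X.newArea R t₀ q 1 4 *
          X.newArea R t₀ q 2 4) *
      (X.newLength R t₀ q 1 * X.newLength R t₀ q 2 ^ 2 * Real.sin (X.planeAngle R t₀ q)) := by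
  have hs := h.isAdaptedSystem hX hX'
  set M := X.spokeAreaMatrix R t₀ q fr' with hM
  -- A face does not depend on the edges that it does not contain: the faces at `EF` and the
  -- remaining ones do not contain `DF`, and the remaining ones do not contain `EF`.
  have hblock : M.submatrix addedAxis addedFace =
      Matrix.fromBlocks (M.submatrix (addedAxis ∘ Sum.inl) (addedFace ∘ Sum.inl)) 0
        (M.submatrix (addedAxis ∘ Sum.inr) (addedFace ∘ Sum.inl))
        (Matrix.fromBlocks
          (M.submatrix (addedAxis ∘ Sum.inr ∘ Sum.inl) (addedFace ∘ Sum.inr ∘ Sum.inl)) 0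
          (M.submatrix (addedAxis ∘ Sum.inr ∘ Sum.inr) (addedFace ∘ Sum.inr ∘ Sum.inl))
          (M.submatrix (addedAxis ∘ Sum.inr ∘ Sum.inr) (addedFace ∘ Sum.inr ∘ Sum.inr))) := by
    ext i j
    rcases i with i | i | i <;> rcases j with j | j | j <;> try rfl
    all_goals
      fin_cases j <;> simp [hM, spokeAreaMatrix, addedAxis, addedFace]
  rw [hblock, Matrix.det_fromBlocks_zero₁₂, Matrix.det_fromBlocks_zero₁₂, abs_mul, abs_mul]
  have hl : ∀ i, 0 < X.newLength R t₀ q i := fun i => by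
    rw [newLength_eq]; exact hs.norm_pos i
  have hA : ∀ {i j : Fin 5} (h : i ≠ j), 0 < X.newArea R t₀ q i j h := fun h =>
    lt_of_le_of_ne (by rw [newArea_eq]; exact triangleArea_nonneg _ _ _)
      (newArea_ne_zero hX' h).symm
  have hD : |(M.submatrix (addedAxis ∘ Sum.inl) (addedFace ∘ Sum.inl)).det| = _ :=
    abs_det_axisBlock hs (hl 3) (hA (i := 0) (j := 3) (by decide)) (hA (i := 1) (j := 3) (by decide))
      (hA (i := 2) (j := 3) (by decide)) (k := 4) (by decide) fun k a => by
        fin_cases a <;> simp [hM, spokeAreaMatrix, addedAxis, addedFace]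
  have hE : |(M.submatrix (addedAxis ∘ Sum.inr ∘ Sum.inl)
      (addedFace ∘ Sum.inr ∘ Sum.inl)).det| = _ :=
    abs_det_axisBlock hs (hl 4) (hA (i := 0) (j := 4) (by decide)) (hA (i := 1) (j := 4) (by decide))
      (hA (i := 2) (j := 4) (by decide)) (k := 3) (by decide) fun k a => by
        fin_cases a <;> simp [hM, spokeAreaMatrix, addedAxis, addedFace]
  have hG : |(M.submatrix (addedAxis ∘ Sum.inr ∘ Sum.inr)
      (addedFace ∘ Sum.inr ∘ Sum.inr)).det| =
      X.newLength R t₀ q 1 * X.newLength R t₀ q 2 ^ 2 * Real.sin (X.planeAngle R t₀ q) := by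
    have h1 : |(M.submatrix (addedAxis ∘ Sum.inr ∘ Sum.inr)
        (addedFace ∘ Sum.inr ∘ Sum.inr)).det| = |M (1, 0) ⟨(0, 1), by decide⟩ *
          M (2, 0) ⟨(0, 2), by decide⟩ * M (2, 1) ⟨(1, 2), by decide⟩| := by
      rw [Matrix.det_fin_three]
      have z1 : M (1, 0) ⟨(0, 2), by decide⟩ = 0 := by simp [hM, spokeAreaMatrix]
      have z2 : M (2, 0) ⟨(0, 1), by decide⟩ = 0 := by simp [hM, spokeAreaMatrix]
      have z3 : M (2, 1) ⟨(0, 1), by decide⟩ = 0 := by simp [hM, spokeAreaMatrix]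
      -- The `x` axis of `CF` is orthogonal to `BF`.
      have z4 : M (2, 0) ⟨(1, 2), by decide⟩ = 0 := by
        have := hs.x_two_inner
        rw [real_inner_comm] at this
        simp [hM, spokeAreaMatrix, this]
      simp [addedAxis, addedFace, z1, z2, z3, z4]
    have m1 : M (1, 0) ⟨(0, 1), by decide⟩ = -(X.newLength R t₀ q 1 ^ 2 /
        (2 * X.newArea R t₀ q 0 1)) * inner ℝ (X.newAxis R t₀ q fr' 1 0) (X.spoke R t₀ q 0) := by
      rw [real_inner_comm]
      simp [hM, spokeAreaMatrix]
    have m2 : M (2, 0) ⟨(0, 2), by decide⟩ = -(X.newLength R t₀ q 2 ^ 2 /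
        (2 * X.newArea R t₀ q 0 2)) * inner ℝ (X.newAxis R t₀ q fr' 2 0) (X.spoke R t₀ q 0) := by
      rw [real_inner_comm]
      simp [hM, spokeAreaMatrix]
    have m3 : M (2, 1) ⟨(1, 2), by decide⟩ = -(X.newLength R t₀ q 2 ^ 2 /
        (2 * X.newArea R t₀ q 1 2)) * inner ℝ (X.newAxis R t₀ q fr' 2 1) (X.spoke R t₀ q 1) := by
      rw [real_inner_comm]
      simp [hM, spokeAreaMatrix]
    have hkey := hs.abs_inner_mul_eq
    rw [← newArea_eq R X t₀ q (i := 0) (j := 1) (by decide), ← newArea_eq R X t₀ q (i := 0) (j := 2) (by decide),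
      ← newArea_eq R X t₀ q (i := 1) (j := 2) (by decide), ← newLength_eq, ← newLength_eq] at hkey
    change _ = _ * Real.sin (X.planeAngle R t₀ q) at hkey
    rw [h1, m1, m2, m3]
    have l1 := hl 1
    have l2 := hl 2
    have a1 := hA (i := 0) (j := 1) (by decide)
    have a2 := hA (i := 0) (j := 2) (by decide)
    have a3 := hA (i := 1) (j := 2) (by decide)
    simp only [abs_mul, abs_neg, abs_div, abs_pow, abs_of_pos l1, abs_of_pos l2, abs_of_pos a1,
      abs_of_pos a2, abs_of_pos a3, abs_of_pos (two_pos (α := ℝ))]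
    generalize |inner ℝ (X.newAxis R t₀ q fr' 1 0) (X.spoke R t₀ q 0)| = x at *
    generalize |inner ℝ (X.newAxis R t₀ q fr' 2 0) (X.spoke R t₀ q 0)| = y at *
    generalize |inner ℝ (X.newAxis R t₀ q fr' 2 1) (X.spoke R t₀ q 1)| = z at *
    field_simp
    linear_combination hkey
  rw [hD, hE, hG]
  have a1 := hA (i := 0) (j := 3) (by decide)
  have a2 := hA (i := 1) (j := 3) (by decide)
  have a3 := hA (i := 2) (j := 3) (by decide)
  have a4 := hA (i := 0) (j := 4) (by decide)
  have a5 := hA (i := 1) (j := 4) (by decide)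
  have a6 := hA (i := 2) (j := 4) (by decide)
  field_simp
  ring

end Triangulation4

/-! ### The minors under the move -/

section Extension

variable {m n p r m' n' : Type*}

theorem mem_image_union_image [DecidableEq m'] (e : m ⊕ p ≃ m') {f : m → m'} {g : p → m'}
    (hf : ∀ x, f x = e (Sum.inl x)) (hg : ∀ x, g x = e (Sum.inr x)) (A : Finset m) (S : Finset p)
    (x : m ⊕ p) : e x ∈ A.image f ∪ S.image g ↔ x ∈ A.disjSum S := by
  rcases x with x | x <;> simp [hf, hg]

theorem mem_compl_iff_mem_disjSum_compl [Fintype m] [Fintype p] [Fintype m'] [DecidableEq m]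
    [DecidableEq p] {_ : DecidableEq m'} {e : m ⊕ p ≃ m'} {A : Finset m} {S : Finset p}
    {A' : Finset m'} (h : ∀ x, e x ∈ A' ↔ x ∈ A.disjSum S) (x : m ⊕ p) :
    e x ∈ A'ᶜ ↔ x ∈ Aᶜ.disjSum Sᶜ := by
  rw [Finset.mem_compl, h]
  rcases x with x | x <;> simp

theorem absMinor_eq_absMinor_submatrix (M : Matrix m' n' ℝ) (e : m ≃ m') (e' : n ≃ n')
    {A : Finset m} {C : Finset n} {A' : Finset m'} {C' : Finset n'}
    (hA : ∀ x, e x ∈ A' ↔ x ∈ A) (hC : ∀ x, e' x ∈ C' ↔ x ∈ C) :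
    absMinor M A' C' = absMinor (M.submatrix e e') A C := by
  classical
  rw [absMinor_submatrix M e.injective e'.injective]
  congr 1
  · ext x
    obtain ⟨x, rfl⟩ := e.surjective x
    simp [hA]
  · ext x
    obtain ⟨x, rfl⟩ := e'.surjective x
    simp [hC]

theorem absMinor_fromRows [DecidableEq m] (A : Matrix m n ℝ) (D : Matrix p n ℝ) (S : Finset m)
    (C : Finset n) : absMinor (Matrix.fromRows A D) (S.disjSum ∅) C = absMinor A S C := by
  classical
  have h := absMinor_submatrix (Matrix.fromRows A D) (f := Sum.inl) (g := id) Sum.inl_injective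
    Function.injective_id S C
  rw [Finset.image_id] at h
  rw [show (S.disjSum ∅ : Finset (m ⊕ p)) = S.image Sum.inl by ext (x | x) <;> simp]
  exact h.symm

theorem absMinor_fromCols (A : Matrix m n ℝ) (D : Matrix m r ℝ) (S : Finset m)
    (C : Finset n) : absMinor (Matrix.fromCols A D) S (C.disjSum ∅) = absMinor A S C := by
  classical
  have h := absMinor_submatrix (Matrix.fromCols A D) (f := id) (g := Sum.inl)
    Function.injective_id Sum.inl_injective S C
  rw [Finset.image_id] at h
  rw [show (C.disjSum ∅ : Finset (n ⊕ r)) = C.image Sum.inl by ext (x | x) <;> simp]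
  exact h.symm

end Extension

namespace Triangulation4

variable {Γ : Type*} [Group Γ] {V T J ι₀ ι₆ : Type*} [LinearOrder V] [Fintype V]
  [Fintype T] [Fintype J] [Fintype ι₀] [Fintype ι₆] [DecidableEq T]
variable {R : Representation4 Γ J} {X : Triangulation4 Γ V T} {t₀ : T} {q : E4}

section ExtendChoice

variable (R X t₀ q) (B : X.Choice R)

theorem mem_extendChoice_B₁ (x : ((V × Fin 4) ⊕ J) ⊕ Fin 4) :
    coordEquiv V J x ∈ (X.extendChoice R t₀ q B).B₁ ↔ x ∈ B.B₁.disjSum ∅ := by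
  classical
  have h := mem_image_union_image (coordEquiv V J)
    (f := Sum.map (Prod.map (fun v : V => (v : WithTop V)) id) id)
    (g := fun α => Sum.inl (⊤, α)) (fun _ => rfl) (fun _ => rfl) B.B₁ ∅ x
  rw [Finset.image_empty, Finset.union_empty] at h
  rw [← h, extendChoice]

theorem mem_extendChoice_B₂ (x : X.Edge ⊕ Fin 5) :
    X.edgeEquiv t₀ q x ∈ (X.extendChoice R t₀ q B).B₂ ↔ x ∈ B.B₂.disjSum {0, 1, 2, 3} :=
  mem_image_union_image (X.edgeEquiv t₀ q) (fun _ => rfl) (fun _ => rfl) _ _ _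

theorem mem_extendChoice_B₃ (x : X.Face ⊕ IndexPair) :
    X.faceEquiv t₀ q x ∈ (X.extendChoice R t₀ q B).B₃ ↔
      x ∈ B.B₃.disjSum {⟨(3, 4), by decide⟩} := by
  have h := mem_image_union_image (X.faceEquiv t₀ q)
    (g := fun p : IndexPair => X.newFace t₀ q p.1.1 p.1.2 p.2.ne) (fun _ => rfl) (fun _ => rfl)
    B.B₃ {⟨(3, 4), by decide⟩} x
  rw [Finset.image_singleton] at h
  exact h

theorem mem_extendChoice_B₄ (x : (X.Edge × Fin 3) ⊕ (Fin 5 × Fin 3)) :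
    X.edgeAxisEquiv t₀ q x ∈ (X.extendChoice R t₀ q B).B₄ ↔ x ∈ B.B₄.disjSum
      {(3, 0), (3, 1), (3, 2), (4, 0), (4, 1), (4, 2), (1, 0), (2, 0), (2, 1)} :=
  mem_image_union_image (X.edgeAxisEquiv t₀ q) (fun _ => rfl) (fun _ => rfl) _ _ _

theorem mem_extendChoice_B₅ (x : (V × Pair) ⊕ Pair) :
    vertexPairEquiv V x ∈ (X.extendChoice R t₀ q B).B₅ ↔ x ∈ B.B₅.disjSum Finset.univ :=
  mem_image_union_image (vertexPairEquiv V) (fun _ => rfl) (fun _ => rfl) _ _ _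

end ExtendChoice

/-- After the reordering of the bases, every extended minor consists of the old one and of a square
block of spokes. -/
theorem minors_extendChoice (hX : X.IsNondegenerate R) (hX' : (X.move t₀ q).IsNondegenerate R)
    (a : Module.Basis ι₀ ℝ R.motions) (s : Module.Basis ι₆ ℝ R.trivialDeviations)
    {fr : X.Edge → Fin 3 → E4} {fr' : (X.move t₀ q).Edge → Fin 3 → E4}
    (h : X.IsAdaptedFraming R t₀ q fr fr') (B : X.Choice R) (k : Fin 6) :
    (X.move t₀ q).minors R a s fr' (X.extendChoice R t₀ q B) k =
      X.moveFactors R t₀ q k * X.minors R a s fr B k := by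
  classical
  have hB₁ := mem_extendChoice_B₁ R X t₀ q B
  have hB₂ := mem_extendChoice_B₂ R X t₀ q B
  have hB₃ := mem_extendChoice_B₃ R X t₀ q B
  have hB₄ := mem_extendChoice_B₄ R X t₀ q B
  have hB₅ := mem_extendChoice_B₅ R X t₀ q B
  fin_cases k
  · change absMinor ((X.move t₀ q).matrix₀ R a) _ _ = 1 * absMinor (X.matrix₀ R a) _ _
    rw [absMinor_eq_absMinor_submatrix _ (coordEquiv V J) (Equiv.refl ι₀) hB₁
      (C := Finset.univ) (by simp), one_mul]
    refine (congrArg (absMinor · _ _) (matrix₀_move R X t₀ q a)).trans ?_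
    exact absMinor_fromRows _ _ _ _
  · change absMinor ((X.move t₀ q).matrix₁ R) _ _ =
      384 * X.newVolume R t₀ q 4 * absMinor (X.matrix₁ R) _ _
    rw [absMinor_eq_absMinor_submatrix _ (X.edgeEquiv t₀ q) (coordEquiv V J) hB₂
      (mem_compl_iff_mem_disjSum_compl hB₁), matrix₁_move,
      absMinor_fromBlocks_zero₁₂ (s := Fin.castSucc) (d := id) _ _ _
        (Fin.castSucc_injective 4) Function.injective_id (by decide) (by simp),
      abs_det_spokeLengthMatrix, mul_comm]
    congr!
  · change absMinor ((X.move t₀ q).matrix₂ R) _ _ = X.newArea R t₀ q 3 4 / 24 *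
      (X.newVolume R t₀ q 4 * X.volume R t₀ / (X.newVolume R t₀ q 0 * X.newVolume R t₀ q 1 *
        X.newVolume R t₀ q 2)) * absMinor (X.matrix₂ R) _ _
    have hs := isSpokeSystem hX hX'
    have h4 : ({0, 1, 2, 3}ᶜ : Finset (Fin 5)) = {4} := by decide
    rw [absMinor_eq_absMinor_submatrix _ (X.faceEquiv t₀ q) (X.edgeEquiv t₀ q) hB₃
      (mem_compl_iff_mem_disjSum_compl hB₂), matrix₂_move_eq_fromBlocks hX hX', h4,
      absMinor_fromBlocks_add_rank_one]
    · rw [abs_mul_newFace_newEdge hX hX', mul_comm]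
      congr!
    · exact mul_ne_zero (neg_ne_zero.2 (moveConst_ne_zero hX hX'))
        (mul_ne_zero (newArea_ne_zero hX' _) (mul_ne_zero (hs.ne_zero 3) (hs.ne_zero 4)))
    · exact neg_ne_zero.2 (hs.ne_zero 4)
  · change absMinor ((X.move t₀ q).areaMatrix R fr')ᵀ _ _ = _ * absMinor (X.areaMatrix R fr)ᵀ _ _
    rw [absMinor_eq_absMinor_submatrix _ (X.edgeAxisEquiv t₀ q) (X.faceEquiv t₀ q) hB₄
      (mem_compl_iff_mem_disjSum_compl hB₃), areaMatrix_move R X t₀ q h.isFraming h.old,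
      absMinor_fromBlocks_zero₂₁ (s := addedAxis) (d := addedFace) _ _ _
        (by decide) (by decide) (by decide) (by decide),
      abs_det_spokeAreaMatrix h hX hX', mul_comm]
    congr!
  · change absMinor ((X.move t₀ q).deviationMatrix R fr')ᵀ _ _ =
      _ * absMinor (X.deviationMatrix R fr)ᵀ _ _
    rw [absMinor_eq_absMinor_submatrix _ (vertexPairEquiv V) (X.edgeAxisEquiv t₀ q) hB₅
      (mem_compl_iff_mem_disjSum_compl hB₄), deviationMatrix_move R X t₀ q h.old,
      absMinor_fromBlocks_zero₂₁ (s := pairList) (d := remainingAxis) _ _ _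
        pairList_bijective.1 (by decide) (by decide) (by decide),
      abs_det_spokeDeviationMatrix h hX hX', mul_comm]
    congr!
  · change absMinor ((X.move t₀ q).trivialMatrix R s)ᵀ _ _ =
      1 * absMinor (X.trivialMatrix R s)ᵀ _ _
    rw [absMinor_eq_absMinor_submatrix _ (Equiv.refl ι₆) (vertexPairEquiv V)
      (A := Finset.univ) (by simp) (mem_compl_iff_mem_disjSum_compl hB₅), one_mul,
      Finset.compl_univ]
    refine (congrArg (absMinor · _ _) (trivialMatrix_move R X t₀ q s)).trans ?_
    rw [absMinor_fromCols]
    congr!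

end Triangulation4

/-! ### Torsion -/

namespace Triangulation4

variable {Γ : Type*} [Group Γ] {V T J ι₀ ι₆ : Type*} [LinearOrder V]
variable {R : Representation4 Γ J} {X : Triangulation4 Γ V T} {t₀ : T} {q : E4}

theorem newLength_pos (hX : X.IsNondegenerate R) (hX' : (X.move t₀ q).IsNondegenerate R)
    (i : Fin 5) : 0 < X.newLength R t₀ q i :=
  lt_of_le_of_ne (by rw [newLength_eq]; exact norm_nonneg _) (newLength_ne_zero hX hX' i).symm

theorem newArea_pos (hX' : (X.move t₀ q).IsNondegenerate R) {i j : Fin 5} (h : i ≠ j) :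
    0 < X.newArea R t₀ q i j h :=
  lt_of_le_of_ne (by rw [newArea_eq]; exact triangleArea_nonneg _ _ _) (newArea_ne_zero hX' h).symm

theorem IsNondegenerate.volume_pos (hX : X.IsNondegenerate R) (t : T) : 0 < X.volume R t :=
  lt_of_le_of_ne (abs_nonneg _) (hX t).symm

theorem IsAdaptedFraming.sin_planeAngle_pos {fr : X.Edge → Fin 3 → E4}
    {fr' : (X.move t₀ q).Edge → Fin 3 → E4} (h : X.IsAdaptedFraming R t₀ q fr fr')
    (hX : X.IsNondegenerate R) (hX' : (X.move t₀ q).IsNondegenerate R) :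
    0 < Real.sin (X.planeAngle R t₀ q) := by
  refine lt_of_le_of_ne (InnerProductGeometry.sin_angle_nonneg _ _) fun h0 => ?_
  have hs := h.isAdaptedSystem hX hX'
  have h1 := hs.sin_angle_mul
  change Real.sin (X.planeAngle R t₀ q) * _ = _ at h1
  rw [← h0, zero_mul, eq_comm, mul_eq_zero, mul_eq_zero, abs_eq_zero, abs_eq_zero] at h1
  -- Otherwise the `x` or the `y` axis of `CF` would be orthogonal to a space that contains it.
  rcases h1 with h1 | h1 | h1
  · exact (pow_pos (hs.norm_pos 2) 2).ne' h1
  · refine hs.axis_ne_zero 2 0 ((inner_self_eq_zero (𝕜 := ℝ)).1 ?_)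
    refine inner_eq_zero_of_mem_span hs.x_two ?_
    simpa [h1, hs.x_two_inner] using hs.inner_axis 2 0
  · refine hs.axis_ne_zero 2 1 ((inner_self_eq_zero (𝕜 := ℝ)).1 ?_)
    refine inner_eq_zero_of_mem_span hs.y_two' ?_
    simpa [h1] using hs.inner_axis 2 1

theorem newAreaProduct_eq : X.newAreaProduct R t₀ q =
    X.newArea R t₀ q 0 1 * X.newArea R t₀ q 0 2 * X.newArea R t₀ q 0 3 * X.newArea R t₀ q 0 4 *
      X.newArea R t₀ q 1 2 * X.newArea R t₀ q 1 3 * X.newArea R t₀ q 1 4 * X.newArea R t₀ q 2 3 *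
      X.newArea R t₀ q 2 4 * X.newArea R t₀ q 3 4 := by
  simp [newAreaProduct, Fin.prod_univ_five, mul_assoc]

theorem moveFactors_ne_zero (hX : X.IsNondegenerate R) (hX' : (X.move t₀ q).IsNondegenerate R)
    (hsin : 0 < Real.sin (X.planeAngle R t₀ q)) (k : Fin 6) : X.moveFactors R t₀ q k ≠ 0 := by
  have hl := newLength_pos hX hX'
  have hA : ∀ {i j : Fin 5} (h : i ≠ j), 0 < X.newArea R t₀ q i j h := newArea_pos hX'
  have hv : ∀ k, 0 < X.newVolume R t₀ q k := fun k => hX'.volume_pos _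
  have hV := hX.volume_pos t₀
  have l0 := hl 0
  have l1 := hl 1
  have l2 := hl 2
  have l3 := hl 3
  have l4 := hl 4
  have v0 := hv 0
  have v1 := hv 1
  have v2 := hv 2
  have v3 := hv 3
  have v4 := hv 4
  have a01 := hA (i := 0) (j := 1) (by decide)
  have a02 := hA (i := 0) (j := 2) (by decide)
  have a03 := hA (i := 0) (j := 3) (by decide)
  have a04 := hA (i := 0) (j := 4) (by decide)
  have a12 := hA (i := 1) (j := 2) (by decide)
  have a13 := hA (i := 1) (j := 3) (by decide)
  have a14 := hA (i := 1) (j := 4) (by decide)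
  have a23 := hA (i := 2) (j := 3) (by decide)
  have a24 := hA (i := 2) (j := 4) (by decide)
  have a34 := hA (i := 3) (j := 4) (by decide)
  refine ne_of_gt ?_
  fin_cases k <;> simp only [moveFactors, Fin.zero_eta, Fin.mk_one, Fin.reduceFinMk, Matrix.cons_val] <;>
    positivity

/-- The sine of the angle between the planes, which depends on the choice of the axes, cancels. -/
theorem alternatingProduct_moveFactors (hX : X.IsNondegenerate R)
    (hX' : (X.move t₀ q).IsNondegenerate R) (hsin : 0 < Real.sin (X.planeAngle R t₀ q)) :
    alternatingProduct (X.moveFactors R t₀ q) = 2 ^ 7 * 3 ^ 4 *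
      ((∏ k, X.newVolume R t₀ q k) / X.volume R t₀) *
      ((∏ i, X.newLength R t₀ q i ^ 5) / X.newAreaProduct R t₀ q) := by
  have hl := fun i => (newLength_pos hX hX' i).ne'
  have hA : ∀ {i j : Fin 5} (h : i ≠ j), X.newArea R t₀ q i j h ≠ 0 := newArea_ne_zero hX'
  have hv : ∀ k, X.newVolume R t₀ q k ≠ 0 := fun k => hX' _
  have hV := hX t₀
  have l0 := hl 0
  have l1 := hl 1
  have l2 := hl 2
  have l3 := hl 3
  have l4 := hl 4
  have v0 := hv 0
  have v1 := hv 1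
  have v2 := hv 2
  have v3 := hv 3
  have v4 := hv 4
  have a01 := hA (i := 0) (j := 1) (by decide)
  have a02 := hA (i := 0) (j := 2) (by decide)
  have a03 := hA (i := 0) (j := 3) (by decide)
  have a04 := hA (i := 0) (j := 4) (by decide)
  have a12 := hA (i := 1) (j := 2) (by decide)
  have a13 := hA (i := 1) (j := 3) (by decide)
  have a14 := hA (i := 1) (j := 4) (by decide)
  have a23 := hA (i := 2) (j := 3) (by decide)
  have a24 := hA (i := 2) (j := 4) (by decide)
  have a34 := hA (i := 3) (j := 4) (by decide)
  have hsin' := hsin.ne'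
  simp only [newAreaProduct_eq, Fin.prod_univ_five, alternatingProduct, moveFactors,
    Matrix.cons_val]
  field_simp
  norm_num

variable [Fintype V] [Fintype T] [Fintype J] [Fintype ι₀] [Fintype ι₆] [DecidableEq T]

/-- All the choices of nonzero minors give the same torsion, and it is the same for all the axes
for the deviations of the edges. -/
theorem Acyclic.exists_torsion {a : Module.Basis ι₀ ℝ R.motions}
    {s : Module.Basis ι₆ ℝ R.trivialDeviations} {fr : X.Edge → Fin 3 → E4}
    (h : X.Acyclic R a s fr) (hX : X.IsNondegenerate R) (hfr : X.IsFraming R fr) :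
    ∃ τ : ℝ, 0 < τ ∧ ∀ fr₁, X.IsFraming R fr₁ → ∀ t, X.IsTorsion R a s fr₁ t ↔ t = τ := by
  obtain ⟨τ, hτ, H⟩ := IsAcyclic.exists_torsion h
  refine ⟨τ, hτ, fun fr₁ hfr₁ t => ?_⟩
  obtain ⟨O, O', hO, hdet, h1, h2⟩ := exists_reframing hX hfr₁ hfr
  obtain ⟨⟨B, hB⟩, huniq⟩ := H O O' hO hdet
  rw [← h1, ← h2] at hB huniq
  constructor
  · rintro ⟨B', hB', rfl⟩
    exact huniq B' hB'
  · rintro rfl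
    exact ⟨B, hB, (huniq B hB).symm⟩

end Triangulation4

theorem mainTheorem3 {Γ : Type*} [Group Γ] {V T J ι₀ ι₆ : Type*} [LinearOrder V] [Fintype V]
    [Fintype T] [DecidableEq T] [Fintype J] [Fintype ι₀] [Fintype ι₆]
    (R : Representation4 Γ J) (X : Triangulation4 Γ V T) (t₀ : T) (q : E4)
    (hX : X.IsNondegenerate R) (hX' : (X.move t₀ q).IsNondegenerate R)
    (a : Module.Basis ι₀ ℝ R.motions) (s : Module.Basis ι₆ ℝ R.trivialDeviations)
    (fr : X.Edge → Fin 3 → E4) (hfr : X.IsFraming R fr) :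
    -- the separate minors: all of them, for any old choice and its extension
    (∀ fr' : (X.move t₀ q).Edge → Fin 3 → E4, X.IsAdaptedFraming R t₀ q fr fr' →
      ∀ (B : X.Choice R) (k : Fin 6),
        (X.move t₀ q).minors R a s fr' (X.extendChoice R t₀ q B) k =
          X.moveFactors R t₀ q k * X.minors R a s fr B k) ∧
    -- acyclicity and torsion, for any choice of the axes for the deviations of edges
    (∀ fr' : (X.move t₀ q).Edge → Fin 3 → E4, (X.move t₀ q).IsFraming R fr' →
      (X.Acyclic R a s fr ↔ (X.move t₀ q).Acyclic R a s fr') ∧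
      (X.Acyclic R a s fr → ∃ τ : ℝ, 0 < τ ∧
        (∀ t, X.IsTorsion R a s fr t ↔ t = τ) ∧
        (∀ t, (X.move t₀ q).IsTorsion R a s fr' t ↔
          t = τ * (2 ^ 7 * 3 ^ 4 *
            ((∏ k, X.newVolume R t₀ q k) / X.volume R t₀) *
            ((∏ i, X.newLength R t₀ q i ^ 5) / X.newAreaProduct R t₀ q))))) := by
  refine ⟨fun fr' h B k => Triangulation4.minors_extendChoice hX hX' a s h B k,
    fun fr' hfr' => ?_⟩
  obtain ⟨fr₁, h₁⟩ := Triangulation4.exists_isAdaptedFraming hX hX' hfr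
  have hiff := Triangulation4.acyclic_move_iff_of_old a s hX hX' h₁.isFraming h₁.old
  refine ⟨hiff.trans (Triangulation4.acyclic_iff_of_isFraming hX' a s h₁.isFraming hfr'),
    fun hac => ?_⟩
  obtain ⟨τ, hτ, H⟩ := hac.exists_torsion hX hfr
  obtain ⟨τ', -, H'⟩ := (hiff.1 hac).exists_torsion hX' h₁.isFraming
  have hsin := h₁.sin_planeAngle_pos hX hX'
  obtain ⟨B, hB, hBτ⟩ := (H fr hfr τ).2 rfl
  -- The extension of nonzero minors by the adapted axes consists of nonzero minors.
  have hτ' : alternatingProduct ((X.move t₀ q).minors R a s fr₁ (X.extendChoice R t₀ q B)) = τ' :=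
    (H' fr₁ h₁.isFraming _).1 ⟨_, fun k => by
      rw [Triangulation4.minors_extendChoice hX hX' a s h₁]
      exact mul_ne_zero (Triangulation4.moveFactors_ne_zero hX hX' hsin k) (hB k), rfl⟩
  refine ⟨τ, hτ, H fr hfr, fun t => ?_⟩
  rw [H' fr' hfr', ← Triangulation4.alternatingProduct_moveFactors hX hX' hsin, ← hτ', hBτ]
  simp only [alternatingProduct, Triangulation4.minors_extendChoice hX hX' a s h₁]
  rw [mul_comm (_ / _), div_mul_div_comm]
  ring_nf
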